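/- **Theorem 5.2 (Harnack inequality).** Let $M$ be a compact connected smooth manifold without boundary, let $g_0$ be a smooth Riemannian metric on $M$, and let $C_0,K,\Lambda>0$. There is a constant $C>0$, depending only on $(M,g_0)$, $C_0$, $K$ and $\Lambda$, such that the following holds. Let $g(t)$, $0\le t<\infty$, be a smooth family of Riemannian metrics on $M$ with $g(0)=g_0$ and, for all $t$, $$\frac1{C_0}\,g(0)\le g(t)\le C_0\,g(0),\qquad \Big|\frac{\partial}{\partial t}g(t)\Big|_{g(t)}\le C_0,\qquad \mathrm{Ric}(g(t))\ge -K\,g(0),$$ where $|h|_{g}\le C_0$ means $|h(v,v)|\le C_0\,g(v,v)$ for all tangent vectors $v$. Let $\lambda(x,t)$ be a smooth positive function on $M\times[0,\infty)$ with $$\frac1\Lambda\le\lambda\le\Lambda,\qquad |\partial_t\lambda|\le\Lambda,\qquad |\nabla\lambda|_{g_0}\le\Lambda .$$ Let $U(x,t)\ge 0$ be a classical solution ($C^2$ in $x$ and $C^1$ in $t$, with these derivatives jointly continuous) on $M\times(0,\infty)$ of $$U_t=\lambda(x,t)\,\Delta_{g(t)}U ,$$ where $\Delta_{g(t)}$ is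 the Laplace–Beltrami operator of $g(t)$. Then for all $0<t_1<t_2<\infty$ $$\sup_{x\in M}U(x,t_1)\;\le\;\inf_{x\in M}U(x,t_2)\; C\Big(\frac{t_2}{t_1}\Big)^{C}\exp\Big\{\frac{C\,C_0^2\,\mathrm{diam}^2(M,g(t_1))}{t_2-t_1}+C(t_2-t_1)\Big\}.$$ -/

import Mathlib

open scoped Manifold ContDiff Bundle

noncomputable section

namespace LiYau

variable {E : Type*} [NormedAddCommGroup E] [NormedSpace ℝ E] [FiniteDimensional ℝ E]

/-- The index set of the coordinates on the model space `E`, identified with `ℝⁿ`, `n = dim E`,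
by a fixed basis. -/
abbrev Idx (E : Type*) [NormedAddCommGroup E] [NormedSpace ℝ E] : Type :=
  Fin (Module.finrank ℝ E)

/-- The `i`-th basis vector of the model space. -/
def e (i : Idx E) : E := Module.finBasis ℝ E i

/-- The `i`-th partial derivative of `f : E → ℝ`. -/
def pd (i : Idx E) (f : E → ℝ) (y : E) : ℝ :=
  fderiv ℝ f y (e i)

/-- Smooth Riemannian metrics on a manifold `M` without boundary modelled on `E` (Mathlib's notion,
for the tangent bundle). -/
abbrev RMetric (E : Type*) [NormedAddCommGroup E] [NormedSpace ℝ E]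
    (M : Type*) [TopologicalSpace M] [ChartedSpace E M] [IsManifold 𝓘(ℝ, E) ∞ M] : Type _ :=
  Bundle.ContMDiffRiemannianMetric 𝓘(ℝ, E) ∞ E (fun x : M => TangentSpace 𝓘(ℝ, E) x)

section Coordinates

variable {M : Type*} [TopologicalSpace M] [ChartedSpace E M] [IsManifold 𝓘(ℝ, E) ∞ M]

/-- The `i`-th coordinate vector field of the chart around `p`, at the point with
coordinates `y`. -/
def coordVec (p : M) (i : Idx E) (y : E) :
    TangentSpace 𝓘(ℝ, E) ((extChartAt 𝓘(ℝ, E) p).symm y) :=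
  mfderiv 𝓘(ℝ, E) 𝓘(ℝ, E) (extChartAt 𝓘(ℝ, E) p).symm y (e i : E)

/-- The coefficients `g_ij` of the metric in the chart around `p`, as functions on `E`
(meaningful on the target of the chart). -/
def coeff (g : RMetric E M) (p : M) (i j : Idx E) (y : E) : ℝ :=
  g.inner ((extChartAt 𝓘(ℝ, E) p).symm y) (coordVec p i y) (coordVec p j y)

/-- The coefficients `g^ij` of the inverse matrix, in the chart around `p`. -/
def invCoeff (g : RMetric E M) (p : M) (i j : Idx E) (y : E) : ℝ :=
  (Matrix.of fun a b => coeff g p a b y)⁻¹ i j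

/-- The Christoffel symbols `Γ^k_ij = ½ g^kl (∂_i g_jl + ∂_j g_il - ∂_l g_ij)` of the Levi-Civita
connection, in the chart around `p`. -/
def christoffel (g : RMetric E M) (p : M) (k i j : Idx E) (y : E) : ℝ :=
  (1 / 2) * ∑ l, invCoeff g p k l y *
    (pd i (coeff g p j l) y + pd j (coeff g p i l) y - pd l (coeff g p i j) y)

/-- The coefficients of the Ricci tensor in the chart around `p`:
`R_ij = ∂_k Γ^k_ij - ∂_j Γ^k_ik + Γ^k_kl Γ^l_ij - Γ^k_jl Γ^l_ik`. -/
def ricciCoeff (g : RMetric E M) (p : M) (i j : Idx E) (y : E) : ℝ :=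
  ∑ k, (pd k (christoffel g p k i j) y - pd j (christoffel g p k i k) y
    + ∑ l, (christoffel g p k k l y * christoffel g p l i j y
      - christoffel g p k j l y * christoffel g p l i k y))

/-- The `i`-th component of a tangent vector at `p` in the chart around `p`. -/
def component {p : M} (v : TangentSpace 𝓘(ℝ, E) p) (i : Idx E) : ℝ :=
  (Module.finBasis ℝ E).repr (mfderiv 𝓘(ℝ, E) 𝓘(ℝ, E) (extChartAt 𝓘(ℝ, E) p) p v) i

/-- The Ricci curvature `Ric(v, v)` of `g`, for a tangent vector `v` at `p`. -/
def ricci (g : RMetric E M) (p : M) (v : TangentSpace 𝓘(ℝ, E) p) : ℝ :=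
  ∑ i, ∑ j, ricciCoeff g p i j (extChartAt 𝓘(ℝ, E) p p) * component v i * component v j

/-- The function `u` read in the chart around `p`. -/
def inChart (p : M) (u : M → ℝ) (y : E) : ℝ :=
  u ((extChartAt 𝓘(ℝ, E) p).symm y)

/-- The Laplace-Beltrami operator `Δ_g u = g^ij (∂_i ∂_j u - Γ^k_ij ∂_k u)`, evaluated at `p` in
the chart around `p`. -/
def laplacian (g : RMetric E M) (u : M → ℝ) (p : M) : ℝ :=
  ∑ i, ∑ j, invCoeff g p i j (extChartAt 𝓘(ℝ, E) p p) *
    (pd i (pd j (inChart p u)) (extChartAt 𝓘(ℝ, E) p p)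
      - ∑ k, christoffel g p k i j (extChartAt 𝓘(ℝ, E) p p) *
          pd k (inChart p u) (extChartAt 𝓘(ℝ, E) p p))

/-- The diameter of `M` for the Riemannian distance of `g` (the infimum of the lengths of
`C^1` paths). -/
def diam (g : RMetric E M) : ℝ :=
  letI : Bundle.RiemannianBundle (fun x : M => TangentSpace 𝓘(ℝ, E) x) := ⟨g.toRiemannianMetric⟩
  (⨆ (x : M) (y : M), Manifold.riemannianEDist 𝓘(ℝ, E) x y).toReal

/-- The family `g t`, `0 ≤ t < ∞`, is smooth: in every chart the coefficients `g_ij` are smooth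
functions of `(t, y)`. -/
def IsSmoothFamily (g : ℝ → RMetric E M) : Prop :=
  ∀ (p : M) (i j : Idx E),
    ContDiffOn ℝ ∞ (fun q : ℝ × E => coeff (g q.1) p i j q.2)
      (Set.Ici 0 ×ˢ (extChartAt 𝓘(ℝ, E) p).target)

/-- Assumptions on the metrics `g t`, `0 ≤ t < ∞`: they are uniformly equivalent to `g 0`, their
time derivative is bounded, and `Ric (g t) ≥ - K g 0`. -/
structure MetricBounds (g : ℝ → RMetric E M) (C₀ K : ℝ) : Prop where
  lower : ∀ t, 0 ≤ t → ∀ (x : M) (v : TangentSpace 𝓘(ℝ, E) x),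
    (1 / C₀) * (g 0).inner x v v ≤ (g t).inner x v v
  upper : ∀ t, 0 ≤ t → ∀ (x : M) (v : TangentSpace 𝓘(ℝ, E) x),
    (g t).inner x v v ≤ C₀ * (g 0).inner x v v
  time_deriv : ∀ t, 0 < t → ∀ (x : M) (v : TangentSpace 𝓘(ℝ, E) x),
    |deriv (fun s => (g s).inner x v v) t| ≤ C₀ * (g t).inner x v v
  ricci_lower : ∀ t, 0 ≤ t → ∀ (x : M) (v : TangentSpace 𝓘(ℝ, E) x),
    -K * (g 0).inner x v v ≤ ricci (g t) x v

/-- Assumptions on the coefficient `lam t x`, for `0 ≤ t < ∞`: it is smooth, it lies between `1/Λ`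
and `Λ`, and its time derivative and its differential in space (measured with the metric `g₀`) are
bounded by `Λ`. -/
structure CoefficientBounds (g₀ : RMetric E M) (lam : ℝ → M → ℝ) (Λ : ℝ) : Prop where
  smooth : ContMDiffOn (𝓘(ℝ, ℝ).prod 𝓘(ℝ, E)) 𝓘(ℝ, ℝ) ∞ (fun q : ℝ × M => lam q.1 q.2)
    (Set.Ici 0 ×ˢ Set.univ)
  lower : ∀ t, 0 ≤ t → ∀ x, 1 / Λ ≤ lam t x
  upper : ∀ t, 0 ≤ t → ∀ x, lam t x ≤ Λ
  time_deriv : ∀ t, 0 < t → ∀ x, |deriv (fun s => lam s x) t| ≤ Λ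
  space_deriv : ∀ t, 0 ≤ t → ∀ (x : M) (v : TangentSpace 𝓘(ℝ, E) x),
    |(show ℝ from mfderiv 𝓘(ℝ, E) 𝓘(ℝ, ℝ) (lam t) x v)| ≤ Λ * √(g₀.inner x v v)

/-- `U` is a classical solution of `U_t = lam(x,t) Δ_{g(t)} U` on `M × (0, ∞)`: it is `C^1` in time
and `C^2` in space, all these derivatives being jointly continuous, and satisfies the equation at
every point. -/
structure IsClassicalSolution (g : ℝ → RMetric E M) (lam U : ℝ → M → ℝ) : Prop where
  continuousOn : ContinuousOn (fun q : ℝ × M => U q.1 q.2) (Set.Ioi 0 ×ˢ Set.univ)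
  differentiableAt_time : ∀ t, 0 < t → ∀ x, DifferentiableAt ℝ (fun s => U s x) t
  continuousOn_time : ContinuousOn (fun q : ℝ × M => deriv (fun s => U s q.2) q.1)
    (Set.Ioi 0 ×ˢ Set.univ)
  contMDiff_space : ∀ t, 0 < t → ContMDiff 𝓘(ℝ, E) 𝓘(ℝ, ℝ) 2 (U t)
  continuousOn_space₁ : ∀ (p : M) (i : Idx E),
    ContinuousOn (fun q : ℝ × E => pd i (inChart p (U q.1)) q.2)
      (Set.Ioi 0 ×ˢ (extChartAt 𝓘(ℝ, E) p).target)
  continuousOn_space₂ : ∀ (p : M) (i j : Idx E),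
    ContinuousOn (fun q : ℝ × E => pd i (pd j (inChart p (U q.1))) q.2)
      (Set.Ioi 0 ×ˢ (extChartAt 𝓘(ℝ, E) p).target)
  equation : ∀ t, 0 < t → ∀ x, deriv (fun s => U s x) t = lam t x * laplacian (g t) (U t) x

end Coordinates

end LiYau

end

noncomputable section

namespace LiYau

open MeasureTheory Set

set_option linter.unusedSectionVars false

/-! ### Differential inequalities on an interval and De Giorgi's iteration. -/

section Calculus

/-! The solution is studied through the distribution of its values. Let `ν t` be the image of λ⁻¹
dvol_{g(t)} under U(·,t), and `e t` the image of |∇U|² dvol_{g(t)}. The weight λ⁻¹ puts the equation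
in divergence form: for ψ ≥ 0, Green's formula gives d/dt ∫ψ(U) λ⁻¹ dvol = -∫ψ''(U)|∇U|² dvol, up to
an error B ∫ψ(U) λ⁻¹ dvol caused by the motion of the metric and of λ. Nash's and Poincaré's
inequalities are proved for g(0) only and pass to functions w(U) by uniform equivalence of the
metrics. These facts make up `EnergyFlow`, with constants fixed by the data of the theorem
(`exists_energyFlow`). The whole parabolic argument, `EnergyFlow.exists_harnack`, uses nothing else:
it only tests with functions ψ of one variable.

Upper bound. De Giorgi iteration on ∫(U-k)₊⁴, driven by a Faber-Krahn inequality, controls the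
maximum by an earlier maximum and the total heat ∫U. Absorbing the earlier maximum leaves max U ≤ C
t^{-n/2} ∫U at one and the same time t ≤ 1 (`exists_hi_le`).

Spreading. Let A be the maximum at time s, and let the heat be at least of order τ^{n/2} A. For
concave powers (U/A)^q the energy term helps, with a factor of order 1/q. Either ∫(U/A)^{q/2}
becomes large within a time governed by q, or ∫(U/A)^q outgrows the total mass, which is absurd.
Halving q from 1/2 down to about τ takes total time at most τ/4. The logarithmic loss contracts at
every step, so the initial loss is forgotten and ∫(U/A)^κ stays above a fixed ε for some κ
comparable with τ. Hence U ≥ e^{-K/τ} A on a set of definite measure (`exists_mass_large`).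

Lower bound. Put w = (k - log U)₊. In the evolution of ∫w³ the concavity of the logarithm produces
the energy of w² as damping. Where w vanishes on a set of definite measure, Poincaré's inequality
turns this into I' ≤ B I - c I^{4/3}, whose solutions are bounded at later times independently of
the initial value. A second De Giorgi iteration, in logarithmic levels, makes the bound pointwise:
log U ≥ log A - K'/τ (`exists_lo_ge`).

Conclusion. The maximum at s is bounded by the heat at s, hence by the heat at s + τ, hence by the
maximum at s + τ, hence by e^{K/τ} times the minimum at s + 2τ ≤ t; and the minimum is nondecreasing
in time. This gives the factor C (t/s)^C e^{C/(t-s)}. The metric g(t₁) is equivalent to g(0), so its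
diameter is at least diam g(0)/√C₀, which is positive unless M is a point, and the constant in the
exponent is absorbed by the diameter term. On a one-point manifold U does not depend on time. Zeros
of U are removed by adding a small constant. -/

theorem le_exp_mul_of_deriv_le {f f' : ℝ → ℝ} {c s t : ℝ} (hst : s ≤ t)
    (hf : ∀ x ∈ Icc s t, HasDerivAt f (f' x) x) (h : ∀ x ∈ Icc s t, f' x ≤ c * f x) :
    f t ≤ Real.exp (c * (t - s)) * f s := by
  have hd : ∀ x ∈ Icc s t, HasDerivAt (fun x => f x * Real.exp (-c * (x - s)))
      (f' x * Real.exp (-c * (x - s)) + f x * (Real.exp (-c * (x - s)) * -c)) x := by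
    intro x hx
    refine (hf x hx).mul ?_
    have : HasDerivAt (fun x => -c * (x - s)) (-c) x := by
      simpa using ((hasDerivAt_id x).sub_const s).const_mul (-c)
    exact this.exp
  have hanti : AntitoneOn (fun x => f x * Real.exp (-c * (x - s))) (Icc s t) := by
    refine antitoneOn_of_deriv_nonpos (convex_Icc s t)
      (fun x hx => (hd x hx).continuousAt.continuousWithinAt)
      (fun x hx => (hd x (interior_subset hx)).differentiableAt.differentiableWithinAt) ?_
    intro x hx
    rw [(hd x (interior_subset hx)).deriv]
    have h1 := h x (interior_subset hx)
    have h2 := Real.exp_pos (-c * (x - s))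
    nlinarith
  have := hanti (left_mem_Icc.2 hst) (right_mem_Icc.2 hst) hst
  simp only [sub_self, mul_zero, Real.exp_zero, mul_one] at this
  calc f t = (f t * Real.exp (-c * (t - s))) * Real.exp (c * (t - s)) := by
        rw [mul_assoc, ← Real.exp_add]; simp
    _ ≤ f s * Real.exp (c * (t - s)) := by gcongr
    _ = _ := mul_comm _ _

theorem exp_mul_le_of_le_deriv {f f' : ℝ → ℝ} {c s t : ℝ} (hst : s ≤ t)
    (hf : ∀ x ∈ Icc s t, HasDerivAt f (f' x) x) (h : ∀ x ∈ Icc s t, c * f x ≤ f' x) :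
    Real.exp (c * (t - s)) * f s ≤ f t := by
  have := le_exp_mul_of_deriv_le (f := fun x => -f x) (f' := fun x => -f' x) (c := c) hst
    (fun x hx => (hf x hx).neg) (fun x hx => by have := h x hx; linarith)
  linarith

/-- A Riccati type differential inequality forces a bound that does not depend on the initial
value. -/
theorem le_of_riccati {f f' : ℝ → ℝ} {B c s t : ℝ} (hB : 0 ≤ B) (hc : 0 < c) (hst : s < t)
    (hst1 : t ≤ s + 1) (hf0 : ∀ x ∈ Icc s t, 0 ≤ f x)
    (hf : ∀ x ∈ Icc s t, HasDerivAt f (f' x) x)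
    (h : ∀ x ∈ Icc s t, f' x ≤ B * f x - c * (f x) ^ (4 / 3 : ℝ)) :
    f t ≤ Real.exp B * (3 / (c * (t - s))) ^ 3 := by
  have hts : 0 < t - s := by linarith
  rcases (hf0 t (right_mem_Icc.2 hst.le)).eq_or_lt with h0 | h0
  · rw [← h0]; positivity
  -- A zero at an earlier time would propagate to `t` by Gronwall. Positivity is needed to take the
  -- power -1/3 below.
  have hpos : ∀ x ∈ Icc s t, 0 < f x := by
    intro x hx
    have := le_exp_mul_of_deriv_le (f := f) (f' := f') (c := B) hx.2
      (fun y hy => hf y ⟨hx.1.trans hy.1, hy.2⟩) (fun y hy => by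
        have h1 := h y ⟨hx.1.trans hy.1, hy.2⟩
        have := mul_nonneg hc.le (Real.rpow_nonneg (hf0 y ⟨hx.1.trans hy.1, hy.2⟩) (4/3))
        linarith)
    have h2 := Real.exp_pos (B * (t - x))
    by_contra hneg
    push Not at hneg
    nlinarith
  -- pass to `g = e^{-B(x-s)} f`, for which `g^{-1/3}` grows linearly
  set g : ℝ → ℝ := fun x => Real.exp (-B * (x - s)) * f x with hg
  have hgpos : ∀ x ∈ Icc s t, 0 < g x := fun x hx => mul_pos (Real.exp_pos _) (hpos x hx)
  have hgd : ∀ x ∈ Icc s t, HasDerivAt g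
      (Real.exp (-B * (x - s)) * -B * f x + Real.exp (-B * (x - s)) * f' x) x := by
    intro x hx
    have h1 : HasDerivAt (fun x => -B * (x - s)) (-B) x := by
      simpa using ((hasDerivAt_id x).sub_const s).const_mul (-B)
    exact h1.exp.mul (hf x hx)
  have hgle : ∀ x ∈ Icc s t, Real.exp (-B * (x - s)) * -B * f x + Real.exp (-B * (x - s)) * f' x
      ≤ -c * (g x) ^ (4 / 3 : ℝ) := by
    intro x hx
    have h1 := h x hx
    have h2 := Real.exp_pos (-B * (x - s))
    have h3 : (g x) ^ (4 / 3 : ℝ) ≤ Real.exp (-B * (x - s)) * (f x) ^ (4 / 3 : ℝ) := by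
      rw [hg, Real.mul_rpow h2.le (hf0 x hx), ← Real.exp_mul]
      refine mul_le_mul_of_nonneg_right ?_ (Real.rpow_nonneg (hf0 x hx) _)
      apply Real.exp_le_exp.2
      have : 0 ≤ B * (x - s) := mul_nonneg hB (by linarith [hx.1])
      linarith
    nlinarith
  have hhd : ∀ x ∈ Icc s t, HasDerivAt (fun x => (g x) ^ (-(1 / 3) : ℝ))
      ((Real.exp (-B * (x - s)) * -B * f x + Real.exp (-B * (x - s)) * f' x) * (-(1 / 3))
        * (g x) ^ (-(1 / 3) - 1 : ℝ)) x := fun x hx =>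
    (hgd x hx).rpow_const (Or.inl (hgpos x hx).ne')
  have hmono : c / 3 * (t - s) ≤ (g t) ^ (-(1 / 3) : ℝ) - (g s) ^ (-(1 / 3) : ℝ) := by
    refine (convex_Icc s t).mul_sub_le_image_sub_of_le_deriv
      (fun x hx => (hhd x hx).continuousAt.continuousWithinAt)
      (fun x hx => (hhd x (interior_subset hx)).differentiableAt.differentiableWithinAt) ?_
      s (left_mem_Icc.2 hst.le) t (right_mem_Icc.2 hst.le) hst.le
    intro x hx
    have hx := interior_subset hx
    rw [(hhd x hx).deriv]
    have h1 := hgle x hx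
    have h2 : (g x) ^ (4 / 3 : ℝ) * (g x) ^ (-(1 / 3) - 1 : ℝ) = 1 := by
      rw [← Real.rpow_add (hgpos x hx)]; norm_num
    have h3 : 0 < (g x) ^ (-(1 / 3) - 1 : ℝ) := Real.rpow_pos_of_pos (hgpos x hx) _
    nlinarith
  have hgt := hgpos t (right_mem_Icc.2 hst.le)
  have hgs : 0 < (g s) ^ (-(1 / 3) : ℝ) :=
    Real.rpow_pos_of_pos (hgpos s (left_mem_Icc.2 hst.le)) _
  have h4 : c * (t - s) / 3 ≤ (g t) ^ (-(1 / 3) : ℝ) := by linarith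
  have h5 : g t ≤ (3 / (c * (t - s))) ^ 3 := by
    have h6 : ((g t) ^ (-(1 / 3) : ℝ)) ^ 3 = (g t)⁻¹ := by
      rw [← Real.rpow_natCast, ← Real.rpow_mul hgt.le, ← Real.rpow_neg_one]; norm_num
    have h7 : (c * (t - s) / 3) ^ 3 ≤ (g t)⁻¹ := by
      rw [← h6]; exact pow_le_pow_left₀ (by positivity) h4 3
    have := inv_anti₀ (by positivity) h7
    rw [inv_inv] at this
    calc g t ≤ _ := this
      _ = _ := by rw [← inv_pow, inv_div]
  have h8 : f t = Real.exp (B * (t - s)) * g t := by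
    simp only [hg]; rw [← mul_assoc, ← Real.exp_add]; simp
  rw [h8]
  have : Real.exp (B * (t - s)) ≤ Real.exp B := Real.exp_le_exp.2 (by nlinarith)
  exact mul_le_mul this h5 hgt.le (Real.exp_pos _).le

/-- At the corner the truncated power is O(x^(m+2)), hence o(x). Applied twice, this makes the cubes
and fourth powers of truncations C², the regularity that `EnergyFlow.evolution` asks of a test
function. -/
theorem hasDerivAt_max_zero_pow (m : ℕ) (x : ℝ) :
    HasDerivAt (fun x : ℝ => max x 0 ^ (m + 2)) ((m + 2 : ℕ) * max x 0 ^ (m + 1)) x := by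
  rcases lt_trichotomy x 0 with h | h | h
  · have : (fun x : ℝ => max x 0 ^ (m + 2)) =ᶠ[nhds x] fun _ => 0 := by
      filter_upwards [Iio_mem_nhds h] with y hy
      simp [max_eq_right (le_of_lt (mem_Iio.1 hy))]
    rw [max_eq_right h.le]
    simpa using (hasDerivAt_const x (0 : ℝ)).congr_of_eventuallyEq this
  · subst h
    simp only [max_self, ne_eq, Nat.add_eq_zero_iff, one_ne_zero, and_false, not_false_eq_true,
      zero_pow, mul_zero]
    rw [hasDerivAt_iff_isLittleO]
    have h1 : (fun x : ℝ => max x 0 ^ (m + 2)) =O[nhds 0] fun x : ℝ => x ^ (m + 2) := by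
      refine Asymptotics.IsBigO.of_bound 1 (Filter.Eventually.of_forall fun y => ?_)
      rw [one_mul, norm_pow, norm_pow]
      refine pow_le_pow_left₀ (norm_nonneg _) ?_ _
      rw [Real.norm_eq_abs, Real.norm_eq_abs, abs_of_nonneg (le_max_right _ _)]
      exact max_le (le_abs_self _) (abs_nonneg _)
    have h2 : (fun x : ℝ => x ^ (m + 2)) =o[nhds 0] fun x : ℝ => x := by
      simpa using Asymptotics.isLittleO_pow_pow (𝕜 := ℝ) (show 1 < m + 2 by omega)
    simpa using h1.trans_isLittleO h2
  · have : (fun x : ℝ => max x 0 ^ (m + 2)) =ᶠ[nhds x] fun x => x ^ (m + 2) := by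
      filter_upwards [Ioi_mem_nhds h] with y hy
      simp [max_eq_left (le_of_lt (mem_Ioi.1 hy))]
    rw [max_eq_left h.le]
    simpa using (hasDerivAt_pow (m + 2) x).congr_of_eventuallyEq this

/-- De Giorgi's iteration lemma, for a quantity depending on a level and on time. -/
theorem eq_zero_of_deGiorgi {X : ℝ → ℝ → ℝ} {D a b η k H t τ : ℝ} (hD : 0 ≤ D) (ha : 0 < a)
    (hb : 0 ≤ b) (hη : 0 < η) (hH : 0 < H) (hτ : 0 < τ)
    (hX0 : ∀ l x, k ≤ l → t ≤ x → 0 ≤ X l x)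
    (hX : ∀ l l' x x', k ≤ l → l < l' → t ≤ x → x < x' → x' ≤ t + τ →
      X l' x' ≤ D * (x' - x) ^ (-a) * (l' - l) ^ (-b) * (X l x) ^ (1 + η))
    (hsmall : D * τ ^ (-a) * H ^ (-b) * (X k t) ^ η * 2 ^ (a + b) ≤ (2 : ℝ) ^ (-((a + b) / η))) :
    X (k + H) (t + τ) = 0 := by
  -- The ratio of geometric decay. It is chosen so that γ^η = 2^{-(a+b)}: the gain of the
  -- superlinear power then exactly compensates the factor 2^{(a+b)j} caused by the shrinking gaps.
  set γ : ℝ := (2 : ℝ) ^ (-((a + b) / η)) with hγ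
  have hγ0 : 0 < γ := by positivity
  have hγη : γ ^ η = (2 : ℝ) ^ (-(a + b)) := by
    rw [hγ, ← Real.rpow_mul (by norm_num)]; congr 1; field_simp
  let K : ℕ → ℝ := fun j => k + H * (1 - (1 / 2) ^ j)
  let T : ℕ → ℝ := fun j => t + τ * (1 - (1 / 2) ^ j)
  have hp : ∀ j : ℕ, (0 : ℝ) < (1 / 2) ^ j ∧ ((1 : ℝ) / 2) ^ j ≤ 1 := fun j =>
    ⟨by positivity, pow_le_one₀ (by norm_num) (by norm_num)⟩
  have hK : ∀ j, k ≤ K j := fun j => by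
    have := hp j; simp only [K]; nlinarith
  have hT : ∀ j, t ≤ T j := fun j => by
    have := hp j; simp only [T]; nlinarith
  have hT' : ∀ j, T j < t + τ := fun j => by
    have := hp j; simp only [T]; nlinarith
  have hX0' : 0 ≤ X k t := hX0 k t le_rfl le_rfl
  have hpow : ∀ (j : ℕ) (z e : ℝ), 0 < z → (z * (1 / 2) ^ j) ^ (-e) = z ^ (-e) * (2 ^ e) ^ j := by
    intro j z e hz
    rw [Real.mul_rpow hz.le (hp j).1.le]
    congr 1
    rw [← Real.rpow_natCast, ← Real.rpow_mul (by norm_num), ← Real.rpow_natCast,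
      ← Real.rpow_mul (by norm_num), one_div, Real.inv_rpow (by norm_num),
      ← Real.rpow_neg (by norm_num)]
    congr 1; ring
  have h2 : ∀ j : ℕ, ((2 : ℝ) ^ a) ^ j * (2 ^ b) ^ j * (γ ^ j) ^ (1 + η) = γ ^ j := by
    intro j
    have e1 : (γ ^ j) ^ (1 + η) = γ ^ j * ((2 : ℝ) ^ (-(a + b))) ^ j := by
      rw [Real.rpow_add (by positivity), Real.rpow_one, ← hγη, ← Real.rpow_natCast,
        ← Real.rpow_mul hγ0.le, ← Real.rpow_natCast, ← Real.rpow_mul hγ0.le, mul_comm η]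
    rw [e1, Real.rpow_neg (by norm_num), Real.rpow_add (by norm_num), ← mul_pow, inv_pow]
    have : ((2 : ℝ) ^ a * 2 ^ b) ^ j ≠ 0 := by positivity
    field_simp
  have hA0 : 0 ≤ D * τ ^ (-a) * H ^ (-b) := by positivity
  -- Stated with the full remaining gaps τ/2^j and H/2^j, so that it serves twice: for the step to
  -- stage j + 1, whose gaps are half as long (an extra factor 2^{a+b}), and for the jump from stage
  -- j to the end point.
  have hgen : ∀ j : ℕ, X (K j) (T j) ≤ X k t * γ ^ j →
      D * (τ * (1 / 2) ^ j) ^ (-a) * (H * (1 / 2) ^ j) ^ (-b) * X (K j) (T j) ^ (1 + η) ≤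
        (D * τ ^ (-a) * H ^ (-b) * (X k t) ^ η) * X k t * γ ^ j := by
    intro j ih
    rw [hpow _ _ _ hτ, hpow _ _ _ hH]
    have e0 := hX0 (K j) (T j) (hK j) (hT j)
    calc D * (τ ^ (-a) * (2 ^ a) ^ j) * (H ^ (-b) * (2 ^ b) ^ j) * X (K j) (T j) ^ (1 + η)
        ≤ D * (τ ^ (-a) * (2 ^ a) ^ j) * (H ^ (-b) * (2 ^ b) ^ j)
            * (X k t * γ ^ j) ^ (1 + η) := by gcongr
      _ = D * (τ ^ (-a) * (2 ^ a) ^ j) * (H ^ (-b) * (2 ^ b) ^ j)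
            * ((X k t) ^ (1 + η) * (γ ^ j) ^ (1 + η)) := by
          rw [Real.mul_rpow hX0' (by positivity)]
      _ = (D * τ ^ (-a) * H ^ (-b)) * (X k t) ^ (1 + η)
            * (((2 : ℝ) ^ a) ^ j * (2 ^ b) ^ j * (γ ^ j) ^ (1 + η)) := by ring
      _ = _ := by
        rw [h2, Real.rpow_add' hX0' (by positivity), Real.rpow_one]; ring
  have hmain : ∀ j, X (K j) (T j) ≤ X k t * γ ^ j := by
    intro j
    induction j with
    | zero => simp [K, T]
    | succ j ih =>
      have hlt1 : K j < K (j + 1) := by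
        have := hp j; simp only [K, pow_succ]; nlinarith
      have hlt2 : T j < T (j + 1) := by
        have := hp j; simp only [T, pow_succ]; nlinarith
      have step := hX (K j) (K (j + 1)) (T j) (T (j + 1)) (hK j) hlt1 (hT j) hlt2 (hT' _).le
      have e1 : T (j + 1) - T j = τ * (1 / 2) ^ (j + 1) := by simp only [T, pow_succ]; ring
      have e2 : K (j + 1) - K j = H * (1 / 2) ^ (j + 1) := by simp only [K, pow_succ]; ring
      rw [e1, e2, hpow _ _ _ hτ, hpow _ _ _ hH] at step
      have hg := hgen j ih
      rw [hpow _ _ _ hτ, hpow _ _ _ hH] at hg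
      calc X (K (j + 1)) (T (j + 1)) ≤ _ := step
        _ = (2 ^ a * 2 ^ b) * (D * (τ ^ (-a) * (2 ^ a) ^ j) * (H ^ (-b) * (2 ^ b) ^ j)
            * X (K j) (T j) ^ (1 + η)) := by rw [pow_succ, pow_succ]; ring
        _ ≤ (2 ^ a * 2 ^ b) * ((D * τ ^ (-a) * H ^ (-b) * (X k t) ^ η) * X k t * γ ^ j) := by
            gcongr
        _ = (D * τ ^ (-a) * H ^ (-b) * (X k t) ^ η * 2 ^ (a + b)) * (X k t * γ ^ j) := by
            rw [Real.rpow_add (by norm_num : (0:ℝ) < 2)]; ring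
        _ ≤ γ * (X k t * γ ^ j) := by gcongr
        _ = _ := by rw [pow_succ]; ring
  -- Jumping from every stage directly to the end point and letting j → ∞ avoids any continuity of
  -- `X` in the level or in time.
  have hfin : ∀ j, X (k + H) (t + τ) ≤
      (D * τ ^ (-a) * H ^ (-b) * (X k t) ^ η) * X k t * γ ^ j := by
    intro j
    have e1 : t + τ - T j = τ * (1 / 2) ^ j := by simp only [T]; ring
    have e2 : k + H - K j = H * (1 / 2) ^ j := by simp only [K]; ring
    have := hX (K j) (k + H) (T j) (t + τ) (hK j) (by have := hp j; simp only [K]; nlinarith)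
      (hT j) (hT' j) le_rfl
    rw [e1, e2] at this
    exact this.trans (hgen j (hmain j))
  refine le_antisymm ?_ (hX0 _ _ (by linarith) (by linarith))
  have hab : 0 < a + b := by linarith
  have hγ1 : γ < 1 := Real.rpow_lt_one_of_one_lt_of_neg (by norm_num)
    (by have := div_pos hab hη; linarith)
  have hlim := (tendsto_pow_atTop_nhds_zero_of_lt_one hγ0.le hγ1).const_mul
    ((D * τ ^ (-a) * H ^ (-b) * (X k t) ^ η) * X k t)
  rw [mul_zero] at hlim
  exact ge_of_tendsto' hlim hfin

end Calculus

/-! ### Energy flows: elementary consequences of the axioms. -/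

/-- The one-dimensional data carried by a positive solution `U` of a diffusion equation: `ν t` is
the distribution of `U t`, and `e t` the distribution of the energy density `|∇U|²` over the values
of `U t`. The range of `U t` is `[lo t, hi t]`. The fields record the evolution of `∫ ψ(U)`, Nash's
inequality and Poincaré's inequality. -/
structure EnergyFlow (n : ℕ) (B : ℝ) (ν e : ℝ → Measure ℝ) (lo hi : ℝ → ℝ) : Prop where
  one_le : 1 ≤ B
  finite_mass : ∀ t, 0 < t → IsFiniteMeasure (ν t)
  finite_energy : ∀ t, 0 < t → IsFiniteMeasure (e t)
  lo_pos : ∀ t, 0 < t → 0 < lo t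
  mass_compl : ∀ t, 0 < t → ν t (Icc (lo t) (hi t))ᶜ = 0
  energy_compl : ∀ t, 0 < t → e t (Icc (lo t) (hi t))ᶜ = 0
  mass_Ioi : ∀ t, 0 < t → ∀ k, k < hi t → ν t (Ioi k) ≠ 0
  mass_Iio : ∀ t, 0 < t → ∀ k, lo t < k → ν t (Iio k) ≠ 0
  le_mass : ∀ t, 0 < t → 1 ≤ B * (ν t).real univ
  mass_le : ∀ t, 0 < t → (ν t).real univ ≤ B
  evolution : ∀ ψ ψ' ψ'' : ℝ → ℝ, (∀ u, 0 < u → HasDerivAt ψ (ψ' u) u) →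
    (∀ u, 0 < u → HasDerivAt ψ' (ψ'' u) u) → ContinuousOn ψ'' (Ioi 0) →
    (∀ u, 0 < u → 0 ≤ ψ u) → ∀ t, 0 < t →
    ∃ X' : ℝ, HasDerivAt (fun s => ∫ u, ψ u ∂ν s) X' t ∧
      |X' + ∫ u, ψ'' u ∂e t| ≤ B * ∫ u, ψ u ∂ν t
  nash : ∀ w w' : ℝ → ℝ, (∀ u, 0 < u → HasDerivAt w (w' u) u) → ContinuousOn w' (Ioi 0) →
    ∀ t, 0 < t → ∀ r, 0 < r → r ≤ 1 →
    ∫ u, w u ^ 2 ∂ν t ≤ B * (r ^ 2 * ∫ u, w' u ^ 2 ∂e t + (r ^ n)⁻¹ * (∫ u, |w u| ∂ν t) ^ 2)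
  poincare : ∀ w w' : ℝ → ℝ, (∀ u, 0 < u → HasDerivAt w (w' u) u) → ContinuousOn w' (Ioi 0) →
    ∀ t, 0 < t → ∫ u, ∫ v, (w u - w v) ^ 2 ∂ν t ∂ν t ≤ B * ∫ u, w' u ^ 2 ∂e t

theorem hasDerivAt_max_sub_pow (m : ℕ) (k u : ℝ) :
    HasDerivAt (fun u : ℝ => max (u - k) 0 ^ (m + 2)) ((m + 2 : ℕ) * max (u - k) 0 ^ (m + 1)) u := by
  have := (hasDerivAt_max_zero_pow m (u - k)).comp u ((hasDerivAt_id u).sub_const k)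
  rwa [mul_one] at this

theorem hasDerivAt_max_rev_pow (m : ℕ) (k u : ℝ) :
    HasDerivAt (fun u : ℝ => max (k - u) 0 ^ (m + 2))
      (-((m + 2 : ℕ) * max (k - u) 0 ^ (m + 1))) u := by
  have := (hasDerivAt_max_zero_pow m (k - u)).comp u ((hasDerivAt_id u).const_sub k)
  rwa [mul_neg_one] at this

theorem hasDerivAt_max_log_pow (m : ℕ) (k : ℝ) {u : ℝ} (hu : 0 < u) :
    HasDerivAt (fun u : ℝ => max (k - Real.log u) 0 ^ (m + 2))
      (-((m + 2 : ℕ) * max (k - Real.log u) 0 ^ (m + 1) * u⁻¹)) u := by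
  have := (hasDerivAt_max_zero_pow m (k - Real.log u)).comp u
    ((Real.hasDerivAt_log hu.ne').const_sub k)
  rwa [mul_neg] at this

namespace EnergyFlow

variable {n : ℕ} {B : ℝ} {ν e : ℝ → Measure ℝ} {lo hi : ℝ → ℝ} {s t : ℝ}

section Basic

theorem ae_mem (h : EnergyFlow n B ν e lo hi) (ht : 0 < t) : ∀ᵐ u ∂ν t, u ∈ Icc (lo t) (hi t) :=
  h.mass_compl t ht

theorem ae_mem_energy (h : EnergyFlow n B ν e lo hi) (ht : 0 < t) :
    ∀ᵐ u ∂e t, u ∈ Icc (lo t) (hi t) :=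
  h.energy_compl t ht

theorem ae_pos (h : EnergyFlow n B ν e lo hi) (ht : 0 < t) : ∀ᵐ u ∂ν t, 0 < u := by
  filter_upwards [h.ae_mem ht] with u hu using (h.lo_pos t ht).trans_le hu.1

theorem ae_pos_energy (h : EnergyFlow n B ν e lo hi) (ht : 0 < t) : ∀ᵐ u ∂e t, 0 < u := by
  filter_upwards [h.ae_mem_energy ht] with u hu using (h.lo_pos t ht).trans_le hu.1

/-- The measure lives on a compact subset of the open half line, so continuity on `Ioi 0` suffices.
This admits logarithms and negative powers as test functions. -/
theorem integrable_of_ae_mem {m : Measure ℝ} [IsFiniteMeasure m] {a b : ℝ} (ha : 0 < a)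
    (hm : ∀ᵐ u ∂m, u ∈ Icc a b) {f : ℝ → ℝ} (hf : ContinuousOn f (Ioi 0)) : Integrable f m := by
  have h1 : m.restrict (Icc a b) = m := Measure.restrict_eq_self_of_ae_mem hm
  rw [← h1]
  exact (hf.mono fun u hu => ha.trans_le hu.1).integrableOn_compact isCompact_Icc

theorem integrable (h : EnergyFlow n B ν e lo hi) (ht : 0 < t) {f : ℝ → ℝ}
    (hf : ContinuousOn f (Ioi 0)) : Integrable f (ν t) :=
  have := h.finite_mass t ht
  integrable_of_ae_mem (h.lo_pos t ht) (h.ae_mem ht) hf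

theorem integrable_energy (h : EnergyFlow n B ν e lo hi) (ht : 0 < t) {f : ℝ → ℝ}
    (hf : ContinuousOn f (Ioi 0)) : Integrable f (e t) :=
  have := h.finite_energy t ht
  integrable_of_ae_mem (h.lo_pos t ht) (h.ae_mem_energy ht) hf

theorem lo_le_hi (h : EnergyFlow n B ν e lo hi) (ht : 0 < t) : lo t ≤ hi t := by
  by_contra hlt
  have h1 := h.mass_compl t ht
  rw [Icc_eq_empty hlt, compl_empty] at h1
  have h2 := h.le_mass t ht
  rw [measureReal_def, h1] at h2
  norm_num at h2

theorem hi_pos (h : EnergyFlow n B ν e lo hi) (ht : 0 < t) : 0 < hi t :=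
  (h.lo_pos t ht).trans_le (h.lo_le_hi ht)

/-- Convexity gives the energy term a sign; once it is dropped, Gronwall's inequality remains. The
concave counterpart below yields lower bounds. -/
theorem integral_le_exp_mul (h : EnergyFlow n B ν e lo hi) {ψ ψ' ψ'' : ℝ → ℝ}
    (h1 : ∀ u, 0 < u → HasDerivAt ψ (ψ' u) u) (h2 : ∀ u, 0 < u → HasDerivAt ψ' (ψ'' u) u)
    (h3 : ContinuousOn ψ'' (Ioi 0)) (h0 : ∀ u, 0 < u → 0 ≤ ψ u) (hc : ∀ u, 0 < u → 0 ≤ ψ'' u)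
    (hs : 0 < s) (hst : s ≤ t) :
    ∫ u, ψ u ∂ν t ≤ Real.exp (B * (t - s)) * ∫ u, ψ u ∂ν s := by
  choose! X' hX' hb using h.evolution ψ ψ' ψ'' h1 h2 h3 h0
  refine le_exp_mul_of_deriv_le hst (fun x hx => hX' x (hs.trans_le hx.1)) fun x hx => ?_
  have hx0 := hs.trans_le hx.1
  have := (abs_le.1 (hb x hx0)).2
  have h4 : 0 ≤ ∫ u, ψ'' u ∂e x := integral_nonneg_of_ae (by
    filter_upwards [h.ae_pos_energy hx0] with u hu using hc u hu)
  linarith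

theorem exp_mul_le_integral (h : EnergyFlow n B ν e lo hi) {ψ ψ' ψ'' : ℝ → ℝ}
    (h1 : ∀ u, 0 < u → HasDerivAt ψ (ψ' u) u) (h2 : ∀ u, 0 < u → HasDerivAt ψ' (ψ'' u) u)
    (h3 : ContinuousOn ψ'' (Ioi 0)) (h0 : ∀ u, 0 < u → 0 ≤ ψ u) (hc : ∀ u, 0 < u → ψ'' u ≤ 0)
    (hs : 0 < s) (hst : s ≤ t) :
    Real.exp (-B * (t - s)) * ∫ u, ψ u ∂ν s ≤ ∫ u, ψ u ∂ν t := by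
  choose! X' hX' hb using h.evolution ψ ψ' ψ'' h1 h2 h3 h0
  refine exp_mul_le_of_le_deriv hst (fun x hx => hX' x (hs.trans_le hx.1)) fun x hx => ?_
  have hx0 := hs.trans_le hx.1
  have := (abs_le.1 (hb x hx0)).1
  have h4 : ∫ u, ψ'' u ∂e x ≤ 0 := integral_nonpos_of_ae (by
    filter_upwards [h.ae_pos_energy hx0] with u hu using hc u hu)
  linarith

theorem mass_Ioi_eq_zero_iff (h : EnergyFlow n B ν e lo hi) (ht : 0 < t) {k : ℝ} :
    ν t (Ioi k) = 0 ↔ hi t ≤ k := by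
  constructor
  · intro h0; by_contra hk; exact h.mass_Ioi t ht k (not_le.1 hk) h0
  · intro hk
    refine measure_mono_null ?_ (h.mass_compl t ht)
    intro u hu hu'
    exact absurd (hu'.2.trans hk) (not_le.2 hu)

theorem mass_Iio_eq_zero_iff (h : EnergyFlow n B ν e lo hi) (ht : 0 < t) {k : ℝ} :
    ν t (Iio k) = 0 ↔ k ≤ lo t := by
  constructor
  · intro h0; by_contra hk; exact h.mass_Iio t ht k (not_le.1 hk) h0
  · intro hk
    refine measure_mono_null ?_ (h.mass_compl t ht)
    intro u hu hu'
    exact absurd (hk.trans hu'.1) (not_le.2 hu)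

theorem measureReal_mul_le_integral {m : Measure ℝ} {f : ℝ → ℝ} {S : Set ℝ} {c : ℝ}
    [IsFiniteMeasure m] (hf : Integrable f m) (h0 : ∀ᵐ u ∂m, 0 ≤ f u) (hc : 0 ≤ c)
    (hS : ∀ u ∈ S, c ≤ f u) : m.real S * c ≤ ∫ u, f u ∂m := by
  have h1 := mul_meas_ge_le_integral_of_nonneg h0 hf c
  have h2 : m.real S ≤ m.real {u | c ≤ f u} := measureReal_mono hS
  nlinarith

theorem measure_eq_zero_of_integral {m : Measure ℝ} {f : ℝ → ℝ} {S : Set ℝ}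
    (hf : Integrable f m) (h0 : ∀ᵐ u ∂m, 0 ≤ f u) (hS : ∀ u ∈ S, f u ≠ 0)
    (hz : ∫ u, f u ∂m = 0) : m S = 0 := by
  have := (integral_eq_zero_iff_of_nonneg_ae h0 hf).1 hz
  exact measure_mono_null (fun u hu => hS u hu) this

/-- The maximum principle: the integral of the convex function (u - hi s)₊³ vanishes at time s, so
it vanishes at all later times. The cube is the lowest integer power of the truncation with a
continuous second derivative. -/
theorem hi_anti (h : EnergyFlow n B ν e lo hi) (hs : 0 < s) (hst : s ≤ t) : hi t ≤ hi s := by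
  have ht := hs.trans_le hst
  have hle := h.integral_le_exp_mul (fun u _ => hasDerivAt_max_sub_pow 1 (hi s) u)
    (fun u _ => (hasDerivAt_max_sub_pow 0 (hi s) u).const_mul _) (by fun_prop)
    (fun u _ => by positivity) (fun u _ => by positivity) hs hst
  have h0 : ∫ u, max (u - hi s) 0 ^ (1 + 2) ∂ν s = 0 := by
    rw [integral_eq_zero_of_ae]
    filter_upwards [h.ae_mem hs] with u hu
    simp [max_eq_right (sub_nonpos.2 hu.2)]
  rw [h0, mul_zero] at hle
  refine (h.mass_Ioi_eq_zero_iff ht).1 (measure_eq_zero_of_integral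
    (h.integrable ht (by fun_prop)) (.of_forall fun u => by positivity) ?_
    (le_antisymm hle (integral_nonneg fun u => by positivity)))
  intro u hu
  exact pow_ne_zero _ (lt_max_of_lt_left (sub_pos.2 hu)).ne'

theorem lo_mono (h : EnergyFlow n B ν e lo hi) (hs : 0 < s) (hst : s ≤ t) : lo s ≤ lo t := by
  have ht := hs.trans_le hst
  have hle := h.integral_le_exp_mul (fun u _ => hasDerivAt_max_rev_pow 1 (lo s) u)
    (fun u _ => ((hasDerivAt_max_rev_pow 0 (lo s) u).const_mul _).neg) (by fun_prop)
    (fun u _ => by positivity) (fun u _ => by rw [mul_neg, neg_neg]; positivity) hs hst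
  have h0 : ∫ u, max (lo s - u) 0 ^ (1 + 2) ∂ν s = 0 := by
    rw [integral_eq_zero_of_ae]
    filter_upwards [h.ae_mem hs] with u hu
    simp [max_eq_right (sub_nonpos.2 hu.1)]
  rw [h0, mul_zero] at hle
  refine (h.mass_Iio_eq_zero_iff ht).1 (measure_eq_zero_of_integral
    (h.integrable ht (by fun_prop)) (.of_forall fun u => by positivity) ?_
    (le_antisymm hle (integral_nonneg fun u => by positivity)))
  intro u hu
  exact pow_ne_zero _ (lt_max_of_lt_left (sub_pos.2 hu)).ne'

/-- The total heat is comparable at comparable times. -/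
theorem exp_mul_heat_le (h : EnergyFlow n B ν e lo hi) (hs : 0 < s) (hst : s ≤ t) :
    Real.exp (-B * (t - s)) * ∫ u, u ∂ν s ≤ ∫ u, u ∂ν t :=
  h.exp_mul_le_integral (ψ' := fun _ => 1) (ψ'' := fun _ => 0) (fun u _ => hasDerivAt_id u)
    (fun u _ => hasDerivAt_const u 1) continuousOn_const (fun _ hu => hu.le) (fun _ _ => le_rfl)
    hs hst

theorem heat_pos (h : EnergyFlow n B ν e lo hi) (ht : 0 < t) : 0 < ∫ u, u ∂ν t := by
  have := h.finite_mass t ht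
  have h1 : ∫ _, lo t ∂ν t ≤ ∫ u, u ∂ν t := by
    refine integral_mono_ae (integrable_const _) (h.integrable ht continuousOn_id) ?_
    filter_upwards [h.ae_mem ht] with u hu using hu.1
  rw [integral_const, smul_eq_mul] at h1
  have h2 := h.le_mass t ht
  have h3 : 0 < (ν t).real univ := by
    by_contra hn
    nlinarith [h.one_le]
  exact (mul_pos h3 (h.lo_pos t ht)).trans_le h1

theorem heat_le (h : EnergyFlow n B ν e lo hi) (ht : 0 < t) : ∫ u, u ∂ν t ≤ B * hi t := by
  have := h.finite_mass t ht
  have h1 : ∫ u, u ∂ν t ≤ ∫ _, hi t ∂ν t := by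
    refine integral_mono_ae (h.integrable ht continuousOn_id) (integrable_const _) ?_
    filter_upwards [h.ae_mem ht] with u hu using hu.2
  rw [integral_const, smul_eq_mul] at h1
  exact h1.trans (mul_le_mul_of_nonneg_right (h.mass_le t ht) (h.hi_pos ht).le)

/-- Cauchy-Schwarz against the indicator of the set where w ≠ 0, obtained by expanding ∫(|w| - a·1)²
≥ 0 and taking the optimal a = Q/σ. -/
theorem sq_integral_abs_le (h : EnergyFlow n B ν e lo hi) {w : ℝ → ℝ}
    (hcont : ContinuousOn w (Ioi 0)) (ht : 0 < t) {σ : ℝ} (hσ : 0 < σ)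
    (hw : (ν t).real {u | 0 < u ∧ w u ≠ 0} ≤ σ) :
    (∫ u, |w u| ∂ν t) ^ 2 ≤ σ * ∫ u, w u ^ 2 ∂ν t := by
  have := h.finite_mass t ht
  have hsq : Integrable (fun u => w u ^ 2) (ν t) := h.integrable ht (hcont.pow 2)
  have hab : Integrable (fun u => |w u|) (ν t) := h.integrable ht hcont.abs
  set P := ∫ u, w u ^ 2 ∂ν t with hP
  set Q := ∫ u, |w u| ∂ν t with hQ
  have key : ∀ a : ℝ, 0 ≤ P - 2 * a * Q + a ^ 2 * σ := by
    intro a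
    have i1 : 0 ≤ ∫ u, (|w u| - {u | 0 < u ∧ w u ≠ 0}.indicator (fun _ => a) u) ^ 2 ∂ν t :=
      integral_nonneg fun u => sq_nonneg _
    have hms : MeasurableSet {u : ℝ | 0 < u ∧ w u ≠ 0} := by
      have : IsOpen (Ioi (0 : ℝ) ∩ w ⁻¹' {0}ᶜ) :=
        hcont.isOpen_inter_preimage isOpen_Ioi isOpen_compl_singleton
      exact this.measurableSet
    have i2 : ∫ u, (|w u| - {u | 0 < u ∧ w u ≠ 0}.indicator (fun _ => a) u) ^ 2 ∂ν t
        = ∫ u, (w u ^ 2 - 2 * a * |w u|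
          + {u | 0 < u ∧ w u ≠ 0}.indicator (fun _ => a ^ 2) u) ∂ν t := by
      refine integral_congr_ae ?_
      filter_upwards [h.ae_pos ht] with u hu
      by_cases hwu : w u = 0
      · simp [hwu]
      · have : u ∈ {u | 0 < u ∧ w u ≠ 0} := ⟨hu, hwu⟩
        simp only [indicator_of_mem this]
        rw [sub_sq, sq_abs]; ring
    have hi0 : Integrable ({u | 0 < u ∧ w u ≠ 0}.indicator fun _ => a ^ 2) (ν t) :=
      (integrable_indicator_iff hms).2 (integrable_const _).integrableOn
    have hi1 : Integrable (fun u => w u ^ 2 - 2 * a * |w u|) (ν t) := hsq.sub (hab.const_mul _)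
    rw [i2, integral_add hi1 hi0, integral_sub hsq (hab.const_mul _), integral_const_mul,
      integral_indicator hms, setIntegral_const, smul_eq_mul] at i1
    nlinarith [sq_nonneg a]
  have h3 := key (Q / σ)
  have h4 : P - 2 * (Q / σ) * Q + (Q / σ) ^ 2 * σ = P - Q ^ 2 / σ := by field_simp; ring
  rw [h4] at h3
  have h5 : Q ^ 2 / σ ≤ P := by linarith
  rw [div_le_iff₀ hσ] at h5
  linarith

theorem sq_integral_mul_le {m : Measure ℝ} {f g : ℝ → ℝ} (hf : Integrable (fun u => f u ^ 2) m)
    (hg : Integrable (fun u => g u ^ 2) m) (hfg : Integrable (fun u => f u * g u) m) :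
    (∫ u, f u * g u ∂m) ^ 2 ≤ (∫ u, f u ^ 2 ∂m) * ∫ u, g u ^ 2 ∂m := by
  have key : ∀ a : ℝ, 0 ≤ (∫ u, g u ^ 2 ∂m) * (a * a) + (-2 * ∫ u, f u * g u ∂m) * a
      + ∫ u, f u ^ 2 ∂m := by
    intro a
    have i1 : 0 ≤ ∫ u, (f u - a * g u) ^ 2 ∂m := integral_nonneg fun u => sq_nonneg _
    have i2 : ∫ u, (f u - a * g u) ^ 2 ∂m
        = ∫ u, (f u ^ 2 - 2 * a * (f u * g u) + a ^ 2 * g u ^ 2) ∂m := by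
      congr 1; ext u; ring
    have i3 : Integrable (fun u => f u ^ 2 - 2 * a * (f u * g u)) m := hf.sub (hfg.const_mul _)
    rw [i2, integral_add i3 (hg.const_mul _), integral_sub hf (hfg.const_mul _),
      integral_const_mul, integral_const_mul] at i1
    linarith
  have := discrim_le_zero key
  rw [discrim] at this
  nlinarith

/-- A Faber-Krahn inequality: functions supported in a set of small measure have large energy. -/
theorem faberKrahn (h : EnergyFlow n B ν e lo hi) (hn : 0 < n) {w w' : ℝ → ℝ}
    (h1 : ∀ u, 0 < u → HasDerivAt w (w' u) u) (h2 : ContinuousOn w' (Ioi 0)) (ht : 0 < t)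
    {σ : ℝ} (hσ : 0 < σ) (hσ1 : 2 * B * σ ≤ 1) (hw : (ν t).real {u | 0 < u ∧ w u ≠ 0} ≤ σ) :
    ∫ u, w u ^ 2 ∂ν t ≤ 2 * B * (2 * B * σ) ^ (2 / n : ℝ) * ∫ u, w' u ^ 2 ∂e t := by
  have := h.finite_mass t ht
  have hB := h.one_le
  have hn' : (n : ℝ) ≠ 0 := by positivity
  have hB0 : 0 < 2 * B * σ := by positivity
  -- The scale at which r^n = 2Bσ. In Nash's inequality the L¹ term is then at most half of the left
  -- side and can be absorbed; the assumption 2Bσ ≤ 1 makes this scale admissible.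
  set r : ℝ := (2 * B * σ) ^ (1 / n : ℝ) with hr
  have hr0 : 0 < r := by positivity
  have hr1 : r ≤ 1 := Real.rpow_le_one hB0.le hσ1 (by positivity)
  have hrn : r ^ n = 2 * B * σ := by
    rw [hr, ← Real.rpow_natCast, ← Real.rpow_mul hB0.le, one_div, inv_mul_cancel₀ hn',
      Real.rpow_one]
  have hr2 : r ^ 2 = (2 * B * σ) ^ (2 / n : ℝ) := by
    rw [hr, ← Real.rpow_natCast, ← Real.rpow_mul hB0.le]; congr 1; push_cast; ring
  have hcont : ContinuousOn w (Ioi 0) := fun u hu => (h1 u hu).continuousAt.continuousWithinAt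
  have hsq : Integrable (fun u => w u ^ 2) (ν t) := h.integrable ht (hcont.pow 2)
  have hab : Integrable (fun u => |w u|) (ν t) := h.integrable ht hcont.abs
  have hN := h.nash w w' h1 h2 t ht r hr0 hr1
  set P := ∫ u, w u ^ 2 ∂ν t with hP
  set Q := ∫ u, |w u| ∂ν t with hQ
  have hP0 : 0 ≤ P := integral_nonneg fun u => sq_nonneg _
  have hCS : Q ^ 2 ≤ σ * P := h.sq_integral_abs_le hcont ht hσ hw
  have h6 : B * ((r ^ n)⁻¹ * Q ^ 2) ≤ P / 2 := by
    rw [hrn]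
    calc B * ((2 * B * σ)⁻¹ * Q ^ 2) ≤ B * ((2 * B * σ)⁻¹ * (σ * P)) := by gcongr
      _ = P / 2 := by field_simp
  rw [← hr2]
  linarith

end Basic
end EnergyFlow

namespace EnergyFlow

variable {n : ℕ} {B : ℝ} {ν e : ℝ → Measure ℝ} {lo hi : ℝ → ℝ} {s t : ℝ}

/-! ### The maximum is controlled by the total heat. -/

section UpperBound

/-- One step of De Giorgi's scheme. Chebyshev's inequality bounds the mass above level l by σ
throughout [s, t]. The second derivative of (u-l)₊⁴ is three times the squared derivative of
(u-l)₊², so Faber-Krahn gives exponential decay at rate 3/Q with Q of order σ^{2/n}, and an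
exponential e^{-3y} is bounded by 1/y. -/
theorem integral_excess_step (h : EnergyFlow n B ν e lo hi) (hn : 0 < n) {k l : ℝ} (hkl : k < l)
    (hs : 0 < s) (hst : s < t) (hts : t ≤ s + 1) :
    ∫ u, max (u - l) 0 ^ 4 ∂ν t ≤
      (2 * B * Real.exp B * (2 * B * Real.exp B) ^ (2 / n : ℝ)) * (t - s) ^ (-1 : ℝ) *
        (l - k) ^ (-(8 / n) : ℝ) * (∫ u, max (u - k) 0 ^ 4 ∂ν s) ^ (1 + 2 / n : ℝ) := by
  have hB := h.one_le
  have ht := hs.trans hst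
  have hts0 : 0 < t - s := by linarith
  have hkl0 : 0 < l - k := by linarith
  have hn' : (0 : ℝ) < n := by positivity
  set X := ∫ u, max (u - k) 0 ^ 4 ∂ν s with hX
  have hX0 : 0 ≤ X := integral_nonneg fun u => by positivity
  have grow : ∀ (k x y : ℝ), 0 < x → x ≤ y → y ≤ x + 1 →
      ∫ u, max (u - k) 0 ^ 4 ∂ν y ≤ Real.exp B * ∫ u, max (u - k) 0 ^ 4 ∂ν x := by
    intro k x y hx hxy hyx
    refine (h.integral_le_exp_mul (fun u _ => hasDerivAt_max_sub_pow 2 k u)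
      (fun u _ => (hasDerivAt_max_sub_pow 1 k u).const_mul _) (by fun_prop)
      (fun u _ => by positivity) (fun u _ => by positivity) hx hxy).trans ?_
    refine mul_le_mul_of_nonneg_right (Real.exp_le_exp.2 (by nlinarith))
      (integral_nonneg fun u => by positivity)
  have level : ∀ x, 0 < x → ∫ u, max (u - l) 0 ^ 4 ∂ν x ≤ ∫ u, max (u - k) 0 ^ 4 ∂ν x := by
    intro x hx
    refine integral_mono (h.integrable hx (by fun_prop)) (h.integrable hx (by fun_prop)) ?_
    intro u
    have : max (u - l) 0 ≤ max (u - k) 0 := max_le_max (by linarith) le_rfl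
    exact pow_le_pow_left₀ (le_max_right _ _) this 4
  set σ : ℝ := Real.exp B * X / (l - k) ^ 4 with hσ
  have hσ0 : 0 ≤ σ := by positivity
  have hmeas : ∀ x, s ≤ x → x ≤ t → (ν x).real (Ioi l) ≤ σ := by
    intro x hsx hxt
    have hx := hs.trans_le hsx
    have := h.finite_mass x hx
    rw [hσ, le_div_iff₀ (by positivity)]
    refine (measureReal_mul_le_integral (f := fun u => max (u - k) 0 ^ 4)
      (h.integrable hx (by fun_prop)) (.of_forall fun u => by positivity) (by positivity) ?_).trans
      (grow k s x hs hsx (by linarith))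
    intro u hu
    exact pow_le_pow_left₀ hkl0.le ((by linarith [mem_Ioi.1 hu] : l - k ≤ u - k).trans
      (le_max_left _ _)) 4
  have hpow : (l - k) ^ (-(8 / n) : ℝ) * X ^ (1 + 2 / n : ℝ)
      = (X / (l - k) ^ 4) ^ (2 / n : ℝ) * X := by
    rw [Real.rpow_add' hX0 (by positivity), Real.rpow_one, Real.div_rpow hX0 (by positivity),
      ← Real.rpow_natCast (l - k), ← Real.rpow_mul hkl0.le, Real.rpow_neg hkl0.le]
    have : ((4 : ℕ) : ℝ) * (2 / n) = 8 / n := by push_cast; ring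
    rw [this]; field_simp
  have hprod : (2 * B * Real.exp B) ^ (2 / n : ℝ) * (X / (l - k) ^ 4) ^ (2 / n : ℝ)
      = (2 * B * σ) ^ (2 / n : ℝ) := by
    rw [← Real.mul_rpow (by positivity) (by positivity)]; congr 1; rw [hσ]; ring
  have hgoal : (2 * B * Real.exp B * (2 * B * Real.exp B) ^ (2 / n : ℝ)) * (t - s) ^ (-1 : ℝ) *
      (l - k) ^ (-(8 / n) : ℝ) * X ^ (1 + 2 / n : ℝ)
      = Real.exp B * (2 * B * (2 * B * σ) ^ (2 / n : ℝ) / (t - s)) * X := by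
    rw [mul_assoc _ ((l - k) ^ _), hpow, ← hprod, Real.rpow_neg_one]; field_simp
  rw [hgoal]
  -- If 2Bσ > 1 the Faber-Krahn inequality is not available, but then the factor on the right is at
  -- least one up to e^B and the crude growth bound suffices.
  rcases lt_or_ge 1 (2 * B * σ) with hbig | hsmall
  · have h1 : (1 : ℝ) ≤ (2 * B * σ) ^ (2 / n : ℝ) := Real.one_le_rpow hbig.le (by positivity)
    have h2 : 1 ≤ 2 * B * (2 * B * σ) ^ (2 / n : ℝ) / (t - s) := by
      rw [le_div_iff₀ hts0]; nlinarith
    calc _ ≤ _ := level t ht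
      _ ≤ Real.exp B * 1 * X := by rw [mul_one]; exact grow k s t hs hst.le hts
      _ ≤ _ := by gcongr
  rcases hσ0.eq_or_lt with hz | hσpos
  · have hXz : X = 0 := by
      rw [hσ, eq_comm, div_eq_zero_iff, mul_eq_zero] at hz
      rcases hz with (hz | hz) | hz
      · exact absurd hz (Real.exp_pos _).ne'
      · exact hz
      · exact absurd hz (by positivity)
    have := (level t ht).trans (grow k s t hs hst.le hts)
    rw [← hX, hXz, mul_zero] at this
    rw [hXz, mul_zero]; exact this
  set Q : ℝ := 2 * B * (2 * B * σ) ^ (2 / n : ℝ) with hQ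
  have hQ0 : 0 < Q := by positivity
  have h1 : ∀ u : ℝ, 0 < u → HasDerivAt (fun u => max (u - l) 0 ^ (0 + 2))
      ((0 + 2 : ℕ) * max (u - l) 0 ^ (0 + 1)) u := fun u _ => hasDerivAt_max_sub_pow 0 l u
  have hFK : ∀ x, s ≤ x → x ≤ t → ∫ u, max (u - l) 0 ^ 4 ∂ν x
      ≤ Q * ∫ u, (((0 + 2 : ℕ) : ℝ) * max (u - l) 0 ^ (0 + 1)) ^ 2 ∂e x := by
    intro x hsx hxt
    have hx := hs.trans_le hsx
    have := h.finite_mass x hx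
    have := h.faberKrahn hn h1 (by fun_prop) hx hσpos hsmall ((measureReal_mono (by
      rintro u ⟨-, hu⟩
      by_contra hul
      exact hu (by simp [max_eq_right (sub_nonpos.2 (not_lt.1 (fun h' => hul (mem_Ioi.2 h'))))]))).trans (hmeas x hsx hxt))
    refine le_trans (le_of_eq ?_) this
    congr 1; ext u; ring
  choose! X' hX' hb using h.evolution _ _ _ (fun u _ => hasDerivAt_max_sub_pow 2 l u)
      (fun u _ => (hasDerivAt_max_sub_pow 1 l u).const_mul _) (by fun_prop)
      (fun u _ => by positivity)
  have hdecay := le_exp_mul_of_deriv_le (c := B - 3 / Q) hst.le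
    (fun x hx => hX' x (hs.trans_le hx.1)) (fun x hx => by
      have e1 := (abs_le.1 (hb x (hs.trans_le hx.1))).2
      have e2 := hFK x hx.1 hx.2
      have e3 : ∫ u, ((2 + 2 : ℕ) : ℝ) * (((1 + 2 : ℕ) : ℝ) * max (u - l) 0 ^ (1 + 1)) ∂e x
          = 3 * ∫ u, (((0 + 2 : ℕ) : ℝ) * max (u - l) 0 ^ (0 + 1)) ^ 2 ∂e x := by
        rw [← integral_const_mul]; congr 1; ext u; push_cast; ring
      rw [e3] at e1
      have key : ∀ x' I E : ℝ, x' + 3 * E ≤ B * I → I ≤ Q * E → x' ≤ (B - 3 / Q) * I := by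
        intro x' I E e1 e2
        have e4 : 3 / Q * I ≤ 3 * E := by
          rw [div_mul_eq_mul_div, div_le_iff₀ hQ0]; linarith
        rw [sub_mul]; linarith
      exact key _ _ _ e1 e2)
  have hexp : Real.exp ((B - 3 / Q) * (t - s)) ≤ Real.exp B * (Q / (t - s)) := by
    have e1 : Real.exp ((B - 3 / Q) * (t - s)) = Real.exp (B * (t - s)) *
        (Real.exp (3 / Q * (t - s)))⁻¹ := by rw [← Real.exp_neg, ← Real.exp_add]; congr 1; ring
    rw [e1]
    have e2 : Real.exp (B * (t - s)) ≤ Real.exp B := Real.exp_le_exp.2 (by nlinarith)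
    have e3 : (t - s) / Q ≤ Real.exp (3 / Q * (t - s)) := by
      have := Real.add_one_le_exp (3 / Q * (t - s))
      have e4 : 0 < (t - s) / Q := by positivity
      have e5 : 3 / Q * (t - s) = 3 * ((t - s) / Q) := by ring
      rw [e5] at this ⊢; linarith
    have e6 : (Real.exp (3 / Q * (t - s)))⁻¹ ≤ Q / (t - s) := by
      rw [← inv_div (t - s) Q]; exact inv_anti₀ (by positivity) e3
    gcongr
  calc ∫ u, max (u - l) 0 ^ 4 ∂ν t ≤ _ := hdecay
    _ ≤ (Real.exp B * (Q / (t - s))) * X := by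
      refine mul_le_mul hexp (level s hs) (integral_nonneg fun u => by positivity) (by positivity)

/-- A bound for the maximum in terms of the maximum and the total heat at an earlier time. -/
theorem exists_hi_pow_le (n : ℕ) (hn : 0 < n) (B : ℝ) (hB : 1 ≤ B) : ∃ C : ℝ, 0 < C ∧
    ∀ (ν e : ℝ → Measure ℝ) (lo hi : ℝ → ℝ), EnergyFlow n B ν e lo hi → ∀ s t, 0 < s → s < t →
      t ≤ s + 1 → (t - s) ^ (n / 2 : ℝ) * hi t ^ 4 ≤ C * hi s ^ 3 * ∫ u, u ∂ν s := by
  have hn' : (0 : ℝ) < n := by positivity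
  set D := 2 * B * Real.exp B * (2 * B * Real.exp B) ^ (2 / n : ℝ) with hD
  have hD0 : 0 < D := by positivity
  set b : ℝ := 8 / n with hb
  set η : ℝ := 2 / n with hη
  have hη0 : 0 < η := by positivity
  have hb0 : 0 < b := by positivity
  set Z : ℝ := D * 2 ^ (1 + b) * 2 ^ ((1 + b) / η) with hZ
  have hZ0 : 0 < Z := by positivity
  refine ⟨Z ^ (n / 2 : ℝ), by positivity, ?_⟩
  intro ν e lo hi h s t hs hst hts
  have ht := hs.trans hst
  have hts0 : 0 < t - s := by linarith
  set X := ∫ u, max (u - 0) 0 ^ 4 ∂ν s with hX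
  have hXle : X ≤ hi s ^ 3 * ∫ u, u ∂ν s := by
    rw [← integral_const_mul]
    refine integral_mono_ae (h.integrable hs (by fun_prop)) (h.integrable hs (by fun_prop)) ?_
    filter_upwards [h.ae_mem hs, h.ae_pos hs] with u hu hu0
    rw [sub_zero, max_eq_left hu0.le, pow_succ]
    exact mul_le_mul_of_nonneg_right (pow_le_pow_left₀ hu0.le hu.2 3) hu0.le
  have hXpos : 0 < X := by
    have := h.finite_mass s hs
    refine lt_of_lt_of_le ?_ (measureReal_mul_le_integral (S := Icc (lo s) (hi s))
      (c := lo s ^ 4) (f := fun u => max (u - 0) 0 ^ 4)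
      (h.integrable hs (by fun_prop)) (.of_forall fun u => by positivity)
      (by have := h.lo_pos s hs; positivity) ?_)
    · have h1 := h.le_mass s hs
      have h2 : (ν s).real (Icc (lo s) (hi s)) = (ν s).real univ := by
        rw [measureReal_def, measureReal_def]
        congr 1
        exact measure_congr (by
          filter_upwards [h.ae_mem hs] with u hu
          exact propext ⟨fun _ => trivial, fun _ => hu⟩)
      rw [h2]
      have h3 : 0 < (ν s).real univ := by by_contra hneg; nlinarith
      have := h.lo_pos s hs
      positivity
    · intro u hu
      have h0 := h.lo_pos s hs
      rw [sub_zero]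
      exact pow_le_pow_left₀ h0.le (hu.1.trans (le_max_left _ _)) 4
  -- The height for which the smallness condition of `eq_zero_of_deGiorgi` is an equality; the
  -- exponent n/8 is 1/b.
  set H : ℝ := (Z * X ^ η / (t - s)) ^ (n / 8 : ℝ) with hH
  have hH0 : 0 < H := by positivity
  have hHb : H ^ (-b) = (Z * X ^ η / (t - s))⁻¹ := by
    rw [hH, ← Real.rpow_mul (by positivity), ← Real.rpow_neg_one]
    congr 1; rw [hb]; field_simp
  have hzero := eq_zero_of_deGiorgi (X := fun k x => ∫ u, max (u - k) 0 ^ 4 ∂ν x) (k := 0) (t := s)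
    (τ := t - s) (D := D) (a := 1) (b := b) (η := η) hD0.le one_pos hb0.le hη0 hH0 hts0
    (fun l x _ _ => integral_nonneg fun u => by positivity)
    (fun l l' x x' _ hl hx hxx hx' =>
      h.integral_excess_step hn hl (hs.trans_le hx) hxx (by linarith)) (by
      rw [hHb, ← hX, Real.rpow_neg_one, hZ, Real.rpow_neg (by norm_num)]
      apply le_of_eq
      have : X ^ η ≠ 0 := by positivity
      field_simp)
  have hts' : s + (t - s) = t := by ring
  rw [hts', zero_add] at hzero
  have hle : hi t ≤ H := by
    refine (h.mass_Ioi_eq_zero_iff ht).1 (measure_eq_zero_of_integral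
      (h.integrable ht (by fun_prop)) (.of_forall fun u => by positivity) ?_ hzero)
    intro u hu
    exact pow_ne_zero _ (lt_max_of_lt_left (sub_pos.2 hu)).ne'
  have hH4 : H ^ 4 = Z ^ (n / 2 : ℝ) * X / (t - s) ^ (n / 2 : ℝ) := by
    rw [hH, ← Real.rpow_natCast, ← Real.rpow_mul (by positivity)]
    have : (n / 8 : ℝ) * (4 : ℕ) = n / 2 := by push_cast; ring
    rw [this, Real.div_rpow (by positivity) hts0.le, Real.mul_rpow hZ0.le (by positivity),
      ← Real.rpow_mul hXpos.le]
    have : η * (n / 2) = 1 := by rw [hη]; field_simp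
    rw [this, Real.rpow_one]
  have hpos : 0 < (t - s) ^ (n / 2 : ℝ) := by positivity
  calc (t - s) ^ (n / 2 : ℝ) * hi t ^ 4 ≤ (t - s) ^ (n / 2 : ℝ) * H ^ 4 := by
        have := (h.hi_pos ht).le; gcongr
    _ = Z ^ (n / 2 : ℝ) * X := by rw [hH4]; field_simp
    _ ≤ Z ^ (n / 2 : ℝ) * (hi s ^ 3 * ∫ u, u ∂ν s) := by gcongr
    _ = _ := by ring

/-- The maximum is controlled by the total heat at the same time. -/
theorem exists_hi_le (n : ℕ) (hn : 0 < n) (B : ℝ) (hB : 1 ≤ B) : ∃ C : ℝ, 0 < C ∧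
    ∀ (ν e : ℝ → Measure ℝ) (lo hi : ℝ → ℝ), EnergyFlow n B ν e lo hi → ∀ t, 0 < t →
      (min t 1) ^ (n / 2 : ℝ) * hi t ≤ C * ∫ u, u ∂ν t := by
  obtain ⟨M, hM, hstep⟩ := exists_hi_pow_le n hn B hB
  set p : ℝ := n / 2 with hp
  have hp0 : 0 ≤ p := by positivity
  refine ⟨2 ^ p * ((2 ^ p) ^ 4 * M * Real.exp B), by positivity, ?_⟩
  intro ν e lo hi h t ht
  set L := min t 1 / 2 with hL
  have hmin : 0 < min t 1 := lt_min ht one_pos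
  have hL0 : 0 < L := by positivity
  have hL1 : L ≤ 1 / 2 := by have := min_le_right t 1; linarith
  have hLt : L < t := by have := min_le_left t 1; linarith
  set s₀ := t - L with hs₀
  have hs₀0 : 0 < s₀ := by linarith
  set m := ∫ u, u ∂ν t with hm
  have hm0 : 0 < m := h.heat_pos ht
  -- The weight compensates the singular factor of `exists_hi_pow_le`, and the supremum S of F is
  -- finite a priori since `hi` is nonincreasing. Using that estimate between s and the midpoint of
  -- s₀ and s gives S⁴ ≤ K S³ m. As S is finite and positive, S³ cancels and the earlier maximum
  -- disappears.
  set F : ℝ → ℝ := fun s => (s - s₀) ^ p * hi s with hF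
  have hbdd : BddAbove (F '' Ioc s₀ t) := by
    refine ⟨L ^ p * hi s₀, ?_⟩
    rintro _ ⟨s, hs, rfl⟩
    have h1 := hs.1
    have h2 := hs.2
    exact mul_le_mul (Real.rpow_le_rpow (by linarith) (by linarith) hp0)
      (h.hi_anti hs₀0 hs.1.le) (h.hi_pos (hs₀0.trans h1)).le (by positivity)
  set S := sSup (F '' Ioc s₀ t) with hS
  have hle : ∀ s ∈ Ioc s₀ t, F s ≤ S := fun s hs => le_csSup hbdd ⟨s, hs, rfl⟩
  have htmem : t ∈ Ioc s₀ t := ⟨by linarith, le_rfl⟩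
  have hFt : 0 < F t := mul_pos (Real.rpow_pos_of_pos (by linarith) _) (h.hi_pos ht)
  have hS0 : 0 < S := hFt.trans_le (hle t htmem)
  set K := (2 ^ p) ^ 4 * M * Real.exp B with hK
  have hK0 : 0 < K := by positivity
  have hF4 : ∀ s ∈ Ioc s₀ t, F s ^ 4 ≤ K * S ^ 3 * m := by
    intro s hs
    have h1 := hs.1
    have h2 := hs.2
    set d := (s - s₀) / 2 with hd
    have hd0 : 0 < d := by rw [hd]; linarith
    have hsd : 0 < s - d := by rw [hd]; linarith
    have hmem : s - d ∈ Ioc s₀ t := ⟨by rw [hd]; linarith, by linarith⟩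
    have hst := hstep ν e lo hi h (s - d) s hsd (by linarith) (by rw [hd]; linarith)
    have e0 : s - (s - d) = d := by ring
    rw [e0] at hst
    have hS' := hle _ hmem
    have e1 : s - d - s₀ = d := by rw [hd]; ring
    simp only [hF, e1] at hS'
    have hheat : ∫ u, u ∂ν (s - d) ≤ Real.exp B * m := by
      have := h.exp_mul_heat_le hsd (show s - d ≤ t by linarith)
      have h3 : Real.exp (-B) ≤ Real.exp (-B * (t - (s - d))) :=
        Real.exp_le_exp.2 (by nlinarith)
      have h4 := h.heat_pos hsd
      have h5 : Real.exp (-B) * ∫ u, u ∂ν (s - d) ≤ m :=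
        (mul_le_mul_of_nonneg_right h3 h4.le).trans this
      rw [Real.exp_neg, inv_mul_le_iff₀ (Real.exp_pos _)] at h5
      exact h5
    have hdp : 0 < d ^ p := by positivity
    have hh0 := h.hi_pos hsd
    have hht := h.heat_pos hsd
    have e2 : F s = 2 ^ p * d ^ p * hi s := by
      rw [← Real.mul_rpow (by norm_num) hd0.le]
      simp only [hF]; congr 2; rw [hd]; ring
    rw [e2]
    calc (2 ^ p * d ^ p * hi s) ^ 4 = (2 ^ p) ^ 4 * (d ^ p) ^ 3 * (d ^ p * hi s ^ 4) := by ring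
      _ ≤ (2 ^ p) ^ 4 * (d ^ p) ^ 3 * (M * hi (s - d) ^ 3 * ∫ u, u ∂ν (s - d)) := by gcongr
      _ = (2 ^ p) ^ 4 * M * (d ^ p * hi (s - d)) ^ 3 * ∫ u, u ∂ν (s - d) := by ring
      _ ≤ (2 ^ p) ^ 4 * M * S ^ 3 * (Real.exp B * m) := by gcongr
      _ = K * S ^ 3 * m := by rw [hK]; ring
  have hS4 : S ^ 4 ≤ K * S ^ 3 * m := by
    have root : ∀ y : ℝ, 0 ≤ y → (y ^ (1 / 4 : ℝ)) ^ 4 = y := by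
      intro y hy
      rw [← Real.rpow_natCast, ← Real.rpow_mul hy]; norm_num
    have h1 : S ≤ (K * S ^ 3 * m) ^ (1 / 4 : ℝ) := by
      refine csSup_le ⟨_, t, htmem, rfl⟩ ?_
      rintro _ ⟨s, hs, rfl⟩
      have h2 : 0 ≤ F s := mul_nonneg (Real.rpow_nonneg (by linarith [hs.1]) _)
        (h.hi_pos (hs₀0.trans hs.1)).le
      refine le_of_pow_le_pow_left₀ (n := 4) (by norm_num) (by positivity) ((hF4 s hs).trans ?_)
      exact (root _ (by positivity)).ge
    refine (pow_le_pow_left₀ hS0.le h1 4).trans ?_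
    exact (root _ (by positivity)).le
  have hSK : S ≤ K * m := by
    have : S ^ 3 * S ≤ S ^ 3 * (K * m) := by linarith [hS4, (by ring : S ^ 4 = S ^ 3 * S)]
    exact le_of_mul_le_mul_left this (by positivity)
  have h3 := (hle t htmem).trans hSK
  have e3 : t - s₀ = L := by rw [hs₀]; ring
  simp only [hF, e3] at h3
  have e4 : (min t 1) ^ p = 2 ^ p * L ^ p := by
    rw [← Real.mul_rpow (by norm_num) hL0.le]; congr 1; rw [hL]; ring
  rw [e4]
  calc 2 ^ p * L ^ p * hi t = 2 ^ p * (L ^ p * hi t) := by ring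
    _ ≤ 2 ^ p * (K * m) := by gcongr
    _ = _ := by ring

end UpperBound
end EnergyFlow

namespace EnergyFlow

variable {n : ℕ} {B : ℝ} {ν e : ℝ → Measure ℝ} {lo hi : ℝ → ℝ} {s t : ℝ}

/-! ### Spreading of heat: concave powers with exponents tending to zero. -/

section SmallPowers

theorem hasDerivAt_div_rpow {A : ℝ} (hA : 0 < A) (q : ℝ) {u : ℝ} (hu : 0 < u) :
    HasDerivAt (fun u : ℝ => (u / A) ^ q) (q * A⁻¹ * (u / A) ^ (q - 1)) u := by
  have h1 : HasDerivAt (fun u : ℝ => u / A) A⁻¹ u := by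
    simpa using (hasDerivAt_id u).div_const A
  have := h1.rpow_const (p := q) (Or.inl (by positivity))
  convert this using 1; ring

theorem continuousOn_div_rpow {A : ℝ} (hA : 0 < A) (q : ℝ) :
    ContinuousOn (fun u : ℝ => (u / A) ^ q) (Ioi 0) := fun _ hu =>
  (hasDerivAt_div_rpow hA q hu).continuousAt.continuousWithinAt

theorem integral_div_rpow_le (h : EnergyFlow n B ν e lo hi) (ht : 0 < t) {A q : ℝ} (hA : 0 < A)
    (hq : 0 ≤ q) (hhi : hi t ≤ A) : ∫ u, (u / A) ^ q ∂ν t ≤ B := by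
  have := h.finite_mass t ht
  have h1 : ∫ u, (u / A) ^ q ∂ν t ≤ ∫ _, (1 : ℝ) ∂ν t := by
    refine integral_mono_ae (h.integrable ht (continuousOn_div_rpow hA q)) (integrable_const _) ?_
    filter_upwards [h.ae_mem ht, h.ae_pos ht] with u hu hu0
    exact Real.rpow_le_one (by positivity) ((div_le_one hA).2 (hu.2.trans hhi)) hq
  rw [integral_const, smul_eq_mul, mul_one] at h1
  exact h1.trans (h.mass_le t ht)

/-- For exponents in [0, 1] the power is concave, so its integral is nondecreasing in time up to the
factor e^{-B}. Lower bounds obtained at one moment thus persist. -/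
theorem exp_mul_integral_div_rpow_le (h : EnergyFlow n B ν e lo hi) {A q : ℝ} (hA : 0 < A)
    (hq : 0 ≤ q) (hq1 : q ≤ 1) (hs : 0 < s) (hst : s ≤ t) (hts : t ≤ s + 1) :
    Real.exp (-B) * ∫ u, (u / A) ^ q ∂ν s ≤ ∫ u, (u / A) ^ q ∂ν t := by
  have hB := h.one_le
  refine le_trans ?_ (h.exp_mul_le_integral (fun u hu => hasDerivAt_div_rpow hA q hu)
    (fun u hu => (hasDerivAt_div_rpow hA (q - 1) hu).const_mul _)
    (((continuousOn_div_rpow hA _).const_mul _).const_mul _) (fun u hu => by positivity)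
    (fun u hu => ?_) hs hst)
  · refine mul_le_mul_of_nonneg_right (Real.exp_le_exp.2 (by nlinarith)) ?_
    refine integral_nonneg_of_ae ?_
    filter_upwards [h.ae_pos hs] with u hu
    positivity
  · have h1 : 0 ≤ A⁻¹ * (A⁻¹ * (u / A) ^ (q - 1 - 1)) := by positivity
    have h2 : q * (q - 1) ≤ 0 := by nlinarith
    nlinarith

/-- Write Y for the integral of (u/A)^q, and E and Z for the energy and the integral of (u/A)^{q/2}.
The evolution gives Y' ≥ (4(1-q)/q) E - BY. If Z² stayed small on the whole interval, the L¹ term in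
Nash's inequality would be absorbed and E would dominate Y. Then Y would grow at a rate of order 1/q
and exceed its trivial bound B before the time s + δ. -/
theorem exists_large_halving (h : EnergyFlow n B ν e lo hi) {A q δ ρ b : ℝ} (hA : 0 < A)
    (hq : 0 < q) (hq1 : q ≤ 1 / 2) (hs : 0 < s) (hhi : hi s ≤ A) (hδ : 0 < δ) (hδ1 : δ ≤ 1)
    (hρ : 1 ≤ ρ) (hqδ : q ≤ ρ * δ) (hb : 0 ≤ b)
    (hY : B * Real.exp (-b) ≤ ∫ u, (u / A) ^ q ∂ν s) :
    ∃ x ∈ Icc s (s + δ), Real.exp (-(n / 2 * Real.log (ρ * B * (B + b + 1)))) *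
      (Real.exp (-B) * (B * Real.exp (-b))) / (2 * B) ≤ (∫ u, (u / A) ^ (q / 2) ∂ν x) ^ 2 := by
  have hB := h.one_le
  -- Growth at rate R/(qB) - B during a time δ ≥ q/ρ multiplies Y by at least e^{b+1}, just enough
  -- to contradict Y ≤ B from the starting value B e^{-b}. The price is r^n = R^{-n/2}, which is
  -- only logarithmic in the exponent.
  set R : ℝ := ρ * B * (B + b + 1) with hR
  have hR1 : 1 ≤ R := by
    have h1 : 1 ≤ ρ * B := by nlinarith
    have h2 : 1 ≤ B + b + 1 := by linarith
    calc (1 : ℝ) = 1 * 1 := by ring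
      _ ≤ _ := by rw [hR]; gcongr
  have hR0 : 0 < R := by linarith
  set r : ℝ := R ^ (-(1 / 2) : ℝ) with hr
  have hr0 : 0 < r := by positivity
  have hr1 : r ≤ 1 := Real.rpow_le_one_of_one_le_of_nonpos hR1 (by norm_num)
  have hr2 : r ^ 2 = R⁻¹ := by
    rw [hr, ← Real.rpow_natCast, ← Real.rpow_mul hR0.le, ← Real.rpow_neg_one]; norm_num
  set y₀ := B * Real.exp (-b) with hy₀
  have hy₀0 : 0 < y₀ := by positivity
  have main : ∃ x ∈ Icc s (s + δ),
      r ^ n * (Real.exp (-B) * y₀) / (2 * B) ≤ (∫ u, (u / A) ^ (q / 2) ∂ν x) ^ 2 := by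
    by_contra hcon
    push Not at hcon
    choose! X' hX' hbd using h.evolution _ _ _ (fun u hu => hasDerivAt_div_rpow hA q hu)
      (fun u hu => (hasDerivAt_div_rpow hA (q - 1) hu).const_mul (q * A⁻¹))
      (((continuousOn_div_rpow hA _).const_mul _).const_mul _) (fun u hu => by positivity)
    have hgrow := exp_mul_le_of_le_deriv (c := R / (q * B) - B) (show s ≤ s + δ by linarith)
      (fun x hx => hX' x (hs.trans_le hx.1)) (fun x hx => by
        have hx0 := hs.trans_le hx.1
        have e1 := (abs_le.1 (hbd x hx0)).1
        have hN := h.nash (fun u => (u / A) ^ (q / 2)) _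
          (fun u hu => hasDerivAt_div_rpow hA (q / 2) hu)
          ((continuousOn_div_rpow hA _).const_mul _) x hx0 r hr0 hr1
        have e2 : ∫ u, ((u / A) ^ (q / 2)) ^ 2 ∂ν x = ∫ u, (u / A) ^ q ∂ν x := by
          refine integral_congr_ae ?_
          filter_upwards [h.ae_pos hx0] with u hu
          rw [← Real.rpow_natCast, ← Real.rpow_mul (by positivity)]; congr 1; push_cast; ring
        have e3 : ∫ u, |(u / A) ^ (q / 2)| ∂ν x = ∫ u, (u / A) ^ (q / 2) ∂ν x := by
          refine integral_congr_ae ?_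
          filter_upwards [h.ae_pos hx0] with u hu
          exact abs_of_nonneg (by positivity)
        have e4 : ∫ u, q * A⁻¹ * ((q - 1) * A⁻¹ * (u / A) ^ (q - 1 - 1)) ∂e x
            = -(4 * (1 - q) / q) * ∫ u, (q / 2 * A⁻¹ * (u / A) ^ (q / 2 - 1)) ^ 2 ∂e x := by
          rw [← integral_const_mul]
          refine integral_congr_ae ?_
          filter_upwards [h.ae_pos_energy hx0] with u hu
          have : ((u / A) ^ (q / 2 - 1)) ^ 2 = (u / A) ^ (q - 1 - 1) := by
            rw [← Real.rpow_natCast, ← Real.rpow_mul (by positivity)]; congr 1; push_cast; ring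
          rw [mul_pow, mul_pow, this]; field_simp; ring
        have hE0 : 0 ≤ ∫ u, (q / 2 * A⁻¹ * (u / A) ^ (q / 2 - 1)) ^ 2 ∂e x :=
          integral_nonneg fun u => sq_nonneg _
        have e5 := hcon x hx
        have e6 := h.exp_mul_integral_div_rpow_le hA hq.le (by linarith) hs hx.1
          (by linarith [hx.2] : x ≤ s + 1)
        rw [e2, e3, hr2] at hN
        rw [e4] at e1
        have e7 : Real.exp (-B) * y₀ ≤ ∫ u, (u / A) ^ q ∂ν x :=
          (mul_le_mul_of_nonneg_left hY (Real.exp_pos _).le).trans e6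
        generalize (∫ u, (q / 2 * A⁻¹ * (u / A) ^ (q / 2 - 1)) ^ 2 ∂e x) = E at *
        generalize (∫ u, (u / A) ^ (q / 2) ∂ν x) = Z at *
        generalize (∫ u, (u / A) ^ q ∂ν x) = Y at *
        have e8 : B * ((r ^ n)⁻¹ * Z ^ 2) ≤ Y / 2 := by
          have hrn : 0 < r ^ n := by positivity
          rw [lt_div_iff₀ (by positivity)] at e5
          have : (r ^ n)⁻¹ * (Z ^ 2 * (2 * B)) ≤ (r ^ n)⁻¹ * (r ^ n * (Real.exp (-B) * y₀)) := by
            gcongr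
          rw [inv_mul_cancel_left₀ hrn.ne'] at this
          linarith
        have e9 : R * Y ≤ 2 * B * E := by
          have : Y / 2 ≤ B * (R⁻¹ * E) := by linarith
          rw [show B * (R⁻¹ * E) = B * E / R by field_simp, le_div_iff₀ hR0] at this
          linarith
        have e10 : 2 / q * E ≤ 4 * (1 - q) / q * E := by
          refine mul_le_mul_of_nonneg_right ?_ hE0
          gcongr; linarith
        have e11 : R / (q * B) * Y ≤ 2 / q * E := by
          rw [div_mul_eq_mul_div, div_mul_eq_mul_div, div_le_div_iff₀ (by positivity) hq]
          nlinarith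
        linarith)
    have hup := h.integral_div_rpow_le (show 0 < s + δ by linarith) hA hq.le
      ((h.hi_anti hs (by linarith)).trans hhi)
    have e1 : b + 1 ≤ (R / (q * B) - B) * (s + δ - s) := by
      have : B + b + 1 ≤ R / (q * B) * δ := by
        rw [div_mul_eq_mul_div, le_div_iff₀ (by positivity), hR]
        have h3 : 0 ≤ B * (B + b + 1) := by positivity
        nlinarith [mul_le_mul_of_nonneg_left hqδ h3]
      nlinarith
    have e2 : Real.exp (b + 1) * y₀ ≤ B :=
      calc Real.exp (b + 1) * y₀ ≤ Real.exp ((R / (q * B) - B) * (s + δ - s)) *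
            ∫ u, (u / A) ^ q ∂ν s := by gcongr
        _ ≤ _ := hgrow
        _ ≤ B := hup
    rw [hy₀, mul_left_comm, ← Real.exp_add] at e2
    have : b + 1 + -b = 1 := by ring
    rw [this] at e2
    have := Real.add_one_le_exp 1
    nlinarith
  have hrn : r ^ n = Real.exp (-(n / 2 * Real.log R)) := by
    rw [hr, ← Real.rpow_natCast, ← Real.rpow_mul hR0.le, Real.rpow_def_of_pos hR0]
    congr 1; ring
  rwa [hrn] at main

/-- Taking the square root halves the loss b. A further b/8 pays for the term log(B + b + 1), which
is bounded by a small multiple of b plus a constant. The resulting factor 5/8 < 1 is what makes the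
iteration contract. -/
theorem halving_constant_le {B b ρ : ℝ} (n : ℕ) (hB : 1 ≤ B) (hb : 0 ≤ b) (hρ : 1 ≤ ρ) :
    (B * Real.exp (B - (4 * B + n * (B + 1) + n * Real.log (2 * n + 1) + 5 / 8 * b
      + n / 4 * Real.log ρ))) ^ 2 ≤ Real.exp (-(n / 2 * Real.log (ρ * B * (B + b + 1)))) *
      (Real.exp (-B) * (B * Real.exp (-b))) / (2 * B) := by
  have hn0 : (0 : ℝ) ≤ n := Nat.cast_nonneg n
  have hlogR : Real.log (ρ * B * (B + b + 1)) = Real.log ρ + Real.log B + Real.log (B + b + 1) := by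
    rw [Real.log_mul (by positivity) (by positivity), Real.log_mul (by positivity)
      (by positivity)]
  have hlogB : Real.log B ≤ B := (Real.log_le_sub_one_of_pos (by linarith)).trans (by linarith)
  have hlogb : n / 2 * Real.log (B + b + 1) ≤ (B + b + 1) / 4 + n * Real.log (2 * n + 1) := by
    have h1 := Real.log_le_sub_one_of_pos (show 0 < (B + b + 1) / (2 * n + 1) by positivity)
    rw [Real.log_div (by positivity) (by positivity)] at h1
    have h4 : 0 ≤ Real.log (2 * n + 1) := Real.log_nonneg (by linarith)
    have h5 : n / 2 * ((B + b + 1) / (2 * n + 1)) ≤ (B + b + 1) / 4 := by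
      rw [div_mul_div_comm, div_le_div_iff₀ (by positivity) (by positivity)]
      nlinarith
    nlinarith
  have h7 : 0 ≤ n * Real.log (2 * n + 1) :=
    mul_nonneg hn0 (Real.log_nonneg (by linarith))
  have h6 : n / 2 * Real.log B ≤ n / 2 * B := by gcongr
  have hlog2 : 2 * B ≤ Real.exp (2 * B) := by linarith [Real.add_one_le_exp (2 * B)]
  have hBe : B ≤ Real.exp B := by linarith [Real.add_one_le_exp B]
  have hnB : 0 ≤ n * B := by positivity
  generalize n * Real.log (2 * n + 1) = V at *
  have e1 : Real.exp (-(n / 2 * Real.log (ρ * B * (B + b + 1)))) *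
      (Real.exp (-B) * (B * Real.exp (-b)))
      = B * Real.exp (-(n / 2 * Real.log (ρ * B * (B + b + 1))) - B - b) := by
    rw [mul_left_comm _ B, mul_left_comm _ B, ← Real.exp_add, ← Real.exp_add]; congr 2; ring
  rw [le_div_iff₀ (by positivity), e1, mul_pow, ← Real.exp_nat_mul, hlogR]
  have hle : 2 * B + B + ((2 : ℕ) : ℝ) * (B - (4 * B + n * (B + 1) + V + 5 / 8 * b
      + n / 4 * Real.log ρ))
      ≤ -(n / 2 * (Real.log ρ + Real.log B + Real.log (B + b + 1))) - B - b := by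
    push_cast
    nlinarith
  have h9 := Real.exp_le_exp.2 hle
  rw [Real.exp_add, Real.exp_add] at h9
  have hE0 := Real.exp_pos (((2 : ℕ) : ℝ) * (B - (4 * B + n * (B + 1) + V + 5 / 8 * b
      + n / 4 * Real.log ρ)))
  generalize Real.exp (((2 : ℕ) : ℝ) * (B - (4 * B + n * (B + 1) + V + 5 / 8 * b
      + n / 4 * Real.log ρ))) = W at *
  calc B ^ 2 * W * (2 * B) = B * ((2 * B) * B * W) := by ring
    _ ≤ B * (Real.exp (2 * B) * Real.exp B * W) := by gcongr
    _ ≤ _ := by gcongr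

/-- The good moment of `exists_large_halving` is unknown; near monotonicity of the concave power
carries the bound to the end of the interval at the cost of e^{-B}. -/
theorem rpow_halving (h : EnergyFlow n B ν e lo hi) {A q δ ρ b : ℝ} (hA : 0 < A) (hq : 0 < q)
    (hq1 : q ≤ 1 / 2) (hs : 0 < s) (hhi : hi s ≤ A) (hδ : 0 < δ) (hδ1 : δ ≤ 1) (hρ : 1 ≤ ρ)
    (hqδ : q ≤ ρ * δ) (hb : 0 ≤ b) (hY : B * Real.exp (-b) ≤ ∫ u, (u / A) ^ q ∂ν s) :
    B * Real.exp (-(4 * B + n * (B + 1) + n * Real.log (2 * n + 1) + 5 / 8 * b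
      + n / 4 * Real.log ρ)) ≤ ∫ u, (u / A) ^ (q / 2) ∂ν (s + δ) := by
  obtain ⟨x, hx, hlarge⟩ := h.exists_large_halving hA hq hq1 hs hhi hδ hδ1 hρ hqδ hb hY
  have hx0 := hs.trans_le hx.1
  have hsq := (halving_constant_le n h.one_le hb hρ).trans hlarge
  have hZ0 : 0 ≤ ∫ u, (u / A) ^ (q / 2) ∂ν x := by
    refine integral_nonneg_of_ae ?_
    filter_upwards [h.ae_pos hx0] with u hu
    positivity
  have hle := le_of_pow_le_pow_left₀ two_ne_zero hZ0 hsq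
  refine le_trans ?_ (h.exp_mul_integral_div_rpow_le hA (show 0 ≤ q / 2 by positivity)
    (by linarith) hx0 hx.2 (by linarith [hx.1] : s + δ ≤ x + 1))
  refine le_trans (le_of_eq ?_) (mul_le_mul_of_nonneg_left hle (Real.exp_pos (-B)).le)
  rw [mul_left_comm, ← Real.exp_add]; congr 2; ring

/-- The linear profile D(2+i) dominates the recursion b ↦ const + 5b/8 as i decreases: the gap
between 2+i and 5(3+i)/8 is 1/8 + 3i/8, and the factor 16 in D turns it into room for c and for the
term with log 4. -/
theorem halving_recursion {n c L i : ℝ} (hn : 0 ≤ n) (hc : 0 ≤ c) (hL : 0 ≤ L) (hi : 0 ≤ i) :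
    c + 5 / 8 * (16 * (c + n + L) * (2 + (i + 1))) + n / 4 * ((i + 2) * Real.log 4) ≤
      16 * (c + n + L) * (2 + i) := by
  have hlog4 : Real.log 4 ≤ 2 := by
    have : Real.log 4 = 2 * Real.log 2 := by
      rw [show (4 : ℝ) = 2 ^ 2 by norm_num, Real.log_pow]; norm_num
    have := Real.log_two_lt_d9
    linarith
  have h4 : n / 4 * ((i + 2) * Real.log 4) ≤ n / 4 * ((i + 2) * 2) := by gcongr
  have h1 := mul_nonneg hn hi
  have h2 := mul_nonneg hc hi
  have h3 := mul_nonneg hL hi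
  linarith

/-- About log₂(1/τ) halvings lead from the exponent 1/2 to an exponent comparable with τ. The
initial logarithmic loss is of order log(1/τ), but each halving contracts it, so the final loss 2D,
and with it ε, does not depend on τ. -/
theorem exists_integral_small_power_ge (n : ℕ) (B : ℝ) (hB : 1 ≤ B) (C : ℝ) (hC : 1 ≤ C) :
    ∃ ε : ℝ, 0 < ε ∧ ε ≤ B ∧
    ∀ (ν e : ℝ → Measure ℝ) (lo hi : ℝ → ℝ), EnergyFlow n B ν e lo hi → ∀ s τ, 0 < s → 0 < τ →
      τ ≤ 1 / 2 → τ ^ (n / 2 : ℝ) * hi s ≤ C * ∫ u, u ∂ν s →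
      ∃ κ, 0 < κ ∧ κ ≤ τ ∧ τ ≤ 2 * κ ∧ ∀ x ∈ Icc (s + τ / 4) (s + τ),
        ε ≤ ∫ u, (u / hi s) ^ κ ∂ν x := by
  have hn0 : (0 : ℝ) ≤ n := Nat.cast_nonneg n
  set c₁ : ℝ := 4 * B + n * (B + 1) + n * Real.log (2 * n + 1) with hc₁
  have hc₁0 : 0 ≤ c₁ := by
    have : 0 ≤ Real.log (2 * n + 1) := Real.log_nonneg (by linarith)
    positivity
  set c₃ : ℝ := c₁ + n + Real.log (B * C) with hc₃
  have hlog0 : 0 ≤ Real.log (B * C) := Real.log_nonneg (by nlinarith)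
  have hc₃0 : 0 ≤ c₃ := by positivity
  set D : ℝ := 16 * c₃ with hD
  have hD0 : 0 ≤ D := by positivity
  set ε₀ : ℝ := Real.exp (-B) * (B * Real.exp (-(D * 2))) with hε₀
  have hε₀0 : 0 < ε₀ := by positivity
  have hε₀1 : ε₀ ≤ B := by
    have h1 : Real.exp (-B) ≤ 1 := Real.exp_le_one_iff.2 (by linarith)
    have h2 : Real.exp (-(D * 2)) ≤ 1 := Real.exp_le_one_iff.2 (by linarith)
    calc ε₀ ≤ 1 * (B * 1) := by rw [hε₀]; gcongr
      _ = B := by ring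
  refine ⟨ε₀, hε₀0, hε₀1, ?_⟩
  intro ν e lo hi h s τ hs hτ hτ1 hstart
  set A := hi s with hA'
  have hA : 0 < A := h.hi_pos hs
  obtain ⟨J, hJ1, hJ2⟩ : ∃ J : ℕ, ((1 : ℝ) / 2) ^ (J + 1) < τ ∧ τ ≤ (1 / 2) ^ J :=
    exists_nat_pow_near_of_lt_one hτ (by linarith) (by norm_num) (by norm_num)
  set κ : ℝ := (1 / 2) ^ (J + 1) with hκ
  have hκ0 : 0 < κ := by positivity
  have hκτ : τ ≤ 2 * κ := by rw [hκ, pow_succ]; linarith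
  have hκJ : 2 ^ J * κ = 1 / 2 := by
    rw [hκ, pow_succ, ← mul_assoc, ← mul_pow]; norm_num
  -- The time at which the exponent 2^{J-m} κ is reached. The waiting times form a geometric
  -- progression, longest for the smallest exponents, and their sum stays below τ/4.
  let T : ℕ → ℝ := fun m => s + τ / 4 * ((1 / 2) ^ (J - m) - (1 / 2) ^ J)
  have hTs : ∀ m, s ≤ T m := fun m => by
    have : ((1 : ℝ) / 2) ^ J ≤ (1 / 2) ^ (J - m) :=
      pow_le_pow_of_le_one (by norm_num) (by norm_num) (Nat.sub_le _ _)
    simp only [T]; nlinarith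
  have claim : ∀ m ≤ J, B * Real.exp (-(D * (2 + (J - m : ℕ)))) ≤
      ∫ u, (u / A) ^ (2 ^ (J - m) * κ) ∂ν (T m) := by
    intro m
    induction m with
    | zero =>
      intro _
      have hT0 : T 0 = s := by simp [T]
      rw [hT0, Nat.sub_zero, hκJ]
      have h1 : τ ^ (n / 2 : ℝ) / C ≤ ∫ u, (u / A) ^ (1 / 2 : ℝ) ∂ν s := by
        have h2 : ∫ u, u / A ∂ν s ≤ ∫ u, (u / A) ^ (1 / 2 : ℝ) ∂ν s := by
          refine integral_mono_ae (h.integrable hs (by fun_prop))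
            (h.integrable hs (continuousOn_div_rpow hA _)) ?_
          filter_upwards [h.ae_mem hs, h.ae_pos hs] with u hu hu0
          conv_lhs => rw [← Real.rpow_one (u / A)]
          exact Real.rpow_le_rpow_of_exponent_ge (by positivity) ((div_le_one hA).2 hu.2)
            (by norm_num)
        refine le_trans ?_ h2
        rw [integral_div, div_le_div_iff₀ (by positivity) hA]
        linarith
      refine le_trans ?_ h1
      rw [le_div_iff₀ (by positivity)]
      -- Since τ > 2^{-(J+1)}, the initial loss is at most linear in J, and the profile D(2+J) has
      -- been chosen large enough to cover it.
      have h3 : B * C * Real.exp (-(D * (2 + (J : ℕ)))) ≤ τ ^ (n / 2 : ℝ) := by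
        have h4 : Real.log τ ≥ -(J + 1 : ℝ) := by
          have h5 := Real.log_le_log hκ0 hJ1.le
          rw [hκ, Real.log_pow, one_div, Real.log_inv] at h5
          have h6 : Real.log 2 ≤ 1 := by have := Real.log_two_lt_d9; linarith
          push_cast at h5
          nlinarith
        rw [Real.rpow_def_of_pos hτ, ← Real.exp_log (show 0 < B * C by positivity),
          ← Real.exp_add]
        refine Real.exp_le_exp.2 ?_
        have h7 : (0 : ℝ) ≤ J := Nat.cast_nonneg J
        have h8 : (n : ℝ) + Real.log (B * C) ≤ D := by linarith
        have h9 : n / 2 * Real.log τ ≥ n / 2 * -(J + 1 : ℝ) :=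
          mul_le_mul_of_nonneg_left h4 (by positivity)
        nlinarith [mul_nonneg h7 hlog0, mul_nonneg h7 hn0, mul_le_mul_of_nonneg_right h8 h7]
      linarith
    | succ m ih =>
      intro hm
      have ih := ih (by omega)
      obtain ⟨i, hi⟩ : ∃ i, J - m = i + 1 := ⟨J - (m + 1), by omega⟩
      have hi' : J - (m + 1) = i := by omega
      have hTm : T m = s + τ / 4 * ((1 / 2) ^ (i + 1) - (1 / 2) ^ J) := by simp only [T, hi]
      have hTm1 : T (m + 1) = T m + τ / 4 * (1 / 2) ^ (i + 1) := by
        rw [hTm]; simp only [T, hi']; rw [pow_succ]; ring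
      have hiJ : i + 1 ≤ J := by omega
      have hp1 : ((1 : ℝ) / 2) ^ (i + 1) ≤ 1 := pow_le_one₀ (by norm_num) (by norm_num)
      have hp2 : (2 : ℝ) ^ (i + 1) * (1 / 2) ^ (i + 1) = 1 := by rw [← mul_pow]; norm_num
      have hp0 : (0 : ℝ) < (1 / 2) ^ (i + 1) := by positivity
      rw [hi] at ih
      -- The exponent exceeds the available time by a factor growing like 4^i, whence ρ = 4^{i+2}:
      -- indeed ρδ = 2^{i+1} τ ≥ q. Only log ρ, linear in i, enters the loss.
      have hstep := h.rpow_halving (q := 2 ^ (i + 1) * κ) (δ := τ / 4 * (1 / 2) ^ (i + 1))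
        (ρ := 4 ^ (i + 2)) (b := D * (2 + (i + 1 : ℕ))) hA (by positivity) (by
          rw [← hκJ]
          exact mul_le_mul_of_nonneg_right (pow_le_pow_right₀ (by norm_num) hiJ) hκ0.le)
        (hs.trans_le (hTs m)) (h.hi_anti hs (hTs m)) (by positivity) (by
          have := mul_le_mul_of_nonneg_left hp1 hτ.le
          linarith)
        (one_le_pow₀ (by norm_num)) (by
          have e1 : (4 : ℝ) ^ (i + 2) * (τ / 4 * (1 / 2) ^ (i + 1))
              = 2 ^ (i + 1) * τ * (2 ^ (i + 1) * (1 / 2) ^ (i + 1)) := by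
            rw [show (4 : ℝ) ^ (i + 2) = 2 ^ (i + 1) * 2 ^ (i + 1) * 4 by
              rw [← mul_pow]; norm_num [pow_succ]]
            ring
          rw [e1, hp2, mul_one]
          gcongr)
        (by positivity) ih
      rw [hi', hTm1]
      have e2 : (2 : ℝ) ^ (i + 1) * κ / 2 = 2 ^ i * κ := by rw [pow_succ]; ring
      rw [e2] at hstep
      refine le_trans ?_ hstep
      refine mul_le_mul_of_nonneg_left (Real.exp_le_exp.2 ?_) (by linarith)
      rw [Real.log_pow, ← hc₁]
      push_cast
      exact neg_le_neg <| halving_recursion hn0 hc₁0 hlog0 (Nat.cast_nonneg i)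
  have hfin := claim J le_rfl
  rw [Nat.sub_self] at hfin
  simp only [pow_zero, one_mul, Nat.cast_zero, add_zero] at hfin
  have hTJ : T J ≤ s + τ / 4 := by
    have : ((1 : ℝ) / 2) ^ J > 0 := by positivity
    simp only [T, Nat.sub_self, pow_zero]; nlinarith
  refine ⟨κ, hκ0, hJ1.le, hκτ, fun x hx => ?_⟩
  have hTx : T J ≤ x := hTJ.trans hx.1
  have hκ1 : κ ≤ 1 := by linarith
  exact (mul_le_mul_of_nonneg_left hfin (Real.exp_pos _).le).trans
      (h.exp_mul_integral_div_rpow_le hA hκ0.le hκ1 (hs.trans_le (hTs J)) hTx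
        (by linarith [hx.2, hTs J]))

/-- Starting from a lower bound for the total heat, after a time `τ / 4` a definite part of the
space is occupied by values of size at least `e^{-K / τ}` times the initial maximum. -/
theorem exists_mass_large (n : ℕ) (B : ℝ) (hB : 1 ≤ B) (C : ℝ) (hC : 1 ≤ C) :
    ∃ K ε : ℝ, 0 < K ∧ 0 < ε ∧
    ∀ (ν e : ℝ → Measure ℝ) (lo hi : ℝ → ℝ), EnergyFlow n B ν e lo hi → ∀ s τ, 0 < s → 0 < τ →
      τ ≤ 1 / 2 → τ ^ (n / 2 : ℝ) * hi s ≤ C * ∫ u, u ∂ν s →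
      ∀ x ∈ Icc (s + τ / 4) (s + τ),
        ε ≤ (ν x).real {u | 0 < u ∧ Real.log (hi s) - Real.log u ≤ K / τ} := by
  obtain ⟨ε₀, hε₀0, hε₀1, hpow⟩ := exists_integral_small_power_ge n B hB C hC
  set K₀ : ℝ := Real.log (2 * B / ε₀) with hK₀
  have hK₀0 : 0 < K₀ := Real.log_pos (by rw [lt_div_iff₀ hε₀0]; linarith)
  refine ⟨2 * K₀, ε₀ / 2, by positivity, by positivity, ?_⟩
  intro ν e lo hi h s τ hs hτ hτ1 hstart
  set A := hi s with hA'
  have hA : 0 < A := h.hi_pos hs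
  obtain ⟨κ, hκ0, hκτ1, hκτ, hlow⟩ := hpow ν e lo hi h s τ hs hτ hτ1 hstart
  intro x hx
  have hsx : s ≤ x := by linarith [hx.1]
  have hx0 : 0 < x := hs.trans_le hsx
  have := h.finite_mass x hx0
  have hlow := hlow x hx
  set G : Set ℝ := {u | 0 < u ∧ Real.log A - Real.log u ≤ 2 * K₀ / τ} with hG
  have hGm : MeasurableSet G :=
    (measurableSet_lt measurable_const measurable_id).inter
      (measurableSet_le (measurable_const.sub Real.measurable_log) measurable_const)
  -- Off `G` one has log(A/u) > 2K₀/τ, and κ ≥ τ/2, so (u/A)^κ < e^{-K₀} = ε₀/(2B). These values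
  -- contribute at most half of the lower bound ε₀; the other half must be mass of `G`.
  have hup : ∫ u, (u / A) ^ κ ∂ν x ≤ ∫ u, (G.indicator (fun _ => (1 : ℝ)) u + ε₀ / (2 * B)) ∂ν x := by
    refine integral_mono_ae (h.integrable hx0 (continuousOn_div_rpow hA _))
      (((integrable_indicator_iff hGm).2 (integrable_const _).integrableOn).add
        (integrable_const _)) ?_
    filter_upwards [h.ae_mem hx0, h.ae_pos hx0] with u hu hu0
    have huA : u / A ≤ 1 := (div_le_one hA).2 (hu.2.trans (h.hi_anti hs hsx))
    by_cases huG : u ∈ G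
    · simp only [indicator_of_mem huG]
      have : (u / A) ^ κ ≤ 1 := Real.rpow_le_one (by positivity) huA hκ0.le
      have : 0 ≤ ε₀ / (2 * B) := by positivity
      linarith
    · simp only [indicator_of_notMem huG, zero_add]
      have hlt : 2 * K₀ / τ < Real.log A - Real.log u := by
        by_contra hcon
        exact huG ⟨hu0, not_lt.1 hcon⟩
      rw [Real.rpow_def_of_pos (by positivity), Real.log_div hu0.ne' hA.ne']
      have h1 : K₀ < (Real.log A - Real.log u) * κ := by
        rw [div_lt_iff₀ hτ] at hlt
        have h2 : 0 < Real.log A - Real.log u := by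
          by_contra hneg
          nlinarith
        nlinarith
      have h2 : Real.exp (-K₀) = ε₀ / (2 * B) := by
        rw [hK₀, Real.exp_neg, Real.exp_log (by positivity), inv_div]
      rw [← h2]
      exact Real.exp_le_exp.2 (by linarith)
  rw [integral_add ((integrable_indicator_iff hGm).2 (integrable_const _).integrableOn)
    (integrable_const _), integral_indicator hGm, setIntegral_const, integral_const, smul_eq_mul,
    smul_eq_mul, mul_one] at hup
  have hmass : (ν x).real univ * (ε₀ / (2 * B)) ≤ ε₀ / 2 := by
    calc _ ≤ B * (ε₀ / (2 * B)) := by gcongr; exact h.mass_le x hx0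
      _ = ε₀ / 2 := by field_simp
  linarith

end SmallPowers
end EnergyFlow

namespace EnergyFlow

variable {n : ℕ} {B : ℝ} {ν e : ℝ → Measure ℝ} {lo hi : ℝ → ℝ} {s t : ℝ}

/-! ### The minimum is controlled from below: truncated logarithms, and Harnack's inequality for
flows. -/

section LowerBound

theorem continuousOn_max_log_pow (k : ℝ) (m : ℕ) :
    ContinuousOn (fun u : ℝ => max (k - Real.log u) 0 ^ m) (Ioi 0) := by
  have : ContinuousOn Real.log (Ioi 0) := Real.continuousOn_log.mono fun _ hu => ne_of_gt hu
  exact ((continuousOn_const.sub this).sup continuousOn_const).pow m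

/-- The second derivative of `u ↦ (k - log u)₊³`. -/
def logExcessDeriv (k u : ℝ) : ℝ :=
  (6 * max (k - Real.log u) 0 + 3 * max (k - Real.log u) 0 ^ 2) * (u⁻¹) ^ 2

theorem continuousOn_inv_Ioi : ContinuousOn (fun u : ℝ => u⁻¹) (Ioi 0) :=
  continuousOn_inv₀.mono fun _ hu => ne_of_gt hu

theorem continuousOn_logExcessDeriv (k : ℝ) : ContinuousOn (logExcessDeriv k) (Ioi 0) := by
  have h1 := continuousOn_max_log_pow k 1
  simp only [pow_one] at h1
  exact ((h1.const_mul 6).add ((continuousOn_max_log_pow k 2).const_mul 3)).mul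
    (continuousOn_inv_Ioi.pow 2)

theorem hasDerivAt_logExcess_deriv (k : ℝ) {u : ℝ} (hu : 0 < u) :
    HasDerivAt (fun u => -(((1 + 2 : ℕ) : ℝ) * max (k - Real.log u) 0 ^ (1 + 1) * u⁻¹))
      (logExcessDeriv k u) u := by
  have h1 := ((hasDerivAt_max_log_pow 0 k hu).const_mul ((1 + 2 : ℕ) : ℝ)).mul
    (hasDerivAt_inv hu.ne')
  have e1 : (fun u => -(((1 + 2 : ℕ) : ℝ) * max (k - Real.log u) 0 ^ (1 + 1) * u⁻¹)) =
      -((fun u => ((1 + 2 : ℕ) : ℝ) * max (k - Real.log u) 0 ^ (0 + 2)) * fun u => u⁻¹) := rfl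
  rw [e1]
  refine h1.neg.congr_deriv ?_
  simp only [logExcessDeriv]
  push_cast
  field_simp
  ring

/-- With w = (k - log u)₊, differentiating the factor u⁻¹ produces 3w²u⁻², which is three quarters
of the squared derivative of w²; the term 6w u⁻² is nonnegative and dropped. The integral of w³ is
thus damped by the energy of w², a quantity of higher order. -/
theorem logExcessDeriv_ge (k u : ℝ) :
    3 / 4 * (-(((0 + 2 : ℕ) : ℝ) * max (k - Real.log u) 0 ^ (0 + 1) * u⁻¹)) ^ 2
      ≤ logExcessDeriv k u := by
  rw [logExcessDeriv]
  have h1 : 0 ≤ max (k - Real.log u) 0 := le_max_right _ _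
  have h2 : 0 ≤ max (k - Real.log u) 0 * (u⁻¹) ^ 2 := by positivity
  push_cast
  ring_nf at h2 ⊢
  linarith

theorem logExcessDeriv_nonneg (k u : ℝ) : 0 ≤ logExcessDeriv k u :=
  le_trans (by positivity) (logExcessDeriv_ge k u)

theorem integral_logExcess_growth (h : EnergyFlow n B ν e lo hi) (k : ℝ) (hs : 0 < s)
    (hst : s ≤ t) (hts : t ≤ s + 1) :
    ∫ u, max (k - Real.log u) 0 ^ 3 ∂ν t ≤ Real.exp B * ∫ u, max (k - Real.log u) 0 ^ 3 ∂ν s := by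
  have hB := h.one_le
  refine (h.integral_le_exp_mul (fun u hu => hasDerivAt_max_log_pow 1 k hu)
      (fun u hu => hasDerivAt_logExcess_deriv k hu) (continuousOn_logExcessDeriv k)
      (fun u _ => by positivity) (fun u _ => logExcessDeriv_nonneg k u) hs hst).trans ?_
  exact mul_le_mul_of_nonneg_right (Real.exp_le_exp.2 (by nlinarith))
    (integral_nonneg fun u => by positivity)

theorem integral_logExcess_mono (h : EnergyFlow n B ν e lo hi) {k l : ℝ} (hkl : k ≤ l)
    (ht : 0 < t) :
    ∫ u, max (k - Real.log u) 0 ^ 3 ∂ν t ≤ ∫ u, max (l - Real.log u) 0 ^ 3 ∂ν t := by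
  refine integral_mono_ae (h.integrable ht (continuousOn_max_log_pow k 3))
    (h.integrable ht (continuousOn_max_log_pow l 3)) (.of_forall fun u => ?_)
  have : max (k - Real.log u) 0 ≤ max (l - Real.log u) 0 := max_le_max (by linarith) le_rfl
  exact pow_le_pow_left₀ (le_max_right _ _) this 3

/-- If the energy of `(k - log u)₊²` controls its `L²` norm, the cubes decay at a rate that does not
depend on the initial value. -/
theorem integral_logExcess_le (h : EnergyFlow n B ν e lo hi) {k c σ : ℝ} (hc : 0 < c)
    (hσ : 0 < σ) (hs : 0 < s) (hst : s < t) (hts : t ≤ s + 1)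
    (hE : ∀ x ∈ Icc s t, c * ∫ u, (max (k - Real.log u) 0 ^ 2) ^ 2 ∂ν x ≤
      ∫ u, (-(((0 + 2 : ℕ) : ℝ) * max (k - Real.log u) 0 ^ (0 + 1) * u⁻¹)) ^ 2 ∂e x)
    (hm : ∀ x ∈ Icc s t, (ν x).real {u | 0 < u ∧ max (k - Real.log u) 0 ^ 2 ≠ 0} ≤ σ) :
    ∫ u, max (k - Real.log u) 0 ^ 3 ∂ν t ≤ Real.exp B * (64 * σ / (c * (t - s)) ^ 3) := by
  have hB := h.one_le
  have hts0 : 0 < t - s := by linarith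
  choose! X' hX' hb using h.evolution _ _ _ (fun u hu => hasDerivAt_max_log_pow 1 k hu)
    (fun u hu => hasDerivAt_logExcess_deriv k hu) (continuousOn_logExcessDeriv k)
    (fun u _ => by positivity)
  -- Put I = ∫w³, P = ∫w², W = ∫w⁴. Then P² ≤ σW because w lives on mass σ, and I² ≤ PW, so I⁴ ≤
  -- σW³. The damping is therefore at least a multiple of σ^{-1/3} I^{4/3}.
  have hric := le_of_riccati (c := 3 / 4 * c * σ ^ (-(1 / 3) : ℝ)) (zero_le_one.trans hB)
    (by positivity) hst hts (fun x _ => integral_nonneg fun u => by positivity)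
    (fun x hx => hX' x (hs.trans_le hx.1)) (fun x hx => by
      have hx0 := hs.trans_le hx.1
      have e1 := (abs_le.1 (hb x hx0)).2
      have e2 : 3 / 4 * ∫ u, (-(((0 + 2 : ℕ) : ℝ) * max (k - Real.log u) 0 ^ (0 + 1) * u⁻¹)) ^ 2 ∂e x
          ≤ ∫ u, logExcessDeriv k u ∂e x := by
        rw [← integral_const_mul]
        refine integral_mono_ae (h.integrable_energy hx0 ?_)
          (h.integrable_energy hx0 (continuousOn_logExcessDeriv k))
          (.of_forall fun u => logExcessDeriv_ge k u)
        exact ((((continuousOn_max_log_pow k (0 + 1)).const_mul _).mul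
          continuousOn_inv_Ioi).neg.pow 2).const_mul _
      have e3 := hE x hx
      -- Hölder's inequality
      have e4 := h.sq_integral_abs_le (continuousOn_max_log_pow k 2) hx0 hσ (hm x hx)
      have e5 : ∫ u, |max (k - Real.log u) 0 ^ 2| ∂ν x = ∫ u, max (k - Real.log u) 0 ^ 2 ∂ν x := by
        congr 1; ext u; exact abs_of_nonneg (by positivity)
      have e6 := sq_integral_mul_le (m := ν x) (f := fun u => max (k - Real.log u) 0)
        (g := fun u => max (k - Real.log u) 0 ^ 2)
        (h.integrable hx0 (continuousOn_max_log_pow k 2))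
        (h.integrable hx0 ((continuousOn_max_log_pow k 2).pow 2))
        ((h.integrable hx0 (continuousOn_max_log_pow k 3)).congr
          (.of_forall fun u => by simp only; ring))
      have e7 : ∫ u, max (k - Real.log u) 0 * max (k - Real.log u) 0 ^ 2 ∂ν x
          = ∫ u, max (k - Real.log u) 0 ^ (1 + 2) ∂ν x := by
        congr 1; ext u; ring
      rw [e5] at e4
      rw [e7] at e6
      have hI0 : 0 ≤ ∫ u, max (k - Real.log u) 0 ^ (1 + 2) ∂ν x :=
        integral_nonneg fun u => by positivity
      have hP0 : 0 ≤ ∫ u, max (k - Real.log u) 0 ^ 2 ∂ν x :=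
        integral_nonneg fun u => by positivity
      have hW0 : 0 ≤ ∫ u, (max (k - Real.log u) 0 ^ 2) ^ 2 ∂ν x :=
        integral_nonneg fun u => by positivity
      have key : ∀ I P W E x' Ψ : ℝ, 0 ≤ I → 0 ≤ P → 0 ≤ W → P ^ 2 ≤ σ * W → I ^ 2 ≤ P * W →
          c * W ≤ E → 3 / 4 * E ≤ Ψ → x' + Ψ ≤ B * I →
          x' ≤ B * I - 3 / 4 * c * σ ^ (-(1 / 3) : ℝ) * I ^ (4 / 3 : ℝ) := by
        intro I P W E x' Ψ hI hP hW h1 h2 h3 h4 h5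
        have h6 : I ^ 4 ≤ σ * W ^ 3 := by
          calc I ^ 4 = (I ^ 2) ^ 2 := by ring
            _ ≤ (P * W) ^ 2 := by gcongr
            _ = P ^ 2 * W ^ 2 := by ring
            _ ≤ σ * W * W ^ 2 := by gcongr
            _ = _ := by ring
        have h7 : I ^ (4 / 3 : ℝ) ≤ σ ^ (1 / 3 : ℝ) * W := by
          have := Real.rpow_le_rpow (by positivity) h6 (show (0 : ℝ) ≤ 1 / 3 by norm_num)
          rw [Real.mul_rpow hσ.le (by positivity), ← Real.rpow_natCast I, ← Real.rpow_mul hI,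
            ← Real.rpow_natCast W, ← Real.rpow_mul hW] at this
          norm_num at this ⊢
          exact this
        have h8 : σ ^ (-(1 / 3) : ℝ) * I ^ (4 / 3 : ℝ) ≤ W := by
          rw [Real.rpow_neg hσ.le, inv_mul_le_iff₀ (by positivity)]; exact h7
        have h9 : c * (σ ^ (-(1 / 3) : ℝ) * I ^ (4 / 3 : ℝ)) ≤ c * W := by gcongr
        linarith
      exact key _ _ _ _ _ _ hI0 hP0 hW0 e4 e6 e3 e2 e1)
  refine hric.trans (le_of_eq ?_)
  have hσ3 : (σ ^ (-(1 / 3) : ℝ)) ^ 3 = σ⁻¹ := by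
    rw [← Real.rpow_natCast, ← Real.rpow_mul hσ.le, ← Real.rpow_neg_one]; norm_num
  rw [div_pow, mul_pow, mul_pow _ (σ ^ _), hσ3]
  field_simp
  norm_num

/-- Poincaré's inequality for functions vanishing on a set of definite measure. -/
theorem integral_sq_le_of_vanishing (h : EnergyFlow n B ν e lo hi) {w w' : ℝ → ℝ}
    (h1 : ∀ u, 0 < u → HasDerivAt w (w' u) u) (h2 : ContinuousOn w' (Ioi 0)) (ht : 0 < t)
    {ε : ℝ} {G : Set ℝ} (hG : ε ≤ (ν t).real G) (hw : ∀ u ∈ G, w u = 0) :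
    ε * ∫ u, w u ^ 2 ∂ν t ≤ B * ∫ u, w' u ^ 2 ∂e t := by
  have := h.finite_mass t ht
  refine le_trans ?_ (h.poincare w w' h1 h2 t ht)
  have hcont : ContinuousOn w (Ioi 0) := fun u hu => (h1 u hu).continuousAt.continuousWithinAt
  have hi1 := h.integrable ht hcont
  have hi2 : Integrable (fun u => w u ^ 2) (ν t) := h.integrable ht (hcont.pow 2)
  have hexp : ∀ u, ∫ v, (w u - w v) ^ 2 ∂ν t
      = w u ^ 2 * (ν t).real univ - 2 * w u * (∫ v, w v ∂ν t) + ∫ v, w v ^ 2 ∂ν t := by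
    intro u
    have e1 : ∀ v, (w u - w v) ^ 2 = w u ^ 2 - 2 * w u * w v + w v ^ 2 := fun v => by ring
    have e2 : Integrable (fun v => w u ^ 2 - 2 * w u * w v) (ν t) :=
      (integrable_const _).sub (hi1.const_mul _)
    simp_rw [e1]
    rw [integral_add e2 hi2, integral_sub (integrable_const _) (hi1.const_mul _),
      integral_const_mul, integral_const, smul_eq_mul]
    ring
  have hint : Integrable (fun u => ∫ v, (w u - w v) ^ 2 ∂ν t) (ν t) := by
    simp_rw [hexp]
    exact (((hi2.mul_const _).sub ((hi1.const_mul 2).mul_const _))).add (integrable_const _)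
  have hW0 : 0 ≤ ∫ u, w u ^ 2 ∂ν t := integral_nonneg fun u => sq_nonneg _
  refine (mul_le_mul_of_nonneg_right hG hW0).trans (measureReal_mul_le_integral hint
    (.of_forall fun u => integral_nonneg fun v => sq_nonneg _) hW0 fun u hu => ?_)
  rw [hexp u, hw u hu]
  simp

/-- The analogue of `integral_excess_step` for logarithmic levels. Faber-Krahn supplies the rate 1/Q
with Q of order σ^{2/n}, and the Riccati bound σQ³/(t-s)³ explains the exponent 1 + 6/n. When σ is
too large for Faber-Krahn, the assumed a priori bound by M replaces it; `D₀` is the maximum of the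
constants of the two regimes. -/
theorem exists_logExcess_step (n : ℕ) (hn : 0 < n) (B : ℝ) (hB : 1 ≤ B) (M : ℝ) (hM : 0 < M) :
    ∃ D : ℝ, 0 < D ∧
    ∀ (ν e : ℝ → Measure ℝ) (lo hi : ℝ → ℝ), EnergyFlow n B ν e lo hi → ∀ s t k l, 0 < s → s < t →
      t ≤ s + 1 → k < l → ∫ u, max (k - Real.log u) 0 ^ 3 ∂ν t ≤ M / (t - s) ^ 3 →
      ∫ u, max (k - Real.log u) 0 ^ 3 ∂ν t ≤ D * (t - s) ^ (-3 : ℝ) *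
        (l - k) ^ (-(3 * (1 + 6 / n)) : ℝ) * (∫ u, max (l - Real.log u) 0 ^ 3 ∂ν s) ^
          (1 + 6 / n : ℝ) := by
  have hn' : (0 : ℝ) < n := by positivity
  set η : ℝ := 6 / n with hη
  have hη0 : 0 < η := by positivity
  set D₀ : ℝ := max (256 * B ^ 2 * Real.exp B) M with hD₀
  have hD₀0 : 0 < D₀ := lt_max_of_lt_right hM
  refine ⟨D₀ * (2 * B * Real.exp B) ^ (1 + η), by positivity, ?_⟩
  intro ν e lo hi h s t k l hs hst hts hkl hbound
  have ht := hs.trans hst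
  have hts0 : 0 < t - s := by linarith
  have hkl0 : 0 < l - k := by linarith
  set X := ∫ u, max (l - Real.log u) 0 ^ 3 ∂ν s with hX
  have hX0 : 0 ≤ X := integral_nonneg fun u => by positivity
  set σ : ℝ := Real.exp B * X / (l - k) ^ 3 with hσ
  have hσ0 : 0 ≤ σ := by positivity
  have hgoal : D₀ * (2 * B * Real.exp B) ^ (1 + η) * (t - s) ^ (-3 : ℝ) *
        (l - k) ^ (-(3 * (1 + η)) : ℝ) * X ^ (1 + η)
      = D₀ * (2 * B * σ) ^ (1 + η) / (t - s) ^ 3 := by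
    have e1 : 2 * B * σ = 2 * B * Real.exp B * X / (l - k) ^ 3 := by rw [hσ]; ring
    rw [e1, Real.div_rpow (by positivity) (by positivity), Real.mul_rpow (by positivity) hX0,
      Real.rpow_neg hts0.le, Real.rpow_neg hkl0.le, Real.rpow_mul hkl0.le,
      show (3 : ℝ) = ((3 : ℕ) : ℝ) by norm_num, Real.rpow_natCast, Real.rpow_natCast]
    field_simp
  rw [hgoal]
  rcases lt_or_ge 1 (2 * B * σ) with hbig | hsmall
  · refine hbound.trans ?_
    have h1 : (1 : ℝ) ≤ (2 * B * σ) ^ (1 + η) := Real.one_le_rpow hbig.le (by positivity)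
    gcongr
    calc M ≤ D₀ * 1 := by rw [mul_one]; exact le_max_right _ _
      _ ≤ _ := by gcongr
  rcases hσ0.eq_or_lt with hz | hσpos
  · have hXz : X = 0 := by
      rw [hσ, eq_comm, div_eq_zero_iff, mul_eq_zero] at hz
      rcases hz with (hz | hz) | hz
      · exact absurd hz (Real.exp_pos _).ne'
      · exact hz
      · exact absurd hz (by positivity)
    have h1 := (h.integral_logExcess_mono hkl.le ht).trans
      (h.integral_logExcess_growth l hs hst.le hts)
    rw [← hX, hXz, mul_zero] at h1
    exact h1.trans (by positivity)
  have hmeas : ∀ x ∈ Icc s t, (ν x).real {u | 0 < u ∧ max (k - Real.log u) 0 ^ 2 ≠ 0} ≤ σ := by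
    intro x hx
    have hx0 := hs.trans_le hx.1
    have := h.finite_mass x hx0
    rw [hσ, le_div_iff₀ (by positivity)]
    refine (measureReal_mul_le_integral (f := fun u => max (l - Real.log u) 0 ^ 3)
      (h.integrable hx0 (continuousOn_max_log_pow l 3)) (.of_forall fun u => by positivity)
      (by positivity) ?_).trans
      (h.integral_logExcess_growth l hs hx.1 (by linarith [hx.2]))
    rintro u ⟨-, hu⟩
    have hul : Real.log u < k := by
      by_contra hcon
      exact hu (by rw [max_eq_right (by linarith)]; norm_num)
    exact pow_le_pow_left₀ hkl0.le ((by linarith : l - k ≤ l - Real.log u).trans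
      (le_max_left _ _)) 3
  set Q : ℝ := 2 * B * (2 * B * σ) ^ (2 / n : ℝ) with hQ
  have hQ0 : 0 < Q := by positivity
  have hle := h.integral_logExcess_le (k := k) (c := Q⁻¹) (by positivity) hσpos hs hst hts
    (fun x hx => by
      rw [inv_mul_le_iff₀ hQ0]
      exact h.faberKrahn hn (fun u hu => hasDerivAt_max_log_pow 0 k hu)
        (((continuousOn_max_log_pow k (0 + 1)).const_mul _).mul continuousOn_inv_Ioi).neg
        (hs.trans_le hx.1) hσpos hsmall (hmeas x hx)) hmeas
  refine hle.trans ?_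
  have hpow : (2 * B * σ) ^ (1 + η) = (2 * B * σ) * ((2 * B * σ) ^ (2 / n : ℝ)) ^ 3 := by
    rw [Real.rpow_add (by positivity), Real.rpow_one, ← Real.rpow_natCast,
      ← Real.rpow_mul (by positivity)]
    congr 2; rw [hη]; push_cast; ring
  rw [hpow]
  have e1 : Real.exp B * (64 * σ / (Q⁻¹ * (t - s)) ^ 3)
      = 256 * B ^ 2 * Real.exp B * (2 * B * σ * ((2 * B * σ) ^ (2 / n : ℝ)) ^ 3) / (t - s) ^ 3 := by
    rw [hQ]; field_simp; ring
  rw [e1]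
  gcongr
  exact le_max_left _ _

/-- A lower bound for the minimum in terms of an earlier maximum. -/
theorem exists_lo_ge (n : ℕ) (hn : 0 < n) (B : ℝ) (hB : 1 ≤ B) (C : ℝ) (hC : 1 ≤ C) :
    ∃ K : ℝ, 0 < K ∧
    ∀ (ν e : ℝ → Measure ℝ) (lo hi : ℝ → ℝ), EnergyFlow n B ν e lo hi → ∀ s τ, 0 < s → 0 < τ →
      τ ≤ 1 / 2 → τ ^ (n / 2 : ℝ) * hi s ≤ C * ∫ u, u ∂ν s →
      hi s ≤ Real.exp (K / τ) * lo (s + τ) := by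
  obtain ⟨K, ε, hK, hε, hmass⟩ := exists_mass_large n B hB C hC
  have hn' : (0 : ℝ) < n := by positivity
  set M : ℝ := Real.exp B * (64 * B / (ε / B) ^ 3) with hM
  have hM0 : 0 < M := by positivity
  obtain ⟨D, hD0, hstep⟩ := exists_logExcess_step n hn B hB M hM0
  set η : ℝ := 6 / n with hη
  have hη0 : 0 < η := by positivity
  set b : ℝ := 3 * (1 + η) with hb
  have hb0 : 0 < b := by positivity
  set W : ℝ := D * 8 * (64 * M) ^ η * 2 ^ (3 + b) * 2 ^ ((3 + b) / η) with hW
  have hW0 : 0 < W := by positivity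
  set Z : ℝ := W ^ (1 / b) with hZ
  have hZ0 : 0 < Z := by positivity
  refine ⟨K + Z, by positivity, ?_⟩
  intro ν e lo hi h s τ hs hτ hτ1 hstart
  have hlarge := hmass ν e lo hi h s τ hs hτ hτ1 hstart
  have hA : 0 < hi s := h.hi_pos hs
  set A := Real.log (hi s) with hAdef
  -- At these levels the excess vanishes on the set of mass ε from `exists_mass_large`, so
  -- Poincaré's inequality holds with rate ε/B and the Riccati bound forgets the state at time x.
  have hfirst : ∀ k x y, k ≤ A - K / τ → s + τ / 4 ≤ x → x < y → y ≤ s + τ →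
      ∫ u, max (k - Real.log u) 0 ^ 3 ∂ν y ≤ M / (y - x) ^ 3 := by
    intro k x y hk hx hxy hy
    have hx0 : 0 < x := by linarith
    have hyx : 0 < y - x := by linarith
    refine (h.integral_logExcess_le (k := k) (c := ε / B) (σ := B) (by positivity) (by linarith)
      hx0 hxy (by linarith) (fun z hz => ?_) (fun z hz => ?_)).trans (le_of_eq ?_)
    · have := h.integral_sq_le_of_vanishing (fun u hu => hasDerivAt_max_log_pow 0 k hu)
        (((continuousOn_max_log_pow k (0 + 1)).const_mul _).mul continuousOn_inv_Ioi).neg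
        (hx0.trans_le hz.1) (hlarge z ⟨hx.trans hz.1, hz.2.trans hy⟩) (by
          rintro u ⟨-, hu⟩
          rw [max_eq_right (by linarith)]; norm_num)
      rw [div_mul_eq_mul_div, div_le_iff₀ (by linarith)]
      linarith
    · have := h.finite_mass z (hx0.trans_le hz.1)
      exact (measureReal_mono (subset_univ _)).trans (h.mass_le z (hx0.trans_le hz.1))
    · rw [hM, mul_pow]; field_simp
  -- The drop in log level. With b = 3(1+η) the powers of τ in the smallness condition cancel,
  -- τ^{-3} τ^b τ^{-3η} = 1, so a drop proportional to 1/τ is enough, with a constant depending only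
  -- on n, B and C.
  set H : ℝ := Z / τ with hH
  have hH0 : 0 < H := by positivity
  have hHb : H ^ (-b) = W⁻¹ * τ ^ b := by
    rw [hH, Real.div_rpow hZ0.le hτ.le, Real.rpow_neg hτ.le, hZ, ← Real.rpow_mul hW0.le,
      div_inv_eq_mul, ← Real.rpow_neg_one]
    congr 2; field_simp
  -- Levels are measured downwards from A = log(hi s), so that raising l shrinks the excess. The
  -- iteration runs over [s + τ/2, s + τ]; the interval [s + τ/4, s + τ/2] supplies its initial
  -- bound.
  have hzero := eq_zero_of_deGiorgi
    (X := fun l x => ∫ u, max ((A - l) - Real.log u) 0 ^ 3 ∂ν x)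
    (k := K / τ) (t := s + τ / 2) (τ := τ / 2) (D := D) (a := 3) (b := b) (η := η) (H := H)
    hD0.le three_pos hb0.le hη0 hH0 (by positivity)
    (fun l x _ _ => integral_nonneg fun u => by positivity)
    (fun l l' x x' hl hll hx hxx hx' => by
      have h1 := hstep ν e lo hi h x x' (A - l') (A - l) (by linarith) hxx (by linarith)
        (by linarith) (hfirst _ x x' (by linarith) (by linarith) hxx (by linarith))
      have e1 : A - l - (A - l') = l' - l := by ring
      rw [e1] at h1
      exact h1) (by
      rw [hHb]
      have h1 := hfirst (A - K / τ) (s + τ / 4) (s + τ / 2) le_rfl le_rfl (by linarith)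
        (by linarith)
      set X := ∫ u, max ((A - K / τ) - Real.log u) 0 ^ 3 ∂ν (s + τ / 2) with hX
      have hX0 : 0 ≤ X := integral_nonneg fun u => by positivity
      have h2 : X ≤ 64 * M / τ ^ 3 := by
        refine h1.trans (le_of_eq ?_)
        have : s + τ / 2 - (s + τ / 4) = τ / 4 := by ring
        rw [this]; field_simp; norm_num
      have h3 : X ^ η ≤ (64 * M) ^ η * τ ^ (-(3 * η)) := by
        refine (Real.rpow_le_rpow hX0 h2 hη0.le).trans (le_of_eq ?_)
        rw [Real.div_rpow (by positivity) (by positivity), Real.rpow_neg hτ.le,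
          ← Real.rpow_natCast, ← Real.rpow_mul hτ.le]
        norm_cast
      have h4 : (τ / 2) ^ (-3 : ℝ) = 8 * τ ^ (-3 : ℝ) := by
        rw [Real.div_rpow hτ.le (by norm_num), Real.rpow_neg (by norm_num : (0:ℝ) ≤ 2)]
        norm_num
        ring
      have h5 : τ ^ (-3 : ℝ) * τ ^ b * τ ^ (-(3 * η)) = 1 := by
        rw [← Real.rpow_add hτ, ← Real.rpow_add hτ, hb]
        have : (-3 : ℝ) + 3 * (1 + η) + -(3 * η) = 0 := by ring
        rw [this, Real.rpow_zero]
      calc D * (τ / 2) ^ (-3 : ℝ) * (W⁻¹ * τ ^ b) * X ^ η * 2 ^ (3 + b)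
          ≤ D * (τ / 2) ^ (-3 : ℝ) * (W⁻¹ * τ ^ b) * ((64 * M) ^ η * τ ^ (-(3 * η)))
            * 2 ^ (3 + b) := by gcongr
        _ = D * 8 * (64 * M) ^ η * 2 ^ (3 + b) * W⁻¹ * (τ ^ (-3 : ℝ) * τ ^ b * τ ^ (-(3 * η))) := by
            rw [h4]; ring
        _ = (2 : ℝ) ^ (-((3 + b) / η)) := by
            rw [h5, hW, Real.rpow_neg (by norm_num : (0:ℝ) ≤ 2)]
            field_simp)
  have e0 : s + τ / 2 + τ / 2 = s + τ := by ring
  rw [e0] at hzero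
  have ht : 0 < s + τ := by linarith
  have hlo : Real.exp (A - (K / τ + H)) ≤ lo (s + τ) := by
    have hz : ν (s + τ) {u | 0 < u ∧ Real.log u < A - (K / τ + H)} = 0 :=
      measure_eq_zero_of_integral (h.integrable ht (continuousOn_max_log_pow _ 3))
        (.of_forall fun u => by positivity) (fun u hu =>
          pow_ne_zero _ (lt_max_of_lt_left (sub_pos.2 hu.2)).ne') hzero
    refine (h.mass_Iio_eq_zero_iff ht).1 ?_
    have hpos := h.ae_pos ht
    rw [ae_iff] at hpos
    refine measure_mono_null (t := {u | 0 < u ∧ Real.log u < A - (K / τ + H)} ∪ {u | ¬ 0 < u})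
      (fun u hu => ?_) (measure_union_null hz hpos)
    by_cases hu0 : 0 < u
    · exact Or.inl ⟨hu0, (Real.log_lt_iff_lt_exp hu0).2 hu⟩
    · exact Or.inr hu0
  calc hi s = Real.exp ((K + Z) / τ) * Real.exp (A - (K / τ + H)) := by
        rw [← Real.exp_add]
        have : (K + Z) / τ + (A - (K / τ + H)) = A := by rw [hH]; ring
        rw [this, hAdef, Real.exp_log hA]
    _ ≤ _ := by gcongr

/-- Harnack's inequality for energy flows. -/
theorem exists_harnack (n : ℕ) (hn : 0 < n) (B : ℝ) (hB : 1 ≤ B) : ∃ C : ℝ, 0 < C ∧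
    ∀ (ν e : ℝ → Measure ℝ) (lo hi : ℝ → ℝ), EnergyFlow n B ν e lo hi → ∀ s t, 0 < s → s < t →
      hi s ≤ lo t * (C * (t / s) ^ C * Real.exp (C / (t - s))) := by
  obtain ⟨C₁, hC₁, hup⟩ := exists_hi_le n hn B hB
  obtain ⟨K, hK, hlow⟩ := exists_lo_ge n hn B hB (C₁ + 1) (by linarith)
  set p : ℝ := n / 2 with hp
  have hp0 : 0 ≤ p := by positivity
  set N : ℝ := C₁ * Real.exp B * B * Real.exp (2 * K) with hN
  have hN0 : 0 < N := by positivity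
  refine ⟨N + p + 2 * K, by positivity, ?_⟩
  intro ν e lo hi h s t hs hst
  set d := t - s with hd
  have hd0 : 0 < d := by linarith
  have ht := hs.trans hst
  set τ := min d 1 / 2 with hτ
  have hmin0 : 0 < min d 1 := lt_min hd0 one_pos
  have hτ0 : 0 < τ := by positivity
  have hτ1 : τ ≤ 1 / 2 := by have := min_le_right d 1; linarith
  have hτd : 2 * τ ≤ d := by have := min_le_left d 1; linarith
  have hsτ : 0 < s + τ := by linarith
  have h1 := hup ν e lo hi h s hs
  have h2 := hup ν e lo hi h (s + τ) hsτ
  have hheat := h.exp_mul_heat_le hs (show s ≤ s + τ by linarith)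
  have hheat0 := h.heat_pos hsτ
  -- Waiting until s + τ makes τ ≤ min(s + τ, 1), so `exists_hi_le` at that time provides the heat
  -- bound at scale τ however small s is.
  have h3 := hlow ν e lo hi h (s + τ) τ hsτ hτ0 hτ1 (by
    have : τ ^ p ≤ min (s + τ) 1 ^ p :=
      Real.rpow_le_rpow hτ0.le (le_min (by linarith) (by linarith)) hp0
    have h4 := mul_le_mul_of_nonneg_right this (h.hi_pos hsτ).le
    linarith)
  have h4 : lo (s + τ + τ) ≤ lo t := h.lo_mono (by linarith) (by linarith)
  have h5 : Real.exp (K / τ) ≤ Real.exp (2 * K) * Real.exp (2 * K / d) := by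
    rw [← Real.exp_add]
    refine Real.exp_le_exp.2 ?_
    have : 1 / τ ≤ 2 + 2 / d := by
      rw [hτ]
      rcases le_total d 1 with hd1 | hd1
      · rw [min_eq_left hd1]; have : 1 / (d / 2) = 2 / d := by field_simp
        linarith
      · rw [min_eq_right hd1]; have : 0 < 2 / d := by positivity
        norm_num; linarith
    calc K / τ = K * (1 / τ) := by ring
      _ ≤ K * (2 + 2 / d) := by gcongr
      _ = _ := by ring
  have hm0 : 0 < min s 1 := lt_min hs one_pos
  have hts1 : 1 ≤ t / s := by rw [le_div_iff₀ hs]; linarith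
  -- The singular factor of the upper bound at time s is traded for (t/s)^p e^{p/d}: for s ≤ 1 the
  -- base of the power is t e^{1/d} ≥ d · (1/d) = 1.
  have h6 : 1 ≤ min s 1 ^ p * ((t / s) ^ p * Real.exp (p / d)) := by
    have e1 : Real.exp (p / d) = (Real.exp (1 / d)) ^ p := by
      rw [← Real.exp_mul]; congr 1; ring
    rw [e1, ← Real.mul_rpow (by positivity) (by positivity),
      ← Real.mul_rpow (by positivity) (by positivity)]
    refine Real.one_le_rpow ?_ hp0
    have e2 : 1 ≤ Real.exp (1 / d) := Real.one_le_exp (by positivity)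
    rcases le_total s 1 with hs1 | hs1
    · rw [min_eq_left hs1]
      have e3 : 1 / d ≤ Real.exp (1 / d) := by linarith [Real.add_one_le_exp (1 / d)]
      have e4 : s * (t / s * Real.exp (1 / d)) = t * Real.exp (1 / d) := by field_simp
      rw [e4]
      calc (1 : ℝ) = d * (1 / d) := by field_simp
        _ ≤ t * Real.exp (1 / d) := by gcongr; linarith
    · rw [min_eq_right hs1, one_mul]
      nlinarith
  have h7 : ∫ u, u ∂ν s ≤ Real.exp B * ∫ u, u ∂ν (s + τ) := by
    have e1 : Real.exp (-B) ≤ Real.exp (-B * (s + τ - s)) := Real.exp_le_exp.2 (by nlinarith)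
    have e2 := (mul_le_mul_of_nonneg_right e1 (h.heat_pos hs).le).trans hheat
    rwa [Real.exp_neg, inv_mul_le_iff₀ (Real.exp_pos _)] at e2
  have hlo0 := h.lo_pos t ht
  have h8 : min s 1 ^ p * hi s ≤ N * (lo t * Real.exp (2 * K / d)) := by
    calc min s 1 ^ p * hi s ≤ C₁ * ∫ u, u ∂ν s := h1
      _ ≤ C₁ * (Real.exp B * (B * hi (s + τ))) := by
        have := h.heat_le hsτ
        gcongr
        exact h7.trans (by gcongr)
      _ ≤ C₁ * (Real.exp B * (B * (Real.exp (2 * K) * Real.exp (2 * K / d) * lo t))) := by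
        gcongr
        exact h3.trans (mul_le_mul h5 h4 (h.lo_pos _ (by linarith)).le (by positivity))
      _ = _ := by rw [hN]; ring
  have hhi := h.hi_pos hs
  have hP : 0 < (t / s) ^ p * Real.exp (p / d) := by positivity
  calc hi s = hi s * 1 := (mul_one _).symm
    _ ≤ hi s * (min s 1 ^ p * ((t / s) ^ p * Real.exp (p / d))) := by gcongr
    _ = (min s 1 ^ p * hi s) * ((t / s) ^ p * Real.exp (p / d)) := by ring
    _ ≤ (N * (lo t * Real.exp (2 * K / d))) * ((t / s) ^ p * Real.exp (p / d)) := by gcongr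
    _ = lo t * (N * (t / s) ^ p * Real.exp ((p + 2 * K) / d)) := by
      rw [show (p + 2 * K) / d = 2 * K / d + p / d by ring, Real.exp_add]; ring
    _ ≤ lo t * ((N + p + 2 * K) * (t / s) ^ (N + p + 2 * K) * Real.exp ((N + p + 2 * K) / d)) := by
      gcongr <;> linarith

end LowerBound
end EnergyFlow

/-! ### Derivatives of determinants and inverse matrices; comparison of determinants. -/

section Matrices

variable {ι : Type*} [Fintype ι] [DecidableEq ι]
variable {E : Type*} [NormedAddCommGroup E] [NormedSpace ℝ E]

/-- Jacobi's formula. -/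
theorem hasFDerivAt_det {G : E → Matrix ι ι ℝ} {G' : ι → ι → E →L[ℝ] ℝ} {y : E}
    (hG : ∀ a b, HasFDerivAt (fun z => G z a b) (G' a b) y) :
    HasFDerivAt (fun z => (G z).det) (∑ i, ∑ a, (G y).adjugate i a • G' a i) y := by
  have h1 : HasFDerivAt (fun z => (G z).det)
      (∑ σ : Equiv.Perm ι, ((Equiv.Perm.sign σ : ℤ) : ℝ) •
        ∑ i, (∏ j ∈ Finset.univ.erase i, G y (σ j) j) • G' (σ i) i) y := by
    have e : (fun z => (G z).det) = fun z => ∑ σ : Equiv.Perm ι,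
        ((Equiv.Perm.sign σ : ℤ) : ℝ) * ∏ i, G z (σ i) i := by
      ext z; rw [Matrix.det_apply']
    rw [e]
    exact HasFDerivAt.fun_sum fun σ _ =>
      (HasFDerivAt.finsetProd fun i _ => hG (σ i) i).const_mul _
  convert h1 using 1
  ext v
  simp only [_root_.sum_apply, _root_.smul_apply, smul_eq_mul]
  have e2 : ∀ i, ∑ a, (G y).adjugate i a * G' a i v
      = ((G y).updateCol i fun a => G' a i v).det := by
    intro i
    have := congrFun ((G y).cramer_eq_adjugate_mulVec fun a => G' a i v) i
    rw [Matrix.cramer_apply] at this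
    rw [this]; rfl
  simp_rw [e2, Matrix.det_apply', Finset.mul_sum]
  rw [Finset.sum_comm]
  refine Finset.sum_congr rfl fun σ _ => Finset.sum_congr rfl fun i _ => ?_
  congr 1
  rw [← Finset.mul_prod_erase _ _ (Finset.mem_univ i), Matrix.updateCol_self, mul_comm]
  congr 1
  refine Finset.prod_congr rfl fun j hj => ?_
  rw [Matrix.updateCol_ne (Finset.ne_of_mem_erase hj)]

theorem contDiffAt_det {n : WithTop ℕ∞} {G : E → Matrix ι ι ℝ} {y : E}
    (hG : ∀ a b, ContDiffAt ℝ n (fun z => G z a b) y) :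
    ContDiffAt ℝ n (fun z => (G z).det) y := by
  simp_rw [Matrix.det_apply']
  exact ContDiffAt.sum fun σ _ => contDiffAt_const.mul (contDiffAt_prod fun i _ => hG (σ i) i)

/-- By Cramer's rule the entries of the inverse are quotients of determinants. -/
theorem contDiffAt_matrix_inv {n : WithTop ℕ∞} {G : E → Matrix ι ι ℝ} {y : E}
    (hG : ∀ a b, ContDiffAt ℝ n (fun z => G z a b) y) (hdet : (G y).det ≠ 0) (i j : ι) :
    ContDiffAt ℝ n (fun z => (G z)⁻¹ i j) y := by
  have e : (fun z => (G z)⁻¹ i j) = fun z => ((G z).det)⁻¹ *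
      ((G z).updateRow j (Pi.single i 1)).det := by
    ext z
    rw [Matrix.inv_def, Matrix.smul_apply, Matrix.adjugate_apply, Ring.inverse_eq_inv', smul_eq_mul]
  rw [e]
  refine ((contDiffAt_det hG).inv hdet).mul (contDiffAt_det fun a b => ?_)
  by_cases ha : a = j
  · subst ha; simp only [Matrix.updateRow_self]; exact contDiffAt_const
  · simp only [Matrix.updateRow_ne ha]; exact hG a b

/-- Differentiate G⁻¹G = 1, an identity valid near y because the determinant stays nonzero there. -/
theorem fderiv_matrix_inv {G : E → Matrix ι ι ℝ} {y : E}
    (hG : ∀ a b, ContDiffAt ℝ 1 (fun z => G z a b) y) (hdet : (G y).det ≠ 0) (v : E) :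
    (Matrix.of fun i j => fderiv ℝ (fun z => (G z)⁻¹ i j) y v) =
      -((G y)⁻¹ * (Matrix.of fun a b => fderiv ℝ (fun z => G z a b) y v) * (G y)⁻¹) := by
  set dG := Matrix.of fun a b => fderiv ℝ (fun z => G z a b) y v with hdG
  set dH := Matrix.of fun i j => fderiv ℝ (fun z => (G z)⁻¹ i j) y v with hdH
  have hunit : IsUnit (G y).det := isUnit_iff_ne_zero.2 hdet
  have hH := contDiffAt_matrix_inv hG hdet
  have key : dH * G y + (G y)⁻¹ * dG = 0 := by
    ext i j
    have hsum : HasFDerivAt (fun z => ∑ k, (G z)⁻¹ i k * G z k j)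
        (∑ k, ((G y)⁻¹ i k • fderiv ℝ (fun z => G z k j) y
          + G y k j • fderiv ℝ (fun z => (G z)⁻¹ i k) y)) y :=
      HasFDerivAt.fun_sum fun k _ =>
        ((hH i k).differentiableAt one_ne_zero).hasFDerivAt.mul
          ((hG k j).differentiableAt one_ne_zero).hasFDerivAt
    have hev : (fun z => ∑ k, (G z)⁻¹ i k * G z k j) =ᶠ[nhds y] fun _ => (1 : Matrix ι ι ℝ) i j := by
      have hc : ContinuousAt (fun z => (G z).det) y := (contDiffAt_det hG).continuousAt
      filter_upwards [hc.eventually_ne hdet] with z hz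
      rw [← Matrix.mul_apply, Matrix.nonsing_inv_mul _ (isUnit_iff_ne_zero.2 hz)]
    have h0 := (hsum.congr_of_eventuallyEq hev.symm).unique (hasFDerivAt_const _ y)
    have h1 := congrArg (fun L : E →L[ℝ] ℝ => L v) h0
    simp only [_root_.sum_apply, _root_.add_apply,
      _root_.smul_apply, smul_eq_mul, _root_.zero_apply] at h1
    rw [Matrix.add_apply, Matrix.mul_apply, Matrix.mul_apply, Matrix.zero_apply, ← h1,
      ← Finset.sum_add_distrib]
    refine Finset.sum_congr rfl fun k _ => ?_
    simp only [hdH, hdG, Matrix.of_apply]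
    ring
  have h2 : dH * G y = -((G y)⁻¹ * dG) := eq_neg_of_add_eq_zero_left key
  calc dH = dH * G y * (G y)⁻¹ := by rw [Matrix.mul_assoc, Matrix.mul_nonsing_inv _ hunit, mul_one]
    _ = _ := by rw [h2, Matrix.neg_mul]

theorem fderiv_sqrt_det {G : E → Matrix ι ι ℝ} {y : E}
    (hG : ∀ a b, ContDiffAt ℝ 1 (fun z => G z a b) y) (hdet : 0 < (G y).det) (v : E) :
    fderiv ℝ (fun z => √(G z).det) y v = 1 / 2 * √(G y).det *
      ((G y)⁻¹ * (Matrix.of fun a b => fderiv ℝ (fun z => G z a b) y v)).trace := by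
  have h1 := (hasFDerivAt_det fun a b => ((hG a b).differentiableAt one_ne_zero).hasFDerivAt).sqrt
    hdet.ne'
  rw [h1.fderiv]
  simp only [_root_.smul_apply, _root_.sum_apply, smul_eq_mul]
  have h2 : ((G y)⁻¹ * (Matrix.of fun a b => fderiv ℝ (fun z => G z a b) y v)).trace
      = ((G y).det)⁻¹ * ∑ i, ∑ a, (G y).adjugate i a * fderiv ℝ (fun z => G z a i) y v := by
    rw [Matrix.trace, Finset.mul_sum]
    refine Finset.sum_congr rfl fun i _ => ?_
    rw [Matrix.diag_apply, Matrix.mul_apply, Finset.mul_sum]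
    refine Finset.sum_congr rfl fun a _ => ?_
    rw [Matrix.inv_def, Matrix.smul_apply, Ring.inverse_eq_inv', smul_eq_mul, Matrix.of_apply]
    ring
  rw [h2]
  have h3 : √(G y).det * √(G y).det = (G y).det := Real.mul_self_sqrt hdet.le
  have h4 : √(G y).det ≠ 0 := (Real.sqrt_pos.2 hdet).ne'
  have h5 : ((G y).det)⁻¹ = (√(G y).det)⁻¹ * (√(G y).det)⁻¹ := by rw [← mul_inv, h3]
  rw [h5]
  generalize √(G y).det = s at h4 ⊢
  field_simp

/-- The divergence of the columns of `√(det G) G⁻¹` in terms of the Christoffel symbols of `G`. -/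
theorem sum_fderiv_sqrt_det_mul_inv {G : E → Matrix ι ι ℝ} {y : E} (b : ι → E)
    (hG : ∀ a b, ContDiffAt ℝ 1 (fun z => G z a b) y)
    (hsymm : ∀ z, (G z).IsSymm) (hdet : 0 < (G y).det) (j : ι) :
    ∑ i, fderiv ℝ (fun z => √(G z).det * (G z)⁻¹ i j) y (b i) =
      -(√(G y).det * ∑ k, ∑ l, (G y)⁻¹ k l * ((1 / 2) * ∑ m, (G y)⁻¹ j m *
        (fderiv ℝ (fun z => G z l m) y (b k) + fderiv ℝ (fun z => G z k m) y (b l)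
          - fderiv ℝ (fun z => G z k l) y (b m)))) := by
  set s := √(G y).det with hs
  set H := (G y)⁻¹ with hH
  let D : ι → Matrix ι ι ℝ := fun i => Matrix.of fun a c => fderiv ℝ (fun z => G z a c) y (b i)
  have hHs : H.IsSymm := by
    rw [hH, Matrix.IsSymm, Matrix.transpose_nonsing_inv, (hsymm y).eq]
  have hHs' : ∀ a c, H a c = H c a := fun a c => (hHs.apply a c).symm
  have hD : ∀ i a c, D i a c = D i c a := fun i a c => by
    have : (fun z => G z a c) = fun z => G z c a := by ext z; exact (hsymm z).apply c a
    simp only [D, Matrix.of_apply, this]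
  have h1 : ∀ i, fderiv ℝ (fun z => √(G z).det * (G z)⁻¹ i j) y (b i)
      = s * (1 / 2 * (H * D i).trace * H i j - (H * D i * H) i j) := by
    intro i
    have d1 : DifferentiableAt ℝ (fun z => √(G z).det) y :=
      ((contDiffAt_det hG).differentiableAt one_ne_zero).sqrt hdet.ne'
    have d2 := (contDiffAt_matrix_inv hG hdet.ne' i j).differentiableAt one_ne_zero
    have e1 := congrFun (congrFun (fderiv_matrix_inv hG hdet.ne' (b i)) i) j
    rw [Matrix.of_apply] at e1
    rw [fderiv_fun_mul d1 d2]
    simp only [_root_.add_apply, _root_.smul_apply, smul_eq_mul]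
    rw [e1, fderiv_sqrt_det hG hdet]
    simp only [Matrix.neg_apply]
    ring
  simp_rw [h1]
  rw [← Finset.mul_sum, ← mul_neg]
  congr 1
  rw [Finset.sum_sub_distrib]
  -- both sides are combinations of the same two contractions
  have t1 : ∑ i, (H * D i * H) i j = ∑ k, ∑ l, ∑ m, H k l * H j m * D k l m := by
    refine Finset.sum_congr rfl fun i _ => ?_
    rw [Matrix.mul_apply, Finset.sum_comm]
    refine Finset.sum_congr rfl fun m _ => ?_
    rw [Matrix.mul_apply, Finset.sum_mul]
    refine Finset.sum_congr rfl fun l _ => ?_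
    rw [hHs' m j]; ring
  have t2 : ∑ i, 1 / 2 * (H * D i).trace * H i j
      = 1 / 2 * ∑ k, ∑ l, ∑ m, H k l * H j m * D m k l := by
    have e1 : ∀ i, 1 / 2 * (H * D i).trace * H i j
        = 1 / 2 * ∑ k, ∑ l, H k l * H j i * D i k l := by
      intro i
      rw [Matrix.trace, mul_assoc, Finset.sum_mul]
      congr 1
      refine Finset.sum_congr rfl fun k _ => ?_
      rw [Matrix.diag_apply, Matrix.mul_apply, Finset.sum_mul]
      refine Finset.sum_congr rfl fun l _ => ?_
      rw [hD i l k, hHs' i j]; ring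
    simp_rw [e1]
    rw [← Finset.mul_sum]
    congr 1
    rw [Finset.sum_comm]
    refine Finset.sum_congr rfl fun k _ => ?_
    rw [Finset.sum_comm]
  have t3 : ∑ k, ∑ l, ∑ m, H k l * H j m * D l k m = ∑ k, ∑ l, ∑ m, H k l * H j m * D k l m := by
    rw [Finset.sum_comm]
    refine Finset.sum_congr rfl fun k _ => Finset.sum_congr rfl fun l _ =>
      Finset.sum_congr rfl fun m _ => ?_
    rw [hHs' l k]
  have t4 : ∑ k, ∑ l, H k l * ((1 / 2) * ∑ m, H j m * (D k l m + D l k m - D m k l))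
      = 1 / 2 * (∑ k, ∑ l, ∑ m, H k l * H j m * D k l m + ∑ k, ∑ l, ∑ m, H k l * H j m * D l k m
        - ∑ k, ∑ l, ∑ m, H k l * H j m * D m k l) := by
    simp only [← Finset.sum_add_distrib, ← Finset.sum_sub_distrib]
    simp only [Finset.mul_sum]
    refine Finset.sum_congr rfl fun k _ => Finset.sum_congr rfl fun l _ =>
      Finset.sum_congr rfl fun m _ => ?_
    ring
  have t5 : ∑ k, ∑ l, H k l * ((1 / 2) * ∑ m, H j m *
        (fderiv ℝ (fun z => G z l m) y (b k) + fderiv ℝ (fun z => G z k m) y (b l)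
          - fderiv ℝ (fun z => G z k l) y (b m)))
      = ∑ k, ∑ l, H k l * ((1 / 2) * ∑ m, H j m * (D k l m + D l k m - D m k l)) := rfl
  rw [t5, t4, t3, t2, t1]
  ring

open scoped MatrixOrder in
/-- Monotonicity of the determinant on positive definite matrices. -/
theorem pow_mul_det_le {A M : Matrix ι ι ℝ} (hA : A.PosDef) (hM : M.IsSymm) {c : ℝ} (hc : 0 ≤ c)
    (h : ∀ x : ι → ℝ, c * (x ⬝ᵥ A.mulVec x) ≤ x ⬝ᵥ M.mulVec x) :
    c ^ Fintype.card ι * A.det ≤ M.det := by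
  -- Conjugating by R⁻¹ reduces to A = 1. All eigenvalues of the conjugate P of M are then at least
  -- c, and its determinant is their product.
  obtain ⟨R, hR⟩ : ∃ R : Matrix ι ι ℝ, A = R.transpose * R := by
    obtain ⟨R, hR⟩ := CStarAlgebra.nonneg_iff_eq_star_mul_self.1 hA.posSemidef.nonneg
    exact ⟨R, by rw [hR, Matrix.star_eq_conjTranspose,
      Matrix.conjTranspose_eq_transpose_of_trivial]⟩
  have hdetA : A.det = R.det ^ 2 := by rw [hR, Matrix.det_mul, Matrix.det_transpose, sq]
  have hRdet : R.det ≠ 0 := fun h0 => by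
    have := hA.det_pos; rw [hdetA, h0] at this; norm_num at this
  have hRu : IsUnit R.det := isUnit_iff_ne_zero.2 hRdet
  set P := (R⁻¹).transpose * M * R⁻¹ with hP
  have hPs : P.IsHermitian := by
    rw [Matrix.IsHermitian, Matrix.conjTranspose_eq_transpose_of_trivial, hP]
    simp only [Matrix.transpose_mul, Matrix.transpose_transpose, hM.eq, Matrix.mul_assoc]
  have hdetP : P.det * A.det = M.det := by
    have : R⁻¹.det * R.det = 1 := by
      rw [← Matrix.det_mul, Matrix.nonsing_inv_mul _ hRu, Matrix.det_one]
    rw [hP, Matrix.det_mul, Matrix.det_mul, Matrix.det_transpose, hdetA]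
    calc _ = M.det * (R⁻¹.det * R.det) ^ 2 := by ring
      _ = _ := by rw [this]; ring
  have hquad : ∀ x : ι → ℝ, c * (x ⬝ᵥ x) ≤ x ⬝ᵥ P.mulVec x := by
    intro x
    have h1 := h (R⁻¹.mulVec x)
    have e1 : R⁻¹.mulVec x ⬝ᵥ A.mulVec (R⁻¹.mulVec x) = x ⬝ᵥ x := by
      rw [hR, ← Matrix.mulVec_mulVec, Matrix.dotProduct_mulVec, Matrix.vecMul_transpose,
        Matrix.mulVec_mulVec, Matrix.mul_nonsing_inv _ hRu, Matrix.one_mulVec]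
    have e2 : R⁻¹.mulVec x ⬝ᵥ M.mulVec (R⁻¹.mulVec x) = x ⬝ᵥ P.mulVec x := by
      rw [hP, Matrix.mul_assoc, ← Matrix.mulVec_mulVec, ← Matrix.mulVec_mulVec,
        Matrix.dotProduct_mulVec x, Matrix.vecMul_transpose]
    rwa [e1, e2] at h1
  have heig : ∀ i, c ≤ hPs.eigenvalues i := by
    intro i
    have h1 := hquad (hPs.eigenvectorBasis i)
    have h2 := hPs.mulVec_eigenvectorBasis i
    rw [h2, dotProduct_smul, smul_eq_mul] at h1
    have h3 : ((hPs.eigenvectorBasis i : EuclideanSpace ℝ ι) : ι → ℝ) ⬝ᵥ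
        ((hPs.eigenvectorBasis i : EuclideanSpace ℝ ι) : ι → ℝ) = 1 := by
      have h4 := hPs.eigenvectorBasis.orthonormal.1 i
      have h5 : ‖hPs.eigenvectorBasis i‖ ^ 2 = 1 := by rw [h4]; norm_num
      rw [EuclideanSpace.norm_sq_eq] at h5
      rw [dotProduct, ← h5]
      refine Finset.sum_congr rfl fun k _ => ?_
      rw [Real.norm_eq_abs, sq_abs, sq]
    rw [h3] at h1
    linarith
  rw [← hdetP]
  refine mul_le_mul_of_nonneg_right ?_ hA.det_pos.le
  rw [hPs.det_eq_prod_eigenvalues]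
  calc c ^ Fintype.card ι = ∏ _i : ι, c := by rw [Finset.prod_const, Finset.card_univ]
    _ ≤ ∏ i, hPs.eigenvalues i := Finset.prod_le_prod (fun _ _ => hc) fun i _ => heig i
    _ = _ := by simp

end Matrices

/-! ### Inner products as bilinear forms, dual norms and Gram determinants. -/

section InnerForms

variable {V : Type*} [AddCommGroup V] [Module ℝ V]

/-- Positive definite symmetric bilinear forms. -/
structure IsInnerForm (β : V → V → ℝ) : Prop where
  add_left : ∀ u v w, β (u + v) w = β u w + β v w
  smul_left : ∀ (c : ℝ) v w, β (c • v) w = c * β v w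
  symm : ∀ v w, β v w = β w v
  pos : ∀ v, v ≠ 0 → 0 < β v v

namespace IsInnerForm

variable {β : V → V → ℝ} (hβ : IsInnerForm β)
include hβ

/-- The linear map `v ↦ β v w`. -/
theorem exists_linearMap (w : V) : ∃ L : V →ₗ[ℝ] ℝ, ∀ v, L v = β v w :=
  ⟨{ toFun := fun v => β v w
     map_add' := fun u v => hβ.add_left u v w
     map_smul' := fun c v => hβ.smul_left c v w }, fun _ => rfl⟩

theorem sum_left {ι : Type*} (s : Finset ι) (c : ι → ℝ) (b : ι → V) (w : V) :
    β (∑ i ∈ s, c i • b i) w = ∑ i ∈ s, c i * β (b i) w := by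
  obtain ⟨L, hL⟩ := hβ.exists_linearMap w
  rw [← hL, map_sum]
  exact Finset.sum_congr rfl fun i _ => by rw [map_smul, hL, smul_eq_mul]

theorem sum_right {ι : Type*} (s : Finset ι) (c : ι → ℝ) (b : ι → V) (w : V) :
    β w (∑ i ∈ s, c i • b i) = ∑ i ∈ s, c i * β w (b i) := by
  rw [hβ.symm, hβ.sum_left]
  exact Finset.sum_congr rfl fun i _ => by rw [hβ.symm]

theorem smul_right (c : ℝ) (v w : V) : β v (c • w) = c * β v w := by
  rw [hβ.symm, hβ.smul_left, hβ.symm]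

theorem sub_left (u v w : V) : β (u - v) w = β u w - β v w := by
  obtain ⟨L, hL⟩ := hβ.exists_linearMap w
  rw [← hL, ← hL, ← hL, map_sub]

theorem sub_right (u v w : V) : β u (v - w) = β u v - β u w := by
  rw [hβ.symm, hβ.sub_left, hβ.symm v, hβ.symm w]

theorem nonneg (v : V) : 0 ≤ β v v := by
  by_cases h : v = 0
  · have := hβ.smul_left 0 v v
    rw [zero_smul, zero_mul] at this
    rw [h] at this ⊢; exact this.ge
  · exact (hβ.pos v h).le

theorem eq_of_forall {u v : V} (h : ∀ w, β u w = β v w) : u = v := by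
  by_contra hne
  have := hβ.pos (u - v) (sub_ne_zero.2 hne)
  rw [hβ.sub_left, h, sub_self] at this
  exact this.false

end IsInnerForm

open Classical in
/-- The vector representing the linear form `ℓ` with respect to `β`. -/
def sharp (β : V → V → ℝ) (ℓ : V →ₗ[ℝ] ℝ) : V :=
  if h : ∃ w, ∀ v, β w v = ℓ v then h.choose else 0

/-- The Gram matrix of a family of vectors. -/
def gram {ι : Type*} (β : V → V → ℝ) (b : ι → V) : Matrix ι ι ℝ :=
  Matrix.of fun i j => β (b i) (b j)

namespace IsInnerForm

variable {β : V → V → ℝ} (hβ : IsInnerForm β)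
include hβ

theorem sharp_eq {ℓ : V →ₗ[ℝ] ℝ} {w : V} (hw : ∀ v, β w v = ℓ v) : sharp β ℓ = w := by
  have h : ∃ w, ∀ v, β w v = ℓ v := ⟨w, hw⟩
  rw [sharp, dif_pos h]
  exact hβ.eq_of_forall fun v => by rw [h.choose_spec v, hw v]

theorem gram_isSymm {ι : Type*} (b : ι → V) : (gram β b).IsSymm := by
  ext i j
  exact hβ.symm _ _

variable {ι : Type*} [Fintype ι]

theorem dotProduct_gram (b : ι → V) (x : ι → ℝ) :
    x ⬝ᵥ (gram β b).mulVec x = β (∑ i, x i • b i) (∑ i, x i • b i) := by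
  rw [hβ.sum_left, dotProduct]
  refine Finset.sum_congr rfl fun i _ => ?_
  rw [hβ.sum_right, Matrix.mulVec, dotProduct]
  congr 1
  exact Finset.sum_congr rfl fun j _ => mul_comm _ _

theorem gram_posDef (b : Module.Basis ι ℝ V) : (gram β b).PosDef := by
  refine Matrix.PosDef.of_dotProduct_mulVec_pos ?_ fun x hx => ?_
  · rw [Matrix.IsHermitian, Matrix.conjTranspose_eq_transpose_of_trivial]
    exact hβ.gram_isSymm _
  · rw [star_trivial, hβ.dotProduct_gram]
    refine hβ.pos _ fun h0 => hx ?_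
    funext i
    exact Fintype.linearIndependent_iff.1 b.linearIndependent x h0 i

variable [DecidableEq ι]

theorem det_gram_pos (b : Module.Basis ι ℝ V) : 0 < (gram β b).det := (hβ.gram_posDef b).det_pos

theorem sharp_eq_sum (b : Module.Basis ι ℝ V) (ℓ : V →ₗ[ℝ] ℝ) :
    sharp β ℓ = ∑ i, (∑ j, (gram β b)⁻¹ i j * ℓ (b j)) • b i := by
  refine hβ.sharp_eq fun v => ?_
  have h1 : ∀ k, β (∑ i, (∑ j, (gram β b)⁻¹ i j * ℓ (b j)) • b i) (b k) = ℓ (b k) := by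
    intro k
    have hs : ∀ i j, (gram β b)⁻¹ i j = (gram β b)⁻¹ j i := fun i j => by
      have : ((gram β b)⁻¹).IsSymm := by
        rw [Matrix.IsSymm, Matrix.transpose_nonsing_inv, (hβ.gram_isSymm _).eq]
      exact (this.apply i j).symm
    rw [hβ.sum_left]
    have h2 : ∀ i, (∑ j, (gram β b)⁻¹ i j * ℓ (b j)) * β (b i) (b k)
        = ∑ j, (gram β b)⁻¹ j i * gram β b i k * ℓ (b j) := by
      intro i
      rw [Finset.sum_mul]
      refine Finset.sum_congr rfl fun j _ => ?_
      rw [hs i j, gram, Matrix.of_apply]; ring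
    simp_rw [h2]
    rw [Finset.sum_comm]
    have h3 : ∀ j, ∑ i, (gram β b)⁻¹ j i * gram β b i k * ℓ (b j)
        = (1 : Matrix ι ι ℝ) j k * ℓ (b j) := by
      intro j
      rw [← Finset.sum_mul, ← Matrix.mul_apply,
        Matrix.nonsing_inv_mul _ (isUnit_iff_ne_zero.2 (hβ.det_gram_pos b).ne')]
    simp_rw [h3, Matrix.one_apply]
    simp
  rw [← b.sum_repr v, hβ.sum_right, map_sum]
  exact Finset.sum_congr rfl fun k _ => by rw [h1, map_smul, smul_eq_mul]

theorem exists_sharp [FiniteDimensional ℝ V] (ℓ : V →ₗ[ℝ] ℝ) (v : V) : β (sharp β ℓ) v = ℓ v := by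
  have h : ∃ w, ∀ v, β w v = ℓ v := by
    let L : V →ₗ[ℝ] Module.Dual ℝ V :=
      { toFun := fun w =>
          { toFun := fun v => β w v
            map_add' := fun u v => by simp only [hβ.symm w, hβ.add_left]
            map_smul' := fun c v => by simp only [hβ.smul_right, RingHom.id_apply, smul_eq_mul] }
        map_add' := fun u v => by ext w; exact hβ.add_left u v w
        map_smul' := fun c v => by ext w; exact hβ.smul_left c v w }
    have hinj : Function.Injective L := fun u v huv =>
      hβ.eq_of_forall fun w => congrArg (fun T : Module.Dual ℝ V => T w) huv
    have hsurj : Function.Surjective L :=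
      (LinearMap.injective_iff_surjective_of_finrank_eq_finrank
        (Subspace.dual_finrank_eq).symm).1 hinj
    obtain ⟨w, hw⟩ := hsurj ℓ
    exact ⟨w, fun v => congrArg (fun T : Module.Dual ℝ V => T v) hw⟩
  rw [sharp, dif_pos h]
  exact h.choose_spec v

/-- The square of a linear form in the dual norm is an upper bound of `2 ℓ v - β v v`. -/
theorem two_mul_sub_le [FiniteDimensional ℝ V] (ℓ : V →ₗ[ℝ] ℝ) (v : V) :
    2 * ℓ v - β v v ≤ ℓ (sharp β ℓ) := by
  have h := hβ.nonneg (v - sharp β ℓ)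
  have e1 := hβ.exists_sharp ℓ v
  have e2 := hβ.exists_sharp ℓ (sharp β ℓ)
  rw [hβ.sub_left, hβ.sub_right, hβ.sub_right, hβ.symm v (sharp β ℓ), e1, e2] at h
  linarith

theorem sharp_nonneg [FiniteDimensional ℝ V] (ℓ : V →ₗ[ℝ] ℝ) : 0 ≤ ℓ (sharp β ℓ) := by
  rw [← hβ.exists_sharp]; exact hβ.nonneg _

/-- Cauchy-Schwarz, by optimising `two_mul_sub_le` along the line spanned by v. -/
theorem sq_le [FiniteDimensional ℝ V] (ℓ : V →ₗ[ℝ] ℝ) (v : V) :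
    ℓ v ^ 2 ≤ ℓ (sharp β ℓ) * β v v := by
  by_cases h0 : v = 0
  · rw [h0, map_zero, zero_pow two_ne_zero]
    exact mul_nonneg (hβ.sharp_nonneg ℓ) (hβ.nonneg _)
  have hp := hβ.pos v h0
  have h := hβ.two_mul_sub_le ℓ ((ℓ v / β v v) • v)
  rw [map_smul, hβ.smul_left, hβ.smul_right, smul_eq_mul] at h
  have e : 2 * (ℓ v / β v v * ℓ v) - ℓ v / β v v * (ℓ v / β v v * β v v) = ℓ v ^ 2 / β v v := by
    field_simp; ring
  rw [e, div_le_iff₀ hp] at h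
  exact h

theorem sharp_smul [FiniteDimensional ℝ V] (c : ℝ) (ℓ : V →ₗ[ℝ] ℝ) :
    sharp β (c • ℓ) = c • sharp β ℓ :=
  hβ.sharp_eq fun v => by rw [hβ.smul_left, hβ.exists_sharp, LinearMap.smul_apply, smul_eq_mul]

/-- A smaller form has a larger dual norm. -/
theorem sharp_mono [FiniteDimensional ℝ V] {β' : V → V → ℝ} (hβ' : IsInnerForm β') {c : ℝ}
    (hc : 0 < c) (h : ∀ v, β v v ≤ c * β' v v) (ℓ : V →ₗ[ℝ] ℝ) :
    ℓ (sharp β' ℓ) ≤ c * ℓ (sharp β ℓ) := by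
  have h1 := hβ.two_mul_sub_le ℓ (c⁻¹ • sharp β' ℓ)
  have h2 := h (sharp β' ℓ)
  rw [hβ'.exists_sharp] at h2
  rw [map_smul, hβ.smul_left, hβ.smul_right, smul_eq_mul] at h1
  have h3 : c⁻¹ * (c⁻¹ * β (sharp β' ℓ) (sharp β' ℓ)) ≤ c⁻¹ * ℓ (sharp β' ℓ) := by
    refine mul_le_mul_of_nonneg_left ?_ (inv_pos.2 hc).le
    rw [inv_mul_le_iff₀ hc]; exact h2
  have h4 : c⁻¹ * ℓ (sharp β' ℓ) ≤ ℓ (sharp β ℓ) := by linarith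
  rwa [inv_mul_le_iff₀ hc] at h4

/-- Change of basis for Gram determinants. -/
theorem det_gram_of_sum (b c : ι → V) (A : Matrix ι ι ℝ) (h : ∀ i, c i = ∑ k, A k i • b k) :
    (gram β c).det = A.det ^ 2 * (gram β b).det := by
  have e : gram β c = A.transpose * gram β b * A := by
    ext i j
    rw [Matrix.mul_apply, gram, Matrix.of_apply, h i, h j, hβ.sum_right]
    refine Finset.sum_congr rfl fun l _ => ?_
    rw [hβ.sum_left, Matrix.mul_apply, mul_comm]
    congr 1
  rw [e, Matrix.det_mul, Matrix.det_mul, Matrix.det_transpose]; ring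

end IsInnerForm

/-- Comparison of Gram determinants. -/
theorem pow_mul_det_gram_le {ι : Type*} [Fintype ι] [DecidableEq ι] {β β' : V → V → ℝ}
    (hβ : IsInnerForm β) (hβ' : IsInnerForm β') {c : ℝ} (hc : 0 ≤ c)
    (h : ∀ v, c * β v v ≤ β' v v) (b : Module.Basis ι ℝ V) :
    c ^ Fintype.card ι * (gram β b).det ≤ (gram β' b).det :=
  pow_mul_det_le (hβ.gram_posDef b) (hβ'.gram_isSymm b) hc fun x => by
    rw [hβ.dotProduct_gram, hβ'.dotProduct_gram]; exact h _

end InnerForms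

/-! ### Metrics, gradients and Laplacians in charts. -/

section Charts

variable {E : Type*} [NormedAddCommGroup E] [NormedSpace ℝ E] [FiniteDimensional ℝ E]
variable {M : Type*} [TopologicalSpace M] [ChartedSpace E M] [IsManifold 𝓘(ℝ, E) ∞ M]

instance (x : M) : FiniteDimensional ℝ (TangentSpace 𝓘(ℝ, E) x) :=
  inferInstanceAs (FiniteDimensional ℝ E)

theorem RMetric.isInnerForm (g : RMetric E M) (x : M) :
    IsInnerForm (fun v w : TangentSpace 𝓘(ℝ, E) x => g.inner x v w) where
  add_left u v w := by simp
  smul_left c v w := by simp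
  symm v w := g.symm x v w
  pos v hv := g.pos x v hv

theorem mdifferentiableAt_chart_symm (p : M) {y : E} (hy : y ∈ (extChartAt 𝓘(ℝ, E) p).target) :
    MDifferentiableAt 𝓘(ℝ, E) 𝓘(ℝ, E) (extChartAt 𝓘(ℝ, E) p).symm y :=
  ((contMDiffOn_extChartAt_symm (n := ∞) p).contMDiffAt
    ((isOpen_extChartAt_target p).mem_nhds hy)).mdifferentiableAt (by simp)

/-- The differential of the inverse of a chart. -/
def chartEquiv (p : M) (y : E) (hy : y ∈ (extChartAt 𝓘(ℝ, E) p).target) :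
    E ≃ₗ[ℝ] TangentSpace 𝓘(ℝ, E) ((extChartAt 𝓘(ℝ, E) p).symm y) := by
  have : IsManifold 𝓘(ℝ, E) 1 M := .of_le (n := ∞) (by simp)
  refine LinearEquiv.ofBijective
    ((mfderiv 𝓘(ℝ, E) 𝓘(ℝ, E) (extChartAt 𝓘(ℝ, E) p).symm y).toLinearMap :
      E →ₗ[ℝ] TangentSpace 𝓘(ℝ, E) ((extChartAt 𝓘(ℝ, E) p).symm y)) ?_
  have h := isInvertible_mfderivWithin_extChartAt_symm hy
  rw [ModelWithCorners.range_eq_univ, mfderivWithin_univ] at h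
  exact h.bijective

theorem chartEquiv_apply (p : M) (y : E) (hy : y ∈ (extChartAt 𝓘(ℝ, E) p).target) (v : E) :
    chartEquiv p y hy v = mfderiv 𝓘(ℝ, E) 𝓘(ℝ, E) (extChartAt 𝓘(ℝ, E) p).symm y v := rfl

/-- The coordinate vector fields form a basis. -/
def coordBasis (p : M) (y : E) (hy : y ∈ (extChartAt 𝓘(ℝ, E) p).target) :
    Module.Basis (Idx E) ℝ (TangentSpace 𝓘(ℝ, E) ((extChartAt 𝓘(ℝ, E) p).symm y)) :=
  (Module.finBasis ℝ E).map (chartEquiv p y hy)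

theorem coordBasis_apply (p : M) (y : E) (hy : y ∈ (extChartAt 𝓘(ℝ, E) p).target) (i : Idx E) :
    coordBasis p y hy i = coordVec p i y := by
  rw [coordBasis, Module.Basis.map_apply, chartEquiv_apply]; rfl

/-- The Gram matrix of the metric in a chart. -/
def gramAt (g : RMetric E M) (p : M) (y : E) : Matrix (Idx E) (Idx E) ℝ :=
  Matrix.of fun a b => coeff g p a b y

theorem gramAt_eq (g : RMetric E M) (p : M) (y : E) (hy : y ∈ (extChartAt 𝓘(ℝ, E) p).target) :
    gramAt g p y = gram (fun v w => g.inner ((extChartAt 𝓘(ℝ, E) p).symm y) v w)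
      (coordBasis p y hy) := by
  ext i j
  rw [gramAt, gram, Matrix.of_apply, Matrix.of_apply, coordBasis_apply, coordBasis_apply, coeff]

theorem gramAt_isSymm (g : RMetric E M) (p : M) (y : E) : (gramAt g p y).IsSymm := by
  ext i j
  exact g.symm _ _ _

theorem det_gramAt_pos (g : RMetric E M) (p : M) (y : E)
    (hy : y ∈ (extChartAt 𝓘(ℝ, E) p).target) : 0 < (gramAt g p y).det := by
  rw [gramAt_eq g p y hy]
  exact (g.isInnerForm _).det_gram_pos _

theorem invCoeff_eq (g : RMetric E M) (p : M) (i j : Idx E) (y : E) :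
    invCoeff g p i j y = (gramAt g p y)⁻¹ i j := rfl

/-- The differential of a function, as a continuous linear form. -/
def differentialL (f : M → ℝ) (x : M) : TangentSpace 𝓘(ℝ, E) x →L[ℝ] ℝ :=
  mfderiv 𝓘(ℝ, E) 𝓘(ℝ, ℝ) f x

/-- The differential of a function, as a linear form. -/
def differential (f : M → ℝ) (x : M) : TangentSpace 𝓘(ℝ, E) x →ₗ[ℝ] ℝ :=
  (differentialL f x).toLinearMap

theorem differential_apply (f : M → ℝ) (x : M) (v : TangentSpace 𝓘(ℝ, E) x) :
    differential f x v = (mfderiv 𝓘(ℝ, E) 𝓘(ℝ, ℝ) f x v : ℝ) := rfl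

theorem fderiv_inChart (p : M) {y : E} (hy : y ∈ (extChartAt 𝓘(ℝ, E) p).target) {f : M → ℝ}
    (hf : MDifferentiableAt 𝓘(ℝ, E) 𝓘(ℝ, ℝ) f ((extChartAt 𝓘(ℝ, E) p).symm y)) (v : E) :
    fderiv ℝ (inChart p f) y v = differential f _ (chartEquiv p y hy v) := by
  have h := mfderiv_comp y hf (mdifferentiableAt_chart_symm p hy)
  have h2 : inChart p f = f ∘ (extChartAt 𝓘(ℝ, E) p).symm := rfl
  rw [h2, ← mfderiv_eq_fderiv, h]
  rfl

theorem pd_inChart (p : M) {y : E} (hy : y ∈ (extChartAt 𝓘(ℝ, E) p).target) {f : M → ℝ}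
    (hf : MDifferentiableAt 𝓘(ℝ, E) 𝓘(ℝ, ℝ) f ((extChartAt 𝓘(ℝ, E) p).symm y)) (i : Idx E) :
    pd i (inChart p f) y = differential f _ (coordBasis p y hy i) := by
  rw [pd, fderiv_inChart p hy hf, coordBasis, Module.Basis.map_apply]; rfl

/-- `⟨∇f, ∇u⟩` for the metric `g`. -/
def gradInner (g : RMetric E M) (f u : M → ℝ) (x : M) : ℝ :=
  differential f x (sharp (fun v w => g.inner x v w) (differential u x))

/-- The left side is defined without coordinates, so the coordinate expression is the same in every
chart. The independence of the Laplacian from the chart is later derived from this. -/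
theorem gradInner_chart (g : RMetric E M) (p : M) {y : E}
    (hy : y ∈ (extChartAt 𝓘(ℝ, E) p).target) {f u : M → ℝ}
    (hf : MDifferentiableAt 𝓘(ℝ, E) 𝓘(ℝ, ℝ) f ((extChartAt 𝓘(ℝ, E) p).symm y))
    (hu : MDifferentiableAt 𝓘(ℝ, E) 𝓘(ℝ, ℝ) u ((extChartAt 𝓘(ℝ, E) p).symm y)) :
    gradInner g f u ((extChartAt 𝓘(ℝ, E) p).symm y) =
      ∑ i, ∑ j, invCoeff g p i j y * pd i (inChart p f) y * pd j (inChart p u) y := by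
  rw [gradInner, (g.isInnerForm _).sharp_eq_sum (coordBasis p y hy), map_sum]
  refine Finset.sum_congr rfl fun i _ => ?_
  rw [map_smul, smul_eq_mul, Finset.sum_mul]
  refine Finset.sum_congr rfl fun j _ => ?_
  rw [pd_inChart p hy hf, pd_inChart p hy hu, invCoeff_eq, gramAt_eq g p y hy]
  ring

theorem gradInner_nonneg (g : RMetric E M) (u : M → ℝ) (x : M) : 0 ≤ gradInner g u u x :=
  (g.isInnerForm x).sharp_nonneg _

theorem gradInner_le (g g' : RMetric E M) {c : ℝ} (hc : 0 < c) (x : M)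
    (h : ∀ v : TangentSpace 𝓘(ℝ, E) x, g.inner x v v ≤ c * g'.inner x v v) (u : M → ℝ) :
    gradInner g' u u x ≤ c * gradInner g u u x :=
  (g.isInnerForm x).sharp_mono (g'.isInnerForm x) hc h _

theorem differential_comp {w : ℝ → ℝ} {w' : ℝ} {u : M → ℝ} {x : M}
    (hu : MDifferentiableAt 𝓘(ℝ, E) 𝓘(ℝ, ℝ) u x) (hw : HasDerivAt w w' (u x)) :
    differential (E := E) (fun z => w (u z)) x = w' • differential (E := E) u x := by
  have h := mfderiv_comp x hw.differentiableAt.mdifferentiableAt hu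
  ext v
  rw [differential_apply, LinearMap.smul_apply, differential_apply]
  have h2 : (fun z => w (u z)) = w ∘ u := rfl
  rw [h2, h, mfderiv_eq_fderiv, hw.hasFDerivAt.fderiv]
  exact mul_comm _ _

theorem gradInner_comp_left (g : RMetric E M) {w : ℝ → ℝ} {w' : ℝ} {u : M → ℝ} {x : M}
    (hu : MDifferentiableAt 𝓘(ℝ, E) 𝓘(ℝ, ℝ) u x) (hw : HasDerivAt w w' (u x)) :
    gradInner g (fun z => w (u z)) u x = w' * gradInner g u u x := by
  rw [gradInner, differential_comp hu hw]; rfl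

theorem gradInner_comp (g : RMetric E M) {w : ℝ → ℝ} {w' : ℝ} {u : M → ℝ} {x : M}
    (hu : MDifferentiableAt 𝓘(ℝ, E) 𝓘(ℝ, ℝ) u x) (hw : HasDerivAt w w' (u x)) :
    gradInner g (fun z => w (u z)) (fun z => w (u z)) x = w' ^ 2 * gradInner g u u x := by
  rw [gradInner, differential_comp hu hw, (g.isInnerForm x).sharp_smul, map_smul,
    LinearMap.smul_apply, gradInner, smul_eq_mul, smul_eq_mul]
  ring

theorem differential_add {f h : M → ℝ} {x : M} (hf : MDifferentiableAt 𝓘(ℝ, E) 𝓘(ℝ, ℝ) f x)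
    (hh : MDifferentiableAt 𝓘(ℝ, E) 𝓘(ℝ, ℝ) h x) :
    differential (E := E) (fun z => f z + h z) x = differential f x + differential h x := by
  ext v
  exact congrArg (fun T : TangentSpace 𝓘(ℝ, E) x →L[ℝ] ℝ => T v) (mfderiv_add hf hh)

theorem differential_sum {ι : Type*} (s : Finset ι) {f : ι → M → ℝ} {x : M}
    (hf : ∀ i ∈ s, MDifferentiableAt 𝓘(ℝ, E) 𝓘(ℝ, ℝ) (f i) x) :
    differential (E := E) (fun z => ∑ i ∈ s, f i z) x = ∑ i ∈ s, differential (E := E) (f i) x := by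
  classical
  suffices h : MDifferentiableAt 𝓘(ℝ, E) 𝓘(ℝ, ℝ) (fun z => ∑ i ∈ s, f i z) x ∧
      differential (E := E) (fun z => ∑ i ∈ s, f i z) x = ∑ i ∈ s, differential (f i) x from h.2
  induction s using Finset.induction_on with
  | empty =>
    simp only [Finset.sum_empty]
    refine ⟨mdifferentiableAt_const, ?_⟩
    ext v
    rw [differential_apply, mfderiv_const]; rfl
  | insert i s hi IH =>
    simp only [Finset.sum_insert hi]
    obtain ⟨h1, h2⟩ := IH fun j hj => hf j (Finset.mem_insert_of_mem hj)
    have h3 := hf i (Finset.mem_insert_self i s)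
    exact ⟨h3.add h1, by rw [differential_add h3 h1, h2]⟩

theorem gradInner_sum_left (g : RMetric E M) {ι : Type*} (s : Finset ι) {f : ι → M → ℝ}
    {u : M → ℝ} {x : M} (hf : ∀ i ∈ s, MDifferentiableAt 𝓘(ℝ, E) 𝓘(ℝ, ℝ) (f i) x) :
    gradInner g (fun z => ∑ i ∈ s, f i z) u x = ∑ i ∈ s, gradInner g (f i) u x := by
  rw [gradInner, differential_sum s hf, LinearMap.sum_apply]; rfl

/-- The coefficients of `g` are smooth functions in the charts. -/
def HasSmoothCoeff (g : RMetric E M) : Prop :=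
  ∀ (p : M) (i j : Idx E), ContDiffOn ℝ ∞ (coeff g p i j) (extChartAt 𝓘(ℝ, E) p).target

theorem IsSmoothFamily.hasSmoothCoeff {g : ℝ → RMetric E M} (hg : IsSmoothFamily g) {t : ℝ}
    (ht : 0 ≤ t) : HasSmoothCoeff (g t) := fun p i j =>
  (hg p i j).comp (f := fun y : E => (t, y)) (contDiffOn_const.prodMk contDiffOn_id)
    fun _ hy => ⟨ht, hy⟩

section Smooth

variable {g : RMetric E M} (hg : HasSmoothCoeff g) (p : M) {y : E}
  (hy : y ∈ (extChartAt 𝓘(ℝ, E) p).target)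
include hg hy

theorem HasSmoothCoeff.contDiffAt (i j : Idx E) {n : ℕ∞} :
    ContDiffAt ℝ n (fun z => gramAt g p z i j) y :=
  ((hg p i j).contDiffAt ((isOpen_extChartAt_target p).mem_nhds hy)).of_le (by exact_mod_cast le_top)

theorem HasSmoothCoeff.contDiffAt_sqrt_det {n : ℕ∞} :
    ContDiffAt ℝ n (fun z => √(gramAt g p z).det) y :=
  (contDiffAt_det fun i j => hg.contDiffAt p hy i j).sqrt (det_gramAt_pos g p y hy).ne'

theorem HasSmoothCoeff.contDiffAt_inv (i j : Idx E) {n : ℕ∞} :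
    ContDiffAt ℝ n (invCoeff g p i j) y :=
  contDiffAt_matrix_inv (fun i j => hg.contDiffAt p hy i j) (det_gramAt_pos g p y hy).ne' i j

theorem HasSmoothCoeff.continuousAt_pd (i a b : Idx E) :
    ContinuousAt (pd i (coeff g p a b)) y :=
  (((hg.contDiffAt p hy a b (n := 1)).fderiv_right (m := 0) (by norm_num)).continuousAt).clm_apply
    continuousAt_const

theorem HasSmoothCoeff.continuousAt_christoffel (k i j : Idx E) :
    ContinuousAt (christoffel g p k i j) y := by
  refine continuousAt_const.mul (tendsto_finsetSum _ fun l _ => ?_)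
  exact ((hg.contDiffAt_inv p hy k l (n := 0)).continuousAt).mul
    (((hg.continuousAt_pd p hy _ _ _).add (hg.continuousAt_pd p hy _ _ _)).sub
      (hg.continuousAt_pd p hy _ _ _))

end Smooth

theorem contDiffAt_inChart {n : ℕ∞} {u : M → ℝ} (hu : ContMDiff 𝓘(ℝ, E) 𝓘(ℝ, ℝ) n u) (p : M) {y : E}
    (hy : y ∈ (extChartAt 𝓘(ℝ, E) p).target) : ContDiffAt ℝ n (inChart p u) y := by
  have h1 := ((contMDiffOn_extChartAt_symm (I := 𝓘(ℝ, E)) (n := ∞) p).contMDiffAt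
    ((isOpen_extChartAt_target p).mem_nhds hy)).of_le (m := n) (by exact_mod_cast le_top)
  have h2 := hu.contMDiffAt.comp y h1
  exact h2.contDiffAt

theorem continuousAt_pd_of_contDiffAt {F : E → ℝ} {y : E} (hF : ContDiffAt ℝ 1 F y) (i : Idx E) :
    ContinuousAt (pd i F) y :=
  ((hF.fderiv_right (m := 0) (by norm_num)).continuousAt).clm_apply continuousAt_const

theorem contDiffAt_pd {F : E → ℝ} {y : E} {m n : WithTop ℕ∞} (hF : ContDiffAt ℝ n F y)
    (hmn : m + 1 ≤ n) (i : Idx E) : ContDiffAt ℝ m (pd i F) y :=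
  (hF.fderiv_right hmn).clm_apply contDiffAt_const

theorem continuous_of_chart {F : M → ℝ}
    (h : ∀ p, ∀ y ∈ (extChartAt 𝓘(ℝ, E) p).target, ContinuousAt (inChart p F) y) :
    Continuous F := by
  rw [continuous_iff_continuousAt]
  intro x
  have h1 := h x _ (mem_extChartAt_target (I := 𝓘(ℝ, E)) x)
  have h2 : ContinuousAt (extChartAt 𝓘(ℝ, E) x) x := continuousAt_extChartAt x
  refine (ContinuousAt.comp (g := inChart x F) h1 h2).congr ?_
  filter_upwards [extChartAt_source_mem_nhds (I := 𝓘(ℝ, E)) x] with z hz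
  rw [Function.comp_apply, inChart, (extChartAt 𝓘(ℝ, E) x).left_inv hz]

theorem continuous_gradInner {g : RMetric E M} (hg : HasSmoothCoeff g) {f u : M → ℝ}
    (hf : ContMDiff 𝓘(ℝ, E) 𝓘(ℝ, ℝ) 1 f) (hu : ContMDiff 𝓘(ℝ, E) 𝓘(ℝ, ℝ) 1 u) :
    Continuous (gradInner g f u) := by
  refine continuous_of_chart (E := E) fun p y hy => ?_
  have h1 : ContinuousAt (fun y => ∑ i, ∑ j, invCoeff g p i j y * pd i (inChart p f) y *
      pd j (inChart p u) y) y := by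
    refine tendsto_finsetSum _ fun i _ => tendsto_finsetSum _ fun j _ => ?_
    exact (((hg.contDiffAt_inv p hy i j (n := 0)).continuousAt).mul
      (continuousAt_pd_of_contDiffAt (contDiffAt_inChart hf p hy) i)).mul
      (continuousAt_pd_of_contDiffAt (contDiffAt_inChart hu p hy) j)
  refine h1.congr ?_
  filter_upwards [(isOpen_extChartAt_target p).mem_nhds hy] with z hz
  rw [inChart, gradInner_chart g p hz (hf.mdifferentiableAt one_ne_zero)
    (hu.mdifferentiableAt one_ne_zero)]

/-- The differential in a chart is controlled by the length of the gradient. -/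
theorem fderiv_sq_le (g : RMetric E M) (p : M) {y : E} (hy : y ∈ (extChartAt 𝓘(ℝ, E) p).target)
    {f : M → ℝ} (hf : MDifferentiableAt 𝓘(ℝ, E) 𝓘(ℝ, ℝ) f ((extChartAt 𝓘(ℝ, E) p).symm y)) (v : E) :
    (fderiv ℝ (inChart p f) y v) ^ 2 ≤ gradInner g f f ((extChartAt 𝓘(ℝ, E) p).symm y) *
      ∑ i, ∑ j, coeff g p i j y * (Module.finBasis ℝ E).repr v i *
        (Module.finBasis ℝ E).repr v j := by
  rw [fderiv_inChart p hy hf]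
  refine ((g.isInnerForm _).sq_le _ _).trans_eq ?_
  congr 1
  have h1 : chartEquiv p y hy v = ∑ i, (Module.finBasis ℝ E).repr v i • coordBasis p y hy i := by
    conv_lhs => rw [← (Module.finBasis ℝ E).sum_repr v, map_sum]
    refine Finset.sum_congr rfl fun i _ => ?_
    rw [map_smul, coordBasis, Module.Basis.map_apply]
  rw [h1, (g.isInnerForm _).sum_left]
  refine Finset.sum_congr rfl fun i _ => ?_
  rw [(g.isInnerForm _).sum_right, Finset.mul_sum]
  refine Finset.sum_congr rfl fun j _ => ?_
  rw [coordBasis_apply, coordBasis_apply, coeff]; ring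

/-- The Laplacian computed in the chart around `p`. -/
def chartLaplacian (g : RMetric E M) (u : M → ℝ) (p : M) (y : E) : ℝ :=
  ∑ i, ∑ j, invCoeff g p i j y * (pd i (pd j (inChart p u)) y
    - ∑ k, christoffel g p k i j y * pd k (inChart p u) y)

theorem continuousAt_chartLaplacian {g : RMetric E M} (hg : HasSmoothCoeff g) {u : M → ℝ}
    (hu : ContMDiff 𝓘(ℝ, E) 𝓘(ℝ, ℝ) 2 u) (p : M) {y : E}
    (hy : y ∈ (extChartAt 𝓘(ℝ, E) p).target) : ContinuousAt (chartLaplacian g u p) y := by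
  have h2 : ContDiffAt ℝ 2 (inChart p u) y := contDiffAt_inChart (n := 2) hu p hy
  refine tendsto_finsetSum _ fun i _ => tendsto_finsetSum _ fun j _ => ?_
  refine ((hg.contDiffAt_inv p hy i j (n := 0)).continuousAt).mul (ContinuousAt.sub ?_ ?_)
  · exact continuousAt_pd_of_contDiffAt (contDiffAt_pd h2 (by norm_num) j) i
  · exact tendsto_finsetSum _ fun k _ => (hg.continuousAt_christoffel p hy k i j).mul
      (continuousAt_pd_of_contDiffAt (h2.of_le (by norm_num)) k)

end Charts

/-! ### The volume density, the divergence form of the Laplacian, and integration by parts in a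
chart. -/

section Volume

variable {E : Type*} [NormedAddCommGroup E] [NormedSpace ℝ E] [FiniteDimensional ℝ E]
  [MeasurableSpace E] [BorelSpace E]
variable {M : Type*} [TopologicalSpace M] [ChartedSpace E M] [IsManifold 𝓘(ℝ, E) ∞ M]

/-- Integration by parts against the constant function 1. -/
theorem integral_pd_eq_zero {H : E → ℝ} (hH : ContDiff ℝ 1 H) (hc : HasCompactSupport H)
    (i : Idx E) : ∫ y, pd i H y ∂(Measure.addHaar : Measure E) = 0 := by
  have hcont : Continuous fun y => fderiv ℝ H y (e i) :=
    (hH.continuous_fderiv one_ne_zero).clm_apply continuous_const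
  have hcs : HasCompactSupport fun y => fderiv ℝ H y (e i) :=
    (hc.fderiv (𝕜 := ℝ)).comp_left (g := fun T : E →L[ℝ] ℝ => T (e i)) rfl
  have h := integral_mul_fderiv_eq_neg_fderiv_mul_of_integrable (μ := (Measure.addHaar : Measure E))
    (f := fun _ : E => (1 : ℝ)) (g := H) (v := (e i : E)) (by simp)
    (by simpa using hcont.integrable_of_hasCompactSupport hcs)
    (by simpa using hH.continuous.integrable_of_hasCompactSupport hc)
    (fun _ _ => differentiableAt_const _) (fun _ _ => hH.differentiable one_ne_zero _)
  simpa [pd] using h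

/-- The density of the Riemannian volume in a chart. -/
def volDensity (g : RMetric E M) (p : M) (y : E) : ℝ := √(gramAt g p y).det

theorem volDensity_pos (g : RMetric E M) (p : M) {y : E}
    (hy : y ∈ (extChartAt 𝓘(ℝ, E) p).target) : 0 < volDensity g p y :=
  Real.sqrt_pos.2 (det_gramAt_pos g p y hy)

/-- The Laplacian in divergence form. -/
theorem sum_pd_mul_flux {g : RMetric E M} (hg : HasSmoothCoeff g) (p : M) {y : E}
    (hy : y ∈ (extChartAt 𝓘(ℝ, E) p).target) {f u : M → ℝ}
    (hf : ContMDiff 𝓘(ℝ, E) 𝓘(ℝ, ℝ) 1 f) (hu : ContMDiff 𝓘(ℝ, E) 𝓘(ℝ, ℝ) 2 u) :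
    ∑ i, pd i (fun z => inChart p f z *
        ∑ j, volDensity g p z * invCoeff g p i j z * pd j (inChart p u) z) y =
      (gradInner g f u ((extChartAt 𝓘(ℝ, E) p).symm y)
        + inChart p f y * chartLaplacian g u p y) * volDensity g p y := by
  have hF : DifferentiableAt ℝ (inChart p f) y :=
    (contDiffAt_inChart (n := 1) hf p hy).differentiableAt one_ne_zero
  have hU : ContDiffAt ℝ 2 (inChart p u) y := contDiffAt_inChart (n := 2) hu p hy
  have hUj : ∀ j, DifferentiableAt ℝ (pd j (inChart p u)) y := fun j =>
    (contDiffAt_pd (m := 1) hU (by norm_num) j).differentiableAt one_ne_zero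
  have hW : ∀ i j, DifferentiableAt ℝ (fun z => volDensity g p z * invCoeff g p i j z) y :=
    fun i j => ((hg.contDiffAt_sqrt_det p hy (n := 1)).differentiableAt one_ne_zero).mul
      ((hg.contDiffAt_inv p hy i j (n := 1)).differentiableAt one_ne_zero)
  -- The derivatives falling on √(det g) g^{ij} produce precisely the first-order part of the
  -- Laplacian, with the Christoffel symbols.
  have hdiv : ∀ j, ∑ i, pd i (fun z => volDensity g p z * invCoeff g p i j z) y =
      -(volDensity g p y * ∑ k, ∑ l, invCoeff g p k l y * christoffel g p j k l y) := fun j =>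
    sum_fderiv_sqrt_det_mul_inv (G := gramAt g p) e (fun a b => hg.contDiffAt p hy a b (n := 1))
      (gramAt_isSymm g p) (det_gramAt_pos g p y hy) j
  have h1 : ∀ i, pd i (fun z => inChart p f z *
        ∑ j, volDensity g p z * invCoeff g p i j z * pd j (inChart p u) z) y =
      pd i (inChart p f) y * ∑ j, volDensity g p y * invCoeff g p i j y * pd j (inChart p u) y
      + inChart p f y * ∑ j, (pd i (fun z => volDensity g p z * invCoeff g p i j z) y *
          pd j (inChart p u) y
        + volDensity g p y * invCoeff g p i j y * pd i (pd j (inChart p u)) y) := by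
    intro i
    have hs : HasFDerivAt (fun z => ∑ j, volDensity g p z * invCoeff g p i j z *
        pd j (inChart p u) z) (∑ j, ((volDensity g p y * invCoeff g p i j y) •
          fderiv ℝ (pd j (inChart p u)) y + pd j (inChart p u) y •
          fderiv ℝ (fun z => volDensity g p z * invCoeff g p i j z) y)) y :=
      HasFDerivAt.fun_sum fun j _ => (hW i j).hasFDerivAt.mul (hUj j).hasFDerivAt
    have := (hF.hasFDerivAt.fun_mul hs).fderiv
    rw [pd, this]
    simp only [_root_.add_apply, _root_.smul_apply, _root_.sum_apply, smul_eq_mul]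
    rw [add_comm, mul_comm (∑ j, volDensity g p y * invCoeff g p i j y * pd j (inChart p u) y)]
    congr 2
    refine Finset.sum_congr rfl fun j _ => ?_
    simp only [pd]; ring
  simp_rw [h1]
  rw [gradInner_chart g p hy (hf.mdifferentiableAt one_ne_zero) (hu.mdifferentiableAt two_ne_zero),
    Finset.sum_add_distrib, ← Finset.mul_sum, add_mul]
  congr 1
  · rw [Finset.sum_mul]
    refine Finset.sum_congr rfl fun i _ => ?_
    rw [Finset.mul_sum, Finset.sum_mul]
    exact Finset.sum_congr rfl fun j _ => by ring
  · rw [mul_assoc]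
    congr 1
    simp_rw [Finset.sum_add_distrib]
    rw [Finset.sum_comm]
    simp_rw [← Finset.sum_mul, hdiv]
    rw [chartLaplacian]
    simp_rw [mul_sub, Finset.sum_sub_distrib, Finset.mul_sum]
    rw [sub_mul, add_comm, sub_eq_add_neg]
    congr 1
    · simp_rw [Finset.sum_mul]
      exact Finset.sum_congr rfl fun i _ => Finset.sum_congr rfl fun j _ => by ring
    · simp_rw [neg_mul, Finset.sum_neg_distrib, Finset.sum_mul]
      congr 1
      rw [Finset.sum_comm]
      refine Finset.sum_congr rfl fun i _ => ?_
      rw [Finset.sum_comm]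
      exact Finset.sum_congr rfl fun j _ => Finset.sum_congr rfl fun k _ => by ring

variable [CompactSpace M]

theorem isCompact_image_tsupport (p : M) {f : M → ℝ}
    (hs : tsupport f ⊆ (extChartAt 𝓘(ℝ, E) p).source) :
    IsCompact (extChartAt 𝓘(ℝ, E) p '' tsupport f) :=
  ((isClosed_tsupport f).isCompact).image_of_continuousOn
    ((continuousOn_extChartAt p).mono hs)

/-- Integration by parts in a chart. -/
theorem integral_chart_eq_zero {g : RMetric E M} (hg : HasSmoothCoeff g) (p : M) {f u : M → ℝ}
    (hf : ContMDiff 𝓘(ℝ, E) 𝓘(ℝ, ℝ) 1 f) (hu : ContMDiff 𝓘(ℝ, E) 𝓘(ℝ, ℝ) 2 u)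
    (hs : tsupport f ⊆ (extChartAt 𝓘(ℝ, E) p).source) :
    ∫ y in (extChartAt 𝓘(ℝ, E) p).target, (gradInner g f u ((extChartAt 𝓘(ℝ, E) p).symm y)
        + inChart p f y * chartLaplacian g u p y) * volDensity g p y
      ∂(Measure.addHaar : Measure E) = 0 := by
  classical
  set T := (extChartAt 𝓘(ℝ, E) p).target with hT
  have hTo : IsOpen T := isOpen_extChartAt_target p
  set K := extChartAt 𝓘(ℝ, E) p '' tsupport f with hK
  have hKc : IsCompact K := isCompact_image_tsupport p hs
  have hKT : K ⊆ T := by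
    rintro _ ⟨x, hx, rfl⟩
    exact (extChartAt 𝓘(ℝ, E) p).map_source (hs hx)
  have hzero : ∀ y ∈ T, y ∉ K → inChart p f y = 0 := by
    intro y hy hyK
    refine image_eq_zero_of_notMem_tsupport (f := f) fun hmem => hyK ?_
    exact ⟨_, hmem, (extChartAt 𝓘(ℝ, E) p).right_inv hy⟩
  let V : Idx E → E → ℝ := fun i z => inChart p f z *
    ∑ j, volDensity g p z * invCoeff g p i j z * pd j (inChart p u) z
  -- The flux extended by zero. It vanishes off the compact set K ⊆ T, so the extension is C¹ on all
  -- of E even though the coefficients mean nothing outside T.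
  let H : Idx E → E → ℝ := fun i => T.indicator (V i)
  have hHz : ∀ i, ∀ y ∉ K, H i y = 0 := by
    intro i y hy
    by_cases hyT : y ∈ T
    · simp only [H, indicator_of_mem hyT, V, hzero y hyT hy, zero_mul]
    · exact indicator_of_notMem hyT _
  have hloc : ∀ y ∉ K, ∀ i, H i =ᶠ[nhds y] fun _ => 0 := fun y hy i => by
    filter_upwards [hKc.isClosed.isOpen_compl.mem_nhds hy] with z hz using hHz i z hz
  have hlocT : ∀ y ∈ T, ∀ i, H i =ᶠ[nhds y] V i := fun y hy i => by
    filter_upwards [hTo.mem_nhds hy] with z hz using indicator_of_mem hz _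
  have hV : ∀ i, ∀ y ∈ T, ContDiffAt ℝ 1 (V i) y := fun i y hy =>
    (contDiffAt_inChart (n := 1) hf p hy).mul (ContDiffAt.sum fun j _ =>
      ((hg.contDiffAt_sqrt_det p hy (n := 1)).mul (hg.contDiffAt_inv p hy i j (n := 1))).mul
        (contDiffAt_pd (contDiffAt_inChart (n := 2) hu p hy) (by norm_num) j))
  have hH : ∀ i, ContDiff ℝ 1 (H i) := fun i => contDiff_iff_contDiffAt.2 fun y => by
    by_cases hy : y ∈ T
    · exact (hV i y hy).congr_of_eventuallyEq (hlocT y hy i)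
    · exact contDiffAt_const.congr_of_eventuallyEq (hloc y (fun h => hy (hKT h)) i)
  have hHc : ∀ i, HasCompactSupport (H i) := fun i => HasCompactSupport.intro hKc (hHz i)
  have hint : ∀ i, Integrable (pd i (H i)) (Measure.addHaar : Measure E) := fun i =>
    (((hH i).continuous_fderiv one_ne_zero).clm_apply
      continuous_const).integrable_of_hasCompactSupport
      (((hHc i).fderiv (𝕜 := ℝ)).comp_left (g := fun T : E →L[ℝ] ℝ => T (e i)) rfl)
  have h0 : ∫ y, ∑ i, pd i (H i) y ∂(Measure.addHaar : Measure E) = 0 := by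
    rw [integral_finsetSum _ fun i _ => hint i]
    exact Finset.sum_eq_zero fun i _ => integral_pd_eq_zero (hH i) (hHc i) i
  rw [← setIntegral_eq_integral_of_forall_compl_eq_zero (s := T)] at h0
  · rw [← h0]
    refine setIntegral_congr_fun hTo.measurableSet fun y hy => ?_
    rw [← sum_pd_mul_flux hg p hy hf hu]
    exact Finset.sum_congr rfl fun i _ => by
      rw [pd, pd, (hlocT y hy i).fderiv_eq]
  · intro y hy
    refine Finset.sum_eq_zero fun i _ => ?_
    rw [pd, (hloc y (fun h => hy (hKT h)) i).fderiv_eq]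
    simp

variable [MeasurableSpace M] [BorelSpace M]

/-- `m` is the Riemannian volume measure of `g`: in every chart it has the
density `√(det g)`. -/
def IsVolume (g : RMetric E M) (m : Measure M) : Prop :=
  ∀ p : M, m.restrict (extChartAt 𝓘(ℝ, E) p).source =
    ((((Measure.addHaar : Measure E).restrict (extChartAt 𝓘(ℝ, E) p).target).withDensity
      fun y => ENNReal.ofReal (volDensity g p y)).map (extChartAt 𝓘(ℝ, E) p).symm)

theorem HasSmoothCoeff.aemeasurable_volDensity {g : RMetric E M} (hg : HasSmoothCoeff g) (p : M) :
    AEMeasurable (volDensity g p)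
      ((Measure.addHaar : Measure E).restrict (extChartAt 𝓘(ℝ, E) p).target) :=
  ContinuousOn.aemeasurable (fun _ hy =>
    ((hg.contDiffAt_sqrt_det p hy (n := 0)).continuousAt).continuousWithinAt)
    (isOpen_extChartAt_target p).measurableSet

theorem aemeasurable_chart_symm (p : M) : AEMeasurable (extChartAt 𝓘(ℝ, E) p).symm
      ((Measure.addHaar : Measure E).restrict (extChartAt 𝓘(ℝ, E) p).target) :=
  (continuousOn_extChartAt_symm p).aemeasurable (isOpen_extChartAt_target p).measurableSet

namespace IsVolume

variable {g : RMetric E M} {m : Measure M} (hm : IsVolume g m) (hg : HasSmoothCoeff g)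
include hm hg

theorem setLIntegral_chart (p : M) {F : M → ENNReal} (hF : Measurable F) :
    ∫⁻ x in (extChartAt 𝓘(ℝ, E) p).source, F x ∂m =
      ∫⁻ y in (extChartAt 𝓘(ℝ, E) p).target, ENNReal.ofReal (volDensity g p y) *
        F ((extChartAt 𝓘(ℝ, E) p).symm y) ∂(Measure.addHaar : Measure E) := by
  have h1 := aemeasurable_chart_symm (E := E) p
  rw [hm p, lintegral_map' hF.aemeasurable (h1.mono_ac (withDensity_absolutelyContinuous _ _))]
  change ∫⁻ a, (F ∘ (extChartAt 𝓘(ℝ, E) p).symm) a ∂_ = _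
  rw [lintegral_withDensity_eq_lintegral_mul₀ (hg.aemeasurable_volDensity p).ennreal_ofReal
      (hF.comp_aemeasurable h1)]
  rfl

theorem setIntegral_chart (p : M) {F : M → ℝ}
    (hF : ContinuousOn F (extChartAt 𝓘(ℝ, E) p).source) :
    ∫ x in (extChartAt 𝓘(ℝ, E) p).source, F x ∂m =
      ∫ y in (extChartAt 𝓘(ℝ, E) p).target, F ((extChartAt 𝓘(ℝ, E) p).symm y) *
        volDensity g p y ∂(Measure.addHaar : Measure E) := by
  have h1 := aemeasurable_chart_symm (E := E) p
  have h2 : AEStronglyMeasurable F (m.restrict (extChartAt 𝓘(ℝ, E) p).source) :=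
    hF.aestronglyMeasurable (isOpen_extChartAt_source p).measurableSet
  rw [hm p] at h2 ⊢
  rw [integral_map (h1.mono_ac (withDensity_absolutelyContinuous _ _)) h2,
    integral_withDensity_eq_integral_toReal_smul₀
      (hg.aemeasurable_volDensity p).ennreal_ofReal (by simp)]
  refine setIntegral_congr_fun (isOpen_extChartAt_target p).measurableSet fun y hy => ?_
  simp only [ENNReal.toReal_ofReal (volDensity_pos g p hy).le, smul_eq_mul, mul_comm]

/-- The density in a chart is positive and Haar measure charges open sets. This is used to pass from
equality almost everywhere to equality of continuous functions, and to see the extrema of U in its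
distribution. -/
theorem isOpenPosMeasure : m.IsOpenPosMeasure := by
  refine ⟨fun W hW ⟨x, hx⟩ h0 => ?_⟩
  set T := (extChartAt 𝓘(ℝ, E) x).target
  have hT : IsOpen T := isOpen_extChartAt_target x
  have hF : Measurable (W.indicator (1 : M → ENNReal)) :=
    measurable_one.indicator hW.measurableSet
  have h1 := hm.setLIntegral_chart hg x hF
  have h2 : ∫⁻ z in (extChartAt 𝓘(ℝ, E) x).source, W.indicator 1 z ∂m = 0 := by
    rw [lintegral_indicator_one hW.measurableSet, Measure.restrict_apply hW.measurableSet]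
    exact measure_mono_null inter_subset_left h0
  rw [h2] at h1
  have h3 := (lintegral_eq_zero_iff' ((hg.aemeasurable_volDensity x).ennreal_ofReal.mul
    (hF.comp_aemeasurable (aemeasurable_chart_symm (E := E) x)))).1 h1.symm
  have h4 := (ae_restrict_iff' hT.measurableSet).1 h3
  have hO : IsOpen (T ∩ (extChartAt 𝓘(ℝ, E) x).symm ⁻¹' W) :=
    (continuousOn_extChartAt_symm x).isOpen_inter_preimage hT hW
  refine (hO.measure_pos (Measure.addHaar : Measure E)
    ⟨extChartAt 𝓘(ℝ, E) x x, mem_extChartAt_target x, ?_⟩).ne' ?_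
  · rw [mem_preimage, extChartAt_to_inv]; exact hx
  · refine measure_mono_null ?_ (ae_iff.1 h4)
    intro y hy h5
    have h6 := h5 hy.1
    simp only [Pi.mul_apply, Function.comp_apply, Pi.zero_apply, mul_eq_zero,
      ENNReal.ofReal_eq_zero, indicator_of_mem (show _ ∈ W from hy.2), Pi.one_apply,
      one_ne_zero, or_false] at h6
    exact absurd (volDensity_pos g x hy.1) (not_lt.2 h6)

end IsVolume

end Volume

/-! ### Green's formula and the independence of the Laplacian from the chart. -/

section Green

variable {E : Type*} [NormedAddCommGroup E] [NormedSpace ℝ E] [FiniteDimensional ℝ E]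
  [MeasurableSpace E] [BorelSpace E]
variable {M : Type*} [TopologicalSpace M] [ChartedSpace E M] [IsManifold 𝓘(ℝ, E) ∞ M]
  [CompactSpace M] [MeasurableSpace M] [BorelSpace M]

theorem differential_eq_zero {f : M → ℝ} {x : M} (hx : x ∉ tsupport f) :
    differential (E := E) f x = 0 := by
  have h : f =ᶠ[nhds x] fun _ => 0 := by
    filter_upwards [(isClosed_tsupport f).isOpen_compl.mem_nhds hx] with z hz
    exact image_eq_zero_of_notMem_tsupport hz
  ext v
  rw [differential_apply, h.mfderiv_eq, mfderiv_const]; rfl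

namespace IsVolume

variable {g : RMetric E M} {m : Measure M} [IsFiniteMeasure m]
  (hm : IsVolume g m) (hg : HasSmoothCoeff g)
include hm hg

theorem continuous_mul_chartLaplacian (p : M) {f u : M → ℝ} (hf : Continuous f)
    (hu : ContMDiff 𝓘(ℝ, E) 𝓘(ℝ, ℝ) 2 u)
    (hs : tsupport f ⊆ (extChartAt 𝓘(ℝ, E) p).source) :
    Continuous fun x => f x * chartLaplacian g u p (extChartAt 𝓘(ℝ, E) p x) := by
  refine ContinuousOn.continuous_of_tsupport_subset (s := (extChartAt 𝓘(ℝ, E) p).source)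
    (hf.continuousOn.mul fun x hx => ?_) (isOpen_extChartAt_source p)
    ((tsupport_mul_subset_left).trans hs)
  exact ((continuousAt_chartLaplacian hg hu p ((extChartAt 𝓘(ℝ, E) p).map_source hx)).comp
    (continuousAt_extChartAt' hx)).continuousWithinAt

/-- Green's formula for f supported in one chart, with the Laplacian of that fixed chart.
`laplacian` uses a different chart at each point, so it is not yet known to be the same or to be
continuous. -/
theorem integral_mul_chartLaplacian (p : M) {f u : M → ℝ} (hf : ContMDiff 𝓘(ℝ, E) 𝓘(ℝ, ℝ) 1 f)
    (hu : ContMDiff 𝓘(ℝ, E) 𝓘(ℝ, ℝ) 2 u)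
    (hs : tsupport f ⊆ (extChartAt 𝓘(ℝ, E) p).source) :
    ∫ x, f x * chartLaplacian g u p (extChartAt 𝓘(ℝ, E) p x) ∂m = -∫ x, gradInner g f u x ∂m := by
  have h1 := hm.continuous_mul_chartLaplacian hg p hf.continuous hu hs
  have h2 := continuous_gradInner hg hf (hu.of_le (by norm_num))
  have h12 : Continuous fun x => gradInner g f u x
      + f x * chartLaplacian g u p (extChartAt 𝓘(ℝ, E) p x) := h2.add h1
  have h3 : ∫ x, (gradInner g f u x + f x * chartLaplacian g u p (extChartAt 𝓘(ℝ, E) p x)) ∂m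
      = 0 := by
    rw [← setIntegral_eq_integral_of_forall_compl_eq_zero
      (s := (extChartAt 𝓘(ℝ, E) p).source), hm.setIntegral_chart hg p h12.continuousOn,
      ← integral_chart_eq_zero hg p hf hu hs]
    · refine setIntegral_congr_fun (isOpen_extChartAt_target p).measurableSet fun y hy => ?_
      simp only [(extChartAt 𝓘(ℝ, E) p).right_inv hy, inChart]
    · intro x hx
      have hx' : x ∉ tsupport f := fun h => hx (hs h)
      rw [gradInner, differential_eq_zero hx', image_eq_zero_of_notMem_tsupport hx']
      simp
  rw [integral_add (h2.integrable_of_hasCompactSupport (.of_compactSpace _))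
    (h1.integrable_of_hasCompactSupport (.of_compactSpace _))] at h3
  linarith

variable [T2Space M]

/-- The Laplacian does not depend on the chart. -/
theorem chartLaplacian_eq {u : M → ℝ} (hu : ContMDiff 𝓘(ℝ, E) 𝓘(ℝ, ℝ) 2 u) (p : M) {x : M}
    (hx : x ∈ (extChartAt 𝓘(ℝ, E) p).source) :
    chartLaplacian g u p (extChartAt 𝓘(ℝ, E) p x) = laplacian g u x := by
  have := hm.isOpenPosMeasure hg
  set O := (extChartAt 𝓘(ℝ, E) p).source ∩ (extChartAt 𝓘(ℝ, E) x).source with hO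
  have hOo : IsOpen O := (isOpen_extChartAt_source p).inter (isOpen_extChartAt_source x)
  have hc : ∀ q : M, O ⊆ (extChartAt 𝓘(ℝ, E) q).source →
      ContinuousOn (fun z => chartLaplacian g u q (extChartAt 𝓘(ℝ, E) q z)) O :=
    fun q hq z hz => ((continuousAt_chartLaplacian hg hu q
      ((extChartAt 𝓘(ℝ, E) q).map_source (hq hz))).comp
      (continuousAt_extChartAt' (hq hz))).continuousWithinAt
  have hc1 := hc p inter_subset_left
  have hc2 := hc x inter_subset_right
  -- Against any test function supported in the overlap both chart expressions have the integral
  -- -∫⟨∇f, ∇u⟩, which does not see the chart. This replaces a transformation law for the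
  -- Christoffel symbols.
  have h0 : ∀ᵐ z ∂m, z ∈ O → chartLaplacian g u p (extChartAt 𝓘(ℝ, E) p z)
      - chartLaplacian g u x (extChartAt 𝓘(ℝ, E) x z) = 0 := by
    refine hOo.ae_eq_zero_of_integral_contMDiff_smul_eq_zero 𝓘(ℝ, E)
      ((hc1.sub hc2).locallyIntegrableOn hOo.measurableSet) fun f hf _ hfO => ?_
    have hf1 : ContMDiff 𝓘(ℝ, E) 𝓘(ℝ, ℝ) 1 f := hf.of_le (by simp)
    have e1 := hm.integral_mul_chartLaplacian hg p hf1 hu (hfO.trans inter_subset_left)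
    have e2 := hm.integral_mul_chartLaplacian hg x hf1 hu (hfO.trans inter_subset_right)
    have i1 := hm.continuous_mul_chartLaplacian hg p hf.continuous hu
      (hfO.trans inter_subset_left)
    have i2 := hm.continuous_mul_chartLaplacian hg x hf.continuous hu
      (hfO.trans inter_subset_right)
    simp only [smul_eq_mul, mul_sub]
    rw [integral_sub (i1.integrable_of_hasCompactSupport (.of_compactSpace _))
      (i2.integrable_of_hasCompactSupport (.of_compactSpace _)), e1, e2, sub_self]
  have h1 := Measure.eqOn_open_of_ae_eq (μ := m) (U := O)
    ((ae_restrict_iff' hOo.measurableSet).2 (h0.mono fun z hz hzO => sub_eq_zero.1 (hz hzO)))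
    hOo hc1 hc2
  exact h1 ⟨hx, mem_extChartAt_source x⟩

theorem continuous_laplacian {u : M → ℝ} (hu : ContMDiff 𝓘(ℝ, E) 𝓘(ℝ, ℝ) 2 u) :
    Continuous (laplacian g u) := by
  refine continuous_of_chart (E := E) fun p y hy => ?_
  refine (continuousAt_chartLaplacian hg hu p hy).congr ?_
  filter_upwards [(isOpen_extChartAt_target p).mem_nhds hy] with z hz
  rw [inChart, ← hm.chartLaplacian_eq hg hu p ((extChartAt 𝓘(ℝ, E) p).map_target hz),
    (extChartAt 𝓘(ℝ, E) p).right_inv hz]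

/-- Green's formula. -/
theorem integral_mul_laplacian {f u : M → ℝ} (hf : ContMDiff 𝓘(ℝ, E) 𝓘(ℝ, ℝ) 1 f)
    (hu : ContMDiff 𝓘(ℝ, E) 𝓘(ℝ, ℝ) 2 u) :
    ∫ x, f x * laplacian g u x ∂m = -∫ x, gradInner g f u x ∂m := by
  obtain ⟨t, ht⟩ := (isCompact_univ (X := M)).elim_finite_subcover
    (fun p : M => (extChartAt 𝓘(ℝ, E) p).source) isOpen_extChartAt_source
    fun x _ => mem_iUnion.2 ⟨x, mem_extChartAt_source x⟩
  -- Only f is cut into pieces; both sides are linear in f, and u is left untouched.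
  obtain ⟨ρ, hρ⟩ := SmoothPartitionOfUnity.exists_isSubordinate 𝓘(ℝ, E) (isClosed_univ (X := M))
    (fun p : t => (extChartAt 𝓘(ℝ, E) (p : M)).source) (fun p => isOpen_extChartAt_source (p : M))
    fun x hx => by
      obtain ⟨p, hp, hxp⟩ := mem_iUnion₂.1 (ht hx)
      exact mem_iUnion.2 ⟨⟨p, hp⟩, hxp⟩
  have hsum : ∀ x, ∑ i, ρ i x = 1 := fun x => by
    rw [← finsum_eq_sum_of_fintype]; exact ρ.sum_eq_one (mem_univ x)
  have hfi : ∀ i, ContMDiff 𝓘(ℝ, E) 𝓘(ℝ, ℝ) 1 fun x => ρ i x * f x := fun i =>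
    ((ρ i).contMDiff.of_le (by simp)).mul hf
  have hsi : ∀ i, tsupport (fun x => ρ i x * f x) ⊆ (extChartAt 𝓘(ℝ, E) (i : M)).source :=
    fun i => (tsupport_mul_subset_left).trans (hρ i)
  have h1 : ∀ i, ∫ x, ρ i x * f x * laplacian g u x ∂m
      = -∫ x, gradInner g (fun x => ρ i x * f x) u x ∂m := by
    intro i
    rw [← hm.integral_mul_chartLaplacian hg i (hfi i) hu (hsi i)]
    congr 1
    ext x
    by_cases hx : x ∈ (extChartAt 𝓘(ℝ, E) (i : M)).source
    · rw [hm.chartLaplacian_eq hg hu i hx]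
    · have : ρ i x * f x = 0 :=
        image_eq_zero_of_notMem_tsupport (f := fun x => ρ i x * f x) fun h => hx (hsi i h)
      rw [this, zero_mul, zero_mul]
  have hL := hm.continuous_laplacian hg hu
  have hi : ∀ i, Integrable (fun x => ρ i x * f x * laplacian g u x) m := fun i =>
    ((hfi i).continuous.mul hL).integrable_of_hasCompactSupport (.of_compactSpace _)
  have e1 : ∀ x, f x * laplacian g u x = ∑ i, ρ i x * f x * laplacian g u x := fun x => by
    rw [← Finset.sum_mul, ← Finset.sum_mul, hsum, one_mul]
  have e2 : ∀ x, gradInner g f u x = ∑ i, gradInner g (fun x => ρ i x * f x) u x := fun x => by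
    rw [← gradInner_sum_left g Finset.univ fun i _ => (hfi i).mdifferentiableAt one_ne_zero]
    congr 1
    ext z
    rw [← Finset.sum_mul, hsum, one_mul]
  simp_rw [e1, e2]
  rw [integral_finsetSum _ fun i _ => hi i,
    integral_finsetSum _ fun i _ => ((continuous_gradInner hg (hfi i)
      (hu.of_le (by norm_num))).integrable_of_hasCompactSupport (.of_compactSpace _)),
    ← Finset.sum_neg_distrib]
  exact Finset.sum_congr rfl fun i _ => h1 i

end IsVolume
end Green

/-! ### Existence of the Riemannian volume and the density of one volume with respect to another. -/

section VolumeExistence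

variable {E : Type*} [NormedAddCommGroup E] [NormedSpace ℝ E] [FiniteDimensional ℝ E]
  [MeasurableSpace E] [BorelSpace E]
variable {M : Type*} [TopologicalSpace M] [ChartedSpace E M] [IsManifold 𝓘(ℝ, E) ∞ M]

/-- The change of coordinates from the chart around `p` to the chart around `q`. -/
def transition (p q : M) : E → E := extChartAt 𝓘(ℝ, E) q ∘ (extChartAt 𝓘(ℝ, E) p).symm

theorem differentiableAt_transition (p q : M) {y : E} (hy : y ∈ (extChartAt 𝓘(ℝ, E) p).target)
    (hq : (extChartAt 𝓘(ℝ, E) p).symm y ∈ (extChartAt 𝓘(ℝ, E) q).source) :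
    DifferentiableAt ℝ (transition p q) y := by
  have : IsManifold 𝓘(ℝ, E) 1 M := .of_le (n := ∞) (by simp)
  rw [extChartAt_source] at hq
  exact ((mdifferentiableAt_extChartAt hq).comp y
    (mdifferentiableAt_chart_symm p hy)).differentiableAt

/-- Transformation of the volume density under a change of coordinates. -/
theorem volDensity_transition (g : RMetric E M) (p q : M) {y : E}
    (hy : y ∈ (extChartAt 𝓘(ℝ, E) p).target)
    (hq : (extChartAt 𝓘(ℝ, E) p).symm y ∈ (extChartAt 𝓘(ℝ, E) q).source) :
    volDensity g p y =
      |(fderiv ℝ (transition p q) y).det| * volDensity g q (transition p q y) := by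
  set τ : E → E := transition p q with hτ
  have hτT : τ y ∈ (extChartAt 𝓘(ℝ, E) q).target := (extChartAt 𝓘(ℝ, E) q).map_source hq
  have hx : (extChartAt 𝓘(ℝ, E) q).symm (τ y) = (extChartAt 𝓘(ℝ, E) p).symm y :=
    (extChartAt 𝓘(ℝ, E) q).left_inv hq
  have hτd : DifferentiableAt ℝ τ y := differentiableAt_transition p q hy hq
  let Lp : E →L[ℝ] E := mfderiv 𝓘(ℝ, E) 𝓘(ℝ, E) (extChartAt 𝓘(ℝ, E) p).symm y
  let Lq : E →L[ℝ] E := mfderiv 𝓘(ℝ, E) 𝓘(ℝ, E) (extChartAt 𝓘(ℝ, E) q).symm (τ y)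
  have hL : Lp = Lq.comp (fderiv ℝ τ y) := by
    have hev : (extChartAt 𝓘(ℝ, E) p).symm =ᶠ[nhds y] (extChartAt 𝓘(ℝ, E) q).symm ∘ τ := by
      have hc : ContinuousAt (extChartAt 𝓘(ℝ, E) p).symm y :=
        (continuousOn_extChartAt_symm p).continuousAt ((isOpen_extChartAt_target p).mem_nhds hy)
      filter_upwards [hc.preimage_mem_nhds ((isOpen_extChartAt_source q).mem_nhds hq)] with z hz
      exact ((extChartAt 𝓘(ℝ, E) q).left_inv hz).symm
    have h1 := mfderiv_comp y (mdifferentiableAt_chart_symm q hτT) hτd.mdifferentiableAt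
    rw [mfderiv_eq_fderiv] at h1
    exact (hev.mfderiv_eq).trans h1
  let b := Module.finBasis ℝ E
  let A : Matrix (Idx E) (Idx E) ℝ := LinearMap.toMatrix b b (fderiv ℝ τ y : E →ₗ[ℝ] E)
  have hA : A.det = (fderiv ℝ τ y).det := LinearMap.det_toMatrix b _
  have hsum : ∀ i, Lp (b i) = ∑ k, A k i • Lq (b k) := by
    intro i
    rw [hL, ContinuousLinearMap.comp_apply]
    conv_lhs => rw [← b.sum_repr (fderiv ℝ τ y (b i)), map_sum]
    refine Finset.sum_congr rfl fun k _ => ?_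
    rw [map_smul]
    exact congrArg (· • Lq (b k)) (LinearMap.toMatrix_apply b b (fderiv ℝ τ y : E →ₗ[ℝ] E) k i).symm
  have hβ := g.isInnerForm ((extChartAt 𝓘(ℝ, E) q).symm (τ y))
  have hdet := hβ.det_gram_of_sum (fun i => Lq (b i)) (fun i => Lp (b i)) A hsum
  have e1 : gramAt g q (τ y) = gram (fun v w => g.inner ((extChartAt 𝓘(ℝ, E) q).symm (τ y)) v w)
      (fun i => Lq (b i)) := rfl
  have e2 : gramAt g p y = gram (fun v w => g.inner ((extChartAt 𝓘(ℝ, E) q).symm (τ y)) v w)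
      (fun i => Lp (b i)) := by
    have key : ∀ x x' : M, x = x' → ∀ v w : E,
        (g.inner x : E →L[ℝ] E →L[ℝ] ℝ) v w = (g.inner x' : E →L[ℝ] E →L[ℝ] ℝ) v w := by
      rintro x _ rfl v w; rfl
    ext i j
    exact key _ _ hx.symm _ _
  rw [volDensity, volDensity, e2, hdet, hA, ← e1, Real.sqrt_mul (sq_nonneg _), Real.sqrt_sq_eq_abs]

variable [CompactSpace M] [MeasurableSpace M] [BorelSpace M]

/-- The Riemannian volume of the domain of a chart. -/
def chartMeasure (g : RMetric E M) (p : M) : Measure M :=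
  (((Measure.addHaar : Measure E).restrict (extChartAt 𝓘(ℝ, E) p).target).withDensity
      fun y => ENNReal.ofReal (volDensity g p y)).map (extChartAt 𝓘(ℝ, E) p).symm

theorem measurableSet_target_inter_preimage (p : M) {B : Set M} (hB : MeasurableSet B) :
    MeasurableSet ((extChartAt 𝓘(ℝ, E) p).target ∩ (extChartAt 𝓘(ℝ, E) p).symm ⁻¹' B) := by
  classical
  have hT := (isOpen_extChartAt_target (I := 𝓘(ℝ, E)) p).measurableSet
  have h := ContinuousOn.measurable_piecewise (continuousOn_extChartAt_symm (I := 𝓘(ℝ, E)) p)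
    (continuousOn_const (c := p)) hT
  have h1 := hT.inter (h hB)
  convert h1 using 1
  ext y
  constructor
  · rintro ⟨h1, h2⟩; exact ⟨h1, by rwa [mem_preimage, piecewise_eq_of_mem _ _ _ h1]⟩
  · rintro ⟨h1, h2⟩; exact ⟨h1, by rwa [mem_preimage, piecewise_eq_of_mem _ _ _ h1] at h2⟩

theorem chartMeasure_apply {g : RMetric E M} (p : M) {B : Set M}
    (hB : MeasurableSet B) :
    chartMeasure g p B = ∫⁻ y in (extChartAt 𝓘(ℝ, E) p).target ∩
      (extChartAt 𝓘(ℝ, E) p).symm ⁻¹' B, ENNReal.ofReal (volDensity g p y)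
        ∂(Measure.addHaar : Measure E) := by
  have h1 := aemeasurable_chart_symm (E := E) p
  have hT := (isOpen_extChartAt_target (I := 𝓘(ℝ, E)) p).measurableSet
  rw [chartMeasure, Measure.map_apply_of_aemeasurable
    (h1.mono_ac (withDensity_absolutelyContinuous _ _)) hB, withDensity_apply']
  rw [Measure.restrict_restrict' hT, inter_comm]

/-- Change of variables under the transition map; its Jacobian is the factor in
`volDensity_transition`. -/
theorem chartMeasure_eq (g : RMetric E M) (p q : M) {B : Set M} (hB : MeasurableSet B)
    (hp : B ⊆ (extChartAt 𝓘(ℝ, E) p).source) (hq : B ⊆ (extChartAt 𝓘(ℝ, E) q).source) :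
    chartMeasure g p B = chartMeasure g q B := by
  rw [chartMeasure_apply p hB, chartMeasure_apply q hB]
  set A := (extChartAt 𝓘(ℝ, E) p).target ∩ (extChartAt 𝓘(ℝ, E) p).symm ⁻¹' B with hA
  have himage : (extChartAt 𝓘(ℝ, E) q).target ∩ (extChartAt 𝓘(ℝ, E) q).symm ⁻¹' B =
      transition p q '' A := by
    ext z
    constructor
    · rintro ⟨hz, hzB⟩
      refine ⟨extChartAt 𝓘(ℝ, E) p ((extChartAt 𝓘(ℝ, E) q).symm z),
        ⟨(extChartAt 𝓘(ℝ, E) p).map_source (hp hzB), ?_⟩, ?_⟩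
      · rw [mem_preimage, (extChartAt 𝓘(ℝ, E) p).left_inv (hp hzB)]; exact hzB
      · rw [transition, Function.comp_apply, (extChartAt 𝓘(ℝ, E) p).left_inv (hp hzB),
          (extChartAt 𝓘(ℝ, E) q).right_inv hz]
    · rintro ⟨y, ⟨hy, hyB⟩, rfl⟩
      refine ⟨(extChartAt 𝓘(ℝ, E) q).map_source (hq hyB), ?_⟩
      rw [mem_preimage, transition, Function.comp_apply,
        (extChartAt 𝓘(ℝ, E) q).left_inv (hq hyB)]
      exact hyB
  have hinj : InjOn (transition p q) A := fun y hy z hz h =>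
    (extChartAt 𝓘(ℝ, E) p).symm.injOn hy.1 hz.1
      ((extChartAt 𝓘(ℝ, E) q).injOn (hq hy.2) (hq hz.2) h)
  have hAm := measurableSet_target_inter_preimage (E := E) p hB
  rw [himage, lintegral_image_eq_lintegral_abs_det_fderiv_mul _ hAm
    (fun y hy => ((differentiableAt_transition p q hy.1
      (hq hy.2)).hasFDerivAt).hasFDerivWithinAt) hinj]
  refine setLIntegral_congr_fun hAm fun y hy => ?_
  rw [← ENNReal.ofReal_mul (abs_nonneg _), ← volDensity_transition g p q hy.1 (hq hy.2)]

theorem chartMeasure_restrict_source (g : RMetric E M) (p : M) :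
    (chartMeasure g p).restrict (extChartAt 𝓘(ℝ, E) p).source = chartMeasure g p := by
  ext B hB
  rw [Measure.restrict_apply hB, chartMeasure_apply p hB,
    chartMeasure_apply p (hB.inter (isOpen_extChartAt_source p).measurableSet)]
  congr 2
  ext y
  constructor
  · rintro ⟨h1, h2⟩; exact ⟨h1, h2.1⟩
  · rintro ⟨h1, h2⟩; exact ⟨h1, h2, (extChartAt 𝓘(ℝ, E) p).map_target h1⟩

/-- Existence of the Riemannian volume measure. -/
theorem exists_isVolume [Nonempty M] (g : RMetric E M) : ∃ m : Measure M, IsVolume g m := by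
  obtain ⟨t, ht⟩ := (isCompact_univ (X := M)).elim_finite_subcover
    (fun p : M => (extChartAt 𝓘(ℝ, E) p).source) isOpen_extChartAt_source
    fun x _ => mem_iUnion.2 ⟨x, mem_extChartAt_source x⟩
  have htne : (t : Set M).Nonempty := by
    obtain ⟨x⟩ := ‹Nonempty M›
    obtain ⟨p, hp, _⟩ := mem_iUnion₂.1 (ht (mem_univ x))
    exact ⟨p, hp⟩
  obtain ⟨f, hf⟩ := t.countable_toSet.exists_eq_range htne
  let S : ℕ → Set M := fun n => (extChartAt 𝓘(ℝ, E) (f n)).source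
  have hS : ∀ n, MeasurableSet (S n) := fun n => (isOpen_extChartAt_source (f n)).measurableSet
  have hAm : ∀ n, MeasurableSet (disjointed S n) := fun n => MeasurableSet.disjointed hS n
  have hU : ⋃ n, disjointed S n = univ := by
    rw [iUnion_disjointed]
    refine eq_univ_of_forall fun x => ?_
    obtain ⟨p, hp, hxp⟩ := mem_iUnion₂.1 (ht (mem_univ x))
    have : p ∈ range f := hf ▸ hp
    obtain ⟨n, rfl⟩ := this
    exact mem_iUnion.2 ⟨n, hxp⟩
  -- The chart measures agree on overlaps, so they are glued along a disjoint refinement of a finite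
  -- cover by chart domains, enumerated with repetitions by ℕ.
  refine ⟨Measure.sum fun n => (chartMeasure g (f n)).restrict (disjointed S n), fun p => ?_⟩
  change _ = chartMeasure g p
  have hSp := (isOpen_extChartAt_source (I := 𝓘(ℝ, E)) p).measurableSet
  rw [Measure.restrict_sum _ hSp]
  have h1 : ∀ n, ((chartMeasure g (f n)).restrict (disjointed S n)).restrict
      (extChartAt 𝓘(ℝ, E) p).source = (chartMeasure g p).restrict (disjointed S n) := by
    intro n
    ext B hB
    rw [Measure.restrict_apply hB, Measure.restrict_apply (hB.inter hSp),
      ← chartMeasure_restrict_source g p, Measure.restrict_restrict (hAm n),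
      Measure.restrict_apply hB]
    have e1 : B ∩ (extChartAt 𝓘(ℝ, E) p).source ∩ disjointed S n
        = B ∩ (disjointed S n ∩ (extChartAt 𝓘(ℝ, E) p).source) := by
      ext z; simp only [mem_inter_iff]; tauto
    rw [e1]
    exact chartMeasure_eq g _ _ (hB.inter ((hAm n).inter hSp))
      (fun z hz => disjointed_subset S n hz.2.1) (fun z hz => hz.2.2)
  simp_rw [h1]
  rw [← Measure.restrict_iUnion (disjoint_disjointed S) hAm, hU, Measure.restrict_univ]

/-- The density is bounded on small closed coordinate balls, so the measure is locally finite, and M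
is compact. -/
theorem IsVolume.isFiniteMeasure {g : RMetric E M} (hg : HasSmoothCoeff g) {m : Measure M}
    (hm : IsVolume g m) : IsFiniteMeasure m := by
  have hloc : IsLocallyFiniteMeasure m := by
    refine ⟨fun x => ?_⟩
    set T := (extChartAt 𝓘(ℝ, E) x).target
    set S := (extChartAt 𝓘(ℝ, E) x).source
    have hT : IsOpen T := isOpen_extChartAt_target x
    obtain ⟨r, hr, hrT⟩ := Metric.nhds_basis_closedBall.mem_iff.1
      (hT.mem_nhds (mem_extChartAt_target (I := 𝓘(ℝ, E)) x))
    set K := Metric.closedBall (extChartAt 𝓘(ℝ, E) x x) r with hK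
    have hO : IsOpen (S ∩ extChartAt 𝓘(ℝ, E) x ⁻¹' Metric.ball (extChartAt 𝓘(ℝ, E) x x) r) :=
      (continuousOn_extChartAt x).isOpen_inter_preimage (isOpen_extChartAt_source x)
        Metric.isOpen_ball
    refine ⟨_, hO.mem_nhds ⟨mem_extChartAt_source x, Metric.mem_ball_self hr⟩, ?_⟩
    set W := S ∩ extChartAt 𝓘(ℝ, E) x ⁻¹' Metric.ball (extChartAt 𝓘(ℝ, E) x x) r
    have h1 : m W = chartMeasure g x W := by
      have h2 : chartMeasure g x = m.restrict S := (hm x).symm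
      rw [h2, Measure.restrict_apply hO.measurableSet, inter_eq_left.2 inter_subset_left]
    have h3 : IntegrableOn (volDensity g x) K (Measure.addHaar : Measure E) :=
      ContinuousOn.integrableOn_compact (isCompact_closedBall _ _) fun y hy =>
        ((hg.contDiffAt_sqrt_det x (hrT hy) (n := 0)).continuousAt).continuousWithinAt
    rw [h1, chartMeasure_apply x hO.measurableSet]
    refine lt_of_le_of_lt (lintegral_mono_set (t := K) ?_) ?_
    · rintro y ⟨hy, hyW⟩
      have := hyW.2
      rw [mem_preimage, (extChartAt 𝓘(ℝ, E) x).right_inv hy] at this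
      exact Metric.ball_subset_closedBall this
    · exact (lintegral_ofReal_le_lintegral_enorm _).trans_lt h3.hasFiniteIntegral
  infer_instance

/-- The density of the volume of `g'` with respect to the volume of `g`. -/
def volRatio (g g' : RMetric E M) (x : M) : ℝ :=
  volDensity g' x (extChartAt 𝓘(ℝ, E) x x) / volDensity g x (extChartAt 𝓘(ℝ, E) x x)

/-- Both densities pick up the same Jacobian under a change of chart. Hence the ratio, defined with
a chart varying from point to point, can be computed in a fixed one. -/
theorem volRatio_chart (g g' : RMetric E M) (p : M) {y : E}
    (hy : y ∈ (extChartAt 𝓘(ℝ, E) p).target) :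
    volRatio g g' ((extChartAt 𝓘(ℝ, E) p).symm y) = volDensity g' p y / volDensity g p y := by
  set x := (extChartAt 𝓘(ℝ, E) p).symm y with hx
  have hq : x ∈ (extChartAt 𝓘(ℝ, E) x).source := mem_extChartAt_source x
  have h1 := volDensity_transition g p x hy hq
  have h2 := volDensity_transition g' p x hy hq
  have h3 : transition p x y = extChartAt 𝓘(ℝ, E) x x := rfl
  have h4 : |(fderiv ℝ (transition p x) y).det| ≠ 0 := fun h0 => by
    rw [h0, zero_mul] at h1
    exact (volDensity_pos g p hy).ne' h1
  rw [volRatio, h1, h2, h3, mul_div_mul_left _ _ h4]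

theorem continuous_volRatio {g g' : RMetric E M} (hg : HasSmoothCoeff g)
    (hg' : HasSmoothCoeff g') : Continuous (volRatio g g') := by
  refine continuous_of_chart (E := E) fun p y hy => ?_
  have h1 : ContinuousAt (fun y => volDensity g' p y / volDensity g p y) y :=
    ((hg'.contDiffAt_sqrt_det p hy (n := 0)).continuousAt).div
      ((hg.contDiffAt_sqrt_det p hy (n := 0)).continuousAt) (volDensity_pos g p hy).ne'
  refine h1.congr ?_
  filter_upwards [(isOpen_extChartAt_target p).mem_nhds hy] with z hz
  rw [inChart, volRatio_chart g g' p hz]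

theorem volRatio_pos (g g' : RMetric E M) (x : M) : 0 < volRatio g g' x :=
  div_pos (volDensity_pos g' x (mem_extChartAt_target x))
    (volDensity_pos g x (mem_extChartAt_target x))

/-- Writes the volumes of all g(t) as densities over the single volume of g(0), so that a time
derivative falls on the integrand only. -/
theorem IsVolume.withDensity {g g' : RMetric E M} (hg : HasSmoothCoeff g)
    (hg' : HasSmoothCoeff g') {m : Measure M} (hm : IsVolume g m) :
    IsVolume g' (m.withDensity fun x => ENNReal.ofReal (volRatio g g' x)) := by
  intro p
  change _ = chartMeasure g' p
  have hr : Measurable fun x => ENNReal.ofReal (volRatio g g' x) :=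
    (continuous_volRatio hg hg').measurable.ennreal_ofReal
  have hS := (isOpen_extChartAt_source (I := 𝓘(ℝ, E)) p).measurableSet
  have hT := (isOpen_extChartAt_target (I := 𝓘(ℝ, E)) p).measurableSet
  ext B hB
  rw [restrict_withDensity hS, withDensity_apply _ hB, ← lintegral_indicator hB,
    hm.setLIntegral_chart hg p (hr.indicator hB), chartMeasure_apply p hB]
  have hBm := measurableSet_target_inter_preimage (E := E) p hB
  rw [← lintegral_indicator hT, ← lintegral_indicator hBm]
  congr 1
  ext y
  by_cases hy : y ∈ (extChartAt 𝓘(ℝ, E) p).target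
  · rw [indicator_of_mem hy]
    by_cases hyB : (extChartAt 𝓘(ℝ, E) p).symm y ∈ B
    · rw [indicator_of_mem hyB, indicator_of_mem (s := _ ∩ _) ⟨hy, hyB⟩,
        volRatio_chart g g' p hy, ← ENNReal.ofReal_mul (volDensity_pos g p hy).le,
        mul_div_cancel₀ _ (volDensity_pos g p hy).ne']
    · rw [indicator_of_notMem hyB, indicator_of_notMem (fun h => hyB h.2), mul_zero]
  · rw [indicator_of_notMem hy, indicator_of_notMem (fun h => hy h.1)]

end VolumeExistence

/-! ### Nash's and Poincaré's inequalities on euclidean balls, by translations. -/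

section Translation

theorem measurable_indicator_of_continuousOn {X : Type*} [TopologicalSpace X] [MeasurableSpace X]
    [BorelSpace X] {S : Set X} {F : X → ℝ} (hF : ContinuousOn F S) (hS : MeasurableSet S) :
    Measurable (S.indicator F) := by
  classical
  rw [← piecewise_eq_indicator]
  exact hF.measurable_piecewise (g := 0) continuousOn_const hS

variable {E : Type*} [NormedAddCommGroup E] [NormedSpace ℝ E] [FiniteDimensional ℝ E]
  [MeasurableSpace E] [BorelSpace E]

omit [MeasurableSpace E] [BorelSpace E] [FiniteDimensional ℝ E] in
-- The fundamental theorem of calculus along the segment from y to y + h, followed by Jensen's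
-- inequality in the form ∫(G - a)² ≥ 0, where a is the mean of G. The indicator allows integration
-- in y over the whole space afterwards.
theorem ofReal_sq_sub_le {S : Set E} (hS : Convex ℝ S) {F : E → ℝ}
    (hF : ∀ y ∈ S, ContDiffAt ℝ 1 F y) {y h : E} (hy : y ∈ S) (hyh : y + h ∈ S) :
    ENNReal.ofReal ((F (y + h) - F y) ^ 2) ≤ ENNReal.ofReal (‖h‖ ^ 2) *
      ∫⁻ τ in Icc (0 : ℝ) 1, S.indicator (fun z => ENNReal.ofReal (‖fderiv ℝ F z‖ ^ 2))
        (y + τ • h) := by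
  have hmem : ∀ τ ∈ Icc (0 : ℝ) 1, y + τ • h ∈ S := fun τ hτ => by
    have := hS.add_smul_sub_mem hy hyh hτ
    rwa [add_sub_cancel_left] at this
  set G : ℝ → ℝ := fun τ => fderiv ℝ F (y + τ • h) h with hG
  have hline : ∀ τ : ℝ, HasDerivAt (fun τ : ℝ => y + τ • h) h τ := fun τ => by
    simpa using ((hasDerivAt_id τ).smul_const h).const_add y
  have hder : ∀ τ ∈ uIcc (0 : ℝ) 1, HasDerivAt (fun τ => F (y + τ • h)) (G τ) τ := by
    intro τ hτ
    rw [uIcc_of_le zero_le_one] at hτ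
    exact ((hF _ (hmem τ hτ)).differentiableAt one_ne_zero).hasFDerivAt.comp_hasDerivAt τ (hline τ)
  have hDc : ContinuousOn (fun τ : ℝ => fderiv ℝ F (y + τ • h)) (Icc 0 1) := fun τ hτ =>
    ((((hF _ (hmem τ hτ)).fderiv_right (m := 0) (by norm_num)).continuousAt).comp
      (f := fun τ : ℝ => y + τ • h) (hline τ).continuousAt).continuousWithinAt
  have hGc : ContinuousOn G (uIcc 0 1) := by
    rw [uIcc_of_le zero_le_one]
    exact hDc.clm_apply continuousOn_const
  have hGi : IntervalIntegrable G volume 0 1 := hGc.intervalIntegrable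
  have h1 : ∫ τ in (0 : ℝ)..1, G τ = F (y + h) - F y := by
    rw [intervalIntegral.integral_eq_sub_of_hasDerivAt hder hGi]; simp
  set a := F (y + h) - F y with ha
  have hG2 : IntervalIntegrable (fun τ => G τ ^ 2) volume 0 1 := (hGc.pow 2).intervalIntegrable
  have h2 : 0 ≤ ∫ τ in (0 : ℝ)..1, (G τ - a) ^ 2 :=
    intervalIntegral.integral_nonneg zero_le_one fun _ _ => sq_nonneg _
  have h3 : ∫ τ in (0 : ℝ)..1, (G τ - a) ^ 2 = (∫ τ in (0 : ℝ)..1, G τ ^ 2) - a ^ 2 := by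
    have e : ∀ τ, (G τ - a) ^ 2 = G τ ^ 2 - (2 * a * G τ - a ^ 2) := fun τ => by ring
    simp_rw [e]
    rw [intervalIntegral.integral_sub hG2 ((hGi.const_mul _).sub intervalIntegrable_const),
      intervalIntegral.integral_sub (hGi.const_mul _) intervalIntegrable_const,
      intervalIntegral.integral_const_mul, h1, intervalIntegral.integral_const]
    simp; ring
  have h4 : a ^ 2 ≤ ∫ τ in (0 : ℝ)..1, G τ ^ 2 := by linarith
  have h5 : ENNReal.ofReal (∫ τ in (0 : ℝ)..1, G τ ^ 2)
      = ∫⁻ τ in Icc (0 : ℝ) 1, ENNReal.ofReal (G τ ^ 2) := by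
    rw [intervalIntegral.integral_of_le zero_le_one, ← integral_Icc_eq_integral_Ioc,
      ofReal_integral_eq_lintegral_ofReal]
    · have := (hGc.pow 2)
      rw [uIcc_of_le zero_le_one] at this
      exact this.integrableOn_compact isCompact_Icc
    · exact Filter.Eventually.of_forall fun _ => sq_nonneg _
  refine (ENNReal.ofReal_le_ofReal h4).trans ?_
  rw [h5, ← lintegral_const_mul' _ _ ENNReal.ofReal_ne_top]
  refine setLIntegral_mono' measurableSet_Icc fun τ hτ => ?_
  rw [indicator_of_mem (hmem τ hτ), ← ENNReal.ofReal_mul (sq_nonneg _)]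
  refine ENNReal.ofReal_le_ofReal ?_
  have := (fderiv ℝ F (y + τ • h)).le_opNorm h
  calc G τ ^ 2 = ‖G τ‖ ^ 2 := by rw [Real.norm_eq_abs, sq_abs]
    _ ≤ (‖fderiv ℝ F (y + τ • h)‖ * ‖h‖) ^ 2 := pow_le_pow_left₀ (norm_nonneg _) this 2
    _ = _ := by ring

/-- The `L²` modulus of continuity is controlled by the `L²` norm of the differential. -/
theorem lintegral_sq_translate_sub_le {S : Set E} (hSo : IsOpen S) (hS : Convex ℝ S) {F : E → ℝ}
    (hF : ∀ y ∈ S, ContDiffAt ℝ 1 F y) (h : E) (A : Set E) (hA : MeasurableSet A) (hAS : A ⊆ S)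
    (hAh : ∀ y ∈ A, y + h ∈ S) :
    ∫⁻ y in A, ENNReal.ofReal ((F (y + h) - F y) ^ 2) ∂(Measure.addHaar : Measure E) ≤
      ENNReal.ofReal (‖h‖ ^ 2) *
        ∫⁻ y in S, ENNReal.ofReal (‖fderiv ℝ F y‖ ^ 2) ∂(Measure.addHaar : Measure E) := by
  set D : E → ENNReal := S.indicator fun z => ENNReal.ofReal (‖fderiv ℝ F z‖ ^ 2) with hD
  have hDm : Measurable D :=
    (((measurable_fderiv ℝ F).norm.pow_const 2).ennreal_ofReal).indicator hSo.measurableSet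
  have h1 : ∫⁻ y in A, ENNReal.ofReal ((F (y + h) - F y) ^ 2) ∂(Measure.addHaar : Measure E) ≤
      ∫⁻ y, ENNReal.ofReal (‖h‖ ^ 2) * (∫⁻ τ in Icc (0 : ℝ) 1, D (y + τ • h))
        ∂(Measure.addHaar : Measure E) :=
    (setLIntegral_mono' hA fun y hy => ofReal_sq_sub_le hS hF (hAS hy) (hAh y hy)).trans
      (setLIntegral_le_lintegral _ _)
  refine h1.trans ?_
  rw [lintegral_const_mul' _ _ ENNReal.ofReal_ne_top]
  refine mul_le_mul_right ?_ _
  rw [lintegral_lintegral_swap]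
  · have h2 : ∀ τ : ℝ, ∫⁻ y, D (y + τ • h) ∂(Measure.addHaar : Measure E)
        = ∫⁻ y, D y ∂(Measure.addHaar : Measure E) := fun τ =>
      lintegral_add_right_eq_self D (τ • h)
    simp_rw [h2]
    rw [lintegral_const, hD, lintegral_indicator hSo.measurableSet]
    simp
  · exact (hDm.comp (measurable_fst.add (measurable_snd.smul_const h))).aemeasurable

/-- Nash's inequality on balls. -/
theorem lintegral_sq_ball_le {F : E → ℝ} {x : E} {R r : ℝ} (hr : 0 < r) (hrR : r ≤ R)
    (hF : ∀ y ∈ Metric.ball x (2 * R), ContDiffAt ℝ 1 F y) :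
    Measure.addHaar (Metric.ball (0 : E) r) *
      ∫⁻ y in Metric.ball x R, ENNReal.ofReal (F y ^ 2) ∂(Measure.addHaar : Measure E) ≤
    Measure.addHaar (Metric.ball (0 : E) r) * (ENNReal.ofReal (r ^ 2) *
      ∫⁻ y in Metric.ball x (2 * R), ENNReal.ofReal (‖fderiv ℝ F y‖ ^ 2)
        ∂(Measure.addHaar : Measure E)) +
    2 * (∫⁻ y in Metric.ball x (2 * R), ENNReal.ofReal |F y| ∂(Measure.addHaar : Measure E)) ^ 2 := by
  set S := Metric.ball x (2 * R) with hS
  set μ : Measure E := Measure.addHaar with hμ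
  have hsub : ∀ y ∈ Metric.ball x R, ∀ h ∈ Metric.ball (0 : E) r, y + h ∈ S := by
    intro y hy h hh
    rw [mem_ball_iff_norm] at hy
    rw [mem_ball_zero_iff] at hh
    rw [hS, mem_ball_iff_norm]
    calc ‖y + h - x‖ = ‖(y - x) + h‖ := by congr 1; abel
      _ ≤ ‖y - x‖ + ‖h‖ := norm_add_le _ _
      _ < 2 * R := by linarith
  have hR : 0 < R := hr.trans_le hrR
  have hBS : Metric.ball x R ⊆ S := Metric.ball_subset_ball (by linarith)
  set F₀ : E → ℝ := S.indicator F with hF₀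
  have hF₀m : Measurable F₀ := measurable_indicator_of_continuousOn
    (fun y hy => (hF y hy).continuousAt.continuousWithinAt) Metric.isOpen_ball.measurableSet
  have hF₀e : ∀ y ∈ S, F₀ y = F y := fun y hy => indicator_of_mem hy _
  -- From a² ≤ (b - a)² + 2|a||b|. Averaged over |h| < r, the first term becomes the gradient term
  -- and the second the square of the L¹ norm. The extension by zero keeps the translates
  -- measurable.
  have key : ∀ y ∈ Metric.ball x R, ∀ h ∈ Metric.ball (0 : E) r, ENNReal.ofReal (F y ^ 2) ≤
      ENNReal.ofReal ((F₀ (y + h) - F₀ y) ^ 2) +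
        2 * (ENNReal.ofReal |F₀ y| * ENNReal.ofReal |F₀ (y + h)|) := by
    intro y hy h hh
    rw [hF₀e _ (hsub y hy h hh), hF₀e _ (hBS hy), ← ENNReal.ofReal_mul (abs_nonneg _),
      ← ENNReal.ofReal_ofNat, ← ENNReal.ofReal_mul (by norm_num),
      ← ENNReal.ofReal_add (sq_nonneg _) (by positivity)]
    refine ENNReal.ofReal_le_ofReal ?_
    rw [← abs_mul]
    nlinarith [neg_abs_le (F y * F (y + h)), le_abs_self (F y * F (y + h)), sq_nonneg (F (y + h))]
  have m1 : Measurable fun q : E × E => ENNReal.ofReal ((F₀ (q.1 + q.2) - F₀ q.1) ^ 2) :=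
    (((hF₀m.comp (measurable_fst.add measurable_snd)).sub (hF₀m.comp measurable_fst)).pow_const
      2).ennreal_ofReal
  have m2 : Measurable fun y => ENNReal.ofReal |F₀ y| := hF₀m.norm.ennreal_ofReal
  have hL1 : ∫⁻ y in S, ENNReal.ofReal |F₀ y| ∂μ = ∫⁻ y in S, ENNReal.ofReal |F y| ∂μ :=
    setLIntegral_congr_fun Metric.isOpen_ball.measurableSet fun y hy => by
      simp only [hF₀e y hy]
  have hpt : ∀ y ∈ Metric.ball x R, μ (Metric.ball (0 : E) r) * ENNReal.ofReal (F y ^ 2) ≤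
      (∫⁻ h in Metric.ball (0 : E) r, ENNReal.ofReal ((F₀ (y + h) - F₀ y) ^ 2) ∂μ) +
      2 * (ENNReal.ofReal |F₀ y| * ∫⁻ h in Metric.ball (0 : E) r,
        ENNReal.ofReal |F₀ (y + h)| ∂μ) := by
    intro y hy
    have m3 : Measurable fun h => ENNReal.ofReal |F₀ (y + h)| :=
      m2.comp (measurable_const_add y)
    have m4 : Measurable fun h => ENNReal.ofReal ((F₀ (y + h) - F₀ y) ^ 2) :=
      (((hF₀m.comp (measurable_const_add y)).sub_const _).pow_const 2).ennreal_ofReal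
    have h1 : ∫⁻ _ in Metric.ball (0 : E) r, ENNReal.ofReal (F y ^ 2) ∂μ ≤
        ∫⁻ h in Metric.ball (0 : E) r, (ENNReal.ofReal ((F₀ (y + h) - F₀ y) ^ 2) +
          2 * (ENNReal.ofReal |F₀ y| * ENNReal.ofReal |F₀ (y + h)|)) ∂μ :=
      setLIntegral_mono' Metric.isOpen_ball.measurableSet fun h hh => key y hy h hh
    rw [setLIntegral_const, mul_comm] at h1
    refine h1.trans_eq ?_
    rw [lintegral_add_left m4, lintegral_const_mul _ (m3.const_mul _), lintegral_const_mul _ m3]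
  have hsplit : μ (Metric.ball (0 : E) r) * ∫⁻ y in Metric.ball x R, ENNReal.ofReal (F y ^ 2) ∂μ ≤
      (∫⁻ y in Metric.ball x R, ∫⁻ h in Metric.ball (0 : E) r,
        ENNReal.ofReal ((F₀ (y + h) - F₀ y) ^ 2) ∂μ ∂μ) +
      ∫⁻ y in Metric.ball x R, 2 * (ENNReal.ofReal |F₀ y| *
        ∫⁻ h in Metric.ball (0 : E) r, ENNReal.ofReal |F₀ (y + h)| ∂μ) ∂μ := by
    have m5 : Measurable fun y => ∫⁻ h in Metric.ball (0 : E) r,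
        ENNReal.ofReal ((F₀ (y + h) - F₀ y) ^ 2) ∂μ := m1.lintegral_prod_right'
    rw [← lintegral_const_mul' _ _ measure_ball_lt_top.ne, ← lintegral_add_left m5]
    exact setLIntegral_mono' Metric.isOpen_ball.measurableSet fun y hy => hpt y hy
  refine hsplit.trans (add_le_add ?_ ?_)
  · rw [lintegral_lintegral_swap m1.aemeasurable, mul_comm, ← setLIntegral_const]
    refine setLIntegral_mono' Metric.isOpen_ball.measurableSet fun h hh => ?_
    have h1 : ∫⁻ y in Metric.ball x R, ENNReal.ofReal ((F₀ (y + h) - F₀ y) ^ 2) ∂μ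
        = ∫⁻ y in Metric.ball x R, ENNReal.ofReal ((F (y + h) - F y) ^ 2) ∂μ :=
      setLIntegral_congr_fun Metric.isOpen_ball.measurableSet fun y hy => by
        simp only [hF₀e _ (hsub y hy h hh), hF₀e _ (hBS hy)]
    rw [h1]
    refine (lintegral_sq_translate_sub_le Metric.isOpen_ball (convex_ball x (2 * R)) hF h _
      Metric.isOpen_ball.measurableSet hBS fun y hy => hsub y hy h hh).trans ?_
    refine mul_le_mul_left (ENNReal.ofReal_le_ofReal ?_) _
    rw [mem_ball_zero_iff] at hh
    exact pow_le_pow_left₀ (norm_nonneg _) hh.le 2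
  · have hb : ∀ y ∈ Metric.ball x R, ∫⁻ h in Metric.ball (0 : E) r, ENNReal.ofReal |F₀ (y + h)| ∂μ
        ≤ ∫⁻ y in S, ENNReal.ofReal |F y| ∂μ := by
      intro y hy
      calc ∫⁻ h in Metric.ball (0 : E) r, ENNReal.ofReal |F₀ (y + h)| ∂μ
          ≤ ∫⁻ h, ENNReal.ofReal |F₀ (y + h)| ∂μ := setLIntegral_le_lintegral _ _
        _ = ∫⁻ h, ENNReal.ofReal |F₀ h| ∂μ :=
            lintegral_add_left_eq_self (fun h => ENNReal.ofReal |F₀ h|) y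
        _ = ∫⁻ h in S, ENNReal.ofReal |F₀ h| ∂μ := by
            rw [← lintegral_indicator Metric.isOpen_ball.measurableSet]
            congr 1
            ext z
            by_cases hz : z ∈ S
            · rw [indicator_of_mem hz]
            · rw [indicator_of_notMem hz, hF₀, indicator_of_notMem hz]; simp
        _ = _ := hL1
    calc ∫⁻ y in Metric.ball x R, 2 * (ENNReal.ofReal |F₀ y| *
          ∫⁻ h in Metric.ball (0 : E) r, ENNReal.ofReal |F₀ (y + h)| ∂μ) ∂μ
        ≤ ∫⁻ y in Metric.ball x R, 2 * (ENNReal.ofReal |F₀ y| *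
          ∫⁻ y in S, ENNReal.ofReal |F y| ∂μ) ∂μ :=
          setLIntegral_mono' Metric.isOpen_ball.measurableSet fun y hy =>
            mul_le_mul_right (mul_le_mul_right (hb y hy) _) _
      _ = 2 * ((∫⁻ y in Metric.ball x R, ENNReal.ofReal |F₀ y| ∂μ) *
          ∫⁻ y in S, ENNReal.ofReal |F y| ∂μ) := by
          rw [lintegral_const_mul _ (m2.mul_const _), lintegral_mul_const _ m2]
      _ ≤ _ := by
          rw [sq, ← hL1]
          exact mul_le_mul_right (mul_le_mul_left (lintegral_mono_set hBS) _) _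

/-- Poincaré's inequality on balls. -/
theorem lintegral_sq_sub_ball_le {F : E → ℝ} {x : E} {R : ℝ}
    (hF : ∀ y ∈ Metric.ball x R, ContDiffAt ℝ 1 F y) :
    ∫⁻ y in Metric.ball x R, ∫⁻ z in Metric.ball x R, ENNReal.ofReal ((F z - F y) ^ 2)
      ∂(Measure.addHaar : Measure E) ∂(Measure.addHaar : Measure E) ≤
    Measure.addHaar (Metric.ball (0 : E) (2 * R)) * (ENNReal.ofReal ((2 * R) ^ 2) *
      ∫⁻ y in Metric.ball x R, ENNReal.ofReal (‖fderiv ℝ F y‖ ^ 2)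
        ∂(Measure.addHaar : Measure E)) := by
  set S := Metric.ball x R with hS
  set μ : Measure E := Measure.addHaar with hμ
  have hSm : MeasurableSet S := Metric.isOpen_ball.measurableSet
  set F₀ : E → ℝ := S.indicator F with hF₀
  have hF₀m : Measurable F₀ := measurable_indicator_of_continuousOn
    (fun y hy => (hF y hy).continuousAt.continuousWithinAt) Metric.isOpen_ball.measurableSet
  have hF₀e : ∀ y ∈ S, F₀ y = F y := fun y hy => indicator_of_mem hy _
  let Q : E × E → ENNReal := fun q => ENNReal.ofReal ((F₀ q.2 - F₀ q.1) ^ 2)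
  have hQ : Measurable Q :=
    (((hF₀m.comp measurable_snd).sub (hF₀m.comp measurable_fst)).pow_const 2).ennreal_ofReal
  have hQS : Measurable ((S ×ˢ S).indicator Q) := hQ.indicator (hSm.prod hSm)
  -- Substituting z = y + h turns the double integral into an integral over displacements |h| < 2R
  -- of the translation estimate.
  have e1 : ∫⁻ y in S, ∫⁻ z in S, ENNReal.ofReal ((F z - F y) ^ 2) ∂μ ∂μ
      = ∫⁻ y, ∫⁻ h, (S ×ˢ S).indicator Q (y, y + h) ∂μ ∂μ := by
    rw [← lintegral_indicator hSm]
    congr 1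
    ext y
    rw [lintegral_add_left_eq_self (fun z => (S ×ˢ S).indicator Q (y, z)) y]
    by_cases hy : y ∈ S
    · rw [indicator_of_mem hy, ← lintegral_indicator hSm]
      congr 1
      ext z
      by_cases hz : z ∈ S
      · rw [indicator_of_mem hz, indicator_of_mem (s := S ×ˢ S) ⟨hy, hz⟩]
        simp only [Q, hF₀e y hy, hF₀e z hz]
      · rw [indicator_of_notMem hz, indicator_of_notMem fun h => hz h.2]
    · rw [indicator_of_notMem hy]
      symm
      have : ∀ z, (S ×ˢ S).indicator Q (y, z) = 0 := fun z =>
        indicator_of_notMem (fun h => hy h.1) _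
      simp_rw [this, lintegral_zero]
  have hQS' : Measurable (Function.uncurry fun y h : E => (S ×ˢ S).indicator Q (y, y + h)) :=
    hQS.comp (measurable_fst.prodMk (measurable_fst.add measurable_snd))
  rw [e1, lintegral_lintegral_swap hQS'.aemeasurable, mul_comm, ← setLIntegral_const, ← lintegral_indicator Metric.isOpen_ball.measurableSet]
  refine lintegral_mono fun h => ?_
  let A : Set E := S ∩ (fun y => y + h) ⁻¹' S
  have hA : MeasurableSet A := hSm.inter ((measurable_id.add_const h) hSm)
  have e2 : ∫⁻ y, (S ×ˢ S).indicator Q (y, y + h) ∂μ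
      = ∫⁻ y in A, ENNReal.ofReal ((F (y + h) - F y) ^ 2) ∂μ := by
    rw [← lintegral_indicator hA]
    congr 1
    ext y
    by_cases hy : y ∈ A
    · have hm : (y, y + h) ∈ S ×ˢ S := ⟨hy.1, hy.2⟩
      rw [indicator_of_mem hy, indicator_of_mem hm]
      simp only [Q, hF₀e y hy.1, hF₀e _ hm.2]
    · have hm : (y, y + h) ∉ S ×ˢ S := fun hm => hy ⟨hm.1, hm.2⟩
      rw [indicator_of_notMem hy, indicator_of_notMem hm]
  rw [e2]
  by_cases hh : h ∈ Metric.ball (0 : E) (2 * R)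
  · rw [indicator_of_mem hh]
    refine (lintegral_sq_translate_sub_le Metric.isOpen_ball (convex_ball x R) hF h A hA
      inter_subset_left fun y hy => hy.2).trans ?_
    refine mul_le_mul_left (ENNReal.ofReal_le_ofReal ?_) _
    rw [mem_ball_zero_iff] at hh
    exact pow_le_pow_left₀ (norm_nonneg _) hh.le 2
  · have : A = ∅ := by
      refine eq_empty_of_forall_notMem fun y hy => hh ?_
      have h1 := hy.1
      have h2 := hy.2
      rw [mem_preimage] at h2
      rw [hS, mem_ball_iff_norm] at h1 h2
      rw [mem_ball_zero_iff]
      calc ‖h‖ = ‖(y + h - x) - (y - x)‖ := by congr 1; abel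
        _ ≤ ‖y + h - x‖ + ‖y - x‖ := norm_sub_le _ _
        _ < 2 * R := by linarith
    rw [this]; simp

end Translation

/-! ### Nash's inequality on the manifold. -/

section FunctionalInequalities

variable {E : Type*} [NormedAddCommGroup E] [NormedSpace ℝ E] [FiniteDimensional ℝ E]
  [MeasurableSpace E] [BorelSpace E]
variable {M : Type*} [TopologicalSpace M] [ChartedSpace E M] [IsManifold 𝓘(ℝ, E) ∞ M]
  [CompactSpace M] [MeasurableSpace M] [BorelSpace M]

/-- In the chart around `x`, on the ball of radius `2 R`, the metric is comparable with the
euclidean one up to the factor `c`. -/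
structure IsChartBall (g : RMetric E M) (x : M) (R c : ℝ) : Prop where
  pos : 0 < R
  le_one : R ≤ 1
  subset : Metric.ball (extChartAt 𝓘(ℝ, E) x x) (2 * R) ⊆ (extChartAt 𝓘(ℝ, E) x).target
  density_le : ∀ y ∈ Metric.ball (extChartAt 𝓘(ℝ, E) x x) (2 * R), volDensity g x y ≤ c
  one_le : ∀ y ∈ Metric.ball (extChartAt 𝓘(ℝ, E) x x) (2 * R), 1 ≤ c * volDensity g x y
  fderiv_le : ∀ y ∈ Metric.ball (extChartAt 𝓘(ℝ, E) x x) (2 * R), ∀ f : M → ℝ,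
    MDifferentiableAt 𝓘(ℝ, E) 𝓘(ℝ, ℝ) f ((extChartAt 𝓘(ℝ, E) x).symm y) →
      ‖fderiv ℝ (inChart x f) y‖ ^ 2 ≤ c * gradInner g f f ((extChartAt 𝓘(ℝ, E) x).symm y)

/-- On a compact coordinate ball the density, its inverse and the coefficients of the metric are
bounded; c is the largest of the resulting constants. -/
theorem exists_isChartBall {g : RMetric E M} (hg : HasSmoothCoeff g) (x : M) :
    ∃ R c : ℝ, IsChartBall g x R c := by
  set T := (extChartAt 𝓘(ℝ, E) x).target with hT
  have hTo : IsOpen T := isOpen_extChartAt_target x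
  obtain ⟨r, hr, hrT⟩ := Metric.nhds_basis_closedBall.mem_iff.1
    (hTo.mem_nhds (mem_extChartAt_target (I := 𝓘(ℝ, E)) x))
  set K := Metric.closedBall (extChartAt 𝓘(ℝ, E) x x) r with hK
  have hKc : IsCompact K := isCompact_closedBall _ _
  have hvc : ContinuousOn (volDensity g x) K := fun y hy =>
    ((hg.contDiffAt_sqrt_det x (hrT hy) (n := 0)).continuousAt).continuousWithinAt
  have hvic : ContinuousOn (fun y => (volDensity g x y)⁻¹) K :=
    hvc.inv₀ fun y hy => (volDensity_pos g x (hrT hy)).ne'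
  have hsc : ContinuousOn (fun y => ∑ i, ∑ j, |coeff g x i j y|) K := fun y hy =>
    ContinuousAt.continuousWithinAt <| tendsto_finsetSum _ fun i _ => tendsto_finsetSum _ fun j _ =>
      ((hg.contDiffAt x (hrT hy) i j (n := 0)).continuousAt).abs
  obtain ⟨a₁, h₁⟩ := hKc.exists_bound_of_continuousOn hvc
  obtain ⟨a₂, h₂⟩ := hKc.exists_bound_of_continuousOn hvic
  obtain ⟨a₃, h₃⟩ := hKc.exists_bound_of_continuousOn hsc
  let b := Module.finBasis ℝ E
  let L : E →L[ℝ] (Idx E → ℝ) := (b.equivFunL : E →L[ℝ] (Idx E → ℝ))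
  have hL : ∀ v i, |b.repr v i| ≤ ‖L‖ * ‖v‖ := fun v i =>
    (norm_le_pi_norm (L v) i).trans (L.le_opNorm v)
  set a₄ := a₃ * ‖L‖ ^ 2 with ha₄
  have hc₁ : a₁ ≤ max a₁ (max a₂ a₄) := le_max_left _ _
  have hc₂ : a₂ ≤ max a₁ (max a₂ a₄) := (le_max_left _ _).trans (le_max_right _ _)
  have hc₄ : a₄ ≤ max a₁ (max a₂ a₄) := (le_max_right _ _).trans (le_max_right _ _)
  have hsub : Metric.ball (extChartAt 𝓘(ℝ, E) x x) (2 * min 1 (r / 2)) ⊆ K := by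
    refine Metric.ball_subset_closedBall.trans (Metric.closedBall_subset_closedBall ?_)
    have := min_le_right 1 (r / 2); linarith
  refine ⟨min 1 (r / 2), max a₁ (max a₂ a₄), ⟨lt_min one_pos (by linarith), min_le_left _ _,
    hsub.trans hrT, fun y hy => ?_, fun y hy => ?_, fun y hy f hf => ?_⟩⟩
  · exact (le_abs_self _).trans ((h₁ y (hsub hy)).trans hc₁)
  · have hp := volDensity_pos g x (hrT (hsub hy))
    rw [← div_le_iff₀ hp, one_div]
    exact (le_abs_self _).trans ((h₂ y (hsub hy)).trans hc₂)
  · have hyT := hrT (hsub hy)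
    have hΓ := gradInner_nonneg g f ((extChartAt 𝓘(ℝ, E) x).symm y)
    set Γ := gradInner g f f ((extChartAt 𝓘(ℝ, E) x).symm y) with hΓd
    have ha₃ : ∑ i, ∑ j, |coeff g x i j y| ≤ a₃ := (le_abs_self _).trans (h₃ y (hsub hy))
    have ha₄0 : 0 ≤ a₄ := mul_nonneg ((Finset.sum_nonneg fun i _ => Finset.sum_nonneg fun j _ =>
      abs_nonneg _).trans ha₃) (sq_nonneg _)
    have hq : ∀ v : E, (fderiv ℝ (inChart x f) y v) ^ 2 ≤ a₄ * Γ * ‖v‖ ^ 2 := by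
      intro v
      refine (fderiv_sq_le g x hyT hf v).trans ?_
      have h5 : ∑ i, ∑ j, coeff g x i j y * b.repr v i * b.repr v j ≤ a₄ * ‖v‖ ^ 2 := by
        calc ∑ i, ∑ j, coeff g x i j y * b.repr v i * b.repr v j
            ≤ ∑ i, ∑ j, |coeff g x i j y| * ((‖L‖ * ‖v‖) * (‖L‖ * ‖v‖)) := by
              refine Finset.sum_le_sum fun i _ => Finset.sum_le_sum fun j _ => ?_
              refine (le_abs_self _).trans ?_
              rw [abs_mul, abs_mul, mul_assoc]
              exact mul_le_mul_of_nonneg_left (mul_le_mul (hL v i) (hL v j) (abs_nonneg _)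
                (by positivity)) (abs_nonneg _)
          _ = (∑ i, ∑ j, |coeff g x i j y|) * ((‖L‖ * ‖v‖) * (‖L‖ * ‖v‖)) := by
              simp_rw [Finset.sum_mul]
          _ ≤ a₃ * ((‖L‖ * ‖v‖) * (‖L‖ * ‖v‖)) :=
              mul_le_mul_of_nonneg_right ha₃ (by positivity)
          _ = a₄ * ‖v‖ ^ 2 := by rw [ha₄]; ring
      calc Γ * ∑ i, ∑ j, coeff g x i j y * b.repr v i * b.repr v j ≤ Γ * (a₄ * ‖v‖ ^ 2) :=
            mul_le_mul_of_nonneg_left h5 hΓ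
        _ = _ := by ring
    have hnorm : ‖fderiv ℝ (inChart x f) y‖ ≤ √(a₄ * Γ) := by
      refine ContinuousLinearMap.opNorm_le_bound _ (Real.sqrt_nonneg _) fun v => ?_
      rw [Real.norm_eq_abs]
      refine abs_le_of_sq_le_sq ?_ (by positivity)
      rw [mul_pow, Real.sq_sqrt (mul_nonneg ha₄0 hΓ)]
      exact hq v
    calc ‖fderiv ℝ (inChart x f) y‖ ^ 2 ≤ √(a₄ * Γ) ^ 2 :=
          pow_le_pow_left₀ (norm_nonneg _) hnorm 2
      _ = a₄ * Γ := Real.sq_sqrt (mul_nonneg ha₄0 hΓ)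
      _ ≤ _ := mul_le_mul_of_nonneg_right hc₄ hΓ

/-- The points of the domain of the chart around `x` with coordinates in a ball. -/
def chartBall (x : M) (ρ : ℝ) : Set M :=
  (extChartAt 𝓘(ℝ, E) x).source ∩
    extChartAt 𝓘(ℝ, E) x ⁻¹' Metric.ball (extChartAt 𝓘(ℝ, E) x x) ρ

theorem isOpen_chartBall (x : M) (ρ : ℝ) : IsOpen (chartBall (E := E) x ρ) :=
  (continuousOn_extChartAt x).isOpen_inter_preimage (isOpen_extChartAt_source x) Metric.isOpen_ball

theorem chartBall_mem_nhds (x : M) {ρ : ℝ} (hρ : 0 < ρ) : chartBall (E := E) x ρ ∈ nhds x :=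
  (isOpen_chartBall x ρ).mem_nhds ⟨mem_extChartAt_source x, Metric.mem_ball_self hρ⟩

namespace IsChartBall

variable {g : RMetric E M} (hg : HasSmoothCoeff g) {m : Measure M} (hm : IsVolume g m)
  {x : M} {R c : ℝ} (h : IsChartBall g x R c)
include hg hm h

theorem setLIntegral_eq {ρ : ℝ} (hρ : ρ ≤ 2 * R) {G : M → ENNReal} (hG : Measurable G) :
    ∫⁻ z in chartBall (E := E) x ρ, G z ∂m =
      ∫⁻ y in Metric.ball (extChartAt 𝓘(ℝ, E) x x) ρ, ENNReal.ofReal (volDensity g x y) *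
        G ((extChartAt 𝓘(ℝ, E) x).symm y) ∂(Measure.addHaar : Measure E) := by
  have hV := (isOpen_chartBall (E := E) x ρ).measurableSet
  have hT := (isOpen_extChartAt_target (I := 𝓘(ℝ, E)) x).measurableSet
  have hBT : Metric.ball (extChartAt 𝓘(ℝ, E) x x) ρ ⊆ (extChartAt 𝓘(ℝ, E) x).target :=
    (Metric.ball_subset_ball hρ).trans h.subset
  have h1 := hm.setLIntegral_chart hg x (hG.indicator hV)
  rw [lintegral_indicator hV, Measure.restrict_restrict hV,
    inter_eq_left.2 (show chartBall (E := E) x ρ ⊆ _ from inter_subset_left)] at h1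
  rw [h1, ← lintegral_indicator hT, ← lintegral_indicator Metric.isOpen_ball.measurableSet]
  congr 1
  ext y
  by_cases hy : y ∈ (extChartAt 𝓘(ℝ, E) x).target
  · rw [indicator_of_mem hy]
    by_cases hyB : y ∈ Metric.ball (extChartAt 𝓘(ℝ, E) x x) ρ
    · have : (extChartAt 𝓘(ℝ, E) x).symm y ∈ chartBall (E := E) x ρ :=
        ⟨(extChartAt 𝓘(ℝ, E) x).map_target hy, by
          rw [mem_preimage, (extChartAt 𝓘(ℝ, E) x).right_inv hy]; exact hyB⟩
      rw [indicator_of_mem hyB, indicator_of_mem this]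
    · have : (extChartAt 𝓘(ℝ, E) x).symm y ∉ chartBall (E := E) x ρ := fun h1 => hyB (by
        have h2 := h1.2
        rwa [mem_preimage, (extChartAt 𝓘(ℝ, E) x).right_inv hy] at h2)
      rw [indicator_of_notMem hyB, indicator_of_notMem this, mul_zero]
  · rw [indicator_of_notMem hy, indicator_of_notMem fun h1 => hy (hBT h1)]

theorem setLIntegral_le {ρ : ℝ} (hρ : ρ ≤ 2 * R) {G : M → ENNReal} (hG : Measurable G) :
    ∫⁻ z in chartBall (E := E) x ρ, G z ∂m ≤ ENNReal.ofReal c *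
      ∫⁻ y in Metric.ball (extChartAt 𝓘(ℝ, E) x x) ρ, G ((extChartAt 𝓘(ℝ, E) x).symm y)
        ∂(Measure.addHaar : Measure E) := by
  rw [h.setLIntegral_eq hg hm hρ hG, ← lintegral_const_mul' _ _ ENNReal.ofReal_ne_top]
  exact setLIntegral_mono' Metric.isOpen_ball.measurableSet fun y hy =>
    mul_le_mul_left (ENNReal.ofReal_le_ofReal (h.density_le y (Metric.ball_subset_ball hρ hy))) _

theorem le_setLIntegral {ρ : ℝ} (hρ : ρ ≤ 2 * R) {G : M → ENNReal} (hG : Measurable G) :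
    ∫⁻ y in Metric.ball (extChartAt 𝓘(ℝ, E) x x) ρ, G ((extChartAt 𝓘(ℝ, E) x).symm y)
        ∂(Measure.addHaar : Measure E) ≤
      ENNReal.ofReal c * ∫⁻ z in chartBall (E := E) x ρ, G z ∂m := by
  rw [h.setLIntegral_eq hg hm hρ hG, ← lintegral_const_mul' _ _ ENNReal.ofReal_ne_top]
  refine setLIntegral_mono' Metric.isOpen_ball.measurableSet fun y hy => ?_
  have hy2 := Metric.ball_subset_ball hρ hy
  have hp := volDensity_pos g x (h.subset hy2)
  rw [← mul_assoc, ← ENNReal.ofReal_mul' hp.le]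
  calc G ((extChartAt 𝓘(ℝ, E) x).symm y) = 1 * G ((extChartAt 𝓘(ℝ, E) x).symm y) := (one_mul _).symm
    _ ≤ _ := mul_le_mul_left (by
        rw [← ENNReal.ofReal_one]; exact ENNReal.ofReal_le_ofReal (h.one_le y hy2)) _

theorem lintegral_fderiv_le {ρ : ℝ} (hρ : ρ ≤ 2 * R) {f : M → ℝ}
    (hf : ContMDiff 𝓘(ℝ, E) 𝓘(ℝ, ℝ) 1 f) :
    ∫⁻ y in Metric.ball (extChartAt 𝓘(ℝ, E) x x) ρ,
        ENNReal.ofReal (‖fderiv ℝ (inChart x f) y‖ ^ 2) ∂(Measure.addHaar : Measure E) ≤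
      ENNReal.ofReal c ^ 2 * ∫⁻ z, ENNReal.ofReal (gradInner g f f z) ∂m := by
  have hΓ : Measurable fun z => ENNReal.ofReal (gradInner g f f z) :=
    (continuous_gradInner hg hf hf).measurable.ennreal_ofReal
  calc _ ≤ ∫⁻ y in Metric.ball (extChartAt 𝓘(ℝ, E) x x) ρ, ENNReal.ofReal c *
        ENNReal.ofReal (gradInner g f f ((extChartAt 𝓘(ℝ, E) x).symm y))
          ∂(Measure.addHaar : Measure E) := by
        refine setLIntegral_mono' Metric.isOpen_ball.measurableSet fun y hy => ?_
        rw [← ENNReal.ofReal_mul' (gradInner_nonneg _ _ _)]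
        exact ENNReal.ofReal_le_ofReal (h.fderiv_le y (Metric.ball_subset_ball hρ hy) f
          (hf.mdifferentiableAt one_ne_zero))
    _ = ENNReal.ofReal c * ∫⁻ y in Metric.ball (extChartAt 𝓘(ℝ, E) x x) ρ,
        ENNReal.ofReal (gradInner g f f ((extChartAt 𝓘(ℝ, E) x).symm y))
          ∂(Measure.addHaar : Measure E) := lintegral_const_mul' _ _ ENNReal.ofReal_ne_top
    _ ≤ ENNReal.ofReal c * (ENNReal.ofReal c *
        ∫⁻ z in chartBall (E := E) x ρ, ENNReal.ofReal (gradInner g f f z) ∂m) :=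
        mul_le_mul_right (h.le_setLIntegral hg hm hρ hΓ) _
    _ ≤ _ := by
        rw [← mul_assoc, ← sq]
        exact mul_le_mul_right (setLIntegral_le_lintegral _ _) _

end IsChartBall

/-- Nash's inequality. -/
theorem IsVolume.exists_nash {g : RMetric E M} (hg : HasSmoothCoeff g) {m : Measure M}
    (hm : IsVolume g m) : ∃ C : ENNReal, C ≠ ⊤ ∧ ∀ f : M → ℝ, ContMDiff 𝓘(ℝ, E) 𝓘(ℝ, ℝ) 1 f →
      ∀ r : ℝ, 0 < r → r ≤ 1 → ∫⁻ z, ENNReal.ofReal (f z ^ 2) ∂m ≤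
        C * (ENNReal.ofReal (r ^ 2) * (∫⁻ z, ENNReal.ofReal (gradInner g f f z) ∂m) +
          ENNReal.ofReal (r ^ Module.finrank ℝ E)⁻¹ * (∫⁻ z, ENNReal.ofReal |f z| ∂m) ^ 2) := by
  -- Only the left side is localised. The property passes to finite unions by adding constants, so
  -- compactness reduces it to small chart balls.
  let P : Set M → Prop := fun s => ∃ C : ENNReal, C ≠ ⊤ ∧
    ∀ f : M → ℝ, ContMDiff 𝓘(ℝ, E) 𝓘(ℝ, ℝ) 1 f → ∀ r : ℝ, 0 < r → r ≤ 1 →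
      ∫⁻ z in s, ENNReal.ofReal (f z ^ 2) ∂m ≤
        C * (ENNReal.ofReal (r ^ 2) * (∫⁻ z, ENNReal.ofReal (gradInner g f f z) ∂m) +
          ENNReal.ofReal (r ^ Module.finrank ℝ E)⁻¹ * (∫⁻ z, ENNReal.ofReal |f z| ∂m) ^ 2)
  suffices hP : P univ by
    obtain ⟨C, hC, h⟩ := hP
    exact ⟨C, hC, by simpa only [Measure.restrict_univ] using h⟩
  refine isCompact_univ.induction_on (p := P) ?_ ?_ ?_ ?_
  · exact ⟨0, by simp, fun f _ r _ _ => by simp⟩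
  · rintro s t hst ⟨C, hC, h⟩
    exact ⟨C, hC, fun f hf r h0 h1 => (lintegral_mono_set hst).trans (h f hf r h0 h1)⟩
  · rintro s t ⟨C, hC, h⟩ ⟨C', hC', h'⟩
    refine ⟨C + C', ENNReal.add_ne_top.2 ⟨hC, hC'⟩, fun f hf r h0 h1 => ?_⟩
    rw [add_mul]
    exact (lintegral_union_le _ _ _).trans (add_le_add (h f hf r h0 h1) (h' f hf r h0 h1))
  · intro x _
    obtain ⟨R, c, hB⟩ := exists_isChartBall hg x
    refine ⟨chartBall (E := E) x R, mem_nhdsWithin_of_mem_nhds (chartBall_mem_nhds x hB.pos), ?_⟩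
    set n := Module.finrank ℝ E with hn
    set μ : Measure E := Measure.addHaar with hμ
    set v := μ (Metric.ball (0 : E) 1) with hv
    have hv0 : v ≠ 0 := (Metric.measure_ball_pos μ _ one_pos).ne'
    have hvt : v ≠ ⊤ := measure_ball_lt_top.ne
    set γ := ENNReal.ofReal c with hγ
    have hγt : γ ≠ ⊤ := ENNReal.ofReal_ne_top
    set κ := ENNReal.ofReal (R ^ n)⁻¹ with hκ
    have hκt : κ ≠ ⊤ := ENNReal.ofReal_ne_top
    refine ⟨γ ^ 3 + 2 * γ ^ 3 * κ * v⁻¹, ?_, fun f hf r hr0 hr1 => ?_⟩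
    · refine ENNReal.add_ne_top.2 ⟨ENNReal.pow_ne_top hγt, ?_⟩
      exact ENNReal.mul_ne_top (ENNReal.mul_ne_top (ENNReal.mul_ne_top (by simp)
        (ENNReal.pow_ne_top hγt)) hκt) (ENNReal.inv_ne_top.2 hv0)
    -- The euclidean inequality is used at scale rR, which is admissible on the ball of radius R for
    -- every r ≤ 1; this changes the constant by R^{-n} only.
    have hRr : 0 < r * R := mul_pos hr0 hB.pos
    have hRr' : r * R ≤ R := by nlinarith [hB.pos]
    have hR2 : R ≤ 2 * R := by linarith [hB.pos]
    have hf2 : Measurable fun z => ENNReal.ofReal (f z ^ 2) :=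
      (hf.continuous.pow 2).measurable.ennreal_ofReal
    have hf1 : Measurable fun z => ENNReal.ofReal |f z| :=
      hf.continuous.abs.measurable.ennreal_ofReal
    set D := ∫⁻ z, ENNReal.ofReal (gradInner g f f z) ∂m with hD
    set A := ∫⁻ z, ENNReal.ofReal |f z| ∂m with hA
    have h1 := lintegral_sq_ball_le (F := inChart x f) (x := extChartAt 𝓘(ℝ, E) x x) hRr hRr'
      fun y hy => contDiffAt_inChart (n := 1) hf x (hB.subset hy)
    have hball : μ (Metric.ball (0 : E) (r * R)) = ENNReal.ofReal (r ^ n * R ^ n) * v := by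
      rw [Measure.addHaar_ball_of_pos μ _ hRr, mul_pow]
    have hrn : 0 < r ^ n * R ^ n := by have := hB.pos; positivity
    set q := ENNReal.ofReal (r ^ n * R ^ n) with hq
    have hq0 : q ≠ 0 := (ENNReal.ofReal_pos.2 hrn).ne'
    have hqt : q ≠ ⊤ := ENNReal.ofReal_ne_top
    set I := ∫⁻ y in Metric.ball (extChartAt 𝓘(ℝ, E) x x) R, ENNReal.ofReal (inChart x f y ^ 2) ∂μ
      with hI
    have hdb := hB.lintegral_fderiv_le hg hm le_rfl hf
    have hab : ∫⁻ y in Metric.ball (extChartAt 𝓘(ℝ, E) x x) (2 * R),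
        ENNReal.ofReal |inChart x f y| ∂μ ≤ γ * A :=
      (hB.le_setLIntegral hg hm le_rfl hf1).trans
        (mul_le_mul_right (setLIntegral_le_lintegral _ _) _)
    rw [hball] at h1
    have h2 : I ≤ ENNReal.ofReal (r ^ 2) * (γ ^ 2 * D) + 2 * (q⁻¹ * v⁻¹) * (γ * A) ^ 2 := by
      have hqv0 : q * v ≠ 0 := mul_ne_zero hq0 hv0
      have hqvt : q * v ≠ ⊤ := ENNReal.mul_ne_top hqt hvt
      rw [← ENNReal.mul_le_mul_iff_right hqv0 hqvt]
      refine h1.trans ?_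
      rw [mul_add]
      refine add_le_add (mul_le_mul_right ?_ _) ?_
      · refine mul_le_mul ?_ hdb zero_le zero_le
        refine ENNReal.ofReal_le_ofReal (pow_le_pow_left₀ hRr.le ?_ 2)
        nlinarith [hB.le_one]
      · have e : q * v * (2 * (q⁻¹ * v⁻¹) * (γ * A) ^ 2) = 2 * (γ * A) ^ 2 := by
          calc q * v * (2 * (q⁻¹ * v⁻¹) * (γ * A) ^ 2)
              = (q * q⁻¹) * (v * v⁻¹) * (2 * (γ * A) ^ 2) := by ring
            _ = _ := by rw [ENNReal.mul_inv_cancel hq0 hqt, ENNReal.mul_inv_cancel hv0 hvt]; simp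
        rw [e]
        gcongr
    have hqinv : q⁻¹ = ENNReal.ofReal (r ^ n)⁻¹ * κ := by
      rw [hq, hκ, ← ENNReal.ofReal_inv_of_pos hrn, mul_inv, ENNReal.ofReal_mul (by positivity)]
    calc ∫⁻ z in chartBall (E := E) x R, ENNReal.ofReal (f z ^ 2) ∂m ≤ γ * I :=
          hB.setLIntegral_le hg hm hR2 hf2
      _ ≤ γ * (ENNReal.ofReal (r ^ 2) * (γ ^ 2 * D) + 2 * (q⁻¹ * v⁻¹) * (γ * A) ^ 2) :=
          mul_le_mul_right h2 _
      _ = γ ^ 3 * (ENNReal.ofReal (r ^ 2) * D) +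
          2 * γ ^ 3 * κ * v⁻¹ * (ENNReal.ofReal (r ^ n)⁻¹ * A ^ 2) := by rw [hqinv]; ring
      _ ≤ _ := by
          rw [add_mul]
          gcongr
          · exact le_self_add
          · exact le_add_self

end FunctionalInequalities

/-! ### Poincaré's inequality by chaining overlapping balls. -/

section Poincare

variable {E : Type*} [NormedAddCommGroup E] [NormedSpace ℝ E] [FiniteDimensional ℝ E]
  [MeasurableSpace E] [BorelSpace E]
variable {M : Type*} [TopologicalSpace M] [ChartedSpace E M] [IsManifold 𝓘(ℝ, E) ∞ M]
  [CompactSpace M] [MeasurableSpace M] [BorelSpace M]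

/-- The inequality `∫_V ∫_W (f z - f y)² ≤ C ∫ |∇f|²` for all functions `f` of class `C¹`. -/
def OscillationBound (g : RMetric E M) (m : Measure M) (V W : Set M) (C : ENNReal) : Prop :=
  ∀ f : M → ℝ, ContMDiff 𝓘(ℝ, E) 𝓘(ℝ, ℝ) 1 f →
    ∫⁻ y in V, ∫⁻ z in W, ENNReal.ofReal ((f z - f y) ^ 2) ∂m ∂m ≤
      C * ∫⁻ z, ENNReal.ofReal (gradInner g f f z) ∂m

theorem measurable_ofReal_sq_sub {f : M → ℝ} (hf : ContMDiff 𝓘(ℝ, E) 𝓘(ℝ, ℝ) 1 f) :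
    Measurable (Function.uncurry fun y z : M => ENNReal.ofReal ((f z - f y) ^ 2)) :=
  (((hf.continuous.measurable.comp measurable_snd).sub
    (hf.continuous.measurable.comp measurable_fst)).pow_const 2).ennreal_ofReal

theorem measurable_lintegral_sq_sub {f : M → ℝ} (hf : ContMDiff 𝓘(ℝ, E) 𝓘(ℝ, ℝ) 1 f)
    (m : Measure M) [SFinite m] (W : Set M) :
    Measurable fun y => ∫⁻ z in W, ENNReal.ofReal ((f z - f y) ^ 2) ∂m :=
  (measurable_ofReal_sq_sub hf).lintegral_prod_right'

namespace OscillationBound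

variable {g : RMetric E M} {m : Measure M} {V W Z : Set M} {C C' : ENNReal}

theorem mono (h : OscillationBound g m V W C) {V' W' : Set M} (hV : V' ⊆ V) (hW : W' ⊆ W) :
    OscillationBound g m V' W' C := fun f hf =>
  ((lintegral_mono_set hV).trans (lintegral_mono fun _ => lintegral_mono_set hW)).trans (h f hf)

variable [IsFiniteMeasure m]

theorem symm (h : OscillationBound g m V W C) : OscillationBound g m W V C := fun f hf => by
  rw [lintegral_lintegral_swap (measurable_ofReal_sq_sub hf).aemeasurable]
  refine le_of_eq_of_le ?_ (h f hf)
  refine lintegral_congr fun y => lintegral_congr fun z => ?_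
  rw [show (f y - f z) ^ 2 = (f z - f y) ^ 2 by ring]

theorem union_left {V' : Set M} (h : OscillationBound g m V W C)
    (h' : OscillationBound g m V' W C') : OscillationBound g m (V ∪ V') W (C + C') := fun f hf => by
  rw [add_mul]
  exact (lintegral_union_le _ _ _).trans (add_le_add (h f hf) (h' f hf))

theorem union_right {W' : Set M} (h : OscillationBound g m V W C)
    (h' : OscillationBound g m V W' C') : OscillationBound g m V (W ∪ W') (C + C') :=
  (h.symm.union_left h'.symm).symm

/-- Average (f z - f y)² ≤ 2(f v - f y)² + 2(f v - f z)² over v in the overlap, which must have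
positive measure. -/
theorem trans {Y Y' : Set M} (h : OscillationBound g m V Y C) (h' : OscillationBound g m Y' Z C')
    (hY : m (Y ∩ Y') ≠ 0) :
    OscillationBound g m V Z ((m (Y ∩ Y'))⁻¹ * (2 * m Z * C + 2 * m V * C')) := by
  intro f hf
  set D := ∫⁻ z, ENNReal.ofReal (gradInner g f f z) ∂m
  set a := m (Y ∩ Y') with ha
  have hat : a ≠ ⊤ := measure_ne_top _ _
  let p : M → ENNReal := fun y => ∫⁻ v in Y ∩ Y', ENNReal.ofReal ((f v - f y) ^ 2) ∂m
  have hp : Measurable p := measurable_lintegral_sq_sub hf m _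
  have hpt : ∀ y z, a * ENNReal.ofReal ((f z - f y) ^ 2) ≤ 2 * p y + 2 * p z := by
    intro y z
    have hm : ∀ y, Measurable fun v => ENNReal.ofReal ((f v - f y) ^ 2) := fun y =>
      ((hf.continuous.sub continuous_const).pow 2).measurable.ennreal_ofReal
    have h1 : ∫⁻ _ in Y ∩ Y', ENNReal.ofReal ((f z - f y) ^ 2) ∂m ≤
        ∫⁻ v in Y ∩ Y', (2 * ENNReal.ofReal ((f v - f y) ^ 2) +
          2 * ENNReal.ofReal ((f v - f z) ^ 2)) ∂m := by
      refine lintegral_mono fun v => ?_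
      rw [← ENNReal.ofReal_ofNat, ← ENNReal.ofReal_mul (by norm_num),
        ← ENNReal.ofReal_mul (by norm_num), ← ENNReal.ofReal_add (by positivity) (by positivity)]
      refine ENNReal.ofReal_le_ofReal ?_
      nlinarith [sq_nonneg ((f v - f y) + (f v - f z))]
    rw [setLIntegral_const, lintegral_add_left ((hm y).const_mul _),
      lintegral_const_mul _ (hm y), lintegral_const_mul _ (hm z), mul_comm] at h1
    exact h1
  have h1 : ∫⁻ y in V, p y ∂m ≤ C * D := h.mono subset_rfl inter_subset_left f hf
  have h2 : ∫⁻ z in Z, p z ∂m ≤ C' * D := h'.symm.mono subset_rfl inter_subset_right f hf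
  have h3 : a * ∫⁻ y in V, ∫⁻ z in Z, ENNReal.ofReal ((f z - f y) ^ 2) ∂m ∂m ≤
      2 * m Z * (C * D) + 2 * m V * (C' * D) := by
    rw [← lintegral_const_mul' _ _ hat]
    calc ∫⁻ y in V, a * ∫⁻ z in Z, ENNReal.ofReal ((f z - f y) ^ 2) ∂m ∂m
        ≤ ∫⁻ y in V, (2 * m Z * p y + 2 * ∫⁻ z in Z, p z ∂m) ∂m := by
          refine lintegral_mono fun y => ?_
          rw [← lintegral_const_mul' _ _ hat]
          calc ∫⁻ z in Z, a * ENNReal.ofReal ((f z - f y) ^ 2) ∂m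
              ≤ ∫⁻ z in Z, (2 * p y + 2 * p z) ∂m := lintegral_mono fun z => hpt y z
            _ = _ := by
              rw [lintegral_add_left measurable_const, setLIntegral_const,
                lintegral_const_mul _ hp]
              ring
      _ = 2 * m Z * ∫⁻ y in V, p y ∂m + 2 * m V * ∫⁻ z in Z, p z ∂m := by
          rw [lintegral_add_left (hp.const_mul _), setLIntegral_const, lintegral_const_mul _ hp]
          ring
      _ ≤ _ := by gcongr
  rw [mul_assoc, ← ENNReal.div_eq_inv_mul, ENNReal.le_div_iff_mul_le (.inl hY) (.inl hat), mul_comm]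
  refine h3.trans_eq ?_
  ring

end OscillationBound

theorem IsVolume.oscillationBound_chartBall {g : RMetric E M} (hg : HasSmoothCoeff g)
    {m : Measure M} [IsFiniteMeasure m] (hm : IsVolume g m) (x : M) :
    ∃ V ∈ nhds x, ∃ C : ENNReal, C ≠ ⊤ ∧ OscillationBound g m V V C := by
  obtain ⟨R, c, hB⟩ := exists_isChartBall hg x
  have hR2 : R ≤ 2 * R := by linarith [hB.pos]
  set γ := ENNReal.ofReal c with hγ
  set μ : Measure E := Measure.addHaar with hμ
  refine ⟨chartBall (E := E) x R, chartBall_mem_nhds x hB.pos,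
    γ ^ 4 * (μ (Metric.ball (0 : E) (2 * R)) * ENNReal.ofReal ((2 * R) ^ 2)), ?_, fun f hf => ?_⟩
  · exact ENNReal.mul_ne_top (ENNReal.pow_ne_top ENNReal.ofReal_ne_top)
      (ENNReal.mul_ne_top measure_ball_lt_top.ne ENNReal.ofReal_ne_top)
  set D := ∫⁻ z, ENNReal.ofReal (gradInner g f f z) ∂m
  have h1 := lintegral_sq_sub_ball_le (F := inChart x f) (x := extChartAt 𝓘(ℝ, E) x x) (R := R)
    fun y hy => contDiffAt_inChart (n := 1) hf x (hB.subset (Metric.ball_subset_ball hR2 hy))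
  have h2 := hB.lintegral_fderiv_le hg hm hR2 hf
  have h3 : ∀ u, Measurable fun z => ENNReal.ofReal ((f z - u) ^ 2) := fun u =>
    ((hf.continuous.sub continuous_const).pow 2).measurable.ennreal_ofReal
  calc ∫⁻ y in chartBall (E := E) x R, ∫⁻ z in chartBall (E := E) x R,
        ENNReal.ofReal ((f z - f y) ^ 2) ∂m ∂m
      ≤ γ * ∫⁻ y in Metric.ball (extChartAt 𝓘(ℝ, E) x x) R, ∫⁻ z in chartBall (E := E) x R,
        ENNReal.ofReal ((f z - inChart x f y) ^ 2) ∂m ∂μ :=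
        hB.setLIntegral_le hg hm hR2 (measurable_lintegral_sq_sub hf m _)
    _ ≤ γ * ∫⁻ y in Metric.ball (extChartAt 𝓘(ℝ, E) x x) R, γ *
        ∫⁻ z in Metric.ball (extChartAt 𝓘(ℝ, E) x x) R,
          ENNReal.ofReal ((inChart x f z - inChart x f y) ^ 2) ∂μ ∂μ :=
        mul_le_mul_right (lintegral_mono fun y => hB.setLIntegral_le hg hm hR2 (h3 _)) _
    _ = γ ^ 2 * ∫⁻ y in Metric.ball (extChartAt 𝓘(ℝ, E) x x) R,
        ∫⁻ z in Metric.ball (extChartAt 𝓘(ℝ, E) x x) R,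
          ENNReal.ofReal ((inChart x f z - inChart x f y) ^ 2) ∂μ ∂μ := by
        rw [lintegral_const_mul' _ _ ENNReal.ofReal_ne_top]; ring
    _ ≤ γ ^ 2 * (μ (Metric.ball (0 : E) (2 * R)) * (ENNReal.ofReal ((2 * R) ^ 2) * (γ ^ 2 * D))) :=
        mul_le_mul_right (h1.trans (mul_le_mul_right (mul_le_mul_right h2 _) _)) _
    _ = _ := by ring

/-- Poincaré's inequality. -/
theorem IsVolume.exists_poincare [ConnectedSpace M] {g : RMetric E M} (hg : HasSmoothCoeff g)
    {m : Measure M} (hm : IsVolume g m) :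
    ∃ C : ENNReal, C ≠ ⊤ ∧ OscillationBound g m univ univ C := by
  have := hm.isFiniteMeasure hg
  have := hm.isOpenPosMeasure hg
  -- This relation is symmetric, transitive, and holds between nearby points, so on a connected
  -- space it holds between any two.
  let P : M → M → Prop := fun x y => ∃ V ∈ nhds x, ∃ W ∈ nhds y, ∃ C : ENNReal, C ≠ ⊤ ∧
    OscillationBound g m V W C
  have : Std.Symm P := ⟨fun x y ⟨V, hV, W, hW, C, hC, h⟩ => ⟨W, hW, V, hV, C, hC, h.symm⟩⟩
  have htrans : IsTrans M P := by
    refine ⟨fun x y z ⟨V, hV, Y, hY, C, hC, h⟩ ⟨Y', hY', Z, hZ, C', hC', h'⟩ => ?_⟩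
    have ha := (Measure.measure_pos_of_mem_nhds m (Filter.inter_mem hY hY')).ne'
    refine ⟨V, hV, Z, hZ, _, ?_, h.trans h' ha⟩
    exact ENNReal.mul_ne_top (ENNReal.inv_ne_top.2 ha) (ENNReal.add_ne_top.2
      ⟨ENNReal.mul_ne_top (ENNReal.mul_ne_top (by simp) (measure_ne_top _ _)) hC,
        ENNReal.mul_ne_top (ENNReal.mul_ne_top (by simp) (measure_ne_top _ _)) hC'⟩)
  have hP : ∀ x y, P x y := by
    refine PreconnectedSpace.induction₂ P (fun x => ?_) htrans
    obtain ⟨V, hV, C, hC, h⟩ := hm.oscillationBound_chartBall hg x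
    filter_upwards [eventually_mem_nhds_iff.2 hV] with y hy
    exact ⟨V, hV, V, hy, C, hC, h⟩
  -- Compactness is used once in each variable, first here for the second set with x fixed.
  have h1 : ∀ x, ∃ V ∈ nhds x, ∃ C : ENNReal, C ≠ ⊤ ∧ OscillationBound g m V univ C := by
    intro x
    refine isCompact_univ.induction_on
      (p := fun s => ∃ V ∈ nhds x, ∃ C : ENNReal, C ≠ ⊤ ∧ OscillationBound g m V s C) ?_ ?_ ?_ ?_
    · exact ⟨univ, Filter.univ_mem, 0, by simp, fun f _ => by simp⟩
    · rintro s t hst ⟨V, hV, C, hC, h⟩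
      exact ⟨V, hV, C, hC, h.mono subset_rfl hst⟩
    · rintro s t ⟨V, hV, C, hC, h⟩ ⟨V', hV', C', hC', h'⟩
      exact ⟨V ∩ V', Filter.inter_mem hV hV', C + C', ENNReal.add_ne_top.2 ⟨hC, hC'⟩,
        (h.mono inter_subset_left subset_rfl).union_right (h'.mono inter_subset_right subset_rfl)⟩
    · intro y _
      obtain ⟨V, hV, W, hW, C, hC, h⟩ := hP x y
      exact ⟨W, mem_nhdsWithin_of_mem_nhds hW, V, hV, C, hC, h⟩
  refine isCompact_univ.induction_on
    (p := fun s => ∃ C : ENNReal, C ≠ ⊤ ∧ OscillationBound g m s univ C) ?_ ?_ ?_ ?_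
  · exact ⟨0, by simp, fun f _ => by simp⟩
  · rintro s t hst ⟨C, hC, h⟩
    exact ⟨C, hC, h.mono hst subset_rfl⟩
  · rintro s t ⟨C, hC, h⟩ ⟨C', hC', h'⟩
    exact ⟨C + C', ENNReal.add_ne_top.2 ⟨hC, hC'⟩, h.union_left h'⟩
  · intro x _
    obtain ⟨V, hV, C, hC, h⟩ := h1 x
    exact ⟨V, mem_nhdsWithin_of_mem_nhds hV, C, hC, h⟩

end Poincare

/-! ### Real-valued forms of the inequalities and image measures on the line. -/

section RealForms

theorem lintegral_ofReal_of_continuous {X : Type*} [TopologicalSpace X] [CompactSpace X]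
    [MeasurableSpace X] [BorelSpace X] (m : Measure X) [IsFiniteMeasure m] {f : X → ℝ}
    (hf : Continuous f) (h0 : ∀ x, 0 ≤ f x) :
    ∫⁻ x, ENNReal.ofReal (f x) ∂m = ENNReal.ofReal (∫ x, f x ∂m) :=
  (ofReal_integral_eq_lintegral_ofReal (hf.integrable_of_hasCompactSupport (.of_compactSpace _))
    (Filter.Eventually.of_forall h0)).symm

variable {E : Type*} [NormedAddCommGroup E] [NormedSpace ℝ E] [FiniteDimensional ℝ E]
  [MeasurableSpace E] [BorelSpace E]
variable {M : Type*} [TopologicalSpace M] [ChartedSpace E M] [IsManifold 𝓘(ℝ, E) ∞ M]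
  [CompactSpace M] [MeasurableSpace M] [BorelSpace M]

theorem IsVolume.exists_nash_real {g : RMetric E M} (hg : HasSmoothCoeff g) {m : Measure M}
    (hm : IsVolume g m) : ∃ C : ℝ, 0 ≤ C ∧ ∀ f : M → ℝ, ContMDiff 𝓘(ℝ, E) 𝓘(ℝ, ℝ) 1 f →
      ∀ r : ℝ, 0 < r → r ≤ 1 → ∫ z, f z ^ 2 ∂m ≤
        C * (r ^ 2 * (∫ z, gradInner g f f z ∂m) +
          (r ^ Module.finrank ℝ E)⁻¹ * (∫ z, |f z| ∂m) ^ 2) := by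
  have := hm.isFiniteMeasure hg
  obtain ⟨C, hC, h⟩ := hm.exists_nash hg
  refine ⟨C.toReal, ENNReal.toReal_nonneg, fun f hf r h0 h1 => ?_⟩
  have h2 := h f hf r h0 h1
  have hD : 0 ≤ ∫ z, gradInner g f f z ∂m := integral_nonneg fun z => gradInner_nonneg g f z
  have hA : 0 ≤ ∫ z, |f z| ∂m := integral_nonneg fun z => abs_nonneg _
  have hf2 : Continuous fun z => f z ^ 2 := hf.continuous.pow 2
  rw [lintegral_ofReal_of_continuous m hf2 fun z => sq_nonneg _,
    lintegral_ofReal_of_continuous m (continuous_gradInner hg hf hf) (gradInner_nonneg g f),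
    lintegral_ofReal_of_continuous m hf.continuous.abs fun z => abs_nonneg _,
    ← ENNReal.ofReal_toReal hC, ← ENNReal.ofReal_mul (by positivity), ← ENNReal.ofReal_pow hA,
    ← ENNReal.ofReal_mul (by positivity), ← ENNReal.ofReal_add (by positivity) (by positivity),
    ← ENNReal.ofReal_mul ENNReal.toReal_nonneg] at h2
  exact (ENNReal.ofReal_le_ofReal_iff
    (mul_nonneg ENNReal.toReal_nonneg (by positivity))).1 h2

theorem IsVolume.exists_poincare_real [ConnectedSpace M] {g : RMetric E M}
    (hg : HasSmoothCoeff g) {m : Measure M} (hm : IsVolume g m) :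
    ∃ C : ℝ, 0 ≤ C ∧ ∀ f : M → ℝ, ContMDiff 𝓘(ℝ, E) 𝓘(ℝ, ℝ) 1 f →
      ∫ y, ∫ z, (f z - f y) ^ 2 ∂m ∂m ≤ C * ∫ z, gradInner g f f z ∂m := by
  have := hm.isFiniteMeasure hg
  obtain ⟨C, hC, h⟩ := hm.exists_poincare hg
  refine ⟨C.toReal, ENNReal.toReal_nonneg, fun f hf => ?_⟩
  have h2 := h f hf
  have hD : 0 ≤ ∫ z, gradInner g f f z ∂m := integral_nonneg fun z => gradInner_nonneg g f z
  have hi : ∀ y, ∫⁻ z, ENNReal.ofReal ((f z - f y) ^ 2) ∂m =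
      ENNReal.ofReal (∫ z, (f z - f y) ^ 2 ∂m) := fun y =>
    lintegral_ofReal_of_continuous m ((hf.continuous.sub continuous_const).pow 2)
      fun z => sq_nonneg _
  have he : ∀ y, ∫ z, (f z - f y) ^ 2 ∂m =
      ∫ z, f z ^ 2 ∂m - 2 * f y * ∫ z, f z ∂m + f y ^ 2 * m.real univ := by
    intro y
    have i1 : Integrable (fun z => f z ^ 2) m :=
      (hf.continuous.pow 2).integrable_of_hasCompactSupport (.of_compactSpace _)
    have i2 : Integrable f m :=
      hf.continuous.integrable_of_hasCompactSupport (.of_compactSpace _)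
    have e1 : ∀ z, (f z - f y) ^ 2 = f z ^ 2 - 2 * f y * f z + f y ^ 2 := fun z => by ring
    simp_rw [e1]
    have i3 : Integrable (fun z => f z ^ 2 - 2 * f y * f z) m := i1.sub (i2.const_mul _)
    rw [integral_add i3 (integrable_const _),
      integral_sub i1 (i2.const_mul _), integral_const_mul, integral_const, smul_eq_mul]
    ring
  have hc : Continuous fun y => ∫ z, (f z - f y) ^ 2 ∂m := by
    simp_rw [he]
    exact (continuous_const.sub ((continuous_const.mul hf.continuous).mul continuous_const)).add
      ((hf.continuous.pow 2).mul continuous_const)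
  simp only [Measure.restrict_univ, hi] at h2
  rw [lintegral_ofReal_of_continuous m hc fun y => integral_nonneg fun z => sq_nonneg _,
    lintegral_ofReal_of_continuous m (continuous_gradInner hg hf hf) (gradInner_nonneg g f),
    ← ENNReal.ofReal_toReal hC, ← ENNReal.ofReal_mul ENNReal.toReal_nonneg] at h2
  exact (ENNReal.ofReal_le_ofReal_iff (mul_nonneg ENNReal.toReal_nonneg hD)).1 h2

/-- Integration against the image of a weighted measure under a positive function. -/
theorem integral_map_weight (m : Measure M) [IsFiniteMeasure m] {u θ : M → ℝ} (hu : Continuous u)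
    (hu0 : ∀ x, 0 < u x) (hθ : Continuous θ) (hθ0 : ∀ x, 0 ≤ θ x) {w : ℝ → ℝ}
    (hw : ContinuousOn w (Ioi 0)) :
    ∫ s, w s ∂((m.withDensity fun x => ENNReal.ofReal (θ x)).map u) =
      ∫ x, w (u x) * θ x ∂m := by
  have h1 : Measurable ((Ioi (0 : ℝ)).indicator w) :=
    measurable_indicator_of_continuousOn hw measurableSet_Ioi
  have h2 : ∀ x, (Ioi (0 : ℝ)).indicator w (u x) = w (u x) := fun x => indicator_of_mem (hu0 x) _
  have h3 : w =ᵐ[(m.withDensity fun x => ENNReal.ofReal (θ x)).map u] (Ioi (0 : ℝ)).indicator w := by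
    have : ∀ᵐ s ∂((m.withDensity fun x => ENNReal.ofReal (θ x)).map u), s ∈ Ioi (0 : ℝ) := by
      refine (ae_map_iff hu.measurable.aemeasurable (p := fun s => s ∈ Ioi (0 : ℝ))
        measurableSet_Ioi).2 ?_
      exact Filter.Eventually.of_forall hu0
    filter_upwards [this] with s hs
    rw [indicator_of_mem hs]
  rw [integral_congr_ae h3, integral_map hu.measurable.aemeasurable h1.aestronglyMeasurable,
    integral_withDensity_eq_integral_toReal_smul₀ hθ.measurable.ennreal_ofReal.aemeasurable
      (by simp)]
  congr 1
  ext x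
  rw [h2, ENNReal.toReal_ofReal (hθ0 x), smul_eq_mul, mul_comm]

theorem isFiniteMeasure_map_weight (m : Measure M) [IsFiniteMeasure m] {u θ : M → ℝ}
    (hθ : Continuous θ) :
    IsFiniteMeasure ((m.withDensity fun x => ENNReal.ofReal (θ x)).map u) := by
  have := isFiniteMeasure_withDensity_ofReal
    (hθ.integrable_of_hasCompactSupport (.of_compactSpace _) (μ := m)).hasFiniteIntegral
  infer_instance

/-- Ensures that the supremum and infimum of U are detected by the measure `ν t`. -/
theorem map_weight_ne_zero (m : Measure M) [m.IsOpenPosMeasure] {u θ : M → ℝ} (hu : Continuous u)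
    (hθ : Continuous θ) (hθ0 : ∀ x, 0 < θ x) {O : Set ℝ} (hO : IsOpen O) {x : M} (hx : u x ∈ O) :
    (m.withDensity fun x => ENNReal.ofReal (θ x)).map u O ≠ 0 := by
  rw [Measure.map_apply hu.measurable hO.measurableSet, Ne,
    withDensity_apply_eq_zero hθ.measurable.ennreal_ofReal]
  have : {x | ENNReal.ofReal (θ x) ≠ 0} ∩ u ⁻¹' O = u ⁻¹' O :=
    inter_eq_right.2 fun z _ => (ENNReal.ofReal_pos.2 (hθ0 z)).ne'
  rw [this]
  exact ((hO.preimage hu).measure_pos m ⟨x, hx⟩).ne'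

theorem contMDiff_comp_of_hasDerivAt {u : M → ℝ} (hu : ContMDiff 𝓘(ℝ, E) 𝓘(ℝ, ℝ) 1 u)
    (hu0 : ∀ x, 0 < u x) {w w' : ℝ → ℝ} (hw : ∀ s, 0 < s → HasDerivAt w (w' s) s)
    (hw' : ContinuousOn w' (Ioi 0)) : ContMDiff 𝓘(ℝ, E) 𝓘(ℝ, ℝ) 1 fun x => w (u x) := by
  have h1 : ContDiffOn ℝ 1 w (Ioi 0) := by
    rw [show (1 : WithTop ℕ∞) = 0 + 1 by norm_num,
      contDiffOn_succ_iff_deriv_of_isOpen isOpen_Ioi]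
    refine ⟨fun s hs => (hw s hs).differentiableAt.differentiableWithinAt, by simp, ?_⟩
    rw [contDiffOn_zero]
    exact hw'.congr fun s hs => (hw s hs).deriv
  intro x
  exact ((h1.contDiffAt (Ioi_mem_nhds (hu0 x))).contMDiffAt).comp x (hu x)

/-- The derivative with respect to a parameter is measurable. -/
theorem measurable_of_hasDerivAt {X : Type*} [MeasurableSpace X] {F : ℝ → X → ℝ} {F' : X → ℝ}
    {t : ℝ} (hF : ∀ s, t ≤ s → Measurable (F s)) (h : ∀ x, HasDerivAt (fun s => F s x) (F' x) t) :
    Measurable F' := by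
  let δ : ℕ → ℝ := fun n => 1 / ((n : ℝ) + 1)
  have hδ : Filter.Tendsto (fun n => t + δ n) Filter.atTop (nhdsWithin t {t}ᶜ) := by
    rw [tendsto_nhdsWithin_iff]
    refine ⟨?_, Filter.Eventually.of_forall fun n => ?_⟩
    · simpa only [add_zero] using tendsto_one_div_add_atTop_nhds_zero_nat.const_add t
    · have : 0 < δ n := Nat.one_div_pos_of_nat
      simp [this.ne']
  refine measurable_of_tendsto_metrizable (f := fun n x => slope (fun s => F s x) t (t + δ n))
    (fun n => ?_) (tendsto_pi_nhds.2 fun x => (hasDerivAt_iff_tendsto_slope.1 (h x)).comp hδ)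
  simp only [slope, vsub_eq_sub, smul_eq_mul]
  have : 0 ≤ δ n := Nat.one_div_pos_of_nat.le
  exact ((hF _ (by linarith)).sub (hF t le_rfl)).const_mul _

end RealForms

/-! ### Evolution in time of the volume and of the weight λ⁻¹ dvol. -/

section TimeDerivatives

variable {E : Type*} [NormedAddCommGroup E] [NormedSpace ℝ E] [FiniteDimensional ℝ E]
  [MeasurableSpace E] [BorelSpace E]
variable {M : Type*} [TopologicalSpace M] [ChartedSpace E M] [IsManifold 𝓘(ℝ, E) ∞ M]
  [CompactSpace M] [MeasurableSpace M] [BorelSpace M]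

theorem deriv_nonneg_of_right {h : ℝ → ℝ} {h' t : ℝ} (hd : HasDerivAt h h' t) (h0 : h t = 0)
    (hp : ∀ s, t < s → 0 ≤ h s) : 0 ≤ h' := by
  have h1 := hasDerivWithinAt_iff_tendsto_slope.1 (hd.hasDerivWithinAt (s := Ioi t))
  rw [sdiff_singleton_eq_self self_notMem_Ioi] at h1
  refine ge_of_tendsto h1 ?_
  filter_upwards [self_mem_nhdsWithin] with s hs
  rw [slope_def_field, h0, sub_zero]
  exact div_nonneg (hp s hs) (sub_nonneg.2 (mem_Ioi.1 hs).le)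

/-- Both exponentials touch f at t, so their one-sided derivatives there bound that of f. This
recovers a bound on a derivative from comparisons at later times. -/
theorem abs_deriv_le_of_exp {f : ℝ → ℝ} {f' t k : ℝ} (hd : HasDerivAt f f' t)
    (hu : ∀ s, t < s → f s ≤ Real.exp (k * (s - t)) * f t)
    (hl : ∀ s, t < s → Real.exp (-(k * (s - t))) * f t ≤ f s) : |f'| ≤ k * f t := by
  have he : ∀ c : ℝ, HasDerivAt (fun s => Real.exp (c * (s - t)) * f t) (c * f t) t := fun c => by
    have h1 : HasDerivAt (fun s : ℝ => c * (s - t)) c t := by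
      simpa using ((hasDerivAt_id t).sub_const t).const_mul c
    simpa using h1.exp.mul_const (f t)
  rw [abs_le]
  constructor
  · have h1 := deriv_nonneg_of_right (hd.sub (he (-k))) (by simp) fun s hs => by
      have := hl s hs
      rw [Pi.sub_apply, neg_mul, sub_nonneg]; exact this
    linarith
  · have h1 := deriv_nonneg_of_right ((he k).sub hd) (by simp) fun s hs => by
      have := hu s hs
      rw [Pi.sub_apply, sub_nonneg]; exact this
    linarith

namespace IsSmoothFamily

variable {g : ℝ → RMetric E M} (hg : IsSmoothFamily g) (p : M) {y : E}
  (hy : y ∈ (extChartAt 𝓘(ℝ, E) p).target)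
include hg hy

theorem contDiffAt_time (i j : Idx E) {t : ℝ} (ht : 0 < t) :
    ContDiffAt ℝ ∞ (fun s => gramAt (g s) p y i j) t := by
  have h1 : ContDiffAt ℝ ∞ (fun q : ℝ × E => coeff (g q.1) p i j q.2) (t, y) :=
    (hg p i j).contDiffAt (prod_mem_nhds (Ici_mem_nhds ht)
      ((isOpen_extChartAt_target p).mem_nhds hy))
  exact h1.comp t (f := fun s : ℝ => (s, y)) (contDiffAt_id.prodMk contDiffAt_const)

theorem differentiableAt_volDensity {t : ℝ} (ht : 0 < t) :
    DifferentiableAt ℝ (fun s => volDensity (g s) p y) t :=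
  ((contDiffAt_det fun i j => hg.contDiffAt_time p hy i j ht).differentiableAt (by simp)).sqrt
    (det_gramAt_pos _ p y hy).ne'

theorem differentiableAt_inner (v : TangentSpace 𝓘(ℝ, E) ((extChartAt 𝓘(ℝ, E) p).symm y)) {t : ℝ}
    (ht : 0 < t) :
    DifferentiableAt ℝ (fun s => (g s).inner ((extChartAt 𝓘(ℝ, E) p).symm y) v v) t := by
  set b := coordBasis p y hy
  have e : ∀ s, (g s).inner ((extChartAt 𝓘(ℝ, E) p).symm y) v v =
      ∑ i, b.repr v i * ∑ j, b.repr v j * gramAt (g s) p y i j := by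
    intro s
    have h1 := ((g s).isInnerForm ((extChartAt 𝓘(ℝ, E) p).symm y)).sum_left Finset.univ
      (fun i => b.repr v i) b v
    rw [b.sum_repr] at h1
    refine h1.trans (Finset.sum_congr rfl fun i _ => ?_)
    have h2 := ((g s).isInnerForm ((extChartAt 𝓘(ℝ, E) p).symm y)).sum_right Finset.univ
      (fun i => b.repr v i) b (b i)
    rw [b.sum_repr] at h2
    rw [h2, gramAt_eq (g s) p y hy]
    rfl
  simp_rw [e]
  exact DifferentiableAt.fun_sum fun i _ => (DifferentiableAt.fun_sum fun j _ =>
    ((hg.contDiffAt_time p hy i j ht).differentiableAt (by simp)).const_mul _).const_mul _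

end IsSmoothFamily

variable {g : ℝ → RMetric E M} {C₀ K : ℝ}

/-- Gronwall's inequality for g(v, v), one fixed vector at a time, compares the metrics at the two
times, and monotonicity of Gram determinants does the rest. -/
theorem MetricBounds.det_le (hg : IsSmoothFamily g) (hb : MetricBounds g C₀ K) (p : M) {y : E}
    (hy : y ∈ (extChartAt 𝓘(ℝ, E) p).target) {t s : ℝ} (ht : 0 < t) (hts : t ≤ s) :
    Real.exp (-(C₀ * (s - t))) ^ Module.finrank ℝ E * (gramAt (g t) p y).det ≤
        (gramAt (g s) p y).det ∧
      (gramAt (g s) p y).det ≤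
        Real.exp (C₀ * (s - t)) ^ Module.finrank ℝ E * (gramAt (g t) p y).det := by
  set x := (extChartAt 𝓘(ℝ, E) p).symm y
  have hd : ∀ (v : TangentSpace 𝓘(ℝ, E) x), ∀ r ∈ Icc t s,
      HasDerivAt (fun s => (g s).inner x v v) (deriv (fun s => (g s).inner x v v) r) r :=
    fun v r hr => (hg.differentiableAt_inner p hy v (ht.trans_le hr.1)).hasDerivAt
  have hbd : ∀ (v : TangentSpace 𝓘(ℝ, E) x), ∀ r ∈ Icc t s, _ := fun v r hr =>
    abs_le.1 (hb.time_deriv r (ht.trans_le hr.1) x v)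
  have h1 : ∀ v : TangentSpace 𝓘(ℝ, E) x, (g s).inner x v v ≤
      Real.exp (C₀ * (s - t)) * (g t).inner x v v := fun v =>
    le_exp_mul_of_deriv_le hts (hd v) fun r hr => (hbd v r hr).2
  have h2 : ∀ v : TangentSpace 𝓘(ℝ, E) x, Real.exp (-(C₀ * (s - t))) * (g t).inner x v v ≤
      (g s).inner x v v := fun v => by
    rw [← neg_mul]
    exact exp_mul_le_of_le_deriv hts (hd v) fun r hr => by
      have := (hbd v r hr).1; linarith
  have hcard : Fintype.card (Idx E) = Module.finrank ℝ E := Fintype.card_fin _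
  have ht' := (g t).isInnerForm x
  have hs' := (g s).isInnerForm x
  have d1 := pow_mul_det_gram_le ht' hs' (Real.exp_pos _).le h2 (coordBasis p y hy)
  have d2 := pow_mul_det_gram_le hs' ht' (Real.exp_pos (-(C₀ * (s - t)))).le (fun v => by
    have := mul_le_mul_of_nonneg_left (h1 v) (Real.exp_pos (-(C₀ * (s - t)))).le
    rwa [← mul_assoc, ← Real.exp_add, neg_add_cancel, Real.exp_zero, one_mul] at this)
    (coordBasis p y hy)
  rw [← gramAt_eq, ← gramAt_eq, hcard] at d1 d2
  refine ⟨d1, ?_⟩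
  have := mul_le_mul_of_nonneg_left d2
    (pow_nonneg (Real.exp_pos (C₀ * (s - t))).le (Module.finrank ℝ E))
  rwa [← mul_assoc, ← mul_pow, ← Real.exp_add, add_neg_cancel, Real.exp_zero, one_pow,
    one_mul] at this

/-- The time derivative of the volume density. -/
theorem MetricBounds.volRatio_deriv (hg : IsSmoothFamily g) (hb : MetricBounds g C₀ K) (x : M)
    {t : ℝ} (ht : 0 < t) :
    ∃ J' : ℝ, HasDerivAt (fun s => volRatio (g 0) (g s) x) J' t ∧
      |J'| ≤ Module.finrank ℝ E * C₀ / 2 * volRatio (g 0) (g t) x := by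
  have hy : extChartAt 𝓘(ℝ, E) x x ∈ (extChartAt 𝓘(ℝ, E) x).target := mem_extChartAt_target x
  set y := extChartAt 𝓘(ℝ, E) x x
  set n := Module.finrank ℝ E
  have hd : HasDerivAt (fun s => volRatio (g 0) (g s) x) _ t :=
    (hg.differentiableAt_volDensity x hy ht).hasDerivAt.div_const (volDensity (g 0) x y)
  refine ⟨_, hd, abs_deriv_le_of_exp (f := fun s => volRatio (g 0) (g s) x) hd (fun s hs => ?_) fun s hs => ?_⟩
  · have h1 := (hb.det_le hg x hy ht hs.le).2
    have h2 : volDensity (g s) x y ≤ Real.exp (n * C₀ / 2 * (s - t)) * volDensity (g t) x y := by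
      refine Real.sqrt_le_iff.2 ⟨mul_nonneg (Real.exp_pos _).le (Real.sqrt_nonneg _), ?_⟩
      rw [mul_pow, volDensity, Real.sq_sqrt (det_gramAt_pos _ x y hy).le]
      refine h1.trans_eq ?_
      rw [← Real.exp_nat_mul, ← Real.exp_nat_mul]
      congr 2
      push_cast; ring
    rw [volRatio, volRatio, ← mul_div_assoc]
    exact div_le_div_of_nonneg_right h2 (volDensity_pos _ x hy).le
  · have h1 := (hb.det_le hg x hy ht hs.le).1
    have h2 : Real.exp (-(n * C₀ / 2 * (s - t))) * volDensity (g t) x y ≤ volDensity (g s) x y := by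
      refine Real.le_sqrt_of_sq_le ?_
      rw [mul_pow, volDensity, Real.sq_sqrt (det_gramAt_pos _ x y hy).le]
      refine le_of_eq_of_le ?_ h1
      rw [← Real.exp_nat_mul, ← Real.exp_nat_mul]
      congr 2
      push_cast; ring
    rw [volRatio, volRatio, ← mul_div_assoc]
    exact div_le_div_of_nonneg_right h2 (volDensity_pos _ x hy).le

theorem MetricBounds.volRatio_bounds (hC₀ : 0 < C₀) (hb : MetricBounds g C₀ K) (x : M)
    {t : ℝ} (ht : 0 ≤ t) :
    volRatio (g 0) (g t) x ≤ √(C₀ ^ Module.finrank ℝ E) ∧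
      1 ≤ √(C₀ ^ Module.finrank ℝ E) * volRatio (g 0) (g t) x := by
  have hy : extChartAt 𝓘(ℝ, E) x x ∈ (extChartAt 𝓘(ℝ, E) x).target := mem_extChartAt_target x
  set y := extChartAt 𝓘(ℝ, E) x x
  set z := (extChartAt 𝓘(ℝ, E) x).symm y
  set n := Module.finrank ℝ E
  have hcard : Fintype.card (Idx E) = n := Fintype.card_fin _
  have h0' := (g 0).isInnerForm z
  have ht' := (g t).isInnerForm z
  have hinv : 0 ≤ 1 / C₀ := by positivity
  have d1 := pow_mul_det_gram_le h0' ht' hinv (hb.lower t ht z) (coordBasis x y hy)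
  have d2 := pow_mul_det_gram_le ht' h0' hinv (fun v => by
    rw [div_mul_eq_mul_div, one_mul, div_le_iff₀ hC₀, mul_comm]
    exact hb.upper t ht z v) (coordBasis x y hy)
  rw [← gramAt_eq, ← gramAt_eq, hcard, div_pow, one_pow, div_mul_eq_mul_div, one_mul,
    div_le_iff₀ (by positivity)] at d1 d2
  have hp0 : 0 < volDensity (g 0) x y := volDensity_pos (g 0) x hy
  have hn : 0 ≤ C₀ ^ n := by positivity
  constructor
  · rw [volRatio, div_le_iff₀ hp0, volDensity, volDensity, ← Real.sqrt_mul hn, mul_comm]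
    exact Real.sqrt_le_sqrt d2
  · rw [volRatio, ← mul_div_assoc, le_div_iff₀ hp0, one_mul, volDensity, volDensity,
      ← Real.sqrt_mul hn, mul_comm]
    exact Real.sqrt_le_sqrt d1

section Coefficient

variable {g₀ : RMetric E M} {lam : ℝ → M → ℝ} {Λ : ℝ}

theorem CoefficientBounds.continuous (hl : CoefficientBounds g₀ lam Λ) {t : ℝ} (ht : 0 ≤ t) :
    Continuous (lam t) := by
  have h1 := hl.smooth.continuousOn.comp (t := Ici 0 ×ˢ univ)
    (f := fun x : M => ((t, x) : ℝ × M)) (s := univ)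
    (Continuous.prodMk continuous_const continuous_id).continuousOn fun x _ => ⟨ht, mem_univ _⟩
  exact continuousOn_univ.1 h1

theorem CoefficientBounds.differentiableAt (hl : CoefficientBounds g₀ lam Λ) {t : ℝ} (ht : 0 < t)
    (x : M) : DifferentiableAt ℝ (fun s => lam s x) t := by
  have h1 : ContMDiffAt (𝓘(ℝ, ℝ).prod 𝓘(ℝ, E)) 𝓘(ℝ, ℝ) ∞ (fun q : ℝ × M => lam q.1 q.2) (t, x) :=
    hl.smooth.contMDiffAt (prod_mem_nhds (Ici_mem_nhds ht) Filter.univ_mem)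
  have h2 : ContMDiffAt 𝓘(ℝ, ℝ) (𝓘(ℝ, ℝ).prod 𝓘(ℝ, E)) ∞ (fun s : ℝ => ((s, x) : ℝ × M)) t :=
    contMDiffAt_id.prodMk contMDiffAt_const
  exact ((h1.comp t h2).contDiffAt).differentiableAt (by simp)

end Coefficient

/-- The density of the measure `λ⁻¹ dvol_{g(t)}` with respect to `dvol_{g(0)}`. -/
def weight (g : ℝ → RMetric E M) (lam : ℝ → M → ℝ) (t : ℝ) (x : M) : ℝ :=
  (lam t x)⁻¹ * volRatio (g 0) (g t) x

variable {lam : ℝ → M → ℝ} {Λ : ℝ}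

theorem CoefficientBounds.pos {g₀ : RMetric E M} (hΛ : 0 < Λ) (hl : CoefficientBounds g₀ lam Λ)
    {t : ℝ} (ht : 0 ≤ t) (x : M) : 0 < lam t x :=
  (by positivity : 0 < 1 / Λ).trans_le (hl.lower t ht x)

theorem continuous_weight (hg : IsSmoothFamily g) (hΛ : 0 < Λ)
    (hl : CoefficientBounds (g 0) lam Λ) {t : ℝ} (ht : 0 ≤ t) : Continuous (weight g lam t) :=
  ((hl.continuous ht).inv₀ fun x => (hl.pos hΛ ht x).ne').mul
    (continuous_volRatio (hg.hasSmoothCoeff le_rfl) (hg.hasSmoothCoeff ht))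

theorem weight_pos (hΛ : 0 < Λ) (hl : CoefficientBounds (g 0) lam Λ) {t : ℝ} (ht : 0 ≤ t) (x : M) :
    0 < weight g lam t x :=
  mul_pos (inv_pos.2 (hl.pos hΛ ht x)) (volRatio_pos _ _ x)

theorem weight_bounds (hC₀ : 0 < C₀) (hb : MetricBounds g C₀ K) (hΛ : 0 < Λ)
    (hl : CoefficientBounds (g 0) lam Λ) {t : ℝ} (ht : 0 ≤ t) (x : M) :
    weight g lam t x ≤ Λ * √(C₀ ^ Module.finrank ℝ E) ∧
      1 ≤ Λ * √(C₀ ^ Module.finrank ℝ E) * weight g lam t x := by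
  obtain ⟨h1, h2⟩ := hb.volRatio_bounds hC₀ x ht
  have h3 := hl.pos hΛ ht x
  have h4 : (lam t x)⁻¹ ≤ Λ := inv_le_of_inv_le₀ hΛ (by rw [← one_div]; exact hl.lower t ht x)
  have h5 : 1 ≤ Λ * (lam t x)⁻¹ := by
    rw [← div_eq_mul_inv, one_le_div h3]; exact hl.upper t ht x
  constructor
  · exact mul_le_mul h4 h1 (volRatio_pos _ _ x).le hΛ.le
  · calc (1 : ℝ) = 1 * 1 := (one_mul 1).symm
      _ ≤ (Λ * (lam t x)⁻¹) * (√(C₀ ^ Module.finrank ℝ E) * volRatio (g 0) (g t) x) :=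
        mul_le_mul h5 h2 zero_le_one (zero_le_one.trans h5)
      _ = _ := by rw [weight]; ring

theorem weight_deriv (hg : IsSmoothFamily g) (hb : MetricBounds g C₀ K) (hΛ : 0 < Λ)
    (hl : CoefficientBounds (g 0) lam Λ) {t : ℝ} (ht : 0 < t) (x : M) :
    ∃ θ' : ℝ, HasDerivAt (fun s => weight g lam s x) θ' t ∧
      |θ'| ≤ (Λ ^ 2 + Module.finrank ℝ E * C₀ / 2) * weight g lam t x := by
  obtain ⟨J', hJ, hJb⟩ := hb.volRatio_deriv hg x ht
  have h3 := hl.pos hΛ ht.le x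
  have hd := ((hl.differentiableAt ht x).hasDerivAt.fun_inv h3.ne').fun_mul hJ
  refine ⟨_, hd, ?_⟩
  set l := lam t x
  set J := volRatio (g 0) (g t) x
  set l' := deriv (fun s => lam s x) t
  have h4 : l⁻¹ ≤ Λ := inv_le_of_inv_le₀ hΛ (by rw [← one_div]; exact hl.lower t ht.le x)
  have hl0 : 0 < l⁻¹ := inv_pos.2 h3
  have hJ0 : 0 < J := volRatio_pos _ _ x
  have hl' : |l'| ≤ Λ := hl.time_deriv t ht x
  have h5 : |(-l' / l ^ 2)| ≤ Λ ^ 2 * l⁻¹ := by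
    rw [abs_div, abs_neg, abs_of_pos (by positivity : 0 < l ^ 2), div_eq_mul_inv]
    calc |l'| * (l ^ 2)⁻¹ = |l'| * l⁻¹ * l⁻¹ := by field_simp
      _ ≤ Λ * Λ * l⁻¹ := by gcongr
      _ = _ := by ring
  calc |(-l' / l ^ 2) * J + l⁻¹ * J'| ≤ |(-l' / l ^ 2)| * J + l⁻¹ * |J'| := by
        refine (abs_add_le _ _).trans_eq ?_
        rw [abs_mul, abs_mul, abs_of_pos hJ0, abs_of_pos hl0]
    _ ≤ Λ ^ 2 * l⁻¹ * J + l⁻¹ * (Module.finrank ℝ E * C₀ / 2 * J) := by gcongr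
    _ = _ := by rw [weight]; ring

end TimeDerivatives

/-! ### A positive solution defines an energy flow. -/

section HeatFlow

variable {E : Type*} [NormedAddCommGroup E] [NormedSpace ℝ E] [FiniteDimensional ℝ E]
  [MeasurableSpace E] [BorelSpace E]
variable {M : Type*} [TopologicalSpace M] [ChartedSpace E M] [IsManifold 𝓘(ℝ, E) ∞ M]
  [CompactSpace M] [MeasurableSpace M] [BorelSpace M]

theorem integral_mono_of_continuous {X : Type*} [TopologicalSpace X] [CompactSpace X]
    [MeasurableSpace X] [BorelSpace X] (m : Measure X) [IsFiniteMeasure m] {f h : X → ℝ}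
    (hf : Continuous f) (hh : Continuous h) (hle : ∀ x, f x ≤ h x) :
    ∫ x, f x ∂m ≤ ∫ x, h x ∂m :=
  integral_mono (hf.integrable_of_hasCompactSupport (.of_compactSpace _))
    (hh.integrable_of_hasCompactSupport (.of_compactSpace _)) hle

theorem integral_sq_sub_mul {X : Type*} [TopologicalSpace X] [CompactSpace X]
    [MeasurableSpace X] [BorelSpace X] (m : Measure X) [IsFiniteMeasure m] {f θ : X → ℝ}
    (hf : Continuous f) (hθ : Continuous θ) (a : ℝ) :
    ∫ z, (a - f z) ^ 2 * θ z ∂m =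
      a ^ 2 * (∫ z, θ z ∂m) - 2 * a * (∫ z, f z * θ z ∂m) + ∫ z, f z ^ 2 * θ z ∂m := by
  have hi : ∀ {k : X → ℝ}, Continuous k → Integrable k m := fun hk =>
    hk.integrable_of_hasCompactSupport (.of_compactSpace _)
  rw [← integral_const_mul, ← integral_const_mul, ← integral_sub, ← integral_add]
  · exact integral_congr_ae (Filter.Eventually.of_forall fun z => by dsimp only; ring)
  · exact hi (by fun_prop)
  · exact hi (by fun_prop)
  · exact hi (by fun_prop)
  · exact hi (by fun_prop)

/-- The distribution of `U t` with respect to the measure `λ⁻¹ dvol_{g(t)}`. -/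
def massMeasure (m : Measure M) (g : ℝ → RMetric E M) (lam U : ℝ → M → ℝ) (t : ℝ) : Measure ℝ :=
  (m.withDensity fun x => ENNReal.ofReal (weight g lam t x)).map (U t)

/-- The density of `|∇U|² dvol_{g(t)}` with respect to `dvol_{g(0)}`. -/
def energyDensity (g : ℝ → RMetric E M) (U : ℝ → M → ℝ) (t : ℝ) (x : M) : ℝ :=
  gradInner (g t) (U t) (U t) x * volRatio (g 0) (g t) x

/-- The distribution of `U t` with respect to the measure `|∇U|² dvol_{g(t)}`. -/
def energyMeasure (m : Measure M) (g : ℝ → RMetric E M) (U : ℝ → M → ℝ) (t : ℝ) : Measure ℝ :=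
  (m.withDensity fun x => ENNReal.ofReal (energyDensity g U t x)).map (U t)

variable {g : ℝ → RMetric E M} {lam U : ℝ → M → ℝ} {C₀ K Λ : ℝ}

theorem energyDensity_nonneg (t : ℝ) (x : M) : 0 ≤ energyDensity g U t x :=
  mul_nonneg (gradInner_nonneg _ _ _) (volRatio_pos _ _ _).le

section Solution

variable (hg : IsSmoothFamily g) (hU : IsClassicalSolution g lam U)
include hU

theorem IsClassicalSolution.continuous {t : ℝ} (ht : 0 < t) : Continuous (U t) :=
  (hU.contMDiff_space t ht).continuous

theorem IsClassicalSolution.mem_Icc [Nonempty M] {t : ℝ} (ht : 0 < t) (x : M) :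
    U t x ∈ Icc (⨅ x, U t x) (⨆ x, U t x) :=
  ⟨ciInf_le (isCompact_range (hU.continuous ht)).bddBelow x,
    le_ciSup (isCompact_range (hU.continuous ht)).bddAbove x⟩

include hg

theorem continuous_energyDensity {t : ℝ} (ht : 0 < t) : Continuous (energyDensity g U t) := by
  have h1 : ContMDiff 𝓘(ℝ, E) 𝓘(ℝ, ℝ) 1 (U t) := (hU.contMDiff_space t ht).of_le (by norm_num)
  exact (continuous_gradInner (hg.hasSmoothCoeff ht.le) h1 h1).mul
    (continuous_volRatio (hg.hasSmoothCoeff le_rfl) (hg.hasSmoothCoeff ht.le))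

variable (hpos : ∀ t, 0 < t → ∀ x, 0 < U t x) (m : Measure M) [IsFiniteMeasure m]
include hpos

theorem integral_energyMeasure {t : ℝ} (ht : 0 < t) {w : ℝ → ℝ} (hw : ContinuousOn w (Ioi 0)) :
    ∫ s, w s ∂(energyMeasure m g U t) = ∫ x, w (U t x) * energyDensity g U t x ∂m :=
  integral_map_weight m (hU.continuous ht) (hpos t ht) (continuous_energyDensity hg hU ht)
    (energyDensity_nonneg t) hw

variable (hΛ : 0 < Λ) (hl : CoefficientBounds (g 0) lam Λ)
include hΛ hl

theorem integral_massMeasure {t : ℝ} (ht : 0 < t) {w : ℝ → ℝ} (hw : ContinuousOn w (Ioi 0)) :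
    ∫ s, w s ∂(massMeasure m g lam U t) = ∫ x, w (U t x) * weight g lam t x ∂m :=
  integral_map_weight m (hU.continuous ht) (hpos t ht) (continuous_weight hg hΛ hl ht.le)
    (fun x => (weight_pos hΛ hl ht.le x).le) hw

/-- The time derivative of `∫ ψ(U) λ⁻¹ dvol_{g(t)}`. -/
theorem IsClassicalSolution.evolution [T2Space M] (hC₀ : 0 < C₀) (hb : MetricBounds g C₀ K)
    (hm : IsVolume (g 0) m) {ψ ψ' ψ'' : ℝ → ℝ} (hψ : ∀ u, 0 < u → HasDerivAt ψ (ψ' u) u)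
    (hψ' : ∀ u, 0 < u → HasDerivAt ψ' (ψ'' u) u) (hψ'' : ContinuousOn ψ'' (Ioi 0))
    (hψ0 : ∀ u, 0 < u → 0 ≤ ψ u) {t : ℝ} (ht : 0 < t) :
    ∃ X' : ℝ, HasDerivAt (fun s => ∫ u, ψ u ∂(massMeasure m g lam U s)) X' t ∧
      |X' + ∫ u, ψ'' u ∂(energyMeasure m g U t)| ≤
        (Λ ^ 2 + Module.finrank ℝ E * C₀ / 2) * ∫ u, ψ u ∂(massMeasure m g lam U t) := by
  have hψc : ContinuousOn ψ (Ioi 0) := fun u hu => (hψ u hu).continuousAt.continuousWithinAt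
  have hψc' : ContinuousOn ψ' (Ioi 0) := fun u hu => (hψ' u hu).continuousAt.continuousWithinAt
  set k := Λ ^ 2 + Module.finrank ℝ E * C₀ / 2
  set L := Λ * √(C₀ ^ Module.finrank ℝ E)
  have hk : 0 ≤ k := by positivity
  have hL : 0 ≤ L := by positivity
  have hcomp : ∀ {w : ℝ → ℝ}, ContinuousOn w (Ioi 0) → ∀ {s : ℝ}, 0 < s →
      Continuous fun x => w (U s x) := fun hw s hs =>
    hw.comp_continuous (hU.continuous hs) fun x => hpos s hs x
  choose! θ' hθ' hθb using fun (s : ℝ) (hs : 0 < s) (x : M) => weight_deriv hg hb hΛ hl hs x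
  have hW : ∀ s, 0 < s → Continuous (weight g lam s) := fun s hs => continuous_weight hg hΛ hl hs.le
  let U' : ℝ → M → ℝ := fun s x => deriv (fun s => U s x) s
  let F : ℝ → M → ℝ := fun s x => ψ (U s x) * weight g lam s x
  let F' : ℝ → M → ℝ := fun s x => ψ' (U s x) * U' s x * weight g lam s x + ψ (U s x) * θ' s x
  have hFd : ∀ s, 0 < s → ∀ x, HasDerivAt (fun s => F s x) (F' s x) s := fun s hs x =>
    (((hψ _ (hpos s hs x)).comp s (hU.differentiableAt_time s hs x).hasDerivAt).mul (hθ' s hs x))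
  have hFc : ∀ s, 0 < s → Continuous (F s) := fun s hs => (hcomp hψc hs).mul (hW s hs)
  -- Differentiation under the integral needs a bound uniform in x for times near t; joint
  -- continuity of U and U_t on this compact set provides it.
  have hKc : IsCompact (Icc (t / 2) (2 * t) ×ˢ (univ : Set M)) := isCompact_Icc.prod isCompact_univ
  have hsub : Icc (t / 2) (2 * t) ×ˢ (univ : Set M) ⊆ Ioi 0 ×ˢ univ := fun q hq =>
    ⟨lt_of_lt_of_le (by positivity : (0 : ℝ) < t / 2) hq.1.1, hq.2⟩
  have hUc := hU.continuousOn.mono hsub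
  have hmap : MapsTo (fun q : ℝ × M => U q.1 q.2) (Icc (t / 2) (2 * t) ×ˢ (univ : Set M)) (Ioi 0) :=
    fun q hq => hpos q.1 (hsub hq).1 q.2
  obtain ⟨A, hA⟩ := hKc.exists_bound_of_continuousOn
    ((hψc'.comp hUc hmap).mul (hU.continuousOn_time.mono hsub))
  obtain ⟨A', hA'⟩ := hKc.exists_bound_of_continuousOn (hψc.comp hUc hmap)
  have hbound : ∀ x, ∀ s ∈ Icc (t / 2) (2 * t), ‖F' s x‖ ≤ A * L + A' * (k * L) := by
    intro x s hs
    have hs0 : 0 < s := (by positivity : 0 < t / 2).trans_le hs.1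
    have h1 := hA (s, x) ⟨hs, mem_univ _⟩
    have h2 := hA' (s, x) ⟨hs, mem_univ _⟩
    have h3 := (weight_bounds hC₀ hb hΛ hl hs0.le x).1
    have h4 := (weight_pos hΛ hl hs0.le x).le
    have h5 : |θ' s x| ≤ k * L := (hθb s hs0 x).trans (mul_le_mul_of_nonneg_left h3 hk)
    refine (norm_add_le _ _).trans (add_le_add ?_ ?_)
    · rw [norm_mul]
      exact mul_le_mul h1 (by rwa [Real.norm_of_nonneg h4]) (norm_nonneg _)
        ((norm_nonneg _).trans h1)
    · rw [norm_mul]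
      exact mul_le_mul h2 h5 (norm_nonneg _) ((norm_nonneg _).trans h2)
  -- The derivative of the weight was chosen point by point, so its measurability comes from
  -- difference quotients.
  have hθm : Measurable (θ' t) :=
    measurable_of_hasDerivAt (fun s hs => (hW s (ht.trans_le hs)).measurable) (hθ' t ht)
  have hFm : Measurable (F' t) :=
    measurable_of_hasDerivAt (fun s hs => (hFc s (ht.trans_le hs)).measurable) (hFd t ht)
  have hi : ∀ {f : M → ℝ}, Continuous f → Integrable f m := fun hf =>
    hf.integrable_of_hasCompactSupport (.of_compactSpace _)
  have hder := (hasDerivAt_integral_of_dominated_loc_of_deriv_le (μ := m) (F := F) (F' := F')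
    (x₀ := t) (bound := fun _ => A * L + A' * (k * L)) (s := Ioo (t / 2) (2 * t))
    (Ioo_mem_nhds (by linarith) (by linarith))
    (by filter_upwards [Ioi_mem_nhds ht] with s hs using (hFc s hs).aestronglyMeasurable)
    (hi (hFc t ht)) hFm.aestronglyMeasurable
    (Filter.Eventually.of_forall fun x s hs => hbound x s (Ioo_subset_Icc_self hs))
    (integrable_const _)
    (Filter.Eventually.of_forall fun x s hs =>
      hFd s ((by positivity : 0 < t / 2).trans hs.1) x)).2
  have hXeq : ∀ s, 0 < s → ∫ u, ψ u ∂(massMeasure m g lam U s) = ∫ x, F s x ∂m := fun s hs =>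
    integral_massMeasure hg hU hpos m hΛ hl hs hψc
  refine ⟨_, hder.congr_of_eventuallyEq ?_, ?_⟩
  · filter_upwards [Ioi_mem_nhds ht] with s hs using hXeq s hs
  · have hU1 : ContMDiff 𝓘(ℝ, E) 𝓘(ℝ, ℝ) 1 (U t) := (hU.contMDiff_space t ht).of_le (by norm_num)
    have hg0 := hg.hasSmoothCoeff le_rfl
    have hgt := hg.hasSmoothCoeff ht.le
    have hJc := continuous_volRatio hg0 hgt
    have hJ0 := fun x => (volRatio_pos (g 0) (g t) x).le
    have hmt := IsVolume.withDensity hg0 hgt hm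
    have hfin : IsFiniteMeasure (m.withDensity fun x => ENNReal.ofReal (volRatio (g 0) (g t) x)) :=
      isFiniteMeasure_withDensity_ofReal (hi hJc).hasFiniteIntegral
    have hwd : ∀ f : M → ℝ, ∫ x, f x ∂(m.withDensity fun x =>
        ENNReal.ofReal (volRatio (g 0) (g t) x)) = ∫ x, f x * volRatio (g 0) (g t) x ∂m := by
      intro f
      rw [integral_withDensity_eq_integral_toReal_smul hJc.measurable.ennreal_ofReal
        (Filter.Eventually.of_forall fun _ => ENNReal.ofReal_lt_top)]
      refine integral_congr_ae (Filter.Eventually.of_forall fun x => ?_)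
      dsimp only
      rw [ENNReal.toReal_ofReal (hJ0 x), smul_eq_mul, mul_comm]
    have h1 := hmt.integral_mul_laplacian hgt (contMDiff_comp_of_hasDerivAt hU1 (hpos t ht) hψ' hψ'')
      (hU.contMDiff_space t ht)
    rw [hwd, hwd] at h1
    -- Here λ⁻¹ in the weight cancels λ in the equation, and Green's formula for g(t) applies
    -- without any derivative of λ in space.
    have e1 : ∀ x, ψ' (U t x) * laplacian (g t) (U t) x * volRatio (g 0) (g t) x =
        ψ' (U t x) * U' t x * weight g lam t x := fun x => by
      have := (hl.pos hΛ ht.le x).ne'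
      simp only [U', hU.equation t ht x, weight]
      field_simp
    have e2 : ∀ x, gradInner (g t) (fun x => ψ' (U t x)) (U t) x * volRatio (g 0) (g t) x =
        ψ'' (U t x) * energyDensity g U t x := fun x => by
      rw [gradInner_comp_left (g t) (hU1.mdifferentiableAt one_ne_zero) (hψ' _ (hpos t ht x)),
        energyDensity, mul_assoc]
    simp_rw [e1, e2] at h1
    rw [integral_energyMeasure hg hU hpos m ht hψ'', hXeq t ht]
    have hUt : Continuous (U' t) := by
      have : U' t = fun x => lam t x * laplacian (g t) (U t) x := funext (hU.equation t ht)
      rw [this]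
      exact (hl.continuous ht.le).mul (hmt.continuous_laplacian hgt (hU.contMDiff_space t ht))
    have i1 : Integrable (fun x => ψ' (U t x) * U' t x * weight g lam t x) m :=
      hi (((hcomp hψc' ht).mul hUt).mul (hW t ht))
    have hkb : ∀ x, ‖ψ (U t x) * θ' t x‖ ≤ k * F t x := fun x => by
      rw [norm_mul, Real.norm_of_nonneg (hψ0 _ (hpos t ht x))]
      refine (mul_le_mul_of_nonneg_left (hθb t ht x) (hψ0 _ (hpos t ht x))).trans_eq ?_
      simp only [F]; ring
    have i3 : Integrable (fun x => k * F t x) m := (hi (hFc t ht)).const_mul k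
    have i2 : Integrable (fun x => ψ (U t x) * θ' t x) m :=
      i3.mono' ((hcomp hψc ht).measurable.mul hθm).aestronglyMeasurable
        (Filter.Eventually.of_forall hkb)
    have e3 : ∫ x, F' t x ∂m = ∫ x, ψ' (U t x) * U' t x * weight g lam t x ∂m +
        ∫ x, ψ (U t x) * θ' t x ∂m := integral_add i1 i2
    rw [e3, h1]
    have e4 := norm_integral_le_of_norm_le i3 (Filter.Eventually.of_forall hkb)
    rw [integral_const_mul] at e4
    rwa [neg_add_eq_sub, sub_add_cancel]

end Solution

/-- The distributions of the values of a positive solution form an energy flow. -/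
theorem exists_energyFlow [T2Space M] [ConnectedSpace M] {g₀ : RMetric E M}
    (hg₀ : HasSmoothCoeff g₀) (hC₀ : 0 < C₀) (hΛ : 0 < Λ) :
    ∃ B : ℝ, 1 ≤ B ∧ ∀ (g : ℝ → RMetric E M) (lam U : ℝ → M → ℝ), g 0 = g₀ → IsSmoothFamily g →
      MetricBounds g C₀ K → CoefficientBounds g₀ lam Λ → IsClassicalSolution g lam U →
      (∀ t, 0 < t → ∀ x, 0 < U t x) → ∃ ν e, EnergyFlow (Module.finrank ℝ E) B ν e
        (fun t => ⨅ x, U t x) (fun t => ⨆ x, U t x) := by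
  -- The volume and the two functional inequalities are fixed with g₀, before the family, λ and U
  -- are introduced; hence the uniformity of B.
  obtain ⟨m, hm⟩ := exists_isVolume g₀
  have := hm.isFiniteMeasure hg₀
  have := hm.isOpenPosMeasure hg₀
  obtain ⟨CN, hCN, hN⟩ := hm.exists_nash_real hg₀
  obtain ⟨CP, hCP, hP⟩ := hm.exists_poincare_real hg₀
  set c := √(C₀ ^ Module.finrank ℝ E)
  set L := Λ * c
  set k := Λ ^ 2 + Module.finrank ℝ E * C₀ / 2 with hkd
  set μ := m.real univ
  have hc : 0 < c := by positivity
  have hL : 0 < L := by positivity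
  have hk : 0 ≤ k := by positivity
  have hμ : 0 < μ := by
    refine ENNReal.toReal_pos ?_ (measure_ne_top _ _)
    exact isOpen_univ.measure_ne_zero m univ_nonempty
  have b0 : 0 ≤ L / μ := by positivity
  have b1 : 0 ≤ L * μ := by positivity
  have b2 : 0 ≤ CN * L * C₀ * c := by positivity
  have b3 : 0 ≤ CN * L ^ 3 := by positivity
  have b4 : 0 ≤ L ^ 2 * CP * C₀ * c := by positivity
  -- One summand for each requirement: B ≥ 1, the lower and upper mass bounds, the evolution, the
  -- gradient and L¹ terms of Nash's inequality, and Poincaré's inequality.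
  refine ⟨1 + L / μ + L * μ + k + CN * L * C₀ * c + CN * L ^ 3 + L ^ 2 * CP * C₀ * c, by linarith, ?_⟩
  rintro g lam U rfl hg hb hl hU hpos
  set B := 1 + L / μ + L * μ + k + CN * L * C₀ * c + CN * L ^ 3 + L ^ 2 * CP * C₀ * c with hB
  have hi : ∀ {f : M → ℝ}, Continuous f → Integrable f m := fun hf =>
    hf.integrable_of_hasCompactSupport (.of_compactSpace _)
  have hW : ∀ {t}, 0 < t → Continuous (weight g lam t) := fun ht => continuous_weight hg hΛ hl ht.le
  have hW0 : ∀ {t}, 0 < t → ∀ x, 0 < weight g lam t x := fun ht x => weight_pos hΛ hl ht.le x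
  have hWb : ∀ {t}, 0 < t → ∀ x, weight g lam t x ≤ L ∧ 1 ≤ L * weight g lam t x :=
    fun ht x => weight_bounds hC₀ hb hΛ hl ht.le x
  have hcomp : ∀ {w w' : ℝ → ℝ}, (∀ u, 0 < u → HasDerivAt w (w' u) u) → ∀ {t : ℝ}, 0 < t →
      Continuous fun x => w (U t x) := fun hw t ht =>
    ContinuousOn.comp_continuous (s := Ioi 0)
      (fun u hu => (hw u hu).continuousAt.continuousWithinAt) (hU.continuous ht)
      fun x => hpos t ht x
  have hmass : ∀ {t}, 0 < t → (massMeasure m g lam U t).real univ = ∫ x, weight g lam t x ∂m := by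
    intro t ht
    have h1 := integral_massMeasure hg hU hpos m hΛ hl ht (w := fun _ => 1) continuousOn_const
    have := isFiniteMeasure_map_weight m (u := U t) (hW ht)
    have : IsFiniteMeasure (massMeasure m g lam U t) := this
    simpa using h1
  -- Transfer of the energy from g(0) to g(t): C₀ compares the dual norms of differentials, c the
  -- volumes.
  have henergy : ∀ {w w' : ℝ → ℝ}, (∀ u, 0 < u → HasDerivAt w (w' u) u) →
      ContinuousOn w' (Ioi 0) → ∀ {t : ℝ}, 0 < t →
      ∫ x, gradInner (g 0) (fun x => w (U t x)) (fun x => w (U t x)) x ∂m ≤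
        C₀ * c * ∫ u, w' u ^ 2 ∂(energyMeasure m g U t) := by
    intro w w' hw hw' t ht
    have hU1 : ContMDiff 𝓘(ℝ, E) 𝓘(ℝ, ℝ) 1 (U t) := (hU.contMDiff_space t ht).of_le (by norm_num)
    have hwU := contMDiff_comp_of_hasDerivAt hU1 (hpos t ht) hw hw'
    rw [integral_energyMeasure hg hU hpos m ht (w := fun u => w' u ^ 2) (hw'.pow 2), ← integral_const_mul]
    refine integral_mono_of_continuous m (continuous_gradInner hg₀ hwU hwU) ?_ fun x => ?_
    · exact continuous_const.mul (((hw'.pow 2).comp_continuous hU1.continuous fun x => hpos t ht x).mul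
        (continuous_energyDensity hg hU ht))
    · have h1 := gradInner_le (g t) (g 0) hC₀ x (hb.upper t ht.le x) fun x => w (U t x)
      have h2 := (hb.volRatio_bounds hC₀ x ht.le).2
      rw [gradInner_comp (g t) (hU1.mdifferentiableAt one_ne_zero) (hw _ (hpos t ht x))] at h1
      have h3 : 0 ≤ C₀ * (w' (U t x) ^ 2 * gradInner (g t) (U t) (U t) x) :=
        mul_nonneg hC₀.le (mul_nonneg (sq_nonneg _) (gradInner_nonneg _ _ _))
      refine h1.trans ((le_mul_of_one_le_right h3 h2).trans_eq ?_)
      simp only [energyDensity]; ring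
  refine ⟨massMeasure m g lam U, energyMeasure m g U, ?_⟩
  refine ⟨by linarith, fun t ht => isFiniteMeasure_map_weight m (hW ht), fun t ht =>
    isFiniteMeasure_map_weight m (continuous_energyDensity hg hU ht), fun t ht => ?_,
    fun t ht => ?_, fun t ht => ?_, fun t ht s hs => ?_, fun t ht s hs => ?_, fun t ht => ?_,
    fun t ht => ?_, fun ψ ψ' ψ'' hψ hψ' hψ'' hψ0 t ht => ?_, fun w w' hw hw' t ht r hr hr1 => ?_,
    fun w w' hw hw' t ht => ?_⟩
  · obtain ⟨x, hx⟩ := (isCompact_range (hU.continuous ht)).sInf_mem (range_nonempty _)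
    rw [← sInf_range, ← hx]
    exact hpos t ht x
  · rw [massMeasure, Measure.map_apply (hU.continuous ht).measurable measurableSet_Icc.compl,
      preimage_compl, preimage_eq_univ_iff.2 (by rintro _ ⟨x, rfl⟩; exact hU.mem_Icc ht x),
      compl_univ, measure_empty]
  · rw [energyMeasure, Measure.map_apply (hU.continuous ht).measurable measurableSet_Icc.compl,
      preimage_compl, preimage_eq_univ_iff.2 (by rintro _ ⟨x, rfl⟩; exact hU.mem_Icc ht x),
      compl_univ, measure_empty]
  · obtain ⟨x, hx⟩ := exists_lt_of_lt_ciSup hs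
    exact map_weight_ne_zero m (hU.continuous ht) (hW ht) (hW0 ht) isOpen_Ioi hx
  · obtain ⟨x, hx⟩ := exists_lt_of_ciInf_lt hs
    exact map_weight_ne_zero m (hU.continuous ht) (hW ht) (hW0 ht) isOpen_Iio hx
  · rw [hmass ht]
    have h1 : μ ≤ L * ∫ x, weight g lam t x ∂m := by
      rw [← integral_const_mul]
      refine le_of_eq_of_le ?_ (integral_mono_of_continuous m continuous_const
        (continuous_const.mul (hW ht)) fun x => (hWb ht x).2)
      simp [μ]
    have h0 : 0 ≤ ∫ x, weight g lam t x ∂m := integral_nonneg fun x => (hW0 ht x).le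
    have h2 : 1 ≤ L / μ * ∫ x, weight g lam t x ∂m := by
      rw [div_mul_eq_mul_div, one_le_div hμ]; exact h1
    exact h2.trans (mul_le_mul_of_nonneg_right (by linarith) h0)
  · rw [hmass ht]
    refine (integral_mono_of_continuous m (hW ht) continuous_const fun x => (hWb ht x).1).trans ?_
    rw [integral_const, smul_eq_mul, mul_comm]
    linarith
  · obtain ⟨X', h1, h2⟩ := hU.evolution hg hpos m hΛ hl hC₀ hb hm hψ hψ' hψ'' hψ0 ht
    refine ⟨X', h1, h2.trans (mul_le_mul_of_nonneg_right (by linarith) ?_)⟩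
    rw [integral_massMeasure hg hU hpos m hΛ hl ht
      fun u hu => (hψ u hu).continuousAt.continuousWithinAt]
    exact integral_nonneg fun x => mul_nonneg (hψ0 _ (hpos t ht x)) (hW0 ht x).le
  · have hwc : ContinuousOn w (Ioi 0) := fun u hu => (hw u hu).continuousAt.continuousWithinAt
    have hf := hcomp hw ht
    have hU1 : ContMDiff 𝓘(ℝ, E) 𝓘(ℝ, ℝ) 1 (U t) := (hU.contMDiff_space t ht).of_le (by norm_num)
    have h1 := hN _ (contMDiff_comp_of_hasDerivAt hU1 (hpos t ht) hw hw') r hr hr1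
    have h2 := henergy hw hw' ht
    rw [integral_massMeasure hg hU hpos m hΛ hl ht (w := fun u => w u ^ 2) (hwc.pow 2),
      integral_massMeasure hg hU hpos m hΛ hl ht (w := fun u => |w u|) hwc.abs]
    have h3 : ∫ x, w (U t x) ^ 2 * weight g lam t x ∂m ≤ L * ∫ x, w (U t x) ^ 2 ∂m := by
      rw [← integral_const_mul]
      refine integral_mono_of_continuous m ((hf.pow 2).mul (hW ht))
        (continuous_const.mul (hf.pow 2)) fun x => ?_
      rw [mul_comm]
      exact mul_le_mul_of_nonneg_right (hWb ht x).1 (sq_nonneg _)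
    have h4 : ∫ x, |w (U t x)| ∂m ≤ L * ∫ x, |w (U t x)| * weight g lam t x ∂m := by
      rw [← integral_const_mul]
      refine integral_mono_of_continuous m hf.abs
        (continuous_const.mul (hf.abs.mul (hW ht))) fun x => ?_
      have := mul_le_mul_of_nonneg_left (hWb ht x).2 (abs_nonneg (w (U t x)))
      linarith
    have h5 : 0 ≤ ∫ x, |w (U t x)| ∂m := integral_nonneg fun x => abs_nonneg _
    have h6 : 0 ≤ ∫ u, w' u ^ 2 ∂(energyMeasure m g U t) := integral_nonneg fun x => sq_nonneg _
    set D := ∫ u, w' u ^ 2 ∂(energyMeasure m g U t)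
    set A := ∫ x, |w (U t x)| * weight g lam t x ∂m
    have hr' : 0 ≤ (r ^ Module.finrank ℝ E)⁻¹ := by positivity
    calc _ ≤ L * (CN * (r ^ 2 * (C₀ * c * D) + (r ^ Module.finrank ℝ E)⁻¹ * (L * A) ^ 2)) := by
          refine h3.trans (mul_le_mul_of_nonneg_left (h1.trans ?_) hL.le)
          gcongr
      _ = (CN * L * C₀ * c) * (r ^ 2 * D) +
          (CN * L ^ 3) * ((r ^ Module.finrank ℝ E)⁻¹ * A ^ 2) := by ring
      _ ≤ B * (r ^ 2 * D) + B * ((r ^ Module.finrank ℝ E)⁻¹ * A ^ 2) := by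
          gcongr <;> linarith
      _ = _ := by ring
  · have hwc : ContinuousOn w (Ioi 0) := fun u hu => (hw u hu).continuousAt.continuousWithinAt
    have hf := hcomp hw ht
    have hU1 : ContMDiff 𝓘(ℝ, E) 𝓘(ℝ, ℝ) 1 (U t) := (hU.contMDiff_space t ht).of_le (by norm_num)
    have h1 := hP _ (contMDiff_comp_of_hasDerivAt hU1 (hpos t ht) hw hw')
    have h2 := henergy hw hw' ht
    have e1 : ∀ u, ∫ v, (w u - w v) ^ 2 ∂(massMeasure m g lam U t) =
        ∫ z, (w u - w (U t z)) ^ 2 * weight g lam t z ∂m := fun u =>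
      integral_massMeasure hg hU hpos m hΛ hl ht (w := fun v => (w u - w v) ^ 2)
        ((continuousOn_const.sub hwc).pow 2)
    have e2 : ∀ u, ∫ v, (w u - w v) ^ 2 ∂(massMeasure m g lam U t) = _ := fun u =>
      (e1 u).trans (integral_sq_sub_mul m hf (hW ht) (w u))
    rw [integral_massMeasure hg hU hpos m hΛ hl ht
      (w := fun u => ∫ v, (w u - w v) ^ 2 ∂(massMeasure m g lam U t))
      (by simp_rw [e2]; fun_prop)]
    have hone : Continuous fun _ : M => (1 : ℝ) := continuous_const
    have e3 := fun a => integral_sq_sub_mul m hf hone a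
    simp only [mul_one] at e3
    have h3 : ∀ y, ∫ z, (w (U t y) - w (U t z)) ^ 2 * weight g lam t z ∂m ≤
        L * ∫ z, (w (U t y) - w (U t z)) ^ 2 ∂m := fun y => by
      rw [← integral_const_mul]
      refine integral_mono_of_continuous m (((continuous_const.sub hf).pow 2).mul (hW ht))
        (continuous_const.mul ((continuous_const.sub hf).pow 2)) fun x => ?_
      rw [mul_comm]
      exact mul_le_mul_of_nonneg_right (hWb ht x).1 (sq_nonneg _)
    have hquad : ∀ a b d : ℝ, Continuous fun y => w (U t y) ^ 2 * a - 2 * w (U t y) * b + d :=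
      fun a b d => (((hf.pow 2).mul continuous_const).sub
        ((continuous_const.mul hf).mul continuous_const)).add continuous_const
    have h4 : ∫ y, (∫ v, (w (U t y) - w v) ^ 2 ∂(massMeasure m g lam U t)) * weight g lam t y ∂m ≤
        L ^ 2 * ∫ y, ∫ z, (w (U t y) - w (U t z)) ^ 2 ∂m ∂m := by
      rw [← integral_const_mul]
      refine integral_mono_of_continuous m ?_ ?_ fun y => ?_
      · simp_rw [e2]
        exact (hquad _ _ _).mul (hW ht)
      · simp_rw [e3]
        exact continuous_const.mul (hquad _ _ _)
      · rw [e1]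
        have h5 : 0 ≤ ∫ z, (w (U t y) - w (U t z)) ^ 2 ∂m := integral_nonneg fun z => sq_nonneg _
        calc _ ≤ L * (∫ z, (w (U t y) - w (U t z)) ^ 2 ∂m) * L :=
              mul_le_mul (h3 y) (hWb ht y).1 (hW0 ht y).le (by positivity)
          _ = _ := by ring
    have h6 : ∫ y, ∫ z, (w (U t y) - w (U t z)) ^ 2 ∂m ∂m =
        ∫ y, ∫ z, (w (U t z) - w (U t y)) ^ 2 ∂m ∂m := by
      simp_rw [sub_sq_comm]
    have h7 : 0 ≤ ∫ u, w' u ^ 2 ∂(energyMeasure m g U t) := integral_nonneg fun x => sq_nonneg _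
    rw [h6] at h4
    calc _ ≤ L ^ 2 * (CP * (C₀ * c * ∫ u, w' u ^ 2 ∂(energyMeasure m g U t))) := by
          refine h4.trans (mul_le_mul_of_nonneg_left (h1.trans ?_) (sq_nonneg _))
          exact mul_le_mul_of_nonneg_left h2 hCP
      _ = (L ^ 2 * CP * C₀ * c) * ∫ u, w' u ^ 2 ∂(energyMeasure m g U t) := by ring
      _ ≤ _ := mul_le_mul_of_nonneg_right (by linarith) h7

end HeatFlow

/-! ### The Riemannian distance and the diameter under comparison of metrics. -/

section Diameter

open Manifold

variable {E : Type*} [NormedAddCommGroup E] [NormedSpace ℝ E] [FiniteDimensional ℝ E]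
variable {M : Type*} [TopologicalSpace M] [ChartedSpace E M] [IsManifold 𝓘(ℝ, E) ∞ M]

/-- The Riemannian distance of `g`. -/
def riemDist (g : RMetric E M) (x y : M) : ENNReal :=
  letI : Bundle.RiemannianBundle (fun x : M => TangentSpace 𝓘(ℝ, E) x) := ⟨g.toRiemannianMetric⟩
  riemannianEDist 𝓘(ℝ, E) x y

theorem diam_eq (g : RMetric E M) : diam g = (⨆ (x : M) (y : M), riemDist g x y).toReal := rfl

theorem riemDist_comm (g : RMetric E M) (x y : M) : riemDist g x y = riemDist g y x :=
  letI : Bundle.RiemannianBundle (fun x : M => TangentSpace 𝓘(ℝ, E) x) := ⟨g.toRiemannianMetric⟩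
  riemannianEDist_comm

theorem riemDist_triangle (g : RMetric E M) (x y z : M) :
    riemDist g x z ≤ riemDist g x y + riemDist g y z :=
  letI : Bundle.RiemannianBundle (fun x : M => TangentSpace 𝓘(ℝ, E) x) := ⟨g.toRiemannianMetric⟩
  have : IsManifold 𝓘(ℝ, E) 1 M := .of_le (n := ∞) (by simp)
  riemannianEDist_triangle

theorem eventually_riemDist_lt (g : RMetric E M) (x : M) {c : ENNReal} (hc : 0 < c) :
    ∀ᶠ y in nhds x, riemDist g x y < c := by
  let : Bundle.RiemannianBundle (fun x : M => TangentSpace 𝓘(ℝ, E) x) := ⟨g.toRiemannianMetric⟩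
  have : IsManifold 𝓘(ℝ, E) 1 M := .of_le (n := ∞) (by simp)
  have : IsContinuousRiemannianBundle E (fun x : M => TangentSpace 𝓘(ℝ, E) x) :=
    ⟨g.inner, g.contMDiff.continuous, fun _ _ _ => rfl⟩
  exact eventually_riemannianEDist_lt 𝓘(ℝ, E) x hc

theorem riemDist_pos [T2Space M] [CompactSpace M] (g : RMetric E M) {x y : M} (hxy : x ≠ y) :
    0 < riemDist g x y := by
  let : Bundle.RiemannianBundle (fun x : M => TangentSpace 𝓘(ℝ, E) x) := ⟨g.toRiemannianMetric⟩
  have : IsManifold 𝓘(ℝ, E) 1 M := .of_le (n := ∞) (by simp)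
  have : IsContinuousRiemannianBundle E (fun x : M => TangentSpace 𝓘(ℝ, E) x) :=
    ⟨g.inner, g.contMDiff.continuous, fun _ _ _ => rfl⟩
  obtain ⟨c, hc, h⟩ := setOfPred_riemannianEDist_lt_subset_nhds' 𝓘(ℝ, E)
    (isOpen_compl_singleton.mem_nhds hxy : {y}ᶜ ∈ nhds x)
  by_contra h0
  have h1 : riemDist g x y = 0 := nonpos_iff_eq_zero.1 (not_lt.1 h0)
  exact h (show riemannianEDist 𝓘(ℝ, E) x y < c from h1.trans_lt hc) rfl

theorem riemDist_lt_top [PreconnectedSpace M] (g : RMetric E M) (x y : M) : riemDist g x y < ⊤ := by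
  refine PreconnectedSpace.induction₂' (fun x y => riemDist g x y < ⊤) (fun x => ?_)
    ⟨fun x y z h1 h2 => (riemDist_triangle g x y z).trans_lt (ENNReal.add_lt_top.2 ⟨h1, h2⟩)⟩ x y
  filter_upwards [eventually_riemDist_lt g x ENNReal.zero_lt_top] with y hy
  exact ⟨hy, by rwa [riemDist_comm]⟩

/-- `diam` is a `toReal`, which would send an infinite supremum to 0; finiteness is therefore needed
for positivity and for comparison of diameters. Finitely many unit balls cover M, and their centres
are at finite distance from a base point. -/
theorem iSup_riemDist_lt_top [CompactSpace M] [ConnectedSpace M] (g : RMetric E M) :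
    ⨆ (x : M) (y : M), riemDist g x y < ⊤ := by
  obtain ⟨p⟩ := (inferInstance : Nonempty M)
  obtain ⟨t, ht⟩ := (isCompact_univ (X := M)).elim_nhds_subcover
    (fun x => {y | riemDist g x y < 1}) fun x _ => eventually_riemDist_lt g x one_pos
  set R := ∑ x ∈ t, riemDist g p x + 1
  have hR : R < ⊤ := ENNReal.add_lt_top.2
    ⟨ENNReal.sum_lt_top.2 fun x _ => riemDist_lt_top g p x, ENNReal.one_lt_top⟩
  have h1 : ∀ y, riemDist g p y ≤ R := fun y => by
    obtain ⟨x, hx, hy⟩ := mem_iUnion₂.1 (ht.2 (mem_univ y))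
    refine (riemDist_triangle g p x y).trans (add_le_add ?_ (le_of_lt hy))
    exact Finset.single_le_sum (f := fun x => riemDist g p x) (fun _ _ => zero_le) hx
  refine lt_of_le_of_lt (iSup₂_le fun x y => (riemDist_triangle g x p y).trans
    (add_le_add (by rw [riemDist_comm]; exact h1 x) (h1 y))) (ENNReal.add_lt_top.2 ⟨hR, hR⟩)

theorem diam_pos [T2Space M] [CompactSpace M] [ConnectedSpace M] [Nontrivial M] (g : RMetric E M) :
    0 < diam g := by
  obtain ⟨x, y, hxy⟩ := exists_pair_ne M
  refine ENNReal.toReal_pos (ne_of_gt ?_) (iSup_riemDist_lt_top g).ne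
  exact (riemDist_pos g hxy).trans_le (le_iSup₂ (f := fun x y => riemDist g x y) x y)

theorem enorm_eq_sqrt (g : RMetric E M) (x : M) (v : TangentSpace 𝓘(ℝ, E) x) :
    letI : Bundle.RiemannianBundle (fun x : M => TangentSpace 𝓘(ℝ, E) x) := ⟨g.toRiemannianMetric⟩
    ‖v‖ₑ = ENNReal.ofReal (√(g.inner x v v)) := by
  let : Bundle.RiemannianBundle (fun x : M => TangentSpace 𝓘(ℝ, E) x) := ⟨g.toRiemannianMetric⟩
  rw [← ofReal_norm, norm_eq_sqrt_real_inner]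
  rfl

/-- The speed of a curve. -/
def speed (g : RMetric E M) (γ : ℝ → M) (t : ℝ) : ENNReal :=
  ENNReal.ofReal (√(g.inner (γ t) (mfderiv 𝓘(ℝ, ℝ) 𝓘(ℝ, E) γ t (1 : ℝ))
    (mfderiv 𝓘(ℝ, ℝ) 𝓘(ℝ, E) γ t (1 : ℝ))))

theorem riemDist_le_lintegral_speed (g : RMetric E M) {γ : ℝ → M} {x y : M}
    (hγ : ContMDiffOn 𝓘(ℝ, ℝ) 𝓘(ℝ, E) 1 γ (Icc 0 1)) (h0 : γ 0 = x) (h1 : γ 1 = y) :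
    riemDist g x y ≤ ∫⁻ t in Icc 0 1, speed g γ t := by
  let : Bundle.RiemannianBundle (fun x : M => TangentSpace 𝓘(ℝ, E) x) := ⟨g.toRiemannianMetric⟩
  refine (riemannianEDist_le_pathELength hγ h0 h1 zero_le_one).trans_eq ?_
  rw [pathELength]
  exact lintegral_congr fun t => enorm_eq_sqrt g _ _

theorem exists_lintegral_speed_lt (g : RMetric E M) {x y : M} {r : ENNReal}
    (h : riemDist g x y < r) : ∃ γ : ℝ → M, γ 0 = x ∧ γ 1 = y ∧
      ContMDiffOn 𝓘(ℝ, ℝ) 𝓘(ℝ, E) 1 γ (Icc 0 1) ∧ ∫⁻ t in Icc 0 1, speed g γ t < r := by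
  let : Bundle.RiemannianBundle (fun x : M => TangentSpace 𝓘(ℝ, E) x) := ⟨g.toRiemannianMetric⟩
  obtain ⟨γ, h0, h1, hγ, hr⟩ := exists_lt_of_riemannianEDist_lt h
  refine ⟨γ, h0, h1, hγ, lt_of_eq_of_lt ?_ hr⟩
  rw [pathELength]
  exact lintegral_congr fun t => (enorm_eq_sqrt g _ _).symm

/-- The speeds of one and the same curve compare pointwise, hence so do its lengths. -/
theorem riemDist_le_mul (g g' : RMetric E M) {c : ℝ} (hc : 0 < c)
    (h : ∀ (x : M) (v : TangentSpace 𝓘(ℝ, E) x), g.inner x v v ≤ c ^ 2 * g'.inner x v v) (x y : M) :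
    riemDist g x y ≤ ENNReal.ofReal c * riemDist g' x y := by
  have hc' : ENNReal.ofReal c ≠ 0 := (ENNReal.ofReal_pos.2 hc).ne'
  rw [← ENNReal.div_le_iff' hc' ENNReal.ofReal_ne_top]
  refine le_of_forall_gt fun r hr => ?_
  obtain ⟨γ, h0, h1, hγ, hlt⟩ := exists_lintegral_speed_lt g' hr
  refine lt_of_le_of_lt ?_ hlt
  rw [ENNReal.div_le_iff' hc' ENNReal.ofReal_ne_top,
    ← lintegral_const_mul' _ _ ENNReal.ofReal_ne_top]
  refine (riemDist_le_lintegral_speed g hγ h0 h1).trans (lintegral_mono fun t => ?_)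
  rw [speed, speed, ← ENNReal.ofReal_mul hc.le]
  refine ENNReal.ofReal_le_ofReal (Real.sqrt_le_iff.2 ⟨by positivity, ?_⟩)
  rw [mul_pow, Real.sq_sqrt ((g'.isInnerForm _).nonneg _)]
  exact h _ _

theorem diam_le_mul [CompactSpace M] [ConnectedSpace M] (g g' : RMetric E M) {c : ℝ} (hc : 0 < c)
    (h : ∀ (x : M) (v : TangentSpace 𝓘(ℝ, E) x), g.inner x v v ≤ c ^ 2 * g'.inner x v v) :
    diam g ≤ c * diam g' := by
  rw [diam_eq, diam_eq, ← ENNReal.toReal_ofReal hc.le, ← ENNReal.toReal_mul]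
  refine ENNReal.toReal_mono (ENNReal.mul_ne_top ENNReal.ofReal_ne_top (iSup_riemDist_lt_top g').ne)
    (iSup₂_le fun x y => (riemDist_le_mul g g' hc h x y).trans ?_)
  gcongr
  exact le_iSup₂ (f := fun x y => riemDist g' x y) x y

end Diameter

/-! ### From energy flows back to the manifold. -/

section Harnack

variable {E : Type*} [NormedAddCommGroup E] [NormedSpace ℝ E] [FiniteDimensional ℝ E]
variable {M : Type*} [TopologicalSpace M] [ChartedSpace E M] [IsManifold 𝓘(ℝ, E) ∞ M]

theorem pd_inChart_add_const (p : M) (i : Idx E) (u : M → ℝ) (ε : ℝ) :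
    pd i (inChart p fun x => u x + ε) = pd i (inChart (E := E) p u) := by
  funext y
  have : inChart (E := E) p (fun x => u x + ε) = fun y => inChart (E := E) p u y + ε := rfl
  rw [pd, this, fderiv_add_const]
  rfl

theorem laplacian_add_const (g : RMetric E M) (u : M → ℝ) (ε : ℝ) :
    laplacian g (fun x => u x + ε) = laplacian g u := by
  funext p
  simp only [laplacian, pd_inChart_add_const]

theorem IsClassicalSolution.add_const {g : ℝ → RMetric E M} {lam U : ℝ → M → ℝ}
    (hU : IsClassicalSolution g lam U) (ε : ℝ) :
    IsClassicalSolution g lam fun t x => U t x + ε where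
  continuousOn := hU.continuousOn.add continuousOn_const
  differentiableAt_time t ht x := (hU.differentiableAt_time t ht x).add_const ε
  continuousOn_time := by
    simp only [deriv_add_const]
    exact hU.continuousOn_time
  contMDiff_space t ht := (hU.contMDiff_space t ht).add contMDiff_const
  continuousOn_space₁ p i := by
    simp only [pd_inChart_add_const]
    exact hU.continuousOn_space₁ p i
  continuousOn_space₂ p i j := by
    simp only [pd_inChart_add_const]
    exact hU.continuousOn_space₂ p i j
  equation t ht x := by
    rw [deriv_add_const, laplacian_add_const]
    exact hU.equation t ht x

theorem laplacian_eq_zero_of_subsingleton [Subsingleton M] (g : RMetric E M) (u : M → ℝ) (p : M) :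
    laplacian g u p = 0 := by
  have h1 : inChart (E := E) p u = fun _ => u p := by
    funext y
    exact congrArg u (Subsingleton.elim _ _)
  have h2 : ∀ i : Idx E, pd i (inChart (E := E) p u) = fun _ => 0 := fun i => by
    funext y
    simp [h1, pd]
  have h3 : ∀ (i : Idx E) (y : E), pd i (fun _ => (0 : ℝ)) y = 0 := fun i y => by simp [pd]
  simp [laplacian, h2, h3]

/-- The exponents 2/n require n > 0. A manifold modelled on a zero-dimensional space is discrete, so
a connected one is a point. -/
theorem finrank_pos_of_nontrivial [ConnectedSpace M] [Nontrivial M] :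
    0 < Module.finrank ℝ E := by
  rw [Nat.pos_iff_ne_zero]
  intro h0
  have hE : Subsingleton E := Module.finrank_zero_iff.1 h0
  have : DiscreteTopology M := discreteTopology_iff_isOpen_singleton.2 fun x => by
    have h1 : (chartAt E x).source = {x} :=
      eq_singleton_iff_unique_mem.2 ⟨mem_chart_source E x, fun y hy =>
        (chartAt E x).injOn hy (mem_chart_source E x) (Subsingleton.elim _ _)⟩
    rw [← h1]
    exact (chartAt E x).open_source
  exact not_subsingleton M (PreconnectedSpace.trivial_of_discrete)

/-- Harnack's inequality on a manifold with one point. -/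
theorem IsClassicalSolution.eq_of_subsingleton [Subsingleton M] {g : ℝ → RMetric E M}
    {lam U : ℝ → M → ℝ} (hU : IsClassicalSolution g lam U) (x : M) {s t : ℝ} (hs : 0 < s)
    (ht : 0 < t) : U s x = U t x := by
  refine isOpen_Ioi.is_const_of_deriv_eq_zero (𝕜 := ℝ) (f := fun t => U t x) isPreconnected_Ioi
    (fun r hr => (hU.differentiableAt_time r hr x).differentiableWithinAt) (fun r hr => ?_) hs ht
  rw [hU.equation r hr x, laplacian_eq_zero_of_subsingleton, mul_zero]
  rfl

/-- Harnack's inequality, with a constant in place of the diameter. -/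
theorem exists_harnack_manifold [T2Space M] [CompactSpace M] [ConnectedSpace M] [Nontrivial M]
    {g₀ : RMetric E M} (hg₀ : HasSmoothCoeff g₀) {C₀ Λ : ℝ} (K : ℝ) (hC₀ : 0 < C₀) (hΛ : 0 < Λ) :
    ∃ C : ℝ, 0 < C ∧ ∀ (g : ℝ → RMetric E M) (lam U : ℝ → M → ℝ), g 0 = g₀ → IsSmoothFamily g →
      MetricBounds g C₀ K → CoefficientBounds g₀ lam Λ → IsClassicalSolution g lam U →
      (∀ t, 0 < t → ∀ x, 0 ≤ U t x) → ∀ s t : ℝ, 0 < s → s < t →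
        (⨆ x, U s x) ≤ (⨅ x, U t x) * (C * (t / s) ^ C * Real.exp (C / (t - s))) := by
  let : MeasurableSpace E := borel E
  have : BorelSpace E := ⟨rfl⟩
  let : MeasurableSpace M := borel M
  have : BorelSpace M := ⟨rfl⟩
  obtain ⟨B, hB, hflow⟩ := exists_energyFlow (K := K) hg₀ hC₀ hΛ
  obtain ⟨C, hC, hH⟩ := EnergyFlow.exists_harnack _ (finrank_pos_of_nontrivial (E := E) (M := M)) B hB
  refine ⟨C, hC, fun g lam U h0 hg hb hl hU hpos s t hs hst => ?_⟩
  have ht : 0 < t := hs.trans hst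
  set A := C * (t / s) ^ C * Real.exp (C / (t - s))
  have hA : 0 < A := by positivity
  -- An energy flow needs a strictly positive solution. Constants solve the equation, so U + ε is
  -- used with ε = δ/A, which costs exactly δ.
  refine le_of_forall_pos_le_add fun δ hδ => ?_
  set ε := δ / A
  have hε : 0 < ε := div_pos hδ hA
  obtain ⟨ν, e, hνe⟩ := hflow g lam _ h0 hg hb hl (hU.add_const ε) fun t ht x =>
    add_pos_of_nonneg_of_pos (hpos t ht x) hε
  have h1 := hH ν e _ _ hνe s t hs hst
  have hbdd := (isCompact_range ((hU.add_const ε).continuous hs)).bddAbove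
  have hbdd' := (isCompact_range ((hU.add_const ε).continuous ht)).bddBelow
  have h2 : ⨆ x, U s x ≤ ⨆ x, U s x + ε :=
    ciSup_le fun x => (le_add_of_nonneg_right hε.le).trans (le_ciSup hbdd x)
  have h3 : (⨅ x, U t x + ε) - ε ≤ ⨅ x, U t x :=
    le_ciInf fun x => sub_le_iff_le_add.2 (ciInf_le hbdd' x)
  calc ⨆ x, U s x ≤ (⨅ x, U t x + ε) * A := h2.trans h1
    _ ≤ ((⨅ x, U t x) + ε) * A := mul_le_mul_of_nonneg_right (by linarith) hA.le
    _ = (⨅ x, U t x) * A + δ := by rw [add_mul, div_mul_cancel₀ _ hA.ne']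

end Harnack
end LiYau

end

/-! ### Introducing the diameter: the main theorem. -/

theorem theorem5p2 {E : Type*} [NormedAddCommGroup E] [NormedSpace ℝ E] [FiniteDimensional ℝ E]
    {M : Type*} [TopologicalSpace M] [T2Space M] [CompactSpace M] [ConnectedSpace M]
    [ChartedSpace E M] [IsManifold 𝓘(ℝ, E) ∞ M]
    (g₀ : LiYau.RMetric E M) (C₀ K Λ : ℝ) (hC₀ : 0 < C₀) (hK : 0 < K) (hΛ : 0 < Λ) :
    ∃ C : ℝ, 0 < C ∧
      ∀ (g : ℝ → LiYau.RMetric E M) (lam U : ℝ → M → ℝ),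
        g 0 = g₀ →
        LiYau.IsSmoothFamily g →
        LiYau.MetricBounds g C₀ K →
        LiYau.CoefficientBounds g₀ lam Λ →
        LiYau.IsClassicalSolution g lam U →
        (∀ t, 0 < t → ∀ x, 0 ≤ U t x) →
        ∀ t₁ t₂ : ℝ, 0 < t₁ → t₁ < t₂ →
          (⨆ x, U t₁ x) ≤
            (⨅ x, U t₂ x) * (C * (t₂ / t₁) ^ C *
              Real.exp (C * C₀ ^ 2 * LiYau.diam (g t₁) ^ 2 / (t₂ - t₁) + C * (t₂ - t₁))) := by
  -- C is chosen before the family, while smoothness of the coefficients of g₀ is read off from the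
  -- family. If it fails there is no admissible family, and any C will do.
  by_cases hg₀ : LiYau.HasSmoothCoeff g₀
  swap
  · refine ⟨1, one_pos, fun g lam U h0 hg => absurd (hg.hasSmoothCoeff le_rfl) ?_⟩
    rwa [h0]
  -- The absorption below divides by diam(g₀)², which needs at least two points.
  rcases subsingleton_or_nontrivial M with hM | hM
  · refine ⟨1, one_pos, fun g lam U h0 hg hb hl hU hpos t₁ t₂ h1 h12 => ?_⟩
    have h2 : 0 < t₂ := h1.trans h12
    have hd : 0 < t₂ - t₁ := sub_pos.2 h12
    refine ciSup_le fun x => ?_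
    have h3 : U t₁ x ≤ ⨅ x, U t₂ x := le_ciInf fun y => by
      rw [Subsingleton.elim y x]; exact (hU.eq_of_subsingleton x h1 h2).le
    have h4 : 1 ≤ Real.exp (1 * C₀ ^ 2 * LiYau.diam (g t₁) ^ 2 / (t₂ - t₁) + 1 * (t₂ - t₁)) :=
      Real.one_le_exp (by positivity)
    have h5 : 1 ≤ t₂ / t₁ := (one_le_div h1).2 h12.le
    rw [Real.rpow_one, one_mul]
    exact h3.trans (le_mul_of_one_le_right ((hpos t₁ h1 x).trans h3)
      (one_le_mul_of_one_le_of_one_le h5 h4))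
  · obtain ⟨C', hC', hH⟩ := LiYau.exists_harnack_manifold hg₀ K hC₀ hΛ
    have hd₀ := LiYau.diam_pos g₀
    set d₀ := LiYau.diam g₀
    have hk : 0 < C₀ * d₀ ^ 2 := by positivity
    -- The second entry makes C' ≤ C C₀ d₀². With d₀² ≤ C₀ diam(g(t₁))² this gives C' ≤ C C₀²
    -- diam(g(t₁))², which accounts for the factor C₀² in the exponent.
    set C := max C' (C' / (C₀ * d₀ ^ 2))
    have hCC : C' ≤ C := le_max_left _ _
    have hC : 0 < C := hC'.trans_le hCC
    have hC2 : C' ≤ C * (C₀ * d₀ ^ 2) := (div_le_iff₀ hk).1 (le_max_right _ _)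
    refine ⟨C, hC, fun g lam U h0 hg hb hl hU hpos t₁ t₂ h1 h12 => ?_⟩
    have hd : 0 < t₂ - t₁ := sub_pos.2 h12
    have h5 : 1 ≤ t₂ / t₁ := (one_le_div h1).2 h12.le
    refine (hH g lam U h0 hg hb hl hU hpos t₁ t₂ h1 h12).trans
      (mul_le_mul_of_nonneg_left ?_ (le_ciInf fun x => hpos t₂ (h1.trans h12) x))
    have hdiam : d₀ ≤ √C₀ * LiYau.diam (g t₁) := by
      refine LiYau.diam_le_mul g₀ (g t₁) (Real.sqrt_pos.2 hC₀) fun x v => ?_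
      rw [Real.sq_sqrt hC₀.le, ← h0, ← div_le_iff₀' hC₀, div_eq_mul_one_div, mul_comm]
      exact hb.lower t₁ h1.le x v
    have hdiam2 : d₀ ^ 2 ≤ C₀ * LiYau.diam (g t₁) ^ 2 := by
      have := pow_le_pow_left₀ hd₀.le hdiam 2
      rwa [mul_pow, Real.sq_sqrt hC₀.le] at this
    have h6 : C' ≤ C * C₀ ^ 2 * LiYau.diam (g t₁) ^ 2 := by
      calc C' ≤ C * (C₀ * d₀ ^ 2) := hC2
        _ ≤ C * (C₀ * (C₀ * LiYau.diam (g t₁) ^ 2)) := by gcongr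
        _ = _ := by ring
    have h7 : C' / (t₂ - t₁) ≤
        C * C₀ ^ 2 * LiYau.diam (g t₁) ^ 2 / (t₂ - t₁) + C * (t₂ - t₁) :=
      (div_le_div_of_nonneg_right h6 hd.le).trans (le_add_of_nonneg_right (by positivity))
    gcongr
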